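/- **Setting.** Let $\mathcal Q\subset\mathbb R^2$ be open, and let $\mathcal R=\mathcal Q\times\mathbb S^2$ carry a smooth Lorentzian metric in double null form $$g=-2\Omega^2(\mathrm du\otimes\mathrm dv+\mathrm dv\otimes\mathrm du)+\gamma_{AB}(\mathrm d\vartheta^A-b^A\mathrm dv)\otimes(\mathrm d\vartheta^B-b^B\mathrm dv),\qquad \Omega>0,$$ where $(u,v)\in\mathcal Q$ and $\gamma$ is the induced Riemannian metric on the sphere $S_{u,v}=\{(u,v)\}\times\mathbb S^2$. The coordinates $u,v$ increase towards the future. Put $\underline L=\partial_u$, $L=\partial_v+b^A\partial_{\vartheta^A}$, $\hat{\underline L}=\Omega^{-1}\underline L$, $\hat L=\Omega^{-1}L$. For $X,Y$ tangent to the spheres let $\chi(X,Y)=g(\nabla_X\hat L,Y)$, $\underline\chi(X,Y)=g(\nabla_X\hat{\underline L},Y)$, $\zeta(X)=\frac12g(\nabla_X\hat L,\hat{\underline L})$. Let $\mathrm{tr}$, $|\cdot|$, and the trace-free parts $\hat\chi,\hat{\underline\chi}$, be taken with respect to $\gamma$, let $d\!\!\!/$ be the differential along the spheres, and let $\hat\omega=\hat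 L\log\Omega$, $\hat{\underline\omega}=\hat{\underline L}\log\Omega$, $\eta=\zeta+d\!\!\!/\log\Omega$, $\underline\eta=-\zeta+d\!\!\!/\log\Omega$. Let $r(u,v)$ be the area radius, $4\pi r^2=\mathrm{Area}(S_{u,v},\gamma)$, let $\overline f(u,v)$ be the average of $f$ over $S_{u,v}$ with respect to the area element of $\gamma$, let $\Sigma_\rho=\{r=\rho\}$, and $$q=\sqrt{\overline{\Omega\,\mathrm{tr}\chi}\,\big/\,\overline{\Omega\,\mathrm{tr}\underline\chi}}\,.$$ **Assumptions.** Let $\epsilon_0,C_0>0$. (BA:I) means that on $\mathcal R$ 1. $\mathrm{tr}\chi>0$ and $\mathrm{tr}\underline\chi>0$; 2. $\Omega|2\hat\omega-\mathrm{tr}\chi|\le C_0\mathrm{tr}\chi$ and $\Omega|2\hat{\underline\omega}-\mathrm{tr}\underline\chi|\le C_0\mathrm{tr}\underline\chi$; 3. $|\Omega\mathrm{tr}\chi-\overline{\Omega\mathrm{tr}\chi}|\le\epsilon_0\overline{\Omega\mathrm{tr}\chi}$ and $|\Omega\mathrm{tr}\underline\chi-\overline{\Omega\mathrm{tr}\underline\chi}|\le\epsilon_0\overline{\Omega\mathrm{tr}\underline\chi}$;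 4. $\Omega|\hat\chi|\le C_0\mathrm{tr}\chi$ and $\Omega|\hat{\underline\chi}|\le C_0\mathrm{tr}\underline\chi$; 5. $|L\log q|\le C_0\mathrm{tr}\chi$ and $|\underline L\log q|\le C_0\mathrm{tr}\underline\chi$; 6. $\Omega|\eta|+\Omega|\underline\eta|+\Omega|d\!\!\!/\log q|\le C_0(q\,\mathrm{tr}\underline\chi+q^{-1}\mathrm{tr}\chi)$. Assume moreover $C_0^{-1}r\le\Omega\le C_0r$ on $\mathcal R$. For a given $r_0>0$, assume also that the domains $\{r_0\le r\le r_2\}\cap\{u\le u_1\}\cap\{v\le v_1\}$ are compact subsets of $\mathcal R$ for all $r_2$ and all leaves $\{u=u_1\}$, $\{v=v_1\}$ of the foliation, so that they are bounded only by pieces of $\Sigma_{r_0}$, $\Sigma_{r_2}$ and of these two leaves. **Energy.** A Weyl field $W$ is a tensor field $W_{\alpha\beta\gamma\delta}$ of class $C^1$ that is antisymmetric in the first two and in the last two indices, satisfies the cyclic identity $W_{\alpha[\beta\gamma\delta]}=0$, and is trace-free. Its Bel-Robinson tensor is $$Q[W]_{\alpha\beta\gamma\delta}=W_{\alpha\rho\gamma\sigma}W_\beta{}^\rho{}_\delta{}^\sigma+{}^*W_{\alpha\rho\gamma\sigma}{}^*W_\beta{}^\rho{}_\delta{}^\sigma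 .$$ With the aligned redshift vector field $M_q=\frac1{2\Omega}(q\hat{\underline L}+q^{-1}\hat L)$ let $P^q[W]_\alpha=-Q[W]_{\alpha\beta\gamma\delta}M_q^\beta M_q^\gamma M_q^\delta$. If $n$ is the future unit normal of $\Sigma_\rho$ and $\mathrm d\mu$ the volume element of its induced metric, then $$\int_{\Sigma_\rho}{}^*P^q[W]=\int_{\Sigma_\rho}-g(P^q[W],n)\,\mathrm d\mu=\int_{\Sigma_\rho}Q[W](n,M_q,M_q,M_q)\,\mathrm d\mu\in[0,\infty].$$ **Proposition (global redshift energy decay).** For all $\epsilon_0,C_0>0$ there is an $\epsilon$ with $0<\epsilon<\epsilon_0$, and for every $r_0>0$ a constant $C(r_0)>0$ (depending only on $r_0,\epsilon_0,C_0$), such that for every $(\mathcal R,g)$ as above and every Weyl field $W$ on $\mathcal R$ that solves the Bianchi equations $\nabla^\alpha W_{\alpha\beta\gamma\delta}=0$, $$r^{6-\epsilon}\int_{\Sigma_r}{}^*P^q[W]\le C(r_0)\int_{\Sigma_{r_0}}{}^*P^q[W]\qquad\text{for all } r\ge r_0 .$$ -/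

import Mathlib

open MeasureTheory
open scoped ContDiff ENNReal

noncomputable section

namespace DoubleNull

/-! ### Coordinates

The spacetime region is `Q × S²`, with `Q` an open set of the `(u, v)`-plane. The sphere is covered by
the two stereographic charts of the Riemann sphere, each with image all of `ℝ²`, related by `z ↦ 1/z`.
A point in either chart is `(u, v, ϑ¹, ϑ²)`. Tensor fields are given by their components in both
charts, subject to the tensor transformation law on the overlap. -/

/-- Coordinates `(x 0, x 1, x 2, x 3) = (u, v, ϑ¹, ϑ²)`. -/
abbrev Pt := Fin 4 → ℝ

/-- Vector fields, in coordinates. -/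
abbrev VecField := Pt → Fin 4 → ℝ

/-- Covariant tensors of rank four, by components. -/
abbrev Tensor4 := Fin 4 → Fin 4 → Fin 4 → Fin 4 → ℝ

/-- The point with coordinates `(u, v, ϑ¹, ϑ²)`. -/
def pt (u v : ℝ) (θ : Fin 2 → ℝ) : Pt := ![u, v, θ 0, θ 1]

/-- The partial derivative `∂f/∂x^μ`. -/
def pd (μ : Fin 4) (f : Pt → ℝ) (x : Pt) : ℝ := fderiv ℝ f x (Pi.single μ 1)

/-- The spacetime index of the angular coordinate `ϑ^A`: `A = 0, 1` correspond to `μ = 2, 3`. -/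
def ang (A : Fin 2) : Fin 4 := Fin.natAdd 2 A

/-- Kronecker delta. -/
def kron (μ ν : Fin 4) : ℝ := if μ = ν then 1 else 0

/-- The transition map between the two charts, `z ↦ 1/z` for `z = ϑ¹ + i ϑ²`
(it is its own inverse and preserves the orientation). -/
def trans (x : Pt) : Pt :=
  ![x 0, x 1, x 2 / (x 2 ^ 2 + x 3 ^ 2), -x 3 / (x 2 ^ 2 + x 3 ^ 2)]

/-- The Jacobian matrix `∂(trans x)^α / ∂x^μ`. -/
def jac (x : Pt) (α μ : Fin 4) : ℝ := pd μ (fun y => trans y α) x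

/-- The one-form `dϑ^A - b^A dv`. -/
def shiftForm (b : Fin 2 → ℝ) (A : Fin 2) (μ : Fin 4) : ℝ := kron (ang A) μ - b A * kron 1 μ

/-- `g = -2 Ω² (du ⊗ dv + dv ⊗ du) + γ_AB (dϑ^A - b^A dv) ⊗ (dϑ^B - b^B dv)`. -/
def doubleNullMetric (Ω : ℝ) (b : Fin 2 → ℝ) (γ : Matrix (Fin 2) (Fin 2) ℝ) :
    Matrix (Fin 4) (Fin 4) ℝ :=
  Matrix.of fun μ ν =>
    -2 * Ω ^ 2 * (kron 0 μ * kron 1 ν + kron 1 μ * kron 0 ν)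
      + ∑ A, ∑ B, γ A B * shiftForm b A μ * shiftForm b B ν

/-- A Lorentzian metric on `Q × S²` in double null form. The index `c : Fin 2` is the chart of the
sphere. `Ω` is the null lapse, `γ` the induced metric on the spheres `S_{u,v}`, `b` the shift. -/
structure Spacetime where
  Q : Set (ℝ × ℝ)
  isOpen_Q : IsOpen Q
  Ω : Fin 2 → Pt → ℝ
  b : Fin 2 → Pt → Fin 2 → ℝ
  γ : Fin 2 → Pt → Matrix (Fin 2) (Fin 2) ℝ
  smooth_Ω : ∀ c, ContDiffOn ℝ ∞ (Ω c) {x | (x 0, x 1) ∈ Q}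
  smooth_b : ∀ c A, ContDiffOn ℝ ∞ (fun x => b c x A) {x | (x 0, x 1) ∈ Q}
  smooth_γ : ∀ c A B, ContDiffOn ℝ ∞ (fun x => γ c x A B) {x | (x 0, x 1) ∈ Q}
  Ω_pos : ∀ c x, (x 0, x 1) ∈ Q → 0 < Ω c x
  γ_posDef : ∀ c x, (x 0, x 1) ∈ Q → (γ c x).PosDef
  /-- The components in the two charts are those of one metric on `Q × S²`. -/
  glue : ∀ x : Pt, (x 0, x 1) ∈ Q → (x 2, x 3) ≠ (0, 0) → ∀ μ ν,
    doubleNullMetric (Ω 0 x) (b 0 x) (γ 0 x) μ ν =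
      ∑ α, ∑ β, jac x α μ * jac x β ν *
        doubleNullMetric (Ω 1 (trans x)) (b 1 (trans x)) (γ 1 (trans x)) α β

namespace Spacetime

variable (S : Spacetime)

/-- The coordinate domain `Q × ℝ²` of each chart. -/
def dom : Set Pt := {x | (x 0, x 1) ∈ S.Q}

/-! ### Metric, connection -/

/-- The metric `g_{μν}` in the chart `c`. -/
def g (c : Fin 2) (x : Pt) : Matrix (Fin 4) (Fin 4) ℝ :=
  doubleNullMetric (S.Ω c x) (S.b c x) (S.γ c x)

/-- The inverse metric `g^{μν}`. -/
def gInv (c : Fin 2) (x : Pt) : Matrix (Fin 4) (Fin 4) ℝ := (S.g c x)⁻¹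

/-- `g(X, Y)`. -/
def inner (c : Fin 2) (x : Pt) (X Y : Fin 4 → ℝ) : ℝ := ∑ μ, ∑ ν, S.g c x μ ν * X μ * Y ν

/-- Christoffel symbols `Γ^κ_{μν}` of the Levi-Civita connection `∇` of `g`. -/
def christoffel (c : Fin 2) (x : Pt) (κ μ ν : Fin 4) : ℝ :=
  (1 / 2) * ∑ l, S.gInv c x κ l *
    (pd μ (fun y => S.g c y ν l) x + pd ν (fun y => S.g c y μ l) x - pd l (fun y => S.g c y μ ν) x)

/-- `(∇_μ X)^κ` for a vector field `X`. -/
def nablaVec (c : Fin 2) (X : VecField) (x : Pt) (μ κ : Fin 4) : ℝ :=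
  pd μ (fun y => X y κ) x + ∑ ν, S.christoffel c x κ μ ν * X x ν

/-- `∇_μ W_{αβγδ}` for a covariant tensor field `W` of rank four. -/
def nabla4 (c : Fin 2) (W : Pt → Tensor4) (x : Pt) (μ α β γ δ : Fin 4) : ℝ :=
  pd μ (fun y => W y α β γ δ) x
    - ∑ l, S.christoffel c x l μ α * W x l β γ δ
    - ∑ l, S.christoffel c x l μ β * W x α l γ δ
    - ∑ l, S.christoffel c x l μ γ * W x α β l δ
    - ∑ l, S.christoffel c x l μ δ * W x α β γ l

/-! ### Null frame and structure coefficients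

`C_u` and `Cb_v` are the level sets of `u` and `v`. The null vector fields are
`Lb = ∂_u` and `L = ∂_v + b^A ∂_{ϑ^A}`, so that `Lb u = L v = 1`, `Lb v = L u = 0`,
`g(L, Lb) = -2 Ω²`, and `Lb`, `L` are proportional to the gradients of `v`, `u`. -/

/-- `Lb = ∂_u`. -/
def Lb : VecField := fun _ μ => kron 0 μ

/-- `L = ∂_v + b^A ∂_{ϑ^A}`. -/
def L (c : Fin 2) : VecField := fun x μ => kron 1 μ + ∑ A, S.b c x A * kron (ang A) μ

/-- The normalised null normal `Ω⁻¹ Lb`. -/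
def LbHat (c : Fin 2) : VecField := fun x μ => (S.Ω c x)⁻¹ * Lb x μ

/-- The normalised null normal `Ω⁻¹ L`. -/
def LHat (c : Fin 2) : VecField := fun x μ => (S.Ω c x)⁻¹ * S.L c x μ

/-- The derivative `X f` of a function along a vector field. -/
def deriv (X : VecField) (f : Pt → ℝ) (x : Pt) : ℝ := ∑ μ, X x μ * pd μ f x

/-- `(∂_A, ∂_B) ↦ g(∇_A N, ∂_B)` on the sphere `S_{u,v}`. -/
def secondForm (c : Fin 2) (N : VecField) (x : Pt) : Matrix (Fin 2) (Fin 2) ℝ :=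
  Matrix.of fun A B => ∑ κ, S.g c x κ (ang B) * S.nablaVec c N x (ang A) κ

/-- `χ(X, Y) = g(∇_X L̂, Y)`. -/
def chi (c : Fin 2) (x : Pt) : Matrix (Fin 2) (Fin 2) ℝ := S.secondForm c (S.LHat c) x

/-- `χb(X, Y) = g(∇_X L̂b, Y)`. -/
def chib (c : Fin 2) (x : Pt) : Matrix (Fin 2) (Fin 2) ℝ := S.secondForm c (S.LbHat c) x

/-- Trace with respect to the metric `γ` on the spheres. -/
def trγ (c : Fin 2) (x : Pt) (h : Matrix (Fin 2) (Fin 2) ℝ) : ℝ :=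
  ∑ A, ∑ B, (S.γ c x)⁻¹ A B * h A B

/-- The null expansion `tr χ`. -/
def trChi (c : Fin 2) (x : Pt) : ℝ := S.trγ c x (S.chi c x)

/-- The null expansion `tr χb`. -/
def trChib (c : Fin 2) (x : Pt) : ℝ := S.trγ c x (S.chib c x)

/-- The trace-free part of a two-tensor on the spheres. -/
def traceFree (c : Fin 2) (x : Pt) (h : Matrix (Fin 2) (Fin 2) ℝ) : Matrix (Fin 2) (Fin 2) ℝ :=
  h - ((1 / 2) * S.trγ c x h) • S.γ c x

/-- The pointwise norm `|h|` of a two-tensor on the spheres, with respect to `γ`. -/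
def norm2 (c : Fin 2) (x : Pt) (h : Matrix (Fin 2) (Fin 2) ℝ) : ℝ :=
  Real.sqrt (∑ A, ∑ B, ∑ C, ∑ D, (S.γ c x)⁻¹ A C * (S.γ c x)⁻¹ B D * h A B * h C D)

/-- The pointwise norm `|ξ|` of a one-form on the spheres, with respect to `γ`. -/
def norm1 (c : Fin 2) (x : Pt) (ξ : Fin 2 → ℝ) : ℝ :=
  Real.sqrt (∑ A, ∑ B, (S.γ c x)⁻¹ A B * ξ A * ξ B)

/-- The differential `d̸f` of a function along the spheres. -/
def dSph (f : Pt → ℝ) (x : Pt) (A : Fin 2) : ℝ := pd (ang A) f x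

/-- `ω̂ = L̂ log Ω`. -/
def omegaHat (c : Fin 2) (x : Pt) : ℝ := deriv (S.LHat c) (fun y => Real.log (S.Ω c y)) x

/-- `ω̂b = L̂b log Ω`. -/
def omegabHat (c : Fin 2) (x : Pt) : ℝ := deriv (S.LbHat c) (fun y => Real.log (S.Ω c y)) x

/-- The torsion `ζ(X) = ½ g(∇_X L̂, L̂b)`. -/
def zeta (c : Fin 2) (x : Pt) (A : Fin 2) : ℝ :=
  (1 / 2) * S.inner c x (S.nablaVec c (S.LHat c) x (ang A)) (S.LbHat c x)

/-- `η = ζ + d̸ log Ω`; equivalently `η(X) = ½ g(∇_{L̂b} L̂, X)`. -/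
def eta (c : Fin 2) (x : Pt) (A : Fin 2) : ℝ :=
  S.zeta c x A + dSph (fun y => Real.log (S.Ω c y)) x A

/-- `ηb = -ζ + d̸ log Ω`; equivalently `ηb(X) = ½ g(∇_{L̂} L̂b, X)`. -/
def etab (c : Fin 2) (x : Pt) (A : Fin 2) : ℝ :=
  -S.zeta c x A + dSph (fun y => Real.log (S.Ω c y)) x A

/-! ### Area radius and spherical averages

Integrals over `S_{u,v}` are computed in the chart `0`, which omits a single point of the sphere. -/

/-- The area element `√det γ` of the sphere. -/
def areaElement (x : Pt) : ℝ := Real.sqrt (S.γ 0 x).det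

/-- The area radius: `4 π r² (u, v)` is the area of `S_{u,v}`. -/
def areaRadius (u v : ℝ) : ℝ :=
  Real.sqrt ((∫ θ : Fin 2 → ℝ, S.areaElement (pt u v θ)) / (4 * Real.pi))

/-- The average of `f` over the sphere `S_{u,v}`. -/
def average (f : Pt → ℝ) (u v : ℝ) : ℝ :=
  (1 / (4 * Real.pi * S.areaRadius u v ^ 2)) *
    ∫ θ : Fin 2 → ℝ, f (pt u v θ) * S.areaElement (pt u v θ)

/-- The average of `Ω tr χ`. -/
def avgTrChi (u v : ℝ) : ℝ := S.average (fun x => S.Ω 0 x * S.trChi 0 x) u v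

/-- The average of `Ω tr χb`. -/
def avgTrChib (u v : ℝ) : ℝ := S.average (fun x => S.Ω 0 x * S.trChib 0 x) u v

/-- The area radius as a function on spacetime. -/
def r (x : Pt) : ℝ := S.areaRadius (x 0) (x 1)

/-- `q² = avg(Ω tr χ) / avg(Ω tr χb)`, as a function on spacetime. -/
def q (x : Pt) : ℝ := Real.sqrt (S.avgTrChi (x 0) (x 1) / S.avgTrChib (x 0) (x 1))

/-! ### The assumptions on the foliation -/

/-- The assumptions on the connection coefficients, with constants `ε₀` and `C₀`. -/
structure BAI (ε₀ C₀ : ℝ) : Prop where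
  expansion : ∀ c, ∀ x ∈ S.dom, 0 < S.trChi c x ∧ 0 < S.trChib c x
  omega : ∀ c, ∀ x ∈ S.dom, S.Ω c x * |2 * S.omegaHat c x - S.trChi c x| ≤ C₀ * S.trChi c x
  omegab : ∀ c, ∀ x ∈ S.dom, S.Ω c x * |2 * S.omegabHat c x - S.trChib c x| ≤ C₀ * S.trChib c x
  mean : ∀ c, ∀ x ∈ S.dom,
    |S.Ω c x * S.trChi c x - S.avgTrChi (x 0) (x 1)| ≤ ε₀ * S.avgTrChi (x 0) (x 1)
  meanb : ∀ c, ∀ x ∈ S.dom,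
    |S.Ω c x * S.trChib c x - S.avgTrChib (x 0) (x 1)| ≤ ε₀ * S.avgTrChib (x 0) (x 1)
  shear : ∀ c, ∀ x ∈ S.dom,
    S.Ω c x * S.norm2 c x (S.traceFree c x (S.chi c x)) ≤ C₀ * S.trChi c x
  shearb : ∀ c, ∀ x ∈ S.dom,
    S.Ω c x * S.norm2 c x (S.traceFree c x (S.chib c x)) ≤ C₀ * S.trChib c x
  dq : ∀ c, ∀ x ∈ S.dom, |deriv (S.L c) (fun y => Real.log (S.q y)) x| ≤ C₀ * S.trChi c x
  dqb : ∀ c, ∀ x ∈ S.dom, |deriv Lb (fun y => Real.log (S.q y)) x| ≤ C₀ * S.trChib c x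
  torsion : ∀ c, ∀ x ∈ S.dom,
    S.Ω c x * S.norm1 c x (S.eta c x) + S.Ω c x * S.norm1 c x (S.etab c x)
        + S.Ω c x * S.norm1 c x (dSph (fun y => Real.log (S.q y)) x)
      ≤ C₀ * (S.q x * S.trChib c x + (S.q x)⁻¹ * S.trChi c x)

/-- `C₀⁻¹ r ≤ Ω ≤ C₀ r`. -/
def LapseComparable (C₀ : ℝ) : Prop :=
  ∀ c, ∀ x ∈ S.dom, C₀⁻¹ * S.r x ≤ S.Ω c x ∧ S.Ω c x ≤ C₀ * S.r x

/-- The domains `{r₀ ≤ r ≤ r₂, u ≤ u₁, v ≤ v₁}` are compact, for all leaves `C_{u₁}`, `Cb_{v₁}` of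
the foliation (compactness in `Q × S²` is compactness in `Q`, the sphere being compact). Thus their
boundary consists of pieces of `Σ_{r₀}`, `Σ_{r₂}`, `C_{u₁}` and `Cb_{v₁}` only. -/
def CompactDomains (r₀ : ℝ) : Prop :=
  ∀ r₂ u₁ v₁ : ℝ, (∃ v, (u₁, v) ∈ S.Q) → (∃ u, (u, v₁) ∈ S.Q) →
    IsCompact {p : ℝ × ℝ | p ∈ S.Q ∧ r₀ ≤ S.areaRadius p.1 p.2 ∧ S.areaRadius p.1 p.2 ≤ r₂ ∧
      p.1 ≤ u₁ ∧ p.2 ≤ v₁}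

/-! ### Weyl fields, the Bianchi equations and the Bel-Robinson tensor -/

/-- Weyl fields on `Q × S²`, of class `C¹`. -/
structure IsWeylField (W : Fin 2 → Pt → Tensor4) : Prop where
  contDiff : ∀ c α β γ δ, ContDiffOn ℝ 1 (fun x => W c x α β γ δ) S.dom
  /-- The components in the two charts are those of one tensor field on `Q × S²`. -/
  glue : ∀ x ∈ S.dom, (x 2, x 3) ≠ (0, 0) → ∀ α β γ δ,
    W 0 x α β γ δ = ∑ α', ∑ β', ∑ γ', ∑ δ',
      jac x α' α * jac x β' β * jac x γ' γ * jac x δ' δ * W 1 (trans x) α' β' γ' δ'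
  antisymm_left : ∀ c, ∀ x ∈ S.dom, ∀ α β γ δ, W c x α β γ δ = -W c x β α γ δ
  antisymm_right : ∀ c, ∀ x ∈ S.dom, ∀ α β γ δ, W c x α β γ δ = -W c x α β δ γ
  cyclic : ∀ c, ∀ x ∈ S.dom, ∀ α β γ δ,
    W c x α β γ δ + W c x α γ δ β + W c x α δ β γ = 0
  traceFree : ∀ c, ∀ x ∈ S.dom, ∀ β δ, ∑ α, ∑ γ, S.gInv c x α γ * W c x α β γ δ = 0

/-- The Bianchi equations `∇^α W_{αβγδ} = 0`. -/
def Bianchi (W : Fin 2 → Pt → Tensor4) : Prop :=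
  ∀ c, ∀ x ∈ S.dom, ∀ β γ δ, ∑ μ, ∑ α, S.gInv c x μ α * S.nabla4 c (W c) x μ α β γ δ = 0

/-- The volume form `ε_{αβγδ}` of `g`, with `ε_{0123} = √|det g| > 0`. -/
def vol (c : Fin 2) (x : Pt) (α β γ δ : Fin 4) : ℝ :=
  Real.sqrt |(S.g c x).det| * Matrix.det (Matrix.of fun i j : Fin 4 => kron (![α, β, γ, δ] i) j)

/-- The dual `*W_{αβμν} = ½ W_{αβ}^{γδ} ε_{γδμν}`. -/
def dual (c : Fin 2) (W : Pt → Tensor4) (x : Pt) : Tensor4 := fun α β μ ν =>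
  (1 / 2) * ∑ γ, ∑ δ, ∑ γ', ∑ δ',
    S.gInv c x γ γ' * S.gInv c x δ δ' * W x α β γ' δ' * S.vol c x γ δ μ ν

/-- `T_{αργσ} T_{β}^{ρ}_{δ}^{σ}`. -/
def square (c : Fin 2) (x : Pt) (T : Tensor4) : Tensor4 := fun α β γ δ =>
  ∑ ρ, ∑ σ, ∑ ρ', ∑ σ', S.gInv c x ρ ρ' * S.gInv c x σ σ' * T α ρ γ σ * T β ρ' δ σ'

/-- The Bel-Robinson tensor
`Q_{αβγδ} = W_{αργσ} W_{β}^{ρ}_{δ}^{σ} + *W_{αργσ} *W_{β}^{ρ}_{δ}^{σ}`. -/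
def belRobinson (c : Fin 2) (W : Pt → Tensor4) (x : Pt) : Tensor4 := fun α β γ δ =>
  S.square c x (W x) α β γ δ + S.square c x (S.dual c W x) α β γ δ

/-- The energy current `P_α = -Q_{αβγδ} X^β Y^γ Z^δ`. -/
def current (c : Fin 2) (W : Pt → Tensor4) (X Y Z : VecField) (x : Pt) (α : Fin 4) : ℝ :=
  -∑ β, ∑ γ, ∑ δ, S.belRobinson c W x α β γ δ * X x β * Y x γ * Z x δ

/-- The aligned redshift vector field `M_q = (1 / 2Ω) (q L̂b + q⁻¹ L̂)`. -/
def Mq (c : Fin 2) : VecField := fun x μ =>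
  (1 / 2) * (S.Ω c x)⁻¹ * (S.q x * S.LbHat c x μ + (S.q x)⁻¹ * S.LHat c x μ)

/-- The current `P^q[W]`. -/
def Pq (c : Fin 2) (W : Pt → Tensor4) (x : Pt) (α : Fin 4) : ℝ :=
  S.current c W (S.Mq c) (S.Mq c) (S.Mq c) x α

/-! ### The energy flux through the level sets `Σ_ρ` of the area radius -/

/-- `V^μ = -g^{μν} ∂_ν r`. -/
def V (c : Fin 2) : VecField := fun x μ => -∑ ν, S.gInv c x μ ν * pd ν S.r x

/-- The lapse `φ = 1 / √(-g(V, V))` of the foliation by the `Σ_ρ`. -/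
def lapse (c : Fin 2) (x : Pt) : ℝ := 1 / Real.sqrt (-S.inner c x (S.V c x) (S.V c x))

/-- The future unit normal `n = φ V` of the `Σ_ρ`. -/
def n (c : Fin 2) : VecField := fun x μ => S.lapse c x * S.V c x μ

/-- The coordinate vectors of `Σ_ρ`, as a hypersurface parametrised by `(u, ϑ¹, ϑ²)`:
`∂_u - (∂_u r / ∂_v r) ∂_v`, `∂_{ϑ¹}` and `∂_{ϑ²}`. -/
def tangent (x : Pt) : Fin 3 → Fin 4 → ℝ :=
  ![fun μ => kron 0 μ - pd 0 S.r x / pd 1 S.r x * kron 1 μ, kron 2, kron 3]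

/-- The volume element of the metric induced on `Σ_ρ`, in the coordinates `(u, ϑ¹, ϑ²)`. -/
def volElement (c : Fin 2) (x : Pt) : ℝ :=
  Real.sqrt (Matrix.det (Matrix.of fun i j : Fin 3 =>
    S.inner c x (S.tangent x i) (S.tangent x j)))

/-- The integrand of `∫_{Σ_ρ} *P = ∫_{Σ_ρ} -g(P, n)`, in the coordinates `(u, ϑ¹, ϑ²)`. For
`P = P^q[W]` this is `Q[W](n, M_q, M_q, M_q) ≥ 0` times the volume element. -/
def fluxDensity (W : Fin 2 → Pt → Tensor4) (x : Pt) : ℝ :=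
  -(∑ α, S.Pq 0 (W 0) x α * S.n 0 x α) * S.volElement 0 x

/-- The energy `∫_{Σ_ρ} *P^q[W]`, possibly infinite. The hypersurface `Σ_ρ` consists of the points
`(u, v, ϑ)` with `(u, v) ∈ Q` and `r(u, v) = ρ`; since `r` is increasing in `v`, it is locally a graph
over `(u, ϑ)`, and the sum over `v` is the sum over the sheets of this graph (usually there is at most
one). -/
def energy (W : Fin 2 → Pt → Tensor4) (ρ : ℝ) : ℝ≥0∞ :=
  ∫⁻ u : ℝ, ∑' v : {v : ℝ // (u, v) ∈ S.Q ∧ S.areaRadius u v = ρ},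
    ∫⁻ θ : Fin 2 → ℝ, ENNReal.ofReal (S.fluxDensity W (pt u v θ))

end Spacetime

end DoubleNull

end

/-! The decay comes from a weight and an almost conservation law. Put K = q Lb + q⁻¹ L, so that M_q
= K / (2Ω²), and let J be the energy current of the Bel-Robinson tensor Q contracted with three
copies of K. The flux density of P^q through a level set of r is the flux density of J divided by
8Ω⁶, and Ω is comparable to r. Hence r⁶ times the energy is comparable, with constants depending
only on C₀, to the flux of J, and it suffices to bound the flux of J through {r = ρ} by a constant
times its flux through {r = r₀}.

The field K is nearly conformally Killing. In an orthonormal frame whose time axis points along K,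
the Lie derivative of the metric along K equals Ω T times the Minkowski metric plus an error of size
C₀ T, where T = q tr χb + q⁻¹ tr χ (`abs_lieK_frame_le`). By the Bianchi equations the divergence of
J contains no derivative of W and is a contraction of Q with this Lie derivative (`divergence_cur`);
since Q is trace-free, the large conformal part drops out. Every component of Q is dominated by its
density in the direction of K, so |div J| is at most a constant times C₀ T times that density
(`cur_estimate`).

The field K is also aligned with the area radius. By the first variation of area, ∂_u r and ∂_v r
are r/2 times the averages of Ω tr χb and Ω tr χ, and q² is the quotient of these averages;
therefore grad r is proportional to K, and the density of J in the direction of K is controlled by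
dr(J). The closeness of Ω tr χ and Ω tr χb to their averages and the lower bound Ω ≥ r / C₀ give T a
factor 1/r. Altogether |div J| ≤ κ r⁻² dr(J) with κ = 6144 (1 + ε₀) C₀² (`divergence_flux_le`). As κ
r⁻² is integrable at infinity, the weight exp(κ / r) absorbs the error: exp(κ / r) J, integrated
over the spheres, is a planar field with nonnegative components and nonpositive divergence
(`radialFlow`). The weight lies between 1 and exp(κ / r₀) on r ≥ r₀.

There remains a monotonicity statement in the (u, v)-plane: the flux of such a field through the
level sets of a function r increasing in u and v does not increase
(`RadialFlow.lintegral_level_mono`). The leaves of constant u and v contribute boundary terms of a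
favourable sign; analytically they are replaced by cutoffs decreasing in u and v, whose support is
compact by assumption. Flux through a level set is rewritten, line by line in v, as an integral over
a superlevel set, so that two levels can be compared by the divergence theorem, and the cutoffs are
removed by Fatou's lemma. This argument allows infinite energies and level sets with several sheets.

The outcome is decay at the full rate r⁻⁶ (`energy_le`); the ε of the theorem is given away at the
very end. -/

open scoped Matrix Topology

noncomputable section

namespace DoubleNull

/-! ### Quadratic curvature expressions and changes of frame -/

/-- The totally antisymmetric symbol. -/
def levi (α β γ δ : Fin 4) : ℝ :=
  Matrix.det (Matrix.of fun i j : Fin 4 => kron (![α, β, γ, δ] i) j)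

/-- The bilinear expression `T_{αργσ} U_{β}^{ρ}_{δ}^{σ}` with respect to the inverse metric `h`. -/
def sqT (h : Matrix (Fin 4) (Fin 4) ℝ) (T U : Tensor4) : Tensor4 := fun α β γ δ =>
  ∑ ρ, ∑ σ, ∑ ρ', ∑ σ', h ρ ρ' * h σ σ' * T α ρ γ σ * U β ρ' δ σ'

/-- The dual in the second pair of indices, with the antisymmetric symbol as volume form. -/
def dualT (h : Matrix (Fin 4) (Fin 4) ℝ) (W : Tensor4) : Tensor4 := fun α β μ ν =>
  (1 / 2) * ∑ γ, ∑ δ, ∑ γ', ∑ δ', h γ γ' * h δ δ' * W α β γ' δ' * levi γ δ μ ν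

/-- The components of a covariant tensor in the frame given by the columns of `A`. -/
def act (A : Matrix (Fin 4) (Fin 4) ℝ) (W : Tensor4) : Tensor4 := fun a b c d =>
  ∑ α, ∑ β, ∑ γ, ∑ δ, A α a * A β b * A γ c * A δ d * W α β γ δ

/-- The polarised Bel-Robinson expression, `s` being the squared volume factor. -/
def belRob (h : Matrix (Fin 4) (Fin 4) ℝ) (s : ℝ) (T U : Tensor4) : Tensor4 := fun α β γ δ =>
  sqT h T U α β γ δ + s * sqT h (dualT h T) (dualT h U) α β γ δ

/-- Contraction of two matrices. -/
def pairing (h M N : Matrix (Fin 4) (Fin 4) ℝ) : ℝ := (Mᵀ * h * N * hᵀ).trace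

/-- The matrix of a rank four tensor in its second and fourth index. -/
def mat24 (T : Tensor4) (α γ : Fin 4) : Matrix (Fin 4) (Fin 4) ℝ := Matrix.of fun ρ σ => T α ρ γ σ

/-- The matrix of a rank four tensor in its last two indices. -/
def mat34 (T : Tensor4) (α β : Fin 4) : Matrix (Fin 4) (Fin 4) ℝ := Matrix.of fun ρ σ => T α β ρ σ

/-- Written as a trace, the double contraction is visibly bilinear, and its behaviour under a change
of frame reduces to cyclicity of the trace (`pairing_conj`). -/
theorem sqT_eq_pairing (h : Matrix (Fin 4) (Fin 4) ℝ) (T U : Tensor4) (α β γ δ : Fin 4) :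
    sqT h T U α β γ δ = pairing h (mat24 T α γ) (mat24 U β δ) := by
  simp only [sqT, pairing, Matrix.trace, Matrix.diag, Matrix.mul_apply, Matrix.transpose_apply,
    mat24, Matrix.of_apply, Finset.sum_mul]
  rw [Finset.sum_comm]
  refine Finset.sum_congr rfl fun σ _ => ?_
  rw [Finset.sum_comm]
  rw [Finset.sum_congr rfl fun ρ' _ => Finset.sum_comm]
  rw [Finset.sum_comm]
  refine Finset.sum_congr rfl fun σ' _ => Finset.sum_congr rfl fun ρ' _ =>
    Finset.sum_congr rfl fun ρ _ => by ring

theorem mat24_act (A : Matrix (Fin 4) (Fin 4) ℝ) (T : Tensor4) (a c : Fin 4) :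
    mat24 (act A T) a c =
      ∑ p : Fin 4 × Fin 4, (A p.1 a * A p.2 c) • (Aᵀ * mat24 T p.1 p.2 * A) := by
  rw [Fintype.sum_prod_type]
  ext b d
  simp only [mat24, act, Matrix.of_apply, Matrix.sum_apply, Matrix.smul_apply, Matrix.mul_apply,
    Matrix.transpose_apply, smul_eq_mul, Finset.sum_mul, Finset.mul_sum]
  refine Finset.sum_congr rfl fun α _ => ?_
  rw [Finset.sum_comm]
  refine Finset.sum_congr rfl fun γ _ => ?_
  rw [Finset.sum_comm]
  refine Finset.sum_congr rfl fun δ _ => Finset.sum_congr rfl fun β _ => by ring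

theorem mat34_act (A : Matrix (Fin 4) (Fin 4) ℝ) (T : Tensor4) (a b : Fin 4) :
    mat34 (act A T) a b =
      ∑ p : Fin 4 × Fin 4, (A p.1 a * A p.2 b) • (Aᵀ * mat34 T p.1 p.2 * A) := by
  rw [Fintype.sum_prod_type]
  ext c d
  simp only [mat34, act, Matrix.of_apply, Matrix.sum_apply, Matrix.smul_apply, Matrix.mul_apply,
    Matrix.transpose_apply, smul_eq_mul, Finset.sum_mul, Finset.mul_sum]
  refine Finset.sum_congr rfl fun α _ => Finset.sum_congr rfl fun β _ => ?_
  rw [Finset.sum_comm]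
  refine Finset.sum_congr rfl fun δ _ => Finset.sum_congr rfl fun γ _ => by ring

theorem pairing_conj (h A M N : Matrix (Fin 4) (Fin 4) ℝ) :
    pairing h (Aᵀ * M * A) (Aᵀ * N * A) = pairing (A * h * Aᵀ) M N := by
  simp only [pairing, Matrix.transpose_mul, Matrix.transpose_transpose]
  rw [show Aᵀ * (Mᵀ * A) * h * (Aᵀ * N * A) * hᵀ = Aᵀ * (Mᵀ * (A * h * Aᵀ) * N * A * hᵀ) by
    simp only [Matrix.mul_assoc], Matrix.trace_mul_comm]
  simp only [Matrix.mul_assoc]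

theorem pairing_sum_left {ι : Type*} (s : Finset ι) (h N : Matrix (Fin 4) (Fin 4) ℝ) (k : ι → ℝ)
    (M : ι → Matrix (Fin 4) (Fin 4) ℝ) :
    pairing h (∑ i ∈ s, k i • M i) N = ∑ i ∈ s, k i * pairing h (M i) N := by
  simp [pairing, Matrix.transpose_sum, Finset.sum_mul, Matrix.trace_sum]

theorem pairing_sum_right {ι : Type*} (s : Finset ι) (h M : Matrix (Fin 4) (Fin 4) ℝ) (k : ι → ℝ)
    (N : ι → Matrix (Fin 4) (Fin 4) ℝ) :
    pairing h M (∑ i ∈ s, k i • N i) = ∑ i ∈ s, k i * pairing h M (N i) := by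
  simp [pairing, Finset.sum_mul, Finset.mul_sum, Matrix.trace_sum]

theorem sqT_act (h A : Matrix (Fin 4) (Fin 4) ℝ) (T U : Tensor4) :
    sqT h (act A T) (act A U) = act A (sqT (A * h * Aᵀ) T U) := by
  funext a b c d
  rw [sqT_eq_pairing, mat24_act, mat24_act, pairing_sum_left]
  simp only [pairing_sum_right, pairing_conj, ← sqT_eq_pairing, Finset.mul_sum]
  simp only [act, Fintype.sum_prod_type]
  refine Finset.sum_congr rfl fun α _ => ?_
  rw [Finset.sum_comm]
  refine Finset.sum_congr rfl fun β _ => Finset.sum_congr rfl fun γ _ =>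
    Finset.sum_congr rfl fun δ _ => by ring

/-- Row i of the product of the selection matrix with Aᵀ is a combination of basis vectors with
coefficients from column `v i` of A. Multilinearity of the determinant in its rows expands the
product formula for determinants into the sum over all index maps. -/
theorem sum_levi (A : Matrix (Fin 4) (Fin 4) ℝ) (a b c d : Fin 4) :
    ∑ α, ∑ β, ∑ γ, ∑ δ, A α a * A β b * A γ c * A δ d * levi α β γ δ = A.det * levi a b c d := by
  have key : ∀ v : Fin 4 → Fin 4, (∑ f : Fin 4 → Fin 4, (∏ i, A (f i) (v i)) *
      Matrix.det (Matrix.of fun i j : Fin 4 => kron (f i) j)) =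
      A.det * Matrix.det (Matrix.of fun i j : Fin 4 => kron (v i) j) := by
    intro v
    rw [mul_comm, ← Matrix.det_transpose A, ← Matrix.det_mul]
    have h1 : (Matrix.of fun i j : Fin 4 => kron (v i) j) * Aᵀ =
        fun i => ∑ k : Fin 4, A k (v i) • (fun j : Fin 4 => kron k j) := by
      ext i j
      simp [Matrix.mul_apply, kron]
    rw [h1]
    change _ = Matrix.detRowAlternating (R := ℝ)
      (fun i : Fin 4 => ∑ k : Fin 4, A k (v i) • (fun j : Fin 4 => kron k j))
    rw [← AlternatingMap.coe_multilinearMap, MultilinearMap.map_sum]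
    refine Finset.sum_congr rfl fun f _ => ?_
    rw [MultilinearMap.map_smul_univ]
    rfl
  have := key ![a, b, c, d]
  unfold levi
  rw [← this]
  let e : (Fin 4 × Fin 4 × Fin 4 × Fin 4) ≃ (Fin 4 → Fin 4) :=
    { toFun := fun p => ![p.1, p.2.1, p.2.2.1, p.2.2.2]
      invFun := fun f => (f 0, f 1, f 2, f 3)
      left_inv := fun p => rfl
      right_inv := fun f => by ext i; fin_cases i <;> rfl }
  rw [← e.sum_comp]
  simp only [Fintype.sum_prod_type, e, Fin.prod_univ_four]
  rfl

/-- The Hodge star on two-index arrays. -/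
def star2 (P : Matrix (Fin 4) (Fin 4) ℝ) : Matrix (Fin 4) (Fin 4) ℝ :=
  Matrix.of fun m n => ∑ c, ∑ d, P c d * levi c d m n

theorem star2_sum {ι : Type*} (s : Finset ι) (k : ι → ℝ) (P : ι → Matrix (Fin 4) (Fin 4) ℝ) :
    star2 (∑ i ∈ s, k i • P i) = ∑ i ∈ s, k i • star2 (P i) := by
  ext m n
  simp only [star2, Matrix.of_apply, Matrix.sum_apply, Matrix.smul_apply, smul_eq_mul,
    Finset.sum_mul, Finset.mul_sum]
  rw [Finset.sum_congr rfl fun c _ => Finset.sum_comm, Finset.sum_comm]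
  simp only [mul_assoc]

theorem sum_reorder (F : Fin 4 → Fin 4 → Fin 4 → Fin 4 → Fin 4 → Fin 4 → ℝ) :
    ∑ ν, ∑ μ, ∑ γ, ∑ δ, ∑ d, ∑ c, F ν μ γ δ d c = ∑ c, ∑ d, ∑ γ, ∑ δ, ∑ μ, ∑ ν, F ν μ γ δ d c := by
  let e : (Fin 4 × Fin 4 × Fin 4 × Fin 4 × Fin 4 × Fin 4) ≃
      (Fin 4 × Fin 4 × Fin 4 × Fin 4 × Fin 4 × Fin 4) :=
    { toFun := fun (ν, μ, γ, δ, d, c) => (c, d, γ, δ, μ, ν)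
      invFun := fun (c, d, γ, δ, μ, ν) => (ν, μ, γ, δ, d, c)
      left_inv := fun p => rfl
      right_inv := fun p => rfl }
  have := e.sum_comp fun p => F p.2.2.2.2.2 p.2.2.2.2.1 p.2.2.1 p.2.2.2.1 p.2.1 p.1
  simp only [Fintype.sum_prod_type] at this
  exact this

/-- The antisymmetric symbol is a density, not a tensor: a change of frame costs one factor of the
determinant. -/
theorem star2_conj (A P : Matrix (Fin 4) (Fin 4) ℝ) :
    Aᵀ * star2 (A * P * Aᵀ) * A = A.det • star2 P := by
  ext m n
  have h : (A.det • star2 P) m n = ∑ c, ∑ d, P c d * (A.det * levi c d m n) := by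
    simp only [star2, Matrix.smul_apply, Matrix.of_apply, smul_eq_mul, Finset.mul_sum]
    exact Finset.sum_congr rfl fun c _ => Finset.sum_congr rfl fun d _ => by ring
  rw [h]
  simp only [← sum_levi, star2, Matrix.mul_apply, Matrix.transpose_apply, Matrix.of_apply,
    Finset.sum_mul, Finset.mul_sum]
  refine (sum_reorder _).trans ?_
  refine Finset.sum_congr rfl fun c _ => Finset.sum_congr rfl fun d _ => Finset.sum_congr rfl
    fun γ _ => Finset.sum_congr rfl fun δ _ => Finset.sum_congr rfl fun μ _ =>
    Finset.sum_congr rfl fun ν _ => by ring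

theorem dualT_eq_star2 (h : Matrix (Fin 4) (Fin 4) ℝ) (W : Tensor4) (α β : Fin 4) :
    mat34 (dualT h W) α β = (1 / 2 : ℝ) • star2 (h * mat34 W α β * hᵀ) := by
  ext μ ν
  simp only [dualT, mat34, star2, Matrix.of_apply, Matrix.smul_apply, smul_eq_mul,
    Matrix.mul_apply, Matrix.transpose_apply, Finset.sum_mul]
  congr 1
  refine Finset.sum_congr rfl fun γ _ => Finset.sum_congr rfl fun δ _ => ?_
  rw [Finset.sum_comm]
  refine Finset.sum_congr rfl fun c _ => Finset.sum_congr rfl fun d _ => by ring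

/-- Two duals occur in the Bel-Robinson expression, so this determinant enters there squared. That
is why `belRob` carries the squared volume factor as a separate argument. -/
theorem dualT_act (h A : Matrix (Fin 4) (Fin 4) ℝ) (W : Tensor4) (a b c d : Fin 4) :
    act A (dualT (A * h * Aᵀ) W) a b c d = A.det * dualT h (act A W) a b c d := by
  have e1 : mat34 (act A (dualT (A * h * Aᵀ) W)) a b =
      A.det • mat34 (dualT h (act A W)) a b := by
    rw [dualT_eq_star2, mat34_act, mat34_act]
    simp only [dualT_eq_star2, Finset.sum_mul, Finset.mul_sum, Matrix.mul_smul, Matrix.smul_mul,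
      star2_sum, Finset.smul_sum]
    refine Finset.sum_congr rfl fun p _ => ?_
    have e2 : Aᵀ * star2 (A * h * Aᵀ * mat34 W p.1 p.2 * (A * h * Aᵀ)ᵀ) * A =
        A.det • star2 (h * (Aᵀ * mat34 W p.1 p.2 * A) * hᵀ) := by
      rw [← star2_conj]
      simp only [Matrix.transpose_mul, Matrix.transpose_transpose, Matrix.mul_assoc]
    rw [e2]
    simp only [smul_smul]
    congr 1
    ring
  simpa [mat34] using congrFun (congrFun e1 c) d

theorem dualT_act_eq (h A : Matrix (Fin 4) (Fin 4) ℝ) (W : Tensor4) :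
    act A (dualT (A * h * Aᵀ) W) = A.det • dualT h (act A W) := by
  funext a b c d
  exact dualT_act h A W a b c d

theorem act_add (A : Matrix (Fin 4) (Fin 4) ℝ) (T U : Tensor4) :
    act A (T + U) = act A T + act A U := by
  funext a b c d
  simp [act, mul_add, Finset.sum_add_distrib]

theorem act_smul (A : Matrix (Fin 4) (Fin 4) ℝ) (k : ℝ) (T : Tensor4) :
    act A (k • T) = k • act A T := by
  funext a b c d
  simp only [act, Pi.smul_apply, smul_eq_mul, Finset.mul_sum]
  refine Finset.sum_congr rfl fun α _ => Finset.sum_congr rfl fun β _ => Finset.sum_congr rfl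
    fun γ _ => Finset.sum_congr rfl fun δ _ => by ring

theorem sqT_smul (h : Matrix (Fin 4) (Fin 4) ℝ) (k l : ℝ) (T U : Tensor4) :
    sqT h (k • T) (l • U) = (k * l) • sqT h T U := by
  funext a b c d
  simp only [sqT, Pi.smul_apply, smul_eq_mul, Finset.mul_sum]
  refine Finset.sum_congr rfl fun α _ => Finset.sum_congr rfl fun β _ => Finset.sum_congr rfl
    fun γ _ => Finset.sum_congr rfl fun δ _ => by ring

/-- The Bel-Robinson expression is covariant under changes of frame. -/
theorem belRob_act (h A : Matrix (Fin 4) (Fin 4) ℝ) (s : ℝ) (T U : Tensor4) :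
    act A (belRob (A * h * Aᵀ) s T U) = belRob h (s * A.det ^ 2) (act A T) (act A U) := by
  have e : ∀ (k : Matrix (Fin 4) (Fin 4) ℝ) (s : ℝ) (T U : Tensor4),
      belRob k s T U = sqT k T U + s • sqT k (dualT k T) (dualT k U) := fun k s T U => rfl
  rw [e, e, act_add, act_smul, ← sqT_act, ← sqT_act, dualT_act_eq, dualT_act_eq, sqT_smul,
    smul_smul, sq]

/-! ### Weyl tensors in an orthonormal frame -/

/-- The signs of the Minkowski metric. -/
def sgn : Fin 4 → ℝ := ![-1, 1, 1, 1]

/-- The Minkowski metric. -/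
def mink : Matrix (Fin 4) (Fin 4) ℝ := Matrix.diagonal sgn

/-- Algebraic Weyl tensors with respect to the inverse metric `h`. -/
structure IsWeyl (h : Matrix (Fin 4) (Fin 4) ℝ) (W : Tensor4) : Prop where
  antisymm_left : ∀ α β γ δ, W α β γ δ = -W β α γ δ
  antisymm_right : ∀ α β γ δ, W α β γ δ = -W α β δ γ
  cyclic : ∀ α β γ δ, W α β γ δ + W α γ δ β + W α δ β γ = 0
  traceFree : ∀ β δ, ∑ α, ∑ γ, h α γ * W α β γ δ = 0

/-- The two-form with given components `01, 02, 03, 23, 31, 12`. -/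
def bivec (x : Fin 6 → ℝ) : Fin 4 → Fin 4 → ℝ :=
  ![![0, x 0, x 1, x 2], ![-x 0, 0, x 5, -x 4], ![-x 1, -x 5, 0, x 3], ![-x 2, x 4, -x 3, 0]]

/-- The matrix on two-forms of the Weyl tensor with electric part `p 0, …, p 4` and magnetic part
`p 5, …, p 9`. -/
def weylMat (p : Fin 10 → ℝ) : Fin 6 → Fin 6 → ℝ :=
  ![![p 0, p 1, p 2, p 5, p 6, p 7],
    ![p 1, p 3, p 4, p 6, p 8, p 9],
    ![p 2, p 4, -p 0 - p 3, p 7, p 9, -p 5 - p 8],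
    ![p 5, p 6, p 7, -p 0, -p 1, -p 2],
    ![p 6, p 8, p 9, -p 1, -p 3, -p 4],
    ![p 7, p 9, -p 5 - p 8, -p 2, -p 4, p 0 + p 3]]

/-- The Weyl tensor with given electric and magnetic parts. -/
def weylOf (p : Fin 10 → ℝ) : Tensor4 := fun a b c d =>
  bivec (fun I => bivec (weylMat p I) c d) a b

/-- The electric and magnetic parts of a Weyl tensor. -/
def weylPar (W : Tensor4) : Fin 10 → ℝ :=
  ![W 0 1 0 1, W 0 1 0 2, W 0 1 0 3, W 0 2 0 2, W 0 2 0 3,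
    W 0 1 2 3, W 0 1 3 1, W 0 1 1 2, W 0 2 3 1, W 0 2 1 2]

theorem eq_bivec {f : Fin 4 → Fin 4 → ℝ} (hf : ∀ a b, f a b = -f b a) (a b : Fin 4) :
    f a b = bivec ![f 0 1, f 0 2, f 0 3, f 2 3, f 3 1, f 1 2] a b := by
  have := hf a b
  have h00 := hf 0 0
  have h11 := hf 1 1
  have h22 := hf 2 2
  have h33 := hf 3 3
  fin_cases a <;> fin_cases b <;> simp [bivec] at * <;> linarith

/-- The mixed trace conditions make the magnetic block symmetric, and the cyclic identity makes its
trace vanish. The time-time trace makes the electric block trace-free, and the spatial traces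
identify the purely spatial block with minus the electric one. Two symmetric trace-free 3×3 matrices
remain, that is, ten parameters; all algebra of Weyl tensors below is polynomial identities in them.
-/
theorem IsWeyl.eq_weylOf {W : Tensor4} (hW : IsWeyl mink W) : W = weylOf (weylPar W) := by
  have hl := hW.antisymm_left
  have hr := hW.antisymm_right
  have hc := hW.cyclic
  have ht : ∀ β δ, -W 0 β 0 δ + W 1 β 1 δ + W 2 β 2 δ + W 3 β 3 δ = 0 := by
    intro β δ
    have := hW.traceFree β δ
    simpa [mink, Matrix.diagonal_apply, Fin.sum_univ_four, sgn] using this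
  -- Pair symmetry: add up the four cyclic identities obtained by rotating the indices; the
  -- antisymmetries cancel everything else.
  have pair : ∀ a b c d, W a b c d = W c d a b := by
    intro a b c d
    linarith [hc a b c d, hc b c d a, hc c d a b, hc d a b c, hl a b c d, hr a b c d, hl a c d b,
      hr a c d b, hl a d b c, hr a d b c, hl b c d a, hr b c d a, hl b d a c, hr b d a c,
      hl b a c d, hr b a c d, hl c d a b, hr c d a b, hl c a b d, hr c a b d, hl c b d a,
      hr c b d a, hl d a b c, hr d a b c, hl d b c a, hr d b c a, hl d c a b, hr d c a b,
      hr b a d c, hl c d b a, hr b d c a, hl d b a c, hr c a d b, hr d a c b, hl a d c b]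
  have z : ∀ a c d, W a a c d = 0 := fun a c d => by linarith [hl a a c d]
  have z' : ∀ a b c, W a b c c = 0 := fun a b c => by linarith [hr a b c c]
  have e : ∀ I : Fin 6, ∀ c d,
      (![W 0 1 c d, W 0 2 c d, W 0 3 c d, W 2 3 c d, W 3 1 c d, W 1 2 c d] : Fin 6 → ℝ) I =
        bivec (weylMat (weylPar W) I) c d := by
    intro I c d
    have h0 := ht 0 0
    have h11 := ht 1 1
    have h22 := ht 2 2
    have h33 := ht 3 3
    have h01 := ht 0 1
    have h02 := ht 0 2
    have h03 := ht 0 3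
    have h12 := ht 1 2
    have h13 := ht 1 3
    have h23 := ht 2 3
    have c0 := hc 0 1 2 3
    rw [eq_bivec (f := fun c d => (![W 0 1 c d, W 0 2 c d, W 0 3 c d, W 2 3 c d, W 3 1 c d,
      W 1 2 c d] : Fin 6 → ℝ) I) (fun c d => by fin_cases I <;> exact hr _ _ _ _)]
    congr 1
    simp only [z, z', hl 1 0, hl 2 0, hl 3 0, hl 2 1, hl 1 3, hl 3 2, hr _ _ 1 0, hr _ _ 2 0,
      hr _ _ 3 0, hr _ _ 2 1, hr _ _ 1 3, hr _ _ 3 2] at h0 h11 h22 h33 h01 h02 h03 h12 h13 h23 c0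
    have q1 := pair 0 1 0 2
    have q2 := pair 0 1 0 3
    have q3 := pair 0 2 0 3
    have q4 := pair 2 3 3 1
    have q5 := pair 2 3 1 2
    have q6 := pair 3 1 1 2
    have r1 := pair 0 1 2 3
    have r2 := pair 0 1 3 1
    have r3 := pair 0 1 1 2
    have r4 := pair 0 2 2 3
    have r5 := pair 0 2 3 1
    have r6 := pair 0 2 1 2
    have r7 := pair 0 3 2 3
    have r8 := pair 0 3 3 1
    have r9 := pair 0 3 1 2
    funext J
    fin_cases I <;> fin_cases J <;> simp [weylMat, weylPar] <;> linarith
  funext a b c d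
  rw [eq_bivec (f := fun a b => W a b c d) (fun a b => hl a b c d)]
  unfold weylOf
  congr 1
  funext I
  exact e I c d

/-- The duality rotation of the electric and magnetic parts. -/
def dualPar (p : Fin 10 → ℝ) : Fin 10 → ℝ :=
  ![p 5, p 6, p 7, p 8, p 9, -p 0, -p 1, -p 2, -p 3, -p 4]

theorem sqT_mink (T U : Tensor4) (α β γ δ : Fin 4) :
    sqT mink T U α β γ δ = ∑ ρ, ∑ σ, sgn ρ * sgn σ * T α ρ γ σ * U β ρ δ σ := by
  simp only [sqT, mink, Matrix.diagonal_apply]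
  refine Finset.sum_congr rfl fun ρ _ => Finset.sum_congr rfl fun σ _ => ?_
  simp

/-- Multiply the selection matrix by the Vandermonde matrix with nodes 0, 1, 2, 3, whose determinant
is 12. The resulting product of differences can be evaluated by arithmetic, which avoids expanding
4×4 determinants. -/
theorem levi_eq (a b c d : Fin 4) : levi a b c d =
    (1 / 12) * (((b : ℕ) - (a : ℕ) : ℝ) * ((c : ℕ) - (a : ℕ)) * ((d : ℕ) - (a : ℕ)) *
      ((c : ℕ) - (b : ℕ)) * ((d : ℕ) - (b : ℕ)) * ((d : ℕ) - (c : ℕ))) := by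
  have h1 : (Matrix.of fun i j : Fin 4 => kron (![a, b, c, d] i) j) *
      Matrix.vandermonde (fun i : Fin 4 => ((i : ℕ) : ℝ)) =
      Matrix.vandermonde (fun i => (((![a, b, c, d] i : Fin 4) : ℕ) : ℝ)) := by
    ext i j
    simp [Matrix.mul_apply, kron, Matrix.vandermonde]
  have h2 := congrArg Matrix.det h1
  rw [Matrix.det_mul, Matrix.det_vandermonde, Matrix.det_vandermonde] at h2
  have i0 : Finset.Ioi (0 : Fin 4) = {1, 2, 3} := rfl
  have i1 : Finset.Ioi (1 : Fin 4) = {2, 3} := rfl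
  have i2 : Finset.Ioi (2 : Fin 4) = {3} := rfl
  have i3 : Finset.Ioi (3 : Fin 4) = ∅ := rfl
  simp only [Fin.prod_univ_four, i0, i1, i2, i3] at h2
  unfold levi
  simp at h2
  norm_num at h2
  linear_combination (1 / 12) * h2

/-- The Hodge dual on the components of a two-form. -/
def dual6 (x : Fin 6 → ℝ) : Fin 6 → ℝ := ![x 3, x 4, x 5, -x 0, -x 1, -x 2]

theorem star2_bivec (x : Fin 6 → ℝ) :
    star2 (mink * Matrix.of (bivec x) * minkᵀ) = (2 : ℝ) • Matrix.of (bivec (dual6 x)) := by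
  have h : ∀ c d, (mink * Matrix.of (bivec x) * minkᵀ) c d = sgn c * bivec x c d * sgn d := by
    intro c d
    simp [mink, Matrix.diagonal_transpose]
  ext m n
  simp only [star2, Matrix.of_apply, h, levi_eq, Matrix.smul_apply, smul_eq_mul]
  fin_cases m <;> fin_cases n <;>
    simp [Fin.sum_univ_four, bivec, dual6, sgn] <;> ring

theorem bivec_eq_sum (x : Fin 6 → ℝ) (a b : Fin 4) :
    bivec x a b = ∑ I, x I * bivec (Pi.single I 1) a b := by
  fin_cases a <;> fin_cases b <;> simp [bivec, Pi.single_apply]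

theorem bivec_comm (M : Fin 6 → Fin 6 → ℝ) (a b c d : Fin 4) :
    bivec (fun I => bivec (M I) c d) a b = bivec (fun J => bivec (fun I => M I J) a b) c d := by
  rw [bivec_eq_sum, bivec_eq_sum (fun J => _) c d]
  simp only [bivec_eq_sum (M _) c d, bivec_eq_sum (fun I => M I _) a b, Finset.sum_mul]
  rw [Finset.sum_comm]
  exact Finset.sum_congr rfl fun I _ => Finset.sum_congr rfl fun J _ => by ring

/-- Duality rotates (E, H) to (H, -E). It therefore stays within the ten-parameter family, and
bounds for W apply to its dual as well. -/
theorem dualT_weylOf (p : Fin 10 → ℝ) : dualT mink (weylOf p) = weylOf (dualPar p) := by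
  funext a b c d
  have h : mat34 (weylOf p) a b =
      Matrix.of (bivec (fun J => bivec (fun I => weylMat p I J) a b)) := by
    ext c d
    exact bivec_comm _ _ _ _ _
  have := congrFun (congrFun (dualT_eq_star2 mink (weylOf p) a b) c) d
  rw [h, star2_bivec, smul_smul] at this
  norm_num [mat34] at this
  rw [this, weylOf, bivec_comm]
  have hm : ∀ I J, weylMat (dualPar p) I J = dual6 (weylMat p I) J := by
    intro I J
    fin_cases I <;> fin_cases J <;> simp [weylMat, dual6, dualPar] <;> ring
  congr 1
  funext J
  have hb : (fun J => bivec (fun I => weylMat p I J) a b) =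
      fun J => ∑ I, weylMat p I J * bivec (Pi.single I 1) a b :=
    funext fun J => bivec_eq_sum _ a b
  rw [hb, bivec_eq_sum (fun I => weylMat (dualPar p) I J) a b]
  simp only [hm]
  fin_cases J <;> simp [dual6]

/-- The polarised Bel-Robinson tensor of two Weyl tensors in an orthonormal frame. -/
theorem belRob_weylOf (p p' : Fin 10 → ℝ) (a b c d : Fin 4) :
    belRob mink 1 (weylOf p) (weylOf p') a b c d =
      (∑ ρ, ∑ σ, sgn ρ * sgn σ * weylOf p a ρ c σ * weylOf p' b ρ d σ) +
        ∑ ρ, ∑ σ, sgn ρ * sgn σ * weylOf (dualPar p) a ρ c σ * weylOf (dualPar p') b ρ d σ := by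
  rw [belRob, dualT_weylOf, dualT_weylOf, sqT_mink, sqT_mink, one_mul]

/-- The energy-momentum density of two Weyl tensors with respect to the time direction. -/
theorem belRob_weylOf_time (p p' : Fin 10 → ℝ) :
    belRob mink 1 (weylOf p) (weylOf p') 0 0 0 0 =
      p 0 * p' 0 + p 3 * p' 3 + (p 0 + p 3) * (p' 0 + p' 3) +
        2 * (p 1 * p' 1 + p 2 * p' 2 + p 4 * p' 4) +
      (p 5 * p' 5 + p 8 * p' 8 + (p 5 + p 8) * (p' 5 + p' 8) +
        2 * (p 6 * p' 6 + p 7 * p' 7 + p 9 * p' 9)) := by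
  rw [belRob_weylOf]
  simp [Fin.sum_univ_four, sgn, weylOf, bivec, weylMat, dualPar]
  ring

theorem belRob_weylOf_time_nonneg (p : Fin 10 → ℝ) :
    0 ≤ belRob mink 1 (weylOf p) (weylOf p) 0 0 0 0 := by
  rw [belRob_weylOf_time]
  nlinarith [sq_nonneg (p 0), sq_nonneg (p 1), sq_nonneg (p 2), sq_nonneg (p 3), sq_nonneg (p 4),
    sq_nonneg (p 5), sq_nonneg (p 6), sq_nonneg (p 7), sq_nonneg (p 8), sq_nonneg (p 9),
    sq_nonneg (p 0 + p 3), sq_nonneg (p 5 + p 8)]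

/-- The energy flux in a spatial direction is dominated by the energy density. -/
theorem abs_belRob_weylOf_flux_le (p : Fin 10 → ℝ) :
    |belRob mink 1 (weylOf p) (weylOf p) 1 0 0 0| ≤
      belRob mink 1 (weylOf p) (weylOf p) 0 0 0 0 := by
  rw [belRob_weylOf_time]
  -- The component is, up to sign, the Poynting expression 2 E × H. Splitting `2 * (p 8 * p 4) + p 5
  -- * p 4` as `p 8 * p 4 + (p 5 + p 8) * p 4`, and likewise the terms with `p 9`, matches each
  -- product with two squares in |E|² + |H|².
  have : belRob mink 1 (weylOf p) (weylOf p) 1 0 0 0 =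
      2 * (p 7 * p 1 + 2 * (p 9 * p 3) + p 9 * p 0 - p 5 * p 4 - 2 * (p 8 * p 4) - p 6 * p 2) := by
    rw [belRob_weylOf]
    simp [Fin.sum_univ_four, sgn, weylOf, bivec, weylMat, dualPar]
    ring
  rw [this, abs_le]
  constructor
  · nlinarith [sq_nonneg (p 7 + p 1), sq_nonneg (p 9 + p 3), sq_nonneg (p 9 + (p 0 + p 3)),
      sq_nonneg (p 8 - p 4), sq_nonneg (p 4 - (p 5 + p 8)), sq_nonneg (p 6 - p 2),
      sq_nonneg (p 0), sq_nonneg (p 5), sq_nonneg (p 1), sq_nonneg (p 2), sq_nonneg (p 6),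
      sq_nonneg (p 7)]
  · nlinarith [sq_nonneg (p 7 - p 1), sq_nonneg (p 9 - p 3), sq_nonneg (p 9 - (p 0 + p 3)),
      sq_nonneg (p 8 + p 4), sq_nonneg (p 4 + (p 5 + p 8)), sq_nonneg (p 6 + p 2),
      sq_nonneg (p 0), sq_nonneg (p 5), sq_nonneg (p 1), sq_nonneg (p 2), sq_nonneg (p 6),
      sq_nonneg (p 7)]

theorem abs_bivec_le {x : Fin 6 → ℝ} {m : ℝ} (hm : 0 ≤ m) (h : ∀ I, |x I| ≤ m) (a b : Fin 4) :
    |bivec x a b| ≤ m := by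
  fin_cases a <;> fin_cases b <;> simp [bivec, hm, h]

theorem sq_weylMat_le (p : Fin 10 → ℝ) (I J : Fin 6) :
    weylMat p I J ^ 2 ≤ belRob mink 1 (weylOf p) (weylOf p) 0 0 0 0 := by
  rw [belRob_weylOf_time]
  have h0 := sq_nonneg (p 0)
  have h1 := sq_nonneg (p 1)
  have h2 := sq_nonneg (p 2)
  have h3 := sq_nonneg (p 3)
  have h4 := sq_nonneg (p 4)
  have h5 := sq_nonneg (p 5)
  have h6 := sq_nonneg (p 6)
  have h7 := sq_nonneg (p 7)
  have h8 := sq_nonneg (p 8)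
  have h9 := sq_nonneg (p 9)
  have h10 := sq_nonneg (p 0 + p 3)
  have h11 := sq_nonneg (p 5 + p 8)
  fin_cases I <;> fin_cases J <;> simp only [weylMat] <;> simp <;> linarith

theorem abs_weylOf_le (p : Fin 10 → ℝ) (a b c d : Fin 4) :
    |weylOf p a b c d| ≤ √(belRob mink 1 (weylOf p) (weylOf p) 0 0 0 0) :=
  abs_bivec_le (Real.sqrt_nonneg _) (fun I => abs_bivec_le (Real.sqrt_nonneg _)
    (fun J => Real.abs_le_sqrt (sq_weylMat_le p I J)) c d) a b

theorem belRob_dualPar_time (p : Fin 10 → ℝ) :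
    belRob mink 1 (weylOf (dualPar p)) (weylOf (dualPar p)) 0 0 0 0 =
      belRob mink 1 (weylOf p) (weylOf p) 0 0 0 0 := by
  simp only [belRob_weylOf_time, dualPar]
  simp
  ring

theorem abs_sgn (a : Fin 4) : |sgn a| = 1 := by fin_cases a <;> simp [sgn]

/-- All components of the Bel-Robinson tensor are dominated by the energy density. -/
theorem abs_belRob_weylOf_le (p : Fin 10 → ℝ) (a b c d : Fin 4) :
    |belRob mink 1 (weylOf p) (weylOf p) a b c d| ≤
      32 * belRob mink 1 (weylOf p) (weylOf p) 0 0 0 0 := by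
  set N := belRob mink 1 (weylOf p) (weylOf p) 0 0 0 0 with hN
  have hN0 : 0 ≤ N := belRob_weylOf_time_nonneg p
  -- Each component of W is at most √N. The contraction has sixteen terms, and W and its dual both
  -- contribute, which gives the constant 32.
  have key : ∀ p' : Fin 10 → ℝ, belRob mink 1 (weylOf p') (weylOf p') 0 0 0 0 = N →
      |∑ ρ, ∑ σ, sgn ρ * sgn σ * weylOf p' a ρ c σ * weylOf p' b ρ d σ| ≤ 16 * N := by
    intro p' h'
    have hb := abs_weylOf_le p'
    rw [h'] at hb
    have hterm : ∀ ρ σ, |sgn ρ * sgn σ * weylOf p' a ρ c σ * weylOf p' b ρ d σ| ≤ N := by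
      intro ρ σ
      rw [abs_mul, abs_mul, abs_mul, abs_sgn, abs_sgn, one_mul, one_mul, ← Real.mul_self_sqrt hN0]
      exact mul_le_mul (hb _ _ _ _) (hb _ _ _ _) (abs_nonneg _) (Real.sqrt_nonneg _)
    calc _ ≤ ∑ ρ : Fin 4, ∑ σ : Fin 4, N :=
          (Finset.abs_sum_le_sum_abs _ _).trans (Finset.sum_le_sum fun ρ _ =>
            (Finset.abs_sum_le_sum_abs _ _).trans (Finset.sum_le_sum fun σ _ => hterm ρ σ))
      _ = 16 * N := by simp; ring
  rw [belRob_weylOf]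
  have h1 := key p rfl
  have h2 := key (dualPar p) (belRob_dualPar_time p)
  exact (abs_add_le _ _).trans (by linarith)

/-- The Bel-Robinson tensor with two time components, symmetrised over the remaining slots. -/
def belSym (Q : Tensor4) (a c : Fin 4) : ℝ := Q a c 0 0 + Q a 0 c 0 + Q a 0 0 c

/-- The Bel-Robinson tensor is totally symmetric, but only this much of the symmetry is used: it
allows ∇K to be replaced by its symmetric part in the divergence of the current. -/
theorem belSym_symm (p : Fin 10 → ℝ) (a c : Fin 4) :
    belSym (belRob mink 1 (weylOf p) (weylOf p)) a c =
      belSym (belRob mink 1 (weylOf p) (weylOf p)) c a := by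
  wlog h : a < c generalizing a c
  · rcases (not_lt.1 h).eq_or_lt with h | h
    · rw [h]
    · exact (this c a h).symm
  simp only [belSym, belRob_weylOf]
  fin_cases a <;> fin_cases c <;> first | exact absurd h (by decide) | skip
  all_goals
    simp [Fin.sum_univ_four, sgn, weylOf, bivec, weylMat, dualPar]
    ring

/-- This removes the conformal part of the deformation tensor of K, the part that the assumptions do
not make small relative to T. -/
theorem belSym_trace (p : Fin 10 → ℝ) :
    ∑ a, sgn a * belSym (belRob mink 1 (weylOf p) (weylOf p)) a a = 0 := by
  simp only [belSym, belRob_weylOf]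
  simp [Fin.sum_univ_four, sgn, weylOf, bivec, weylMat, dualPar]
  ring

/-- The algebraic form of the conservation law of the Bel-Robinson tensor: `t a` are the components
of the derivative in the direction `a`. -/
theorem belRob_conservation (p : Fin 10 → ℝ) (t : Fin 4 → Fin 10 → ℝ)
    (h : ∀ c d e, ∑ a, sgn a * weylOf (t a) a c d e = 0) :
    ∑ a, sgn a * (belRob mink 1 (weylOf (t a)) (weylOf p) a 0 0 0 +
      belRob mink 1 (weylOf p) (weylOf (t a)) a 0 0 0) = 0 := by
  have e : ∀ c d e, -weylOf (t 0) 0 c d e + weylOf (t 1) 1 c d e + weylOf (t 2) 2 c d e +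
      weylOf (t 3) 3 c d e = 0 := fun c d e => by
    have := h c d e
    simpa [Fin.sum_univ_four, sgn] using this
  have e11 := e 1 0 1
  have e12 := e 1 0 2
  have e13 := e 1 0 3
  have e21 := e 2 0 1
  have e22 := e 2 0 2
  have e23 := e 2 0 3
  have e31 := e 3 0 1
  have e32 := e 3 0 2
  have e33 := e 3 0 3
  have b11 := e 1 2 3
  have b12 := e 1 3 1
  have b13 := e 1 1 2
  have b21 := e 2 2 3
  have b22 := e 2 3 1
  have b23 := e 2 1 2
  have b31 := e 3 2 3
  have b32 := e 3 3 1
  have b33 := e 3 1 2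
  clear e h
  simp only [belRob_weylOf]
  simp [Fin.sum_univ_four, sgn, weylOf, bivec, weylMat, dualPar] at *
  -- The multipliers are E against the components (c, 0, d) of the Bianchi equations and H against
  -- the components whose last pair is spatial. The latter act as the Bianchi equations of the dual
  -- field, so no separate hypothesis on the dual is needed.
  linear_combination 2 * (p 0 * e11 + p 1 * e12 + p 2 * e13 + p 1 * e21 + p 3 * e22 + p 4 * e23 +
    p 2 * e31 + p 4 * e32 + (-p 0 - p 3) * e33 +
    p 5 * b11 + p 6 * b12 + p 7 * b13 + p 6 * b21 + p 8 * b22 + p 9 * b23 +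
    p 7 * b31 + p 9 * b32 + (-p 5 - p 8) * b33)

/-! ### Derivatives of frame components along a curve -/

/-- Entrywise derivative at `0` of a curve of matrices. -/
def MatDeriv (M : ℝ → Matrix (Fin 4) (Fin 4) ℝ) (M' : Matrix (Fin 4) (Fin 4) ℝ) : Prop :=
  ∀ i j, HasDerivAt (fun t => M t i j) (M' i j) 0

theorem MatDeriv.mul {M N : ℝ → Matrix (Fin 4) (Fin 4) ℝ} {M' N' : Matrix (Fin 4) (Fin 4) ℝ}
    (hM : MatDeriv M M') (hN : MatDeriv N N') :
    MatDeriv (fun t => M t * N t) (M' * N 0 + M 0 * N') := by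
  intro i j
  simp only [Matrix.mul_apply, Matrix.add_apply, ← Finset.sum_add_distrib]
  exact HasDerivAt.fun_sum fun k _ => (hM i k).mul (hN k j)

theorem MatDeriv.transpose {M : ℝ → Matrix (Fin 4) (Fin 4) ℝ} {M' : Matrix (Fin 4) (Fin 4) ℝ}
    (hM : MatDeriv M M') : MatDeriv (fun t => (M t)ᵀ) M'ᵀ := fun i j => hM j i

theorem matDeriv_const (M : Matrix (Fin 4) (Fin 4) ℝ) : MatDeriv (fun _ => M) 0 :=
  fun i j => hasDerivAt_const (0 : ℝ) (M i j)

theorem MatDeriv.congr_deriv {M : ℝ → Matrix (Fin 4) (Fin 4) ℝ}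
    {M' N' : Matrix (Fin 4) (Fin 4) ℝ} (hM : MatDeriv M M') (h : M' = N') : MatDeriv M N' := h ▸ hM

theorem differentiable_det :
    Differentiable ℝ (fun M : Fin 4 → Fin 4 → ℝ => Matrix.det (Matrix.of M)) := by
  simp only [Matrix.det_apply, Matrix.of_apply]
  fun_prop

theorem MatDeriv.hasDerivAt_pi {M : ℝ → Matrix (Fin 4) (Fin 4) ℝ}
    {M' : Matrix (Fin 4) (Fin 4) ℝ} (hM : MatDeriv M M') :
    HasDerivAt (fun t => (fun i j => M t i j : Fin 4 → Fin 4 → ℝ)) (fun i j => M' i j) 0 :=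
  _root_.hasDerivAt_pi.2 fun i => _root_.hasDerivAt_pi.2 fun j => hM i j

theorem hasDerivAt_det_comp {m : ℝ → Fin 4 → Fin 4 → ℝ} {m' : Fin 4 → Fin 4 → ℝ}
    (h : HasDerivAt m m' 0) : HasDerivAt (fun t => (Matrix.of (m t)).det)
      (fderiv ℝ (fun N : Fin 4 → Fin 4 → ℝ => Matrix.det (Matrix.of N)) (m 0) m') 0 :=
  (differentiable_det (m 0)).hasFDerivAt.comp_hasDerivAt 0 h

theorem MatDeriv.differentiableAt_det {M : ℝ → Matrix (Fin 4) (Fin 4) ℝ}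
    {M' : Matrix (Fin 4) (Fin 4) ℝ} (hM : MatDeriv M M') :
    DifferentiableAt ℝ (fun t => (M t).det) 0 :=
  (hasDerivAt_det_comp hM.hasDerivAt_pi).differentiableAt

theorem MatDeriv.hasDerivAt_det_zero {M : ℝ → Matrix (Fin 4) (Fin 4) ℝ} (hM : MatDeriv M 0) :
    HasDerivAt (fun t => (M t).det) 0 0 :=
  (hasDerivAt_det_comp hM.hasDerivAt_pi).congr_deriv
    (map_zero (fderiv ℝ (fun N : Fin 4 → Fin 4 → ℝ => Matrix.det (Matrix.of N))
      (fun i j => M 0 i j)))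

/-- The inverse of a differentiable curve of invertible matrices. -/
theorem MatDeriv.inv {M : ℝ → Matrix (Fin 4) (Fin 4) ℝ} {M' : Matrix (Fin 4) (Fin 4) ℝ}
    (hM : MatDeriv M M') (h0 : (M 0).det ≠ 0) :
    MatDeriv (fun t => (M t)⁻¹) (-((M 0)⁻¹ * M' * (M 0)⁻¹)) := by
  -- Cramer's rule gives differentiability of the inverse; its derivative is then read off by
  -- differentiating `M t * (M t)⁻¹ = 1`.
  have hdiff : ∀ i j, DifferentiableAt ℝ (fun t => (M t)⁻¹ i j) 0 := by
    intro i j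
    have hadj : DifferentiableAt ℝ (fun t => (M t).adjugate i j) 0 := by
      simp only [Matrix.adjugate_apply]
      have : MatDeriv (fun t => (M t).updateRow j (Pi.single i 1))
          (M'.updateRow j 0) := by
        intro a b
        by_cases hab : a = j
        · subst hab
          simp only [Matrix.updateRow_self]
          exact hasDerivAt_const _ _
        · simp only [Matrix.updateRow_ne hab]
          exact hM a b
      exact this.differentiableAt_det
    simp only [Matrix.inv_def, Ring.inverse_eq_inv', Matrix.smul_apply, smul_eq_mul]
    exact (hM.differentiableAt_det.inv h0).mul hadj
  have hN : MatDeriv (fun t => (M t)⁻¹)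
      (Matrix.of fun i j => _root_.deriv (fun t => (M t)⁻¹ i j) 0) :=
    fun i j => (hdiff i j).hasDerivAt
  set N' : Matrix (Fin 4) (Fin 4) ℝ := Matrix.of fun i j => _root_.deriv (fun t => (M t)⁻¹ i j) 0
  have hev : ∀ᶠ t in 𝓝 (0 : ℝ), (M t).det ≠ 0 :=
    hM.differentiableAt_det.continuousAt.eventually_ne h0
  have hone : (M 0)⁻¹ * M 0 = 1 := Matrix.nonsing_inv_mul _ (isUnit_iff_ne_zero.2 h0)
  have hone' : M 0 * (M 0)⁻¹ = 1 := Matrix.mul_nonsing_inv _ (isUnit_iff_ne_zero.2 h0)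
  have hz : M' * (M 0)⁻¹ + M 0 * N' = 0 := by
    ext i j
    have h1 := hM.mul hN i j
    have h2 : HasDerivAt (fun t => (M t * (M t)⁻¹) i j) 0 0 := by
      refine (hasDerivAt_const (0 : ℝ) ((1 : Matrix (Fin 4) (Fin 4) ℝ) i j)).congr_of_eventuallyEq ?_
      filter_upwards [hev] with t ht
      rw [Matrix.mul_nonsing_inv _ (isUnit_iff_ne_zero.2 ht)]
    exact h1.unique h2
  refine hN.congr_deriv ?_
  have h3 : (M 0)⁻¹ * (M' * (M 0)⁻¹ + M 0 * N') = 0 := by rw [hz, Matrix.mul_zero]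
  rw [Matrix.mul_add, ← Matrix.mul_assoc, ← Matrix.mul_assoc, hone, Matrix.one_mul] at h3
  exact eq_neg_of_add_eq_zero_right h3

theorem sum_swap (F : Fin 4 → Fin 4 → Fin 4 → Fin 4 → ℝ) :
    ∑ a, ∑ c, ∑ β, ∑ δ, F a c β δ = ∑ β, ∑ δ, ∑ a, ∑ c, F a c β δ := by
  let e : (Fin 4 × Fin 4 × Fin 4 × Fin 4) ≃ (Fin 4 × Fin 4 × Fin 4 × Fin 4) :=
    { toFun := fun (a, c, β, δ) => (β, δ, a, c)
      invFun := fun (β, δ, a, c) => (a, c, β, δ)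
      left_inv := fun p => rfl
      right_inv := fun p => rfl }
  have := e.sum_comp fun p => F p.2.2.1 p.2.2.2 p.1 p.2.1
  simp only [Fintype.sum_prod_type] at this
  exact this

theorem IsWeyl.act {h k A : Matrix (Fin 4) (Fin 4) ℝ} {W : Tensor4} (hW : IsWeyl k W)
    (hA : k = A * h * Aᵀ) : IsWeyl h (act A W) where
  antisymm_left a b c d := by
    simp only [DoubleNull.act]
    rw [Finset.sum_comm]
    simp only [← Finset.sum_neg_distrib]
    refine Finset.sum_congr rfl fun α _ => Finset.sum_congr rfl fun β _ => Finset.sum_congr rfl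
      fun γ _ => Finset.sum_congr rfl fun δ _ => by rw [hW.antisymm_left]; ring
  antisymm_right a b c d := by
    simp only [DoubleNull.act, ← Finset.sum_neg_distrib]
    refine Finset.sum_congr rfl fun α _ => Finset.sum_congr rfl fun β _ => ?_
    rw [Finset.sum_comm]
    refine Finset.sum_congr rfl
      fun γ _ => Finset.sum_congr rfl fun δ _ => by rw [hW.antisymm_right]; ring
  cyclic a b c d := by
    have e1 : DoubleNull.act A W a c d b =
        ∑ α, ∑ β, ∑ γ, ∑ δ, A α a * A β b * A γ c * A δ d * W α γ δ β := by
      simp only [DoubleNull.act]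
      refine Finset.sum_congr rfl fun α _ => ?_
      rw [Finset.sum_congr rfl fun β _ => Finset.sum_comm, Finset.sum_comm]
      refine Finset.sum_congr rfl fun β _ => Finset.sum_congr rfl fun γ _ =>
        Finset.sum_congr rfl fun δ _ => by ring
    have e2 : DoubleNull.act A W a d b c =
        ∑ α, ∑ β, ∑ γ, ∑ δ, A α a * A β b * A γ c * A δ d * W α δ β γ := by
      simp only [DoubleNull.act]
      refine Finset.sum_congr rfl fun α _ => ?_
      rw [Finset.sum_comm]
      refine (Finset.sum_congr rfl fun β _ => ?_)
      rw [Finset.sum_comm]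
      refine Finset.sum_congr rfl fun γ _ => Finset.sum_congr rfl fun δ _ => by ring
    rw [e1, e2, DoubleNull.act]
    simp only [← Finset.sum_add_distrib]
    refine Finset.sum_eq_zero fun α _ => Finset.sum_eq_zero fun β _ => Finset.sum_eq_zero
      fun γ _ => Finset.sum_eq_zero fun δ _ => ?_
    rw [← mul_add, ← mul_add, hW.cyclic, mul_zero]
  traceFree b d := by
    have e : ∑ a, ∑ c, h a c * DoubleNull.act A W a b c d =
        ∑ β, ∑ δ, A β b * A δ d * ∑ α, ∑ γ, k α γ * W α β γ δ := by
      have e1 : ∀ M : Matrix (Fin 4) (Fin 4) ℝ, ∑ α, ∑ γ, k α γ * M α γ =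
          ∑ a, ∑ c, h a c * (Aᵀ * M * A) a c := by
        have : ∀ P M : Matrix (Fin 4) (Fin 4) ℝ, ∑ α, ∑ γ, P α γ * M α γ = (Pᵀ * M).trace := by
          intro P M
          simp only [Matrix.trace, Matrix.diag, Matrix.mul_apply, Matrix.transpose_apply]
          exact Finset.sum_comm
        intro M
        rw [this, this, hA]
        simp only [Matrix.transpose_mul, Matrix.transpose_transpose]
        rw [Matrix.mul_assoc, Matrix.trace_mul_comm, ← Matrix.mul_assoc, Matrix.mul_assoc,
          Matrix.mul_assoc]
        simp only [Matrix.mul_assoc]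
      have e2 : ∀ a c, DoubleNull.act A W a b c d = ∑ β, ∑ δ, A β b * A δ d *
          (Aᵀ * (Matrix.of fun α γ => W α β γ δ) * A) a c := by
        intro a c
        simp only [DoubleNull.act, Finset.mul_sum, Matrix.mul_apply, Matrix.transpose_apply,
          Finset.sum_mul, Matrix.of_apply]
        rw [Finset.sum_comm]
        refine Finset.sum_congr rfl fun β _ => ?_
        rw [Finset.sum_congr rfl fun α _ => Finset.sum_comm, Finset.sum_comm]
        refine Finset.sum_congr rfl fun δ _ => ?_
        rw [Finset.sum_comm]
        refine Finset.sum_congr rfl fun γ _ => Finset.sum_congr rfl fun α _ => by ring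
      have e3 : ∀ β δ, ∑ α, ∑ γ, k α γ * W α β γ δ = ∑ a, ∑ c, h a c *
          (Aᵀ * (Matrix.of fun α γ => W α β γ δ) * A) a c := fun β δ =>
        e1 (Matrix.of fun α γ => W α β γ δ)
      simp only [e2, e3, Finset.mul_sum]
      refine (sum_swap _).trans ?_
      refine Finset.sum_congr rfl fun β _ => Finset.sum_congr rfl fun δ _ =>
        Finset.sum_congr rfl fun a _ => Finset.sum_congr rfl fun c _ => by ring
    rw [e]
    simp only [hW.traceFree, mul_zero, Finset.sum_const_zero]

/-- Contraction of the last three slots with a vector. -/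
def contract3 (Q : Tensor4) (k : Fin 4 → ℝ) (a : Fin 4) : ℝ :=
  ∑ b, ∑ c, ∑ d, Q a b c d * k b * k c * k d

/-- The current built from the inverse metric, a Weyl tensor and a vector. -/
def curOf (h : Matrix (Fin 4) (Fin 4) ℝ) (w : Tensor4) (k : Fin 4 → ℝ) (μ : Fin 4) : ℝ :=
  ∑ α, h μ α * contract3 (belRob h (-(h.det)⁻¹) w w) k α

/-- The covariant derivative of a rank four tensor in a direction with connection matrix `Γ`. -/
def covT (Γ : Matrix (Fin 4) (Fin 4) ℝ) (w w' : Tensor4) : Tensor4 := fun α β γ δ =>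
  w' α β γ δ - ∑ l, Γ l α * w l β γ δ - ∑ l, Γ l β * w α l γ δ - ∑ l, Γ l γ * w α β l δ
    - ∑ l, Γ l δ * w α β γ l

theorem sum_swap34 (F : Fin 4 → Fin 4 → Fin 4 → Fin 4 → Fin 4 → Fin 4 → Fin 4 → ℝ) :
    ∑ b, ∑ c, ∑ d, ∑ α, ∑ β, ∑ γ, ∑ δ, F b c d α β γ δ =
      ∑ α, ∑ β, ∑ γ, ∑ δ, ∑ b, ∑ c, ∑ d, F b c d α β γ δ := by
  let e : (Fin 4 × Fin 4 × Fin 4 × Fin 4 × Fin 4 × Fin 4 × Fin 4) ≃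
      (Fin 4 × Fin 4 × Fin 4 × Fin 4 × Fin 4 × Fin 4 × Fin 4) :=
    { toFun := fun (b, c, d, α, β, γ, δ) => (α, β, γ, δ, b, c, d)
      invFun := fun (α, β, γ, δ, b, c, d) => (b, c, d, α, β, γ, δ)
      left_inv := fun p => rfl
      right_inv := fun p => rfl }
  have := e.sum_comp fun p => F p.2.2.2.2.1 p.2.2.2.2.2.1 p.2.2.2.2.2.2 p.1 p.2.1 p.2.2.1 p.2.2.2.1
  simp only [Fintype.sum_prod_type] at this
  exact this

theorem contract3_act (A : Matrix (Fin 4) (Fin 4) ℝ) (Q : Tensor4) (k : Fin 4 → ℝ) (a : Fin 4) :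
    contract3 (act A Q) k a = ∑ α, A α a * contract3 Q (A *ᵥ k) α := by
  have e : ∀ (x : ℝ) (f g h : Fin 4 → ℝ), x * (∑ b, f b) * (∑ c, g c) * (∑ d, h d) =
      ∑ b, ∑ c, ∑ d, x * f b * g c * h d := by
    intro x f g h
    simp only [Fin.sum_univ_four]
    ring
  simp only [contract3, Matrix.mulVec, dotProduct, e]
  simp only [act, Finset.mul_sum, Finset.sum_mul]
  rw [sum_swap34]
  exact Finset.sum_congr rfl fun _ _ => Finset.sum_congr rfl fun _ _ =>
    Finset.sum_congr rfl fun _ _ => Finset.sum_congr rfl fun _ _ => Finset.sum_congr rfl fun _ _ =>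
    Finset.sum_congr rfl fun _ _ => Finset.sum_congr rfl fun _ _ => by ring

/-- The frame components of the current as a function of all its arguments. -/
def currentMap (a : Fin 4) (z : (Fin 4 → Fin 4 → ℝ) × ℝ × Tensor4 × (Fin 4 → ℝ)) : ℝ :=
  contract3 (belRob (Matrix.of z.1) z.2.1 z.2.2.1 z.2.2.1) z.2.2.2 a

theorem differentiableAt_sqT {E : Type*} [NormedAddCommGroup E] [NormedSpace ℝ E] {z : E}
    {h : E → Matrix (Fin 4) (Fin 4) ℝ} {T U : E → Tensor4}
    (hh : ∀ i j, DifferentiableAt ℝ (fun z => h z i j) z)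
    (hT : ∀ α β γ δ, DifferentiableAt ℝ (fun z => T z α β γ δ) z)
    (hU : ∀ α β γ δ, DifferentiableAt ℝ (fun z => U z α β γ δ) z) (α β γ δ : Fin 4) :
    DifferentiableAt ℝ (fun z => sqT (h z) (T z) (U z) α β γ δ) z := by
  unfold sqT
  exact DifferentiableAt.fun_sum fun a _ => DifferentiableAt.fun_sum fun b _ =>
    DifferentiableAt.fun_sum fun c _ => DifferentiableAt.fun_sum fun d _ =>
      (((hh _ _).mul (hh _ _)).mul (hT _ _ _ _)).mul (hU _ _ _ _)

theorem differentiableAt_dualT {E : Type*} [NormedAddCommGroup E] [NormedSpace ℝ E] {z : E}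
    {h : E → Matrix (Fin 4) (Fin 4) ℝ} {T : E → Tensor4}
    (hh : ∀ i j, DifferentiableAt ℝ (fun z => h z i j) z)
    (hT : ∀ α β γ δ, DifferentiableAt ℝ (fun z => T z α β γ δ) z) (α β γ δ : Fin 4) :
    DifferentiableAt ℝ (fun z => dualT (h z) (T z) α β γ δ) z := by
  unfold dualT
  exact (DifferentiableAt.fun_sum fun a _ => DifferentiableAt.fun_sum fun b _ =>
    DifferentiableAt.fun_sum fun c _ => DifferentiableAt.fun_sum fun d _ =>
      (((hh _ _).mul (hh _ _)).mul (hT _ _ _ _)).mul_const _).const_mul _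

theorem differentiableAt_contract3_belRob {E : Type*} [NormedAddCommGroup E] [NormedSpace ℝ E]
    {z : E} {h : E → Matrix (Fin 4) (Fin 4) ℝ} {s : E → ℝ} {T : E → Tensor4} {k : E → Fin 4 → ℝ}
    (hh : ∀ i j, DifferentiableAt ℝ (fun z => h z i j) z) (hs : DifferentiableAt ℝ s z)
    (hT : ∀ α β γ δ, DifferentiableAt ℝ (fun z => T z α β γ δ) z)
    (hk : ∀ a, DifferentiableAt ℝ (fun z => k z a) z) (a : Fin 4) :
    DifferentiableAt ℝ (fun z => contract3 (belRob (h z) (s z) (T z) (T z)) (k z) a) z := by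
  unfold contract3 belRob
  exact DifferentiableAt.fun_sum fun b _ => DifferentiableAt.fun_sum fun c _ =>
    DifferentiableAt.fun_sum fun d _ => ((((differentiableAt_sqT hh hT hT _ _ _ _).add
      (hs.mul (differentiableAt_sqT hh (differentiableAt_dualT hh hT)
        (differentiableAt_dualT hh hT) _ _ _ _))).mul (hk _)).mul (hk _)).mul (hk _)

theorem differentiable_currentMap (a : Fin 4) : Differentiable ℝ (currentMap a) := by
  intro z
  refine differentiableAt_contract3_belRob
    (h := fun z : (Fin 4 → Fin 4 → ℝ) × ℝ × Tensor4 × (Fin 4 → ℝ) => Matrix.of z.1)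
    (s := fun z => z.2.1) (T := fun z => z.2.2.1) (k := fun z => z.2.2.2) ?_ ?_ ?_ ?_ a
  · intro i j
    simp only [Matrix.of_apply]
    fun_prop
  · fun_prop
  · intro α β γ δ
    fun_prop
  · intro a
    fun_prop

theorem belRob_expand (h : Matrix (Fin 4) (Fin 4) ℝ) (s t : ℝ) (W T : Tensor4)
    (a b c d : Fin 4) :
    belRob h s (W + t • T) (W + t • T) a b c d = belRob h s W W a b c d +
      t * (belRob h s T W a b c d + belRob h s W T a b c d) + t ^ 2 * belRob h s T T a b c d := by
  have h1 : dualT h (W + t • T) = dualT h W + t • dualT h T := by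
    funext a b c d
    simp only [dualT, Pi.add_apply, Pi.smul_apply, smul_eq_mul, Finset.mul_sum,
      ← Finset.sum_add_distrib]
    exact Finset.sum_congr rfl fun b _ => Finset.sum_congr rfl fun c _ =>
      Finset.sum_congr rfl fun d _ => Finset.sum_congr rfl fun d _ => by ring
  have h2 : ∀ W T : Tensor4, sqT h (W + t • T) (W + t • T) a b c d = sqT h W W a b c d +
      t * (sqT h T W a b c d + sqT h W T a b c d) + t ^ 2 * sqT h T T a b c d := by
    intro W T
    simp only [sqT, Pi.add_apply, Pi.smul_apply, smul_eq_mul, Finset.mul_sum,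
      ← Finset.sum_add_distrib]
    exact Finset.sum_congr rfl fun b _ => Finset.sum_congr rfl fun c _ =>
      Finset.sum_congr rfl fun d _ => Finset.sum_congr rfl fun d _ => by ring
  simp only [belRob, h1, h2]
  ring

/-- The metric and the volume factor are frozen at their Minkowski values, so only W and k vary,
polynomially. Since k starts along the time axis, differentiating one of its three slots leaves two
time slots, and the three contributions add up to `belSym`. -/
theorem hasDerivAt_currentMap_line (a : Fin 4) (W T : Tensor4) (κ : ℝ) (k' : Fin 4 → ℝ) :
    HasDerivAt (fun t : ℝ => currentMap a (mink, 1, W + t • T, Pi.single 0 κ + t • k'))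
      (κ ^ 3 * (belRob mink 1 T W a 0 0 0 + belRob mink 1 W T a 0 0 0) +
        κ ^ 2 * ∑ c, belSym (belRob mink 1 W W) a c * k' c) 0 := by
  simp only [currentMap, contract3]
  have e : Matrix.of mink = mink := rfl
  rw [e]
  simp only [belRob_expand]
  have h1 : ∀ b c d, HasDerivAt (fun t : ℝ => belRob mink 1 W W a b c d +
      t * (belRob mink 1 T W a b c d + belRob mink 1 W T a b c d) +
      t ^ 2 * belRob mink 1 T T a b c d)
      (belRob mink 1 T W a b c d + belRob mink 1 W T a b c d) 0 := by
    intro b c d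
    have := ((hasDerivAt_id (0 : ℝ)).mul_const
      (belRob mink 1 T W a b c d + belRob mink 1 W T a b c d)).const_add (belRob mink 1 W W a b c d)
    have h2 := ((hasDerivAt_id (0 : ℝ)).pow 2).mul_const (belRob mink 1 T T a b c d)
    refine (this.add h2).congr_deriv ?_
    simp
  have h2 : ∀ b, HasDerivAt (fun t : ℝ => (Pi.single 0 κ + t • k' : Fin 4 → ℝ) b) (k' b) 0 := by
    intro b
    have := ((hasDerivAt_id (0 : ℝ)).mul_const (k' b)).const_add ((Pi.single 0 κ : Fin 4 → ℝ) b)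
    refine this.congr_deriv (by simp)
  have := HasDerivAt.fun_sum (u := Finset.univ) fun b _ => HasDerivAt.fun_sum (u := Finset.univ)
    fun c _ => HasDerivAt.fun_sum (u := Finset.univ) fun d _ =>
      (((h1 b c d).mul (h2 b)).mul (h2 c)).mul (h2 d)
  refine this.congr_deriv ?_
  simp [Fin.sum_univ_four, belSym, Pi.single_apply]
  ring

/-- The derivative of the frame components of the current along a curve on which the metric is
orthonormal to first order. -/
theorem hasDerivAt_currentMap_curve (a : Fin 4) {h : ℝ → Matrix (Fin 4) (Fin 4) ℝ} {s : ℝ → ℝ}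
    {w : ℝ → Tensor4} {k : ℝ → Fin 4 → ℝ} {T : Tensor4} {k' : Fin 4 → ℝ} {κ : ℝ}
    (hh : MatDeriv h 0) (h0 : h 0 = mink) (hs : HasDerivAt s 0 0) (s0 : s 0 = 1)
    (hw : ∀ α β γ δ, HasDerivAt (fun t => w t α β γ δ) (T α β γ δ) 0)
    (hk : ∀ c, HasDerivAt (fun t => k t c) (k' c) 0) (hk0 : k 0 = Pi.single 0 κ) :
    HasDerivAt (fun t => contract3 (belRob (h t) (s t) (w t) (w t)) (k t) a)
      (κ ^ 3 * (belRob mink 1 T (w 0) a 0 0 0 + belRob mink 1 (w 0) T a 0 0 0) +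
        κ ^ 2 * ∑ c, belSym (belRob mink 1 (w 0) (w 0)) a c * k' c) 0 := by
  have hh' : HasDerivAt (fun t => (fun i j => h t i j : Fin 4 → Fin 4 → ℝ)) 0 0 :=
    hh.hasDerivAt_pi
  have hw' : HasDerivAt w T 0 := hasDerivAt_pi.2 fun α => hasDerivAt_pi.2 fun β =>
    hasDerivAt_pi.2 fun γ => hasDerivAt_pi.2 fun δ => hw α β γ δ
  have hk' : HasDerivAt k k' 0 := hasDerivAt_pi.2 hk
  have c1 := hh'.prodMk (hs.prodMk (hw'.prodMk hk'))
  have z0 : ((fun i j => h 0 i j : Fin 4 → Fin 4 → ℝ), s 0, w 0, k 0) =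
      ((fun i j => mink i j : Fin 4 → Fin 4 → ℝ), (1 : ℝ), w 0, (Pi.single 0 κ : Fin 4 → ℝ)) := by
    rw [h0, s0, hk0]
  have hl : HasDerivAt (fun t : ℝ => ((fun i j => mink i j : Fin 4 → Fin 4 → ℝ), (1 : ℝ),
      w 0 + t • T, (Pi.single 0 κ : Fin 4 → ℝ) + t • k')) (0, 0, T, k') 0 := by
    have e1 : HasDerivAt (fun t : ℝ => w 0 + t • T) T 0 := by
      simpa using ((hasDerivAt_id (0 : ℝ)).smul_const T).const_add (w 0)
    have e2 : HasDerivAt (fun t : ℝ => (Pi.single 0 κ : Fin 4 → ℝ) + t • k') k' 0 := by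
      simpa using ((hasDerivAt_id (0 : ℝ)).smul_const k').const_add (Pi.single 0 κ : Fin 4 → ℝ)
    exact (hasDerivAt_const _ _).prodMk ((hasDerivAt_const _ _).prodMk (e1.prodMk e2))
  -- By the chain rule only the velocity at 0 matters, so the curve may be exchanged for the
  -- straight line with the same initial point and velocity.
  have d1 := HasFDerivAt.comp_hasDerivAt (0 : ℝ)
    (differentiable_currentMap a ((fun i j => h 0 i j : Fin 4 → Fin 4 → ℝ), s 0, w 0, k 0)).hasFDerivAt
    c1
  have d2 := HasFDerivAt.comp_hasDerivAt_of_eq (0 : ℝ)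
    (differentiable_currentMap a ((fun i j => h 0 i j : Fin 4 → Fin 4 → ℝ), s 0, w 0, k 0)).hasFDerivAt
    hl (by rw [z0]; simp)
  have e := d2.unique (hasDerivAt_currentMap_line a (w 0) T κ k')
  rw [e] at d1
  exact d1

/-- The derivative of the frame components of a tensor is the frame component of the covariant
derivative, in a frame that is parallel to first order. -/
theorem hasDerivAt_act {E : ℝ → Matrix (Fin 4) (Fin 4) ℝ} {w : ℝ → Tensor4} {w' : Tensor4}
    {Γ : Matrix (Fin 4) (Fin 4) ℝ} (hE : MatDeriv E (-(Γ * E 0)))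
    (hw : ∀ α β γ δ, HasDerivAt (fun t => w t α β γ δ) (w' α β γ δ) 0) (a b c d : Fin 4) :
    HasDerivAt (fun t => act (E t) (w t) a b c d) (act (E 0) (covT Γ (w 0) w') a b c d) 0 := by
  have h := HasDerivAt.fun_sum (u := Finset.univ) fun α _ => HasDerivAt.fun_sum
    (u := Finset.univ) fun β _ => HasDerivAt.fun_sum (u := Finset.univ) fun γ _ =>
    HasDerivAt.fun_sum (u := Finset.univ) fun δ _ =>
    ((((hE α a).fun_mul (hE β b)).fun_mul (hE γ c)).fun_mul (hE δ d)).fun_mul (hw α β γ δ)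
  refine h.congr_deriv ?_
  have r1 : ∀ (f : Fin 4 → ℝ) (a : Fin 4), ∑ α, (-(Γ * E 0)) α a * f α =
      -∑ α, E 0 α a * ∑ l, Γ l α * f l := by
    intro f a
    simp only [Matrix.neg_apply, Matrix.mul_apply, neg_mul, Finset.sum_neg_distrib,
      Finset.sum_mul, Finset.mul_sum]
    rw [Finset.sum_comm]
    congr 1
    exact Finset.sum_congr rfl fun _ _ => Finset.sum_congr rfl fun _ _ => by ring
  have q : ∀ F : Tensor4, act (E 0) F a b c d =
      ∑ α, E 0 α a * ∑ β, E 0 β b * ∑ γ, E 0 γ c * ∑ δ, E 0 δ d * F α β γ δ := by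
    intro F
    simp only [act, Finset.mul_sum]
    exact Finset.sum_congr rfl fun _ _ => Finset.sum_congr rfl fun _ _ =>
      Finset.sum_congr rfl fun _ _ => Finset.sum_congr rfl fun _ _ => by ring
  have sp : covT Γ (w 0) w' = w' + (-1 : ℝ) • (fun α β γ δ => ∑ l, Γ l α * w 0 l β γ δ) +
      (-1 : ℝ) • (fun α β γ δ => ∑ l, Γ l β * w 0 α l γ δ) +
      (-1 : ℝ) • (fun α β γ δ => ∑ l, Γ l γ * w 0 α β l δ) +
      (-1 : ℝ) • (fun α β γ δ => ∑ l, Γ l δ * w 0 α β γ l) := by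
    funext α β γ δ
    simp only [covT, Pi.add_apply, Pi.smul_apply, smul_eq_mul]
    ring
  rw [sp]
  simp only [act_add, act_smul, Pi.add_apply, Pi.smul_apply, smul_eq_mul]
  have p1 : ∀ (x y : Fin 4 → ℝ) (F : Fin 4 → Fin 4 → ℝ),
      ∑ l, x l * ∑ γ, y γ * F l γ = ∑ γ, y γ * ∑ l, x l * F l γ := by
    intro x y F
    simp only [Finset.mul_sum]
    rw [Finset.sum_comm]
    exact Finset.sum_congr rfl fun _ _ => Finset.sum_congr rfl fun _ _ => by ring
  have p2 : ∀ (x y z : Fin 4 → ℝ) (F : Fin 4 → Fin 4 → Fin 4 → ℝ),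
      ∑ l, x l * ∑ γ, y γ * ∑ δ, z δ * F l γ δ = ∑ γ, y γ * ∑ δ, z δ * ∑ l, x l * F l γ δ := by
    intro x y z F
    rw [p1]
    exact Finset.sum_congr rfl fun _ _ => by rw [p1]
  have p3 : ∀ (x y z u : Fin 4 → ℝ) (F : Fin 4 → Fin 4 → Fin 4 → Fin 4 → ℝ),
      ∑ l, x l * ∑ γ, y γ * ∑ δ, z δ * ∑ ε, u ε * F l γ δ ε =
        ∑ γ, y γ * ∑ δ, z δ * ∑ ε, u ε * ∑ l, x l * F l γ δ ε := by
    intro x y z u F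
    rw [p1]
    exact Finset.sum_congr rfl fun _ _ => by rw [p2]
  have q' : ∀ (A B C D : Fin 4 → ℝ) (F : Tensor4),
      ∑ α, ∑ β, ∑ γ, ∑ δ, A α * B β * C γ * D δ * F α β γ δ =
        ∑ α, A α * ∑ β, B β * ∑ γ, C γ * ∑ δ, D δ * F α β γ δ := by
    intro A B C D F
    simp only [Finset.mul_sum]
    exact Finset.sum_congr rfl fun _ _ => Finset.sum_congr rfl fun _ _ =>
      Finset.sum_congr rfl fun _ _ => Finset.sum_congr rfl fun _ _ => by ring
  have t1 : -1 * act (E 0) (fun α β γ δ => ∑ l, Γ l α * w 0 l β γ δ) a b c d =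
      ∑ α, ∑ β, ∑ γ, ∑ δ, (-(Γ * E 0)) α a * E 0 β b * E 0 γ c * E 0 δ d * w 0 α β γ δ := by
    rw [q, q' (fun α => (-(Γ * E 0)) α a) (fun β => E 0 β b) (fun γ => E 0 γ c)
      (fun δ => E 0 δ d), r1, neg_one_mul]
    congr 1
    exact Finset.sum_congr rfl fun α _ => by rw [p3 (fun l => Γ l α)]
  have t2 : -1 * act (E 0) (fun α β γ δ => ∑ l, Γ l β * w 0 α l γ δ) a b c d =
      ∑ α, ∑ β, ∑ γ, ∑ δ, E 0 α a * (-(Γ * E 0)) β b * E 0 γ c * E 0 δ d * w 0 α β γ δ := by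
    rw [q, q' (fun α => E 0 α a) (fun β => (-(Γ * E 0)) β b) (fun γ => E 0 γ c)
      (fun δ => E 0 δ d), neg_one_mul]
    have : ∀ α, ∑ β, E 0 β b * ∑ l, Γ l β * ∑ γ, E 0 γ c * ∑ δ, E 0 δ d * w 0 α l γ δ =
        ∑ β, E 0 β b * ∑ γ, E 0 γ c * ∑ δ, E 0 δ d * ∑ l, Γ l β * w 0 α l γ δ := fun α =>
      Finset.sum_congr rfl fun β _ => by rw [p2 (fun l => Γ l β)]
    simp only [r1, this, mul_neg, Finset.sum_neg_distrib]
  have t3 : -1 * act (E 0) (fun α β γ δ => ∑ l, Γ l γ * w 0 α β l δ) a b c d =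
      ∑ α, ∑ β, ∑ γ, ∑ δ, E 0 α a * E 0 β b * (-(Γ * E 0)) γ c * E 0 δ d * w 0 α β γ δ := by
    rw [q, q' (fun α => E 0 α a) (fun β => E 0 β b) (fun γ => (-(Γ * E 0)) γ c)
      (fun δ => E 0 δ d), neg_one_mul]
    have : ∀ α β, ∑ γ, E 0 γ c * ∑ l, Γ l γ * ∑ δ, E 0 δ d * w 0 α β l δ =
        ∑ γ, E 0 γ c * ∑ δ, E 0 δ d * ∑ l, Γ l γ * w 0 α β l δ := fun α β =>
      Finset.sum_congr rfl fun γ _ => by rw [p1 (fun l => Γ l γ)]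
    simp only [r1, this, mul_neg, Finset.sum_neg_distrib]
  have t4 : -1 * act (E 0) (fun α β γ δ => ∑ l, Γ l δ * w 0 α β γ l) a b c d =
      ∑ α, ∑ β, ∑ γ, ∑ δ, E 0 α a * E 0 β b * E 0 γ c * (-(Γ * E 0)) δ d * w 0 α β γ δ := by
    rw [q, q' (fun α => E 0 α a) (fun β => E 0 β b) (fun γ => E 0 γ c)
      (fun δ => (-(Γ * E 0)) δ d), neg_one_mul]
    simp only [r1, mul_neg, Finset.sum_neg_distrib]
  rw [t1, t2, t3, t4]
  simp only [act, ← Finset.sum_add_distrib]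
  exact Finset.sum_congr rfl fun _ _ => Finset.sum_congr rfl fun _ _ =>
    Finset.sum_congr rfl fun _ _ => Finset.sum_congr rfl fun _ _ => by ring

/-- The Weyl conditions are linear in the tensor, and the metric in the trace condition is
stationary to first order. Consequently each ∇_a W, in frame components, is again described by ten
parameters. -/
theorem isWeyl_of_hasDerivAt {h : ℝ → Matrix (Fin 4) (Fin 4) ℝ} {w : ℝ → Tensor4} {T : Tensor4}
    (hh : MatDeriv h 0) (hw : ∀ α β γ δ, HasDerivAt (fun t => w t α β γ δ) (T α β γ δ) 0)
    (hW : ∀ᶠ t in 𝓝 (0 : ℝ), IsWeyl (h t) (w t)) : IsWeyl (h 0) T where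
  antisymm_left α β γ δ := by
    refine (hw α β γ δ).unique ((hw β α γ δ).neg.congr_of_eventuallyEq ?_)
    filter_upwards [hW] with t ht using ht.antisymm_left α β γ δ
  antisymm_right α β γ δ := by
    refine (hw α β γ δ).unique ((hw α β δ γ).neg.congr_of_eventuallyEq ?_)
    filter_upwards [hW] with t ht using ht.antisymm_right α β γ δ
  cyclic α β γ δ := by
    refine (((hw α β γ δ).add (hw α γ δ β)).add (hw α δ β γ)).unique
      ((hasDerivAt_const (0 : ℝ) (0 : ℝ)).congr_of_eventuallyEq ?_)
    filter_upwards [hW] with t ht using ht.cyclic α β γ δ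
  traceFree β δ := by
    have h1 := HasDerivAt.fun_sum (u := Finset.univ) fun α _ => HasDerivAt.fun_sum
      (u := Finset.univ) fun γ _ => (hh α γ).mul (hw α β γ δ)
    have h2 : HasDerivAt (fun t => ∑ α, ∑ γ, h t α γ * w t α β γ δ) 0 0 := by
      refine (hasDerivAt_const (0 : ℝ) (0 : ℝ)).congr_of_eventuallyEq ?_
      filter_upwards [hW] with t ht using ht.traceFree β δ
    have := h1.unique h2
    simpa using this

theorem det_mink : mink.det = -1 := by
  simp [mink, Matrix.det_diagonal, Fin.prod_univ_four, sgn]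

/-- The derivative of the current along a curve, in terms of an orthonormal frame `e` at the initial
point, whose time direction is proportional to the vector field. -/
theorem curOf_deriv_frame {h : ℝ → Matrix (Fin 4) (Fin 4) ℝ} {w : ℝ → Tensor4}
    {K : ℝ → Fin 4 → ℝ} {Γ e : Matrix (Fin 4) (Fin 4) ℝ} {w' : Tensor4} {K' X' : Fin 4 → ℝ} {κ : ℝ}
    (hh : MatDeriv h (-(Γ * h 0 + h 0 * Γᵀ)))
    (hw : ∀ α β γ δ, HasDerivAt (fun t => w t α β γ δ) (w' α β γ δ) 0)
    (hK : ∀ μ, HasDerivAt (fun t => K t μ) (K' μ) 0)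
    (he : e * mink * eᵀ = h 0) (hdet : e.det ≠ 0) (heK : K 0 = e *ᵥ Pi.single 0 κ)
    (hW : ∀ᶠ t in 𝓝 (0 : ℝ), IsWeyl (h t) (w t))
    (hX : ∀ μ, HasDerivAt (fun t => curOf (h t) (w t) (K t) μ) (X' μ) 0) :
    IsWeyl mink (act e (covT Γ (w 0) w')) ∧
    ∀ b, (e⁻¹ *ᵥ (X' + Γ *ᵥ curOf (h 0) (w 0) (K 0))) b =
      sgn b * (κ ^ 3 * (belRob mink 1 (act e (covT Γ (w 0) w')) (act e (w 0)) b 0 0 0 +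
          belRob mink 1 (act e (w 0)) (act e (covT Γ (w 0) w')) b 0 0 0) +
        κ ^ 2 * ∑ c, belSym (belRob mink 1 (act e (w 0)) (act e (w 0))) b c *
          (e⁻¹ *ᵥ (K' + Γ *ᵥ K 0)) c) := by
  have heu : IsUnit e.det := isUnit_iff_ne_zero.2 hdet
  have ei1 : e⁻¹ * e = 1 := Matrix.nonsing_inv_mul _ heu
  have ei2 : e * e⁻¹ = 1 := Matrix.mul_nonsing_inv _ heu
  -- A moving coframe whose dual frame `E = θ⁻¹` satisfies E' = -ΓE at 0, that is, `E` is parallel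
  -- to first order. In it the metric components `k` have zero derivative (`dk`), and derivatives of
  -- tensor components are covariant derivatives. This plays the role of normal coordinates.
  set θ : ℝ → Matrix (Fin 4) (Fin 4) ℝ := fun t => e⁻¹ * (1 + t • Γ) with hθ
  have θ0 : θ 0 = e⁻¹ := by simp [hθ]
  have dθ : MatDeriv θ (e⁻¹ * Γ) := by
    have h1 : MatDeriv (fun t : ℝ => 1 + t • Γ) Γ := by
      intro i j
      simp only [Matrix.add_apply, Matrix.smul_apply, smul_eq_mul]
      simpa using ((hasDerivAt_id (0 : ℝ)).mul_const (Γ i j)).const_add ((1 : Matrix (Fin 4) (Fin 4) ℝ) i j)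
    refine ((matDeriv_const e⁻¹).mul h1).congr_deriv ?_
    simp
  have hθdet : (θ 0).det ≠ 0 := by
    rw [θ0, Matrix.det_nonsing_inv, Ring.inverse_eq_inv']
    exact inv_ne_zero hdet
  set E : ℝ → Matrix (Fin 4) (Fin 4) ℝ := fun t => (θ t)⁻¹ with hE
  have E0 : E 0 = e := by
    simp only [hE, θ0]
    exact Matrix.nonsing_inv_nonsing_inv _ heu
  have dE : MatDeriv E (-(Γ * E 0)) := by
    refine (dθ.inv hθdet).congr_deriv ?_
    change -(E 0 * (e⁻¹ * Γ) * E 0) = _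
    rw [E0, ← Matrix.mul_assoc, ei2, Matrix.one_mul]
  have hev : ∀ᶠ t in 𝓝 (0 : ℝ), (θ t).det ≠ 0 :=
    dθ.differentiableAt_det.continuousAt.eventually_ne hθdet
  set k : ℝ → Matrix (Fin 4) (Fin 4) ℝ := fun t => θ t * h t * (θ t)ᵀ with hk
  have k0 : k 0 = mink := by
    simp only [hk, θ0, ← he]
    rw [show e⁻¹ * (e * mink * eᵀ) * e⁻¹ᵀ = (e⁻¹ * e) * mink * (e⁻¹ * e)ᵀ by
      simp only [Matrix.transpose_mul, Matrix.mul_assoc], ei1]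
    simp
  have dk : MatDeriv k 0 := by
    refine ((dθ.mul hh).mul dθ.transpose).congr_deriv ?_
    simp only [θ0, Matrix.transpose_mul, Matrix.mul_add, Matrix.add_mul, Matrix.mul_neg,
      Matrix.neg_mul, Matrix.mul_assoc, neg_add]
    abel
  have hkh : ∀ᶠ t in 𝓝 (0 : ℝ), h t = E t * k t * (E t)ᵀ := by
    filter_upwards [hev] with t ht
    have e1 : E t * θ t = 1 := Matrix.nonsing_inv_mul _ (isUnit_iff_ne_zero.2 ht)
    simp only [hk]
    rw [show E t * (θ t * h t * (θ t)ᵀ) * (E t)ᵀ = (E t * θ t) * h t * (E t * θ t)ᵀ by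
      simp only [Matrix.transpose_mul, Matrix.mul_assoc], e1]
    simp
  set s : ℝ → ℝ := fun t => -((k t).det)⁻¹ with hs
  have s0 : s 0 = 1 := by simp [hs, k0, det_mink]
  have ds : HasDerivAt s 0 0 := by
    have := (dk.hasDerivAt_det_zero.fun_inv (by rw [k0, det_mink]; norm_num)).fun_neg
    exact this.congr_deriv (by simp)
  have dw := hasDerivAt_act dE hw
  have dkK : ∀ c, HasDerivAt (fun t => (θ t *ᵥ K t) c) ((e⁻¹ *ᵥ (K' + Γ *ᵥ K 0)) c) 0 := by
    intro c
    have := HasDerivAt.fun_sum (u := Finset.univ) fun μ _ => (dθ c μ).mul (hK μ)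
    refine this.congr_deriv ?_
    rw [Matrix.mulVec_add, Matrix.mulVec_mulVec]
    simp only [θ0, Finset.sum_add_distrib, Matrix.mulVec, dotProduct, Pi.add_apply]
    ring
  have kK0 : θ 0 *ᵥ K 0 = Pi.single 0 κ := by
    rw [θ0, heK, Matrix.mulVec_mulVec, ei1, Matrix.one_mulVec]
  have hWk : ∀ᶠ t in 𝓝 (0 : ℝ), IsWeyl (k t) (act (E t) (w t)) := by
    filter_upwards [hkh, hW] with t h1 h2 using h2.act h1
  have hweyl := isWeyl_of_hasDerivAt dk dw hWk
  rw [k0, E0] at hweyl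
  refine ⟨hweyl, fun b => ?_⟩
  have dcur := fun a => hasDerivAt_currentMap_curve a dk k0 ds s0 dw dkK kK0
  rw [E0] at dcur
  -- Covariance of `belRob` and of `contract3` expresses the current in the moving frame by frame
  -- data alone; only near 0 is `θ t` known to be invertible.
  have hxhat : ∀ᶠ t in 𝓝 (0 : ℝ), (θ t *ᵥ curOf (h t) (w t) (K t)) b =
      ∑ c, k t b c * contract3 (belRob (k t) (s t) (act (E t) (w t)) (act (E t) (w t)))
        (θ t *ᵥ K t) c := by
    filter_upwards [hkh, hev] with t h1 h2
    have e1 : E t * θ t = 1 := Matrix.nonsing_inv_mul _ (isUnit_iff_ne_zero.2 h2)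
    have hEd : (E t).det ≠ 0 := by
      intro h0
      have := congrArg Matrix.det e1
      rw [Matrix.det_mul, h0, zero_mul, Matrix.det_one] at this
      exact zero_ne_one this
    have e2 : belRob (k t) (s t) (act (E t) (w t)) (act (E t) (w t)) =
        act (E t) (belRob (h t) (-((h t).det)⁻¹) (w t) (w t)) := by
      have e3 : s t = -((E t * k t * (E t)ᵀ).det)⁻¹ * (E t).det ^ 2 := by
        rw [Matrix.det_mul, Matrix.det_mul, Matrix.det_transpose]
        by_cases hkd : (k t).det = 0
        · simp [hs, hkd]
        · simp only [hs]
          field_simp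
      rw [e3, ← belRob_act, ← h1]
    have e4 : k t * (E t)ᵀ = θ t * h t := by
      have : (θ t)ᵀ * (E t)ᵀ = 1 := by rw [← Matrix.transpose_mul, e1, Matrix.transpose_one]
      simp only [hk, Matrix.mul_assoc, this, Matrix.mul_one]
    have e5 : E t *ᵥ (θ t *ᵥ K t) = K t := by
      rw [Matrix.mulVec_mulVec, e1, Matrix.one_mulVec]
    have e6 : (fun c => contract3 (belRob (k t) (s t) (act (E t) (w t)) (act (E t) (w t)))
        (θ t *ᵥ K t) c) =
        (E t)ᵀ *ᵥ (contract3 (belRob (h t) (-((h t).det)⁻¹) (w t) (w t)) (K t)) := by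
      funext c
      rw [e2, contract3_act, e5]
      rfl
    have e7 : curOf (h t) (w t) (K t) =
        h t *ᵥ (contract3 (belRob (h t) (-((h t).det)⁻¹) (w t) (w t)) (K t)) := rfl
    change _ = (k t *ᵥ (fun c => contract3 (belRob (k t) (s t) (act (E t) (w t))
      (act (E t) (w t))) (θ t *ᵥ K t) c)) b
    rw [e6, Matrix.mulVec_mulVec, e4, e7, Matrix.mulVec_mulVec]
  have d1 := HasDerivAt.fun_sum (u := Finset.univ) fun c _ => (dk b c).mul (dcur c)
  have d2 := HasDerivAt.fun_sum (u := Finset.univ) fun μ _ => (dθ b μ).mul (hX μ)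
  have d3 := d2.unique (d1.congr_of_eventuallyEq hxhat)
  have d4 : (e⁻¹ *ᵥ (X' + Γ *ᵥ curOf (h 0) (w 0) (K 0))) b = ∑ μ, ((e⁻¹ * Γ) b μ *
      curOf (h 0) (w 0) (K 0) μ + θ 0 b μ * X' μ) := by
    rw [Matrix.mulVec_add, Matrix.mulVec_mulVec]
    simp only [θ0, Finset.sum_add_distrib, Matrix.mulVec, dotProduct, Pi.add_apply]
    ring
  rw [d4, d3, k0]
  simp only [mink, Matrix.zero_apply, zero_mul, zero_add, Matrix.diagonal_apply, ite_mul,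
    Finset.sum_ite_eq, Finset.mem_univ, if_true]

/-! ### The double null metric and its inverse -/

/-- The inverse of the double null metric. -/
def doubleNullInv (Ω : ℝ) (b : Fin 2 → ℝ) (γ : Matrix (Fin 2) (Fin 2) ℝ) :
    Matrix (Fin 4) (Fin 4) ℝ :=
  !![0, -(1 / (2 * Ω ^ 2)), -(b 0 / (2 * Ω ^ 2)), -(b 1 / (2 * Ω ^ 2));
    -(1 / (2 * Ω ^ 2)), 0, 0, 0;
    -(b 0 / (2 * Ω ^ 2)), 0, γ 1 1 / γ.det, -(γ 0 1 / γ.det);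
    -(b 1 / (2 * Ω ^ 2)), 0, -(γ 0 1 / γ.det), γ 0 0 / γ.det]

theorem doubleNullMetric_eq (Ω : ℝ) (b : Fin 2 → ℝ) {γ : Matrix (Fin 2) (Fin 2) ℝ}
    (hγ : γ 1 0 = γ 0 1) : doubleNullMetric Ω b γ =
    !![0, -2 * Ω ^ 2, 0, 0;
      -2 * Ω ^ 2, γ 0 0 * b 0 ^ 2 + 2 * γ 0 1 * b 0 * b 1 + γ 1 1 * b 1 ^ 2,
        -(γ 0 0 * b 0 + γ 0 1 * b 1), -(γ 0 1 * b 0 + γ 1 1 * b 1);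
      0, -(γ 0 0 * b 0 + γ 0 1 * b 1), γ 0 0, γ 0 1;
      0, -(γ 0 1 * b 0 + γ 1 1 * b 1), γ 0 1, γ 1 1] := by
  have a0 : ang 0 = 2 := rfl
  have a1 : ang 1 = 3 := rfl
  ext i j
  fin_cases i <;> fin_cases j <;>
    simp [doubleNullMetric, shiftForm, kron, Fin.sum_univ_two, a0, a1, hγ] <;> ring

theorem doubleNullMetric_mul_inv {Ω : ℝ} (hΩ : Ω ≠ 0) (b : Fin 2 → ℝ)
    {γ : Matrix (Fin 2) (Fin 2) ℝ} (hγ : γ 1 0 = γ 0 1) (hd : γ.det ≠ 0) :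
    doubleNullMetric Ω b γ * doubleNullInv Ω b γ = 1 := by
  rw [doubleNullMetric_eq Ω b hγ]
  have hd' : γ 0 0 * γ 1 1 - γ 0 1 ^ 2 ≠ 0 := by
    rw [Matrix.det_fin_two, hγ, ← sq] at hd; exact hd
  ext i j
  simp only [Matrix.mul_apply, Fin.sum_univ_four, doubleNullInv, Matrix.det_fin_two, hγ]
  fin_cases i <;> fin_cases j <;> simp <;> field_simp <;> ring

theorem det_doubleNullMetric (Ω : ℝ) (b : Fin 2 → ℝ) {γ : Matrix (Fin 2) (Fin 2) ℝ}
    (hγ : γ 1 0 = γ 0 1) : (doubleNullMetric Ω b γ).det = -4 * Ω ^ 4 * γ.det := by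
  rw [doubleNullMetric_eq Ω b hγ, Matrix.det_succ_row_zero]
  simp [Fin.sum_univ_succ, Matrix.det_fin_three, Fin.succAbove, Matrix.det_fin_two, hγ]
  ring

namespace Spacetime

variable (S : Spacetime)

theorem isOpen_dom : IsOpen S.dom :=
  S.isOpen_Q.preimage (by fun_prop : Continuous fun x : Pt => (x 0, x 1))

theorem γ_symm {c : Fin 2} {x : Pt} (hx : x ∈ S.dom) : S.γ c x 1 0 = S.γ c x 0 1 := by
  have := (S.γ_posDef c x hx).isHermitian.apply 0 1
  simpa using this

theorem γ_det_pos {c : Fin 2} {x : Pt} (hx : x ∈ S.dom) : 0 < (S.γ c x).det :=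
  (S.γ_posDef c x hx).det_pos

theorem g_mul {c : Fin 2} {x : Pt} (hx : x ∈ S.dom) :
    S.g c x * doubleNullInv (S.Ω c x) (S.b c x) (S.γ c x) = 1 :=
  doubleNullMetric_mul_inv (S.Ω_pos c x hx).ne' _ (S.γ_symm hx) (S.γ_det_pos hx).ne'

theorem gInv_eq {c : Fin 2} {x : Pt} (hx : x ∈ S.dom) :
    S.gInv c x = doubleNullInv (S.Ω c x) (S.b c x) (S.γ c x) :=
  Matrix.inv_eq_right_inv (S.g_mul hx)

theorem g_mul_gInv {c : Fin 2} {x : Pt} (hx : x ∈ S.dom) : S.g c x * S.gInv c x = 1 := by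
  rw [S.gInv_eq hx, S.g_mul hx]

theorem gInv_mul_g {c : Fin 2} {x : Pt} (hx : x ∈ S.dom) : S.gInv c x * S.g c x = 1 :=
  mul_eq_one_comm.1 (S.g_mul_gInv hx)

theorem det_g {c : Fin 2} {x : Pt} (hx : x ∈ S.dom) :
    (S.g c x).det = -4 * S.Ω c x ^ 4 * (S.γ c x).det :=
  det_doubleNullMetric _ _ (S.γ_symm hx)

theorem det_g_neg {c : Fin 2} {x : Pt} (hx : x ∈ S.dom) : (S.g c x).det < 0 := by
  rw [S.det_g hx]
  have h1 := S.γ_det_pos (c := c) hx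
  have h2 := S.Ω_pos c x hx
  have : 0 < S.Ω c x ^ 4 * (S.γ c x).det := by positivity
  linarith

theorem g_symm (c : Fin 2) {x : Pt} (hx : x ∈ S.dom) (μ ν : Fin 4) : S.g c x μ ν = S.g c x ν μ := by
  rw [g, doubleNullMetric_eq _ _ (S.γ_symm hx)]
  fin_cases μ <;> fin_cases ν <;> rfl

/-- The volume density `√|det g|`. -/
def dens (c : Fin 2) (x : Pt) : ℝ := Real.sqrt |(S.g c x).det|

theorem dens_eq {c : Fin 2} {x : Pt} (hx : x ∈ S.dom) :
    S.dens c x = 2 * S.Ω c x ^ 2 * Real.sqrt (S.γ c x).det := by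
  have h1 := S.γ_det_pos (c := c) hx
  rw [dens, abs_of_neg (S.det_g_neg hx), S.det_g hx,
    show -(-4 * S.Ω c x ^ 4 * (S.γ c x).det) = (2 * S.Ω c x ^ 2) ^ 2 * (S.γ c x).det by ring,
    Real.sqrt_mul (by positivity), Real.sqrt_sq (by positivity)]

theorem dens_pos {c : Fin 2} {x : Pt} (hx : x ∈ S.dom) : 0 < S.dens c x :=
  Real.sqrt_pos.2 (abs_pos.2 (S.det_g_neg hx).ne)

theorem contDiffOn_g (c : Fin 2) (μ ν : Fin 4) : ContDiffOn ℝ ∞ (fun x => S.g c x μ ν) S.dom := by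
  have h1 : ContDiffOn ℝ ∞ (S.Ω c) S.dom := S.smooth_Ω c
  have h2 : ∀ A, ContDiffOn ℝ ∞ (fun x => S.b c x A) S.dom := S.smooth_b c
  have h3 : ∀ A B, ContDiffOn ℝ ∞ (fun x => S.γ c x A B) S.dom := S.smooth_γ c
  simp only [g, doubleNullMetric, Matrix.of_apply, shiftForm]
  refine ContDiffOn.add ((contDiffOn_const.mul (h1.pow 2)).mul contDiffOn_const) ?_
  exact ContDiffOn.sum fun A _ => ContDiffOn.sum fun B _ =>
    ((h3 A B).mul (contDiffOn_const.sub ((h2 A).mul contDiffOn_const))).mul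
      (contDiffOn_const.sub ((h2 B).mul contDiffOn_const))

theorem contDiffOn_det_γ (c : Fin 2) : ContDiffOn ℝ ∞ (fun x => (S.γ c x).det) S.dom := by
  have h3 : ∀ A B, ContDiffOn ℝ ∞ (fun x => S.γ c x A B) S.dom := S.smooth_γ c
  simp only [Matrix.det_fin_two]
  exact ((h3 0 0).mul (h3 1 1)).sub ((h3 0 1).mul (h3 1 0))

theorem contDiffOn_gInv (c : Fin 2) (μ ν : Fin 4) :
    ContDiffOn ℝ ∞ (fun x => S.gInv c x μ ν) S.dom := by
  have h1 : ContDiffOn ℝ ∞ (S.Ω c) S.dom := S.smooth_Ω c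
  have h2 : ∀ A, ContDiffOn ℝ ∞ (fun x => S.b c x A) S.dom := S.smooth_b c
  have h3 : ∀ A B, ContDiffOn ℝ ∞ (fun x => S.γ c x A B) S.dom := S.smooth_γ c
  have h4 := S.contDiffOn_det_γ c
  have k1 : ContDiffOn ℝ ∞ (fun x => 2 * S.Ω c x ^ 2) S.dom := contDiffOn_const.mul (h1.pow 2)
  have k2 : ∀ x ∈ S.dom, 2 * S.Ω c x ^ 2 ≠ 0 := fun x hx => by
    have := S.Ω_pos c x hx
    positivity
  have k3 : ∀ x ∈ S.dom, (S.γ c x).det ≠ 0 := fun x hx => (S.γ_det_pos hx).ne'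
  have hz : ContDiffOn ℝ ∞ (fun _ : Pt => (0 : ℝ)) S.dom := contDiffOn_const
  have e1 := (contDiffOn_const (c := (1 : ℝ))).div k1 k2 |>.neg
  have e2 := fun A => ((h2 A).div k1 k2).neg
  have e3 := fun A B => (h3 A B).div h4 k3
  refine ContDiffOn.congr (f := fun x => doubleNullInv (S.Ω c x) (S.b c x) (S.γ c x) μ ν) ?_
    fun x hx => by rw [S.gInv_eq hx]
  fin_cases μ <;> fin_cases ν <;> simp only [doubleNullInv] <;>
    first
    | exact hz | exact e1 | exact e2 0 | exact e2 1
    | exact e3 1 1 | exact e3 0 0 | exact (e3 0 1).neg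

theorem contDiffOn_dens (c : Fin 2) : ContDiffOn ℝ ∞ (S.dens c) S.dom := by
  have h1 : ContDiffOn ℝ ∞ (S.Ω c) S.dom := S.smooth_Ω c
  refine ContDiffOn.congr ((contDiffOn_const.mul (h1.pow 2)).mul
    ((S.contDiffOn_det_γ c).sqrt fun x hx => (S.γ_det_pos hx).ne')) fun x hx => S.dens_eq hx

theorem differentiableAt_g (c : Fin 2) {x : Pt} (hx : x ∈ S.dom) (μ ν : Fin 4) :
    DifferentiableAt ℝ (fun x => S.g c x μ ν) x :=
  ((S.contDiffOn_g c μ ν).contDiffAt (S.isOpen_dom.mem_nhds hx)).differentiableAt (by simp)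

/-! ### The connection -/

theorem christoffel_symm (c : Fin 2) {x : Pt} (hx : x ∈ S.dom) (κ μ ν : Fin 4) :
    S.christoffel c x κ μ ν = S.christoffel c x κ ν μ := by
  have : ∀ l, pd l (fun y => S.g c y μ ν) x = pd l (fun y => S.g c y ν μ) x := by
    intro l
    unfold pd
    rw [Filter.EventuallyEq.fderiv_eq]
    filter_upwards [S.isOpen_dom.mem_nhds hx] with y hy using S.g_symm c hy μ ν
  simp only [christoffel, this]
  congr 1
  exact Finset.sum_congr rfl fun l _ => by ring

theorem pd_g_symm (c : Fin 2) {x : Pt} (hx : x ∈ S.dom) (l μ ν : Fin 4) :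
    pd l (fun y => S.g c y μ ν) x = pd l (fun y => S.g c y ν μ) x := by
  unfold pd
  rw [Filter.EventuallyEq.fderiv_eq]
  filter_upwards [S.isOpen_dom.mem_nhds hx] with y hy using S.g_symm c hy μ ν

/-- Lowering the upper index of the Christoffel symbols. -/
theorem g_christoffel (c : Fin 2) {x : Pt} (hx : x ∈ S.dom) (β μ ν : Fin 4) :
    ∑ κ, S.g c x β κ * S.christoffel c x κ μ ν = (1 / 2) * (pd μ (fun y => S.g c y ν β) x +
      pd ν (fun y => S.g c y μ β) x - pd β (fun y => S.g c y μ ν) x) := by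
  have h : ∀ f : Fin 4 → ℝ, ∑ κ, S.g c x β κ * ∑ l, S.gInv c x κ l * f l = f β := by
    intro f
    have := congrFun (congrArg (fun M => M *ᵥ f) (S.g_mul_gInv (c := c) hx)) β
    rw [← Matrix.mulVec_mulVec, Matrix.one_mulVec] at this
    exact this
  have h2 := h fun l => (1 / 2) * (pd μ (fun y => S.g c y ν l) x +
      pd ν (fun y => S.g c y μ l) x - pd l (fun y => S.g c y μ ν) x)
  rw [← h2]
  refine Finset.sum_congr rfl fun κ _ => ?_
  rw [christoffel, Finset.mul_sum]
  congr 1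
  exact Finset.sum_congr rfl fun l _ => by ring

/-- The connection is compatible with the metric. -/
theorem pd_g (c : Fin 2) {x : Pt} (hx : x ∈ S.dom) (μ α β : Fin 4) :
    pd μ (fun y => S.g c y α β) x = ∑ κ, S.g c x β κ * S.christoffel c x κ μ α +
      ∑ κ, S.g c x α κ * S.christoffel c x κ μ β := by
  rw [S.g_christoffel c hx, S.g_christoffel c hx, S.pd_g_symm c hx α μ β, S.pd_g_symm c hx β μ α,
    S.pd_g_symm c hx μ β α, S.pd_g_symm c hx α β μ]
  ring

end Spacetime

theorem fderiv_eq_sum_pd (f : Pt → ℝ) (x v : Pt) : fderiv ℝ f x v = ∑ μ, v μ * pd μ f x := by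
  have h := LinearMap.pi_apply_eq_sum_univ (fderiv ℝ f x).toLinearMap v
  refine h.trans (Finset.sum_congr rfl fun μ _ => ?_)
  rw [pd, smul_eq_mul]
  have : (fun j => if μ = j then (1 : ℝ) else 0) = Pi.single μ 1 := by
    funext j
    simp [Pi.single_apply, eq_comm]
  rw [this]
  rfl

theorem hasDerivAt_line {f : Pt → ℝ} {x : Pt} (hf : DifferentiableAt ℝ f x) (v : Pt) :
    HasDerivAt (fun t : ℝ => f (x + t • v)) (∑ μ, v μ * pd μ f x) 0 := by
  have h1 : HasDerivAt (fun t : ℝ => x + t • v) v 0 := by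
    simpa using ((hasDerivAt_id (0 : ℝ)).smul_const v).const_add x
  have h2 := HasFDerivAt.comp_hasDerivAt_of_eq (0 : ℝ) hf.hasFDerivAt h1 (by simp)
  rw [fderiv_eq_sum_pd] at h2
  exact h2

theorem pd_mul {f h : Pt → ℝ} {x : Pt} (hf : DifferentiableAt ℝ f x) (hh : DifferentiableAt ℝ h x)
    (μ : Fin 4) : pd μ (fun y => f y * h y) x = f x * pd μ h x + h x * pd μ f x := by
  unfold pd
  rw [fderiv_fun_mul hf hh]
  simp

namespace Spacetime

variable (S : Spacetime)

/-- The connection matrix in the direction `v`. -/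
def conn (c : Fin 2) (x v : Pt) : Matrix (Fin 4) (Fin 4) ℝ :=
  Matrix.of fun κ α => ∑ μ, v μ * S.christoffel c x κ μ α

theorem line_mem {x : Pt} (hx : x ∈ S.dom) (v : Pt) : ∀ᶠ t in 𝓝 (0 : ℝ), x + t • v ∈ S.dom := by
  have : ContinuousAt (fun t : ℝ => x + t • v) 0 := by fun_prop
  exact this.eventually_mem (by simpa using S.isOpen_dom.mem_nhds hx)

theorem matDeriv_g {c : Fin 2} {x : Pt} (hx : x ∈ S.dom) (v : Pt) :
    MatDeriv (fun t => S.g c (x + t • v))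
      ((S.conn c x v)ᵀ * S.g c x + S.g c x * S.conn c x v) := by
  intro α β
  refine (hasDerivAt_line (S.differentiableAt_g c hx α β) v).congr_deriv ?_
  simp only [S.pd_g c hx, mul_add, Finset.sum_add_distrib, Matrix.add_apply, Matrix.mul_apply,
    Matrix.transpose_apply, conn, Matrix.of_apply, Finset.mul_sum, Finset.sum_mul]
  congr 1
  · rw [Finset.sum_comm]
    exact Finset.sum_congr rfl fun κ _ => Finset.sum_congr rfl fun μ _ => by
      rw [S.g_symm c hx β κ]; ring
  · rw [Finset.sum_comm]
    exact Finset.sum_congr rfl fun κ _ => Finset.sum_congr rfl fun μ _ => by ring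

theorem matDeriv_gInv {c : Fin 2} {x : Pt} (hx : x ∈ S.dom) (v : Pt) :
    MatDeriv (fun t => S.gInv c (x + t • v))
      (-(S.conn c x v * S.gInv c x + S.gInv c x * (S.conn c x v)ᵀ)) := by
  have h := (S.matDeriv_g (c := c) hx v).inv (by simpa using (S.det_g_neg (c := c) hx).ne)
  refine h.congr_deriv ?_
  have e1 := S.g_mul_gInv (c := c) hx
  have e2 := S.gInv_mul_g (c := c) hx
  simp only [zero_smul, add_zero]
  change -(S.gInv c x * _ * S.gInv c x) = _
  rw [Matrix.mul_add, Matrix.add_mul, ← Matrix.mul_assoc (S.gInv c x) (S.g c x), e2,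
    Matrix.one_mul, Matrix.mul_assoc (S.gInv c x) (_ * S.g c x), Matrix.mul_assoc _ (S.g c x), e1,
    Matrix.mul_one, add_comm]

/-- The logarithmic derivative of the volume density. -/
theorem deriv_dens {c : Fin 2} {x : Pt} (hx : x ∈ S.dom) (v : Pt) :
    HasDerivAt (fun t : ℝ => S.dens c (x + t • v)) (S.dens c x * (S.conn c x v).trace) 0 := by
  set Γ := S.conn c x v with hΓ
  have d1 : MatDeriv (fun t : ℝ => 1 + t • (-Γ)) (-Γ) := by
    intro i j
    simp only [Matrix.add_apply, Matrix.smul_apply, smul_eq_mul]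
    simpa using ((hasDerivAt_id (0 : ℝ)).mul_const ((-Γ) i j)).const_add
      ((1 : Matrix (Fin 4) (Fin 4) ℝ) i j)
  -- Conjugating by 1 - tΓ makes the metric stationary, so the determinant of the conjugate has zero
  -- derivative. As det(1 - tΓ) has derivative -tr Γ and occurs twice, det g has derivative 2 tr Γ
  -- det g.
  have d2 : MatDeriv (fun t : ℝ => (1 + t • (-Γ))ᵀ * S.g c (x + t • v) * (1 + t • (-Γ))) 0 := by
    refine ((d1.transpose.mul (S.matDeriv_g hx v)).mul d1).congr_deriv ?_
    simp only [zero_smul, add_zero, Matrix.transpose_one, Matrix.one_mul, Matrix.mul_one,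
      Matrix.transpose_neg, Matrix.neg_mul, Matrix.mul_neg]
    rw [← hΓ]
    abel
  have d3 := d2.hasDerivAt_det_zero
  have d4 : HasDerivAt (fun t : ℝ => (1 + t • (-Γ)).det) (-Γ.trace) 0 := by
    have e : (fun t : ℝ => (1 + t • (-Γ)).det) = _ := funext fun t => Matrix.det_one_add_smul t (-Γ)
    rw [e]
    have h1 := (hasDerivAt_id (0 : ℝ)).const_mul (-Γ).trace |>.const_add 1
    have h2 := ((Matrix.det (1 + (Polynomial.X : Polynomial ℝ) •
      (-Γ).map Polynomial.C)).divX.divX.hasDerivAt (0 : ℝ)).fun_mul ((hasDerivAt_id (0 : ℝ)).pow 2)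
    refine (h1.fun_add h2).congr_deriv ?_
    simp
  have d5 : DifferentiableAt ℝ (fun t : ℝ => (S.g c (x + t • v)).det) 0 :=
    (S.matDeriv_g (c := c) hx v).differentiableAt_det
  have d6 := (d4.fun_mul d5.hasDerivAt).fun_mul d4
  have e7 : (fun t : ℝ => ((1 + t • (-Γ))ᵀ * S.g c (x + t • v) * (1 + t • (-Γ))).det) =
      fun t => (1 + t • (-Γ)).det * (S.g c (x + t • v)).det * (1 + t • (-Γ)).det := by
    funext t
    rw [Matrix.det_mul, Matrix.det_mul, Matrix.det_transpose]
  rw [e7] at d3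
  have e8 := d6.unique d3
  simp only [zero_smul, add_zero, Matrix.det_one, one_mul, mul_one] at e8
  have hdet : HasDerivAt (fun t : ℝ => (S.g c (x + t • v)).det) ((S.g c x).det * (2 * Γ.trace)) 0 := by
    refine d5.hasDerivAt.congr_deriv ?_
    linear_combination e8
  have hneg := S.det_g_neg (c := c) hx
  have h9 := hdet.fun_neg.sqrt (by simpa using hneg.ne)
  have h10 := h9.congr_of_eventuallyEq (f₁ := fun t : ℝ => S.dens c (x + t • v)) (by
    filter_upwards [S.line_mem hx v] with t ht
    rw [dens, abs_of_neg (S.det_g_neg ht)])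
  refine h10.congr_deriv ?_
  simp only [zero_smul, add_zero]
  have h11 : S.dens c x = √(-(S.g c x).det) := by rw [dens, abs_of_neg hneg]
  have h12 := Real.mul_self_sqrt (neg_pos.2 hneg).le
  have h13 : 0 < √(-(S.g c x).det) := Real.sqrt_pos.2 (neg_pos.2 hneg)
  rw [h11, div_eq_iff (by positivity)]
  linear_combination (-2 * Γ.trace) * h12

/-! ### The Bel-Robinson current -/

/-- The volume form is √|det g| times the symbol and occurs once in each dual, so the factor in
front of the dual term is |det g| = -(det g⁻¹)⁻¹. -/
theorem belRobinson_eq {c : Fin 2} {x : Pt} (hx : x ∈ S.dom) (W : Pt → Tensor4) :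
    S.belRobinson c W x = belRob (S.gInv c x) (-((S.gInv c x).det)⁻¹) (W x) (W x) := by
  have e1 : S.dual c W x = S.dens c x • dualT (S.gInv c x) (W x) := by
    funext α β μ ν
    simp only [dual, dualT, vol, Pi.smul_apply, smul_eq_mul, Finset.mul_sum, levi, dens]
    exact Finset.sum_congr rfl fun _ _ => Finset.sum_congr rfl fun _ _ =>
      Finset.sum_congr rfl fun _ _ => Finset.sum_congr rfl fun _ _ => by ring
  have e2 : S.dens c x * S.dens c x = -((S.gInv c x).det)⁻¹ := by
    rw [dens, Real.mul_self_sqrt (abs_nonneg _), abs_of_neg (S.det_g_neg hx), gInv,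
      Matrix.det_nonsing_inv, Ring.inverse_eq_inv', inv_inv]
  funext α β γ δ
  have e3 : ∀ T : Tensor4, S.square c x T = sqT (S.gInv c x) T T := fun T => rfl
  rw [belRobinson, e3, e3, e1, sqT_smul, e2]
  rfl

/-- The vector field `K = q Lb + q⁻¹ L`. -/
def K (c : Fin 2) (x : Pt) : Fin 4 → ℝ := fun μ => S.q x * Lb x μ + (S.q x)⁻¹ * S.L c x μ

/-- The current `g^{μα} Q_{αβγδ} K^β K^γ K^δ`. -/
def cur (c : Fin 2) (W : Pt → Tensor4) (x : Pt) : Fin 4 → ℝ := curOf (S.gInv c x) (W x) (S.K c x)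

/-- The Lie derivative of the metric along `K`. -/
def lieK (c : Fin 2) (x : Pt) (μ ν : Fin 4) : ℝ :=
  ∑ l, (S.K c x l * pd l (fun y => S.g c y μ ν) x + S.g c x l ν * pd μ (fun y => S.K c y l) x +
    S.g c x μ l * pd ν (fun y => S.K c y l) x)

theorem nablaVec_K_symm {c : Fin 2} {x : Pt} (hx : x ∈ S.dom) (μ ν : Fin 4) :
    ∑ κ, S.g c x ν κ * S.nablaVec c (S.K c) x μ κ + ∑ κ, S.g c x μ κ * S.nablaVec c (S.K c) x ν κ =
      S.lieK c x μ ν := by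
  have h : ∀ μ ν, ∑ κ, S.g c x ν κ * S.nablaVec c (S.K c) x μ κ =
      ∑ κ, S.g c x ν κ * pd μ (fun y => S.K c y κ) x +
        ∑ l, S.K c x l * ∑ κ, S.g c x ν κ * S.christoffel c x κ μ l := by
    intro μ ν
    simp only [nablaVec, mul_add, Finset.sum_add_distrib, Finset.mul_sum]
    congr 1
    rw [Finset.sum_comm]
    exact Finset.sum_congr rfl fun _ _ => Finset.sum_congr rfl fun _ _ => by ring
  have h2 : ∀ l, pd l (fun y => S.g c y μ ν) x = ∑ κ, S.g c x ν κ * S.christoffel c x κ μ l +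
      ∑ κ, S.g c x μ κ * S.christoffel c x κ ν l := by
    intro l
    rw [S.pd_g c hx]
    simp only [S.christoffel_symm c hx _ l]
  rw [h, h, lieK]
  simp only [h2, mul_add, Finset.sum_add_distrib, S.g_symm c hx _ ν]
  ring

end Spacetime

theorem sum_rotate (F : Fin 4 → Fin 4 → Fin 4 → Fin 4 → Fin 4 → Fin 4 → ℝ) :
    ∑ a, ∑ μ, ∑ α, ∑ β, ∑ γ, ∑ δ, F a μ α β γ δ = ∑ β, ∑ γ, ∑ δ, ∑ μ, ∑ α, ∑ a, F a μ α β γ δ := by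
  let e : (Fin 4 × Fin 4 × Fin 4 × Fin 4 × Fin 4 × Fin 4) ≃
      (Fin 4 × Fin 4 × Fin 4 × Fin 4 × Fin 4 × Fin 4) :=
    { toFun := fun (a, μ, α, β, γ, δ) => (β, γ, δ, μ, α, a)
      invFun := fun (β, γ, δ, μ, α, a) => (a, μ, α, β, γ, δ)
      left_inv := fun p => rfl
      right_inv := fun p => rfl }
  have := e.sum_comp fun p => F p.2.2.2.2.2 p.2.2.2.1 p.2.2.2.2.1 p.1 p.2.1 p.2.2.1
  simp only [Fintype.sum_prod_type] at this
  exact this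

namespace Spacetime

variable (S : Spacetime)

theorem isWeyl_field {W : Fin 2 → Pt → Tensor4} (hW : S.IsWeylField W) (c : Fin 2) {x : Pt}
    (hx : x ∈ S.dom) : IsWeyl (S.gInv c x) (W c x) where
  antisymm_left := hW.antisymm_left c x hx
  antisymm_right := hW.antisymm_right c x hx
  cyclic := hW.cyclic c x hx
  traceFree := hW.traceFree c x hx

theorem differentiableAt_field {W : Fin 2 → Pt → Tensor4} (hW : S.IsWeylField W) (c : Fin 2)
    {x : Pt} (hx : x ∈ S.dom) (α β γ δ : Fin 4) :
    DifferentiableAt ℝ (fun y => W c y α β γ δ) x :=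
  ((hW.contDiff c α β γ δ).contDiffAt (S.isOpen_dom.mem_nhds hx)).differentiableAt (by simp)

theorem differentiableAt_gInv (c : Fin 2) {x : Pt} (hx : x ∈ S.dom) (μ ν : Fin 4) :
    DifferentiableAt ℝ (fun x => S.gInv c x μ ν) x :=
  ((S.contDiffOn_gInv c μ ν).contDiffAt (S.isOpen_dom.mem_nhds hx)).differentiableAt (by simp)

theorem differentiableAt_dens (c : Fin 2) {x : Pt} (hx : x ∈ S.dom) :
    DifferentiableAt ℝ (S.dens c) x :=
  ((S.contDiffOn_dens c).contDiffAt (S.isOpen_dom.mem_nhds hx)).differentiableAt (by simp)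

theorem differentiableAt_b (c : Fin 2) {x : Pt} (hx : x ∈ S.dom) (A : Fin 2) :
    DifferentiableAt ℝ (fun x => S.b c x A) x :=
  ((S.smooth_b c A).contDiffAt (S.isOpen_dom.mem_nhds hx)).differentiableAt (by simp)

theorem differentiableAt_Ω (c : Fin 2) {x : Pt} (hx : x ∈ S.dom) :
    DifferentiableAt ℝ (S.Ω c) x :=
  ((S.smooth_Ω c).contDiffAt (S.isOpen_dom.mem_nhds hx)).differentiableAt (by simp)

theorem differentiableAt_γ (c : Fin 2) {x : Pt} (hx : x ∈ S.dom) (A B : Fin 2) :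
    DifferentiableAt ℝ (fun x => S.γ c x A B) x :=
  ((S.smooth_γ c A B).contDiffAt (S.isOpen_dom.mem_nhds hx)).differentiableAt (by simp)

theorem differentiableAt_K (c : Fin 2) {x : Pt} (hx : x ∈ S.dom) (hq : DifferentiableAt ℝ S.q x)
    (hq0 : S.q x ≠ 0) (μ : Fin 4) : DifferentiableAt ℝ (fun y => S.K c y μ) x := by
  have hb := S.differentiableAt_b c hx
  have hL : DifferentiableAt ℝ (fun y => S.L c y μ) x := by
    simp only [L]
    exact (differentiableAt_const _).add
      (DifferentiableAt.fun_sum fun A _ => (hb A).mul (differentiableAt_const _))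
  simp only [K]
  exact (hq.mul (differentiableAt_const _)).add ((hq.inv hq0).mul hL)

theorem det_gInv_ne_zero {c : Fin 2} {x : Pt} (hx : x ∈ S.dom) : (S.gInv c x).det ≠ 0 := by
  rw [gInv, Matrix.det_nonsing_inv, Ring.inverse_eq_inv']
  exact inv_ne_zero (S.det_g_neg hx).ne

theorem differentiableAt_det_gInv (c : Fin 2) {x : Pt} (hx : x ∈ S.dom) :
    DifferentiableAt ℝ (fun y => (S.gInv c y).det) x := by
  have h := S.differentiableAt_gInv c hx
  have h1 : DifferentiableAt ℝ (fun y => (fun i j => S.gInv c y i j : Fin 4 → Fin 4 → ℝ)) x :=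
    differentiableAt_pi.2 fun i => differentiableAt_pi.2 fun j => h i j
  exact (differentiable_det _).comp x h1

theorem differentiableAt_cur {W : Fin 2 → Pt → Tensor4} (hW : S.IsWeylField W) (c : Fin 2)
    {x : Pt} (hx : x ∈ S.dom) (hq : DifferentiableAt ℝ S.q x) (hq0 : S.q x ≠ 0) (μ : Fin 4) :
    DifferentiableAt ℝ (fun y => S.cur c (W c) y μ) x := by
  simp only [cur, curOf]
  exact DifferentiableAt.fun_sum fun α _ => (S.differentiableAt_gInv c hx μ α).mul
    (differentiableAt_contract3_belRob (S.differentiableAt_gInv c hx)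
      ((S.differentiableAt_det_gInv c hx).inv (S.det_gInv_ne_zero hx)).neg
      (S.differentiableAt_field hW c hx) (S.differentiableAt_K c hx hq hq0) α)

/-- The divergence of the current, in terms of an orthonormal frame `e` whose time direction is
proportional to `K`. -/
theorem divergence_cur {W : Fin 2 → Pt → Tensor4} (hW : S.IsWeylField W) (hB : S.Bianchi W)
    (c : Fin 2) {x : Pt} (hx : x ∈ S.dom) (hq : DifferentiableAt ℝ S.q x) (hq0 : S.q x ≠ 0)
    {e : Matrix (Fin 4) (Fin 4) ℝ} {κ : ℝ} (he : e * mink * eᵀ = S.gInv c x)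
    (heK : S.K c x = e *ᵥ Pi.single 0 κ) :
    ∑ μ, pd μ (fun y => S.dens c y * S.cur c (W c) y μ) x = S.dens c x * (κ ^ 2 / 2 *
      ∑ a, ∑ b, sgn a * sgn b * belSym (belRob mink 1 (act e (W c x)) (act e (W c x))) a b *
        ∑ μ, ∑ ν, e μ a * e ν b * S.lieK c x μ ν) := by
  have hdet : e.det ≠ 0 := by
    intro h0
    have := congrArg Matrix.det he
    rw [Matrix.det_mul, Matrix.det_mul, h0, zero_mul, zero_mul] at this
    exact S.det_gInv_ne_zero hx this.symm
  have heu : IsUnit e.det := isUnit_iff_ne_zero.2 hdet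
  have ei1 : e⁻¹ * e = 1 := Matrix.nonsing_inv_mul _ heu
  have ei2 : e * e⁻¹ = 1 := Matrix.mul_nonsing_inv _ heu
  have hmm : mink * mink = 1 := by
    ext i j
    fin_cases i <;> fin_cases j <;> simp [mink, sgn]
  -- the coframe is obtained by lowering indices
  have einv : e⁻¹ = mink * eᵀ * S.g c x := by
    refine Matrix.inv_eq_left_inv ?_
    have h1 : e * (mink * eᵀ * S.g c x) = 1 := by
      rw [← Matrix.mul_assoc, ← Matrix.mul_assoc, he, S.gInv_mul_g hx]
    exact mul_eq_one_comm.1 h1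
  set col : Fin 4 → Pt := fun a μ => e μ a with hcol
  set p := fun a : Fin 4 => act e (covT (S.conn c x (col a)) (W c x)
    (fun α β γ δ => ∑ μ, col a μ * pd μ (fun y => W c y α β γ δ) x)) with hp
  have key : ∀ a, IsWeyl mink (p a) ∧ ∀ b, (e⁻¹ *ᵥ ((fun μ => ∑ ν, col a ν *
      pd ν (fun y => S.cur c (W c) y μ) x) + S.conn c x (col a) *ᵥ S.cur c (W c) x)) b =
      sgn b * (κ ^ 3 * (belRob mink 1 (p a) (act e (W c x)) b 0 0 0 +
          belRob mink 1 (act e (W c x)) (p a) b 0 0 0) +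
        κ ^ 2 * ∑ d, belSym (belRob mink 1 (act e (W c x)) (act e (W c x))) b d *
          (e⁻¹ *ᵥ ((fun μ => ∑ ν, col a ν * pd ν (fun y => S.K c y μ) x) +
            S.conn c x (col a) *ᵥ S.K c x)) d) := by
    intro a
    have := curOf_deriv_frame (h := fun t => S.gInv c (x + t • col a))
      (w := fun t => W c (x + t • col a)) (K := fun t => S.K c (x + t • col a))
      (Γ := S.conn c x (col a)) (e := e) (κ := κ)
      (w' := fun α β γ δ => ∑ μ, col a μ * pd μ (fun y => W c y α β γ δ) x)
      (K' := fun μ => ∑ ν, col a ν * pd ν (fun y => S.K c y μ) x)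
      (X' := fun μ => ∑ ν, col a ν * pd ν (fun y => S.cur c (W c) y μ) x)
      (by simpa using S.matDeriv_gInv hx (col a))
      (fun α β γ δ => hasDerivAt_line (S.differentiableAt_field hW c hx α β γ δ) _)
      (fun μ => hasDerivAt_line (S.differentiableAt_K c hx hq hq0 μ) _)
      (by simpa using he) hdet (by simpa using heK)
      (by filter_upwards [S.line_mem hx (col a)] with t ht using S.isWeyl_field hW c ht)
      (fun μ => hasDerivAt_line (S.differentiableAt_cur hW c hx hq hq0 μ) _)
    simp only [zero_smul, add_zero] at this
    exact this
  have hWw : IsWeyl mink (act e (W c x)) := (S.isWeyl_field hW c hx).act he.symm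
  -- Here `p a` is the covariant derivative of W along the frame vector `e_a`, in frame components.
  -- The Bianchi equations and the algebraic conservation law eliminate all derivatives of W from
  -- the divergence.
  have hcons : ∑ a, sgn a * (belRob mink 1 (p a) (act e (W c x)) a 0 0 0 +
      belRob mink 1 (act e (W c x)) (p a) a 0 0 0) = 0 := by
    have h1 := fun a => (key a).1.eq_weylOf
    have := belRob_conservation (weylPar (act e (W c x))) (fun a => weylPar (p a)) ?_
    · simp only [← h1, ← hWw.eq_weylOf] at this
      exact this
    · intro b d f
      simp only [← h1]
      have h2 : ∀ a, p a = ∑ μ, e μ a • act e (fun α β γ δ => S.nabla4 c (W c) x μ α β γ δ) := by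
        intro a
        have h3 : covT (S.conn c x (col a)) (W c x)
            (fun α β γ δ => ∑ μ, col a μ * pd μ (fun y => W c y α β γ δ) x) =
            ∑ μ, e μ a • (fun α β γ δ => S.nabla4 c (W c) x μ α β γ δ : Tensor4) := by
          funext α β γ δ
          simp only [Finset.sum_apply, Pi.smul_apply, smul_eq_mul, covT, nabla4, conn,
            Matrix.of_apply, mul_sub, Finset.sum_sub_distrib, hcol, Finset.sum_mul, Finset.mul_sum]
          congr 1
          · congr 1
            · congr 1
              · congr 1
                rw [Finset.sum_comm]
                exact Finset.sum_congr rfl fun _ _ => Finset.sum_congr rfl fun _ _ => by ring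
              · rw [Finset.sum_comm]
                exact Finset.sum_congr rfl fun _ _ => Finset.sum_congr rfl fun _ _ => by ring
            · rw [Finset.sum_comm]
              exact Finset.sum_congr rfl fun _ _ => Finset.sum_congr rfl fun _ _ => by ring
          · rw [Finset.sum_comm]
            exact Finset.sum_congr rfl fun _ _ => Finset.sum_congr rfl fun _ _ => by ring
        simp only [hp]
        rw [h3]
        simp only [Fin.sum_univ_four, act_add, act_smul]
      have h4 : ∀ μ α, S.gInv c x μ α = ∑ a, sgn a * e μ a * e α a := by
        intro μ α
        rw [← he, Matrix.mul_apply]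
        refine Finset.sum_congr rfl fun a _ => ?_
        rw [mink, Matrix.mul_diagonal, Matrix.transpose_apply]
        ring
      have h5 : ∑ a, sgn a * p a a b d f = ∑ β, ∑ γ, ∑ δ, e β b * e γ d * e δ f *
          ∑ μ, ∑ α, S.gInv c x μ α * S.nabla4 c (W c) x μ α β γ δ := by
        simp only [h2, h4, Finset.sum_apply, Pi.smul_apply, smul_eq_mul, act, Finset.mul_sum,
          Finset.sum_mul]
        refine (sum_rotate _).trans ?_
        exact Finset.sum_congr rfl fun _ _ => Finset.sum_congr rfl fun _ _ =>
          Finset.sum_congr rfl fun _ _ => Finset.sum_congr rfl fun _ _ =>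
          Finset.sum_congr rfl fun _ _ => Finset.sum_congr rfl fun _ _ => by ring
      rw [h5]
      simp only [hB c x hx, mul_zero, Finset.sum_const_zero]
  set X := S.cur c (W c) x with hX
  set Q := belRob mink 1 (act e (W c x)) (act e (W c x)) with hQ
  set N : Matrix (Fin 4) (Fin 4) ℝ := Matrix.of fun μ ν =>
    pd ν (fun y => S.cur c (W c) y μ) x + ∑ l, S.christoffel c x μ ν l * X l with hN
  set M : Matrix (Fin 4) (Fin 4) ℝ := Matrix.of fun μ ν => S.nablaVec c (S.K c) x ν μ with hM
  have hNe : ∀ a, ((fun μ => ∑ ν, col a ν * pd ν (fun y => S.cur c (W c) y μ) x) +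
      S.conn c x (col a) *ᵥ X) = fun μ => (N * e) μ a := by
    intro a
    funext μ
    simp only [Pi.add_apply, Matrix.mulVec, dotProduct, conn, Matrix.of_apply, Matrix.mul_apply,
      hN, hcol, add_mul, Finset.sum_add_distrib, Finset.sum_mul]
    congr 1
    · exact Finset.sum_congr rfl fun _ _ => by ring
    · rw [Finset.sum_comm]
      exact Finset.sum_congr rfl fun _ _ => Finset.sum_congr rfl fun _ _ => by ring
  have hMe : ∀ a, ((fun μ => ∑ ν, col a ν * pd ν (fun y => S.K c y μ) x) +
      S.conn c x (col a) *ᵥ S.K c x) = fun μ => (M * e) μ a := by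
    intro a
    funext μ
    simp only [Pi.add_apply, Matrix.mulVec, dotProduct, conn, Matrix.of_apply, Matrix.mul_apply,
      hM, nablaVec, hcol, add_mul, Finset.sum_add_distrib, Finset.sum_mul]
    congr 1
    · exact Finset.sum_congr rfl fun _ _ => by ring
    · rw [Finset.sum_comm]
      exact Finset.sum_congr rfl fun _ _ => Finset.sum_congr rfl fun _ _ => by ring
  set B : Fin 4 → Fin 4 → ℝ := fun a d => ∑ μ, ∑ ν, e μ a * e ν d * (S.g c x * M) ν μ with hBdef
  have hMB : ∀ a d, (e⁻¹ *ᵥ fun μ => (M * e) μ a) d = sgn d * B a d := by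
    intro a d
    have h1 : (e⁻¹ *ᵥ fun μ => (M * e) μ a) d = (mink * (eᵀ * (S.g c x * M) * e)) d a := by
      have : (e⁻¹ *ᵥ fun μ => (M * e) μ a) d = (e⁻¹ * (M * e)) d a := rfl
      rw [this, einv]
      simp only [Matrix.mul_assoc]
    rw [h1, mink, Matrix.diagonal_mul]
    congr 1
    simp only [hBdef, Matrix.mul_apply (M := eᵀ * _), Matrix.mul_apply (M := eᵀ),
      Matrix.transpose_apply, Finset.sum_mul]
    exact Finset.sum_congr rfl fun _ _ => Finset.sum_congr rfl fun _ _ => by ring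
  have hBB : ∀ a d, B a d + B d a = ∑ μ, ∑ ν, e μ a * e ν d * S.lieK c x μ ν := by
    intro a d
    have h1 : B d a = ∑ μ, ∑ ν, e μ a * e ν d * (S.g c x * M) μ ν := by
      simp only [hBdef]
      rw [Finset.sum_comm]
      exact Finset.sum_congr rfl fun _ _ => Finset.sum_congr rfl fun _ _ => by ring
    rw [h1]
    simp only [hBdef, ← Finset.sum_add_distrib]
    refine Finset.sum_congr rfl fun μ _ => Finset.sum_congr rfl fun ν _ => ?_
    rw [← S.nablaVec_K_symm hx μ ν, ← mul_add]
    rfl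
  have htr : ∑ a, (e⁻¹ *ᵥ fun μ => (N * e) μ a) a = N.trace := by
    have : ∑ a, (e⁻¹ *ᵥ fun μ => (N * e) μ a) a = (e⁻¹ * (N * e)).trace := rfl
    rw [this, Matrix.trace_mul_comm, Matrix.mul_assoc, ei2, Matrix.mul_one]
  -- The coordinate divergence of the densitised current is the covariant divergence: the derivative
  -- of log `dens` along X is the trace of the connection matrix, and the Christoffel symbols are
  -- symmetric.
  have hlhs : ∑ μ, pd μ (fun y => S.dens c y * S.cur c (W c) y μ) x = S.dens c x * N.trace := by
    have h1 : ∀ μ, pd μ (fun y => S.dens c y * S.cur c (W c) y μ) x =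
        S.dens c x * pd μ (fun y => S.cur c (W c) y μ) x + X μ * pd μ (S.dens c) x := fun μ =>
      pd_mul (S.differentiableAt_dens c hx) (S.differentiableAt_cur hW c hx hq hq0 μ) μ
    have h2 := (hasDerivAt_line (S.differentiableAt_dens c hx) X).unique (S.deriv_dens hx X)
    simp only [h1, Finset.sum_add_distrib, h2, Matrix.trace, Matrix.diag, hN, Matrix.of_apply,
      conn, mul_add, Finset.mul_sum]
    congr 1
    refine Finset.sum_congr rfl fun μ _ => Finset.sum_congr rfl fun ν _ => ?_
    rw [S.christoffel_symm c hx μ μ ν]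
    ring
  have hsum : ∑ a, (e⁻¹ *ᵥ fun μ => (N * e) μ a) a =
      κ ^ 2 * ∑ a, ∑ b, sgn a * sgn b * belSym Q a b * B a b := by
    have h1 : ∀ a, (e⁻¹ *ᵥ fun μ => (N * e) μ a) a = sgn a * (κ ^ 3 *
        (belRob mink 1 (p a) (act e (W c x)) a 0 0 0 +
          belRob mink 1 (act e (W c x)) (p a) a 0 0 0) +
        κ ^ 2 * ∑ d, belSym Q a d * (sgn d * B a d)) := fun a => by
      have h := (key a).2 a
      rw [hNe a] at h
      simp only [hMe, hMB] at h
      exact h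
    simp only [h1, mul_add, Finset.sum_add_distrib]
    have h2 : ∑ a, sgn a * (κ ^ 3 * belRob mink 1 (p a) (act e (W c x)) a 0 0 0) +
        ∑ a, sgn a * (κ ^ 3 * belRob mink 1 (act e (W c x)) (p a) a 0 0 0) = 0 := by
      have : κ ^ 3 * ∑ a, sgn a * (belRob mink 1 (p a) (act e (W c x)) a 0 0 0 +
        belRob mink 1 (act e (W c x)) (p a) a 0 0 0) = 0 := by rw [hcons, mul_zero]
      rw [← this, Finset.mul_sum, ← Finset.sum_add_distrib]
      exact Finset.sum_congr rfl fun _ _ => by ring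
    rw [h2, zero_add]
    simp only [Finset.mul_sum]
    exact Finset.sum_congr rfl fun _ _ => Finset.sum_congr rfl fun _ _ => by ring
  have hsym : ∀ a b, belSym Q a b = belSym Q b a := by
    intro a b
    rw [hQ, hWw.eq_weylOf]
    exact belSym_symm _ a b
  -- By the symmetry of `belSym` only the symmetric part of ∇K survives; it is half the Lie
  -- derivative of the metric.
  have hhalf : ∑ a, ∑ b, sgn a * sgn b * belSym Q a b * B a b =
      1 / 2 * ∑ a, ∑ b, sgn a * sgn b * belSym Q a b *
        ∑ μ, ∑ ν, e μ a * e ν b * S.lieK c x μ ν := by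
    have h1 : ∑ a, ∑ b, sgn a * sgn b * belSym Q a b * B a b =
        ∑ a, ∑ b, sgn a * sgn b * belSym Q a b * B b a := by
      rw [Finset.sum_comm]
      exact Finset.sum_congr rfl fun a _ => Finset.sum_congr rfl fun b _ => by
        rw [hsym b a]; ring
    simp only [← hBB, mul_add, Finset.sum_add_distrib, ← h1]
    ring
  rw [hlhs, ← htr, hsum, hhalf]
  ring

end Spacetime

/-! ### The deformation tensor of K in terms of the connection coefficients -/

/-- The derivative of the double null metric, in terms of those of `Ω`, `b`, `γ`. -/
def metricDeriv (Ω : ℝ) (b : Fin 2 → ℝ) (γ : Matrix (Fin 2) (Fin 2) ℝ) (Ω' : ℝ) (b' : Fin 2 → ℝ)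
    (γ' : Matrix (Fin 2) (Fin 2) ℝ) : Matrix (Fin 4) (Fin 4) ℝ :=
  !![0, -4 * Ω * Ω', 0, 0;
    -4 * Ω * Ω', γ' 0 0 * b 0 ^ 2 + 2 * γ' 0 1 * b 0 * b 1 + γ' 1 1 * b 1 ^ 2 +
        2 * (γ 0 0 * b 0 * b' 0 + γ 0 1 * b' 0 * b 1 + γ 0 1 * b 0 * b' 1 + γ 1 1 * b 1 * b' 1),
      -(γ' 0 0 * b 0 + γ' 0 1 * b 1 + γ 0 0 * b' 0 + γ 0 1 * b' 1),
      -(γ' 0 1 * b 0 + γ' 1 1 * b 1 + γ 0 1 * b' 0 + γ 1 1 * b' 1);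
    0, -(γ' 0 0 * b 0 + γ' 0 1 * b 1 + γ 0 0 * b' 0 + γ 0 1 * b' 1), γ' 0 0, γ' 0 1;
    0, -(γ' 0 1 * b 0 + γ' 1 1 * b 1 + γ 0 1 * b' 0 + γ 1 1 * b' 1), γ' 0 1, γ' 1 1]

theorem hasDerivAt_line_single {f : Pt → ℝ} {x : Pt} (hf : DifferentiableAt ℝ f x) (μ : Fin 4) :
    HasDerivAt (fun t : ℝ => f (x + t • Pi.single μ 1)) (pd μ f x) 0 := by
  refine (hasDerivAt_line hf (Pi.single μ 1)).congr_deriv ?_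
  simp [Pi.single_apply]

namespace Spacetime

variable (S : Spacetime)

theorem pd_γ_symm {c : Fin 2} {x : Pt} (hx : x ∈ S.dom) (μ : Fin 4) :
    pd μ (fun y => S.γ c y 1 0) x = pd μ (fun y => S.γ c y 0 1) x := by
  unfold pd
  rw [Filter.EventuallyEq.fderiv_eq]
  filter_upwards [S.isOpen_dom.mem_nhds hx] with y hy using S.γ_symm hy

/-- The partial derivatives of `Ω`, `b` and `γ`. -/
def dΩ (c : Fin 2) (x : Pt) (μ : Fin 4) : ℝ := pd μ (S.Ω c) x
def db (c : Fin 2) (x : Pt) (μ : Fin 4) (A : Fin 2) : ℝ := pd μ (fun y => S.b c y A) x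
def dγ (c : Fin 2) (x : Pt) (μ : Fin 4) : Matrix (Fin 2) (Fin 2) ℝ :=
  Matrix.of fun A B => pd μ (fun y => S.γ c y A B) x

theorem pd_g_eq {c : Fin 2} {x : Pt} (hx : x ∈ S.dom) (l μ ν : Fin 4) :
    pd l (fun y => S.g c y μ ν) x =
      metricDeriv (S.Ω c x) (S.b c x) (S.γ c x) (S.dΩ c x l) (S.db c x l) (S.dγ c x l) μ ν := by
  have h1 := (hasDerivAt_line_single (S.differentiableAt_g c hx μ ν) l)
  have hΩ := hasDerivAt_line_single (S.differentiableAt_Ω c hx) l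
  have hb := fun A => hasDerivAt_line_single (S.differentiableAt_b c hx A) l
  have hγ := fun A B => hasDerivAt_line_single (S.differentiableAt_γ c hx A B) l
  have h2 := (((hΩ.fun_pow 2).const_mul (-2)).mul_const
      (kron 0 μ * kron 1 ν + kron 1 μ * kron 0 ν)).fun_add
    (HasDerivAt.fun_sum (u := Finset.univ) fun A _ => HasDerivAt.fun_sum (u := Finset.univ) fun B _ =>
      ((hγ A B).fun_mul (((hb A).mul_const (kron 1 μ)).const_sub (kron (ang A) μ))).fun_mul
        (((hb B).mul_const (kron 1 ν)).const_sub (kron (ang B) ν)))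
  rw [h1.unique h2]
  have a0 : ang 0 = 2 := rfl
  have a1 : ang 1 = 3 := rfl
  have s1 := S.γ_symm (c := c) hx
  have s2 := S.pd_γ_symm (c := c) hx l
  fin_cases μ <;> fin_cases ν <;>
    simp [metricDeriv, kron, Fin.sum_univ_two, a0, a1, s1, s2, dΩ, db, dγ] <;> ring

theorem pd_L {c : Fin 2} (x : Pt) (μ κ : Fin 4) :
    pd μ (fun y => S.L c y κ) x = ![0, 0, S.db c x μ 0, S.db c x μ 1] κ := by
  have a0 : ang 0 = 2 := rfl
  have a1 : ang 1 = 3 := rfl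
  fin_cases κ <;> simp [L, Fin.sum_univ_two, kron, a0, a1, db, pd]

theorem L_eq (c : Fin 2) (x : Pt) : S.L c x = ![0, 1, S.b c x 0, S.b c x 1] := by
  have a0 : ang 0 = 2 := rfl
  have a1 : ang 1 = 3 := rfl
  funext κ
  fin_cases κ <;> simp [L, Fin.sum_univ_two, kron, a0, a1]

theorem Lb_eq (x : Pt) : Lb x = ![1, 0, 0, 0] := by
  funext κ
  fin_cases κ <;> simp [Lb, kron]

theorem g_eq {c : Fin 2} {x : Pt} (hx : x ∈ S.dom) : S.g c x =
    !![0, -2 * S.Ω c x ^ 2, 0, 0;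
      -2 * S.Ω c x ^ 2, S.γ c x 0 0 * S.b c x 0 ^ 2 + 2 * S.γ c x 0 1 * S.b c x 0 * S.b c x 1 +
          S.γ c x 1 1 * S.b c x 1 ^ 2,
        -(S.γ c x 0 0 * S.b c x 0 + S.γ c x 0 1 * S.b c x 1),
        -(S.γ c x 0 1 * S.b c x 0 + S.γ c x 1 1 * S.b c x 1);
      0, -(S.γ c x 0 0 * S.b c x 0 + S.γ c x 0 1 * S.b c x 1), S.γ c x 0 0, S.γ c x 0 1;
      0, -(S.γ c x 0 1 * S.b c x 0 + S.γ c x 1 1 * S.b c x 1), S.γ c x 0 1, S.γ c x 1 1] :=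
  doubleNullMetric_eq (S.Ω c x) (S.b c x) (S.γ_symm hx)

theorem pd_inv {f : Pt → ℝ} {x : Pt} (hf : DifferentiableAt ℝ f x) (h0 : f x ≠ 0) (μ : Fin 4) :
    pd μ (fun y => (f y)⁻¹) x = -pd μ f x / f x ^ 2 := by
  have h1 := hasDerivAt_line_single hf μ
  have h2 := hasDerivAt_line_single (hf.fun_inv h0) μ
  have := h2.unique (h1.fun_inv (by simpa using h0))
  simpa using this

/-- `g(∇_μ N, ∂_ν)`. -/
theorem g_nablaVec {c : Fin 2} {x : Pt} (hx : x ∈ S.dom) (N : VecField) (μ β : Fin 4) :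
    ∑ κ, S.g c x κ β * S.nablaVec c N x μ κ = ∑ κ, S.g c x κ β * pd μ (fun y => N y κ) x +
      ∑ ν, N x ν * ((1 / 2) * (pd μ (fun y => S.g c y ν β) x +
        pd ν (fun y => S.g c y μ β) x - pd β (fun y => S.g c y μ ν) x)) := by
  simp only [← S.g_christoffel c hx, nablaVec, mul_add, Finset.sum_add_distrib, Finset.mul_sum]
  congr 1
  rw [Finset.sum_comm]
  exact Finset.sum_congr rfl fun _ _ => Finset.sum_congr rfl fun _ _ => by
    rw [S.g_symm c hx β]; ring

theorem differentiableAt_L {c : Fin 2} {x : Pt} (hx : x ∈ S.dom) (κ : Fin 4) :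
    DifferentiableAt ℝ (fun y => S.L c y κ) x := by
  simp only [L]
  exact (differentiableAt_const _).add (DifferentiableAt.fun_sum fun A _ =>
    (S.differentiableAt_b c hx A).mul (differentiableAt_const _))

theorem LbHat_apply (c : Fin 2) (x : Pt) (κ : Fin 4) : S.LbHat c x κ = (S.Ω c x)⁻¹ * Lb x κ := rfl

theorem LHat_apply (c : Fin 2) (x : Pt) (κ : Fin 4) : S.LHat c x κ = (S.Ω c x)⁻¹ * S.L c x κ := rfl

theorem pd_LHat {c : Fin 2} {x : Pt} (hx : x ∈ S.dom) (μ κ : Fin 4) :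
    pd μ (fun y => S.LHat c y κ) x = (S.Ω c x)⁻¹ * ![0, 0, S.db c x μ 0, S.db c x μ 1] κ +
      S.L c x κ * (-S.dΩ c x μ / S.Ω c x ^ 2) := by
  have hΩ := (S.Ω_pos c x hx).ne'
  have := pd_mul ((S.differentiableAt_Ω c hx).fun_inv hΩ) (S.differentiableAt_L (c := c) hx κ) μ
  simp only [LHat]
  rw [this, pd_inv (S.differentiableAt_Ω c hx) hΩ, S.pd_L]
  rfl

theorem chib_eq {c : Fin 2} {x : Pt} (hx : x ∈ S.dom) :
    S.chib c x = (1 / (2 * S.Ω c x)) • S.dγ c x 0 := by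
  have hΩ := (S.Ω_pos c x hx).ne'
  have a0 : ang 0 = 2 := rfl
  have a1 : ang 1 = 3 := rfl
  have s1 := S.γ_symm (c := c) hx
  have s2 : S.dγ c x 0 1 0 = S.dγ c x 0 0 1 := S.pd_γ_symm (c := c) hx 0
  have hd : ∀ μ κ, pd μ (fun y => S.LbHat c y κ) x =
      Lb x κ * (-S.dΩ c x μ / S.Ω c x ^ 2) := by
    intro μ κ
    have := pd_mul ((S.differentiableAt_Ω c hx).fun_inv hΩ)
      (differentiableAt_const (𝕜 := ℝ) (kron 0 κ) (x := x)) μ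
    simp only [LbHat, Lb]
    rw [this, pd_inv (S.differentiableAt_Ω c hx) hΩ]
    simp [pd, dΩ]
  ext A B
  simp only [chib, secondForm, Matrix.of_apply, S.g_nablaVec hx, hd, S.pd_g_eq hx]
  simp only [LbHat_apply]
  rw [S.g_eq hx, Lb_eq]
  fin_cases A <;> fin_cases B <;>
    simp [Fin.sum_univ_four, a0, a1, metricDeriv, s2] <;> ring

theorem chi_eq {c : Fin 2} {x : Pt} (hx : x ∈ S.dom) (A B : Fin 2) :
    S.chi c x A B = (1 / (2 * S.Ω c x)) * (S.dγ c x 1 A B +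
      (∑ C, S.b c x C * S.dγ c x (ang C) A B) +
      ∑ C, (S.γ c x C B * S.db c x (ang A) C + S.γ c x A C * S.db c x (ang B) C)) := by
  have hΩ := (S.Ω_pos c x hx).ne'
  have a0 : ang 0 = 2 := rfl
  have a1 : ang 1 = 3 := rfl
  have s1 := S.γ_symm (c := c) hx
  have s2 : ∀ μ, S.dγ c x μ 1 0 = S.dγ c x μ 0 1 := S.pd_γ_symm (c := c) hx
  simp only [chi, secondForm, Matrix.of_apply, S.g_nablaVec hx, S.pd_LHat hx, S.pd_g_eq hx]
  simp only [LHat_apply]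
  rw [S.g_eq hx, S.L_eq]
  fin_cases A <;> fin_cases B <;>
    simp [Fin.sum_univ_four, a0, a1, metricDeriv, s1, s2] <;> field_simp <;> ring

theorem zeta_eq {c : Fin 2} {x : Pt} (hx : x ∈ S.dom) (A : Fin 2) :
    S.zeta c x A = 1 / (4 * S.Ω c x ^ 2) * ∑ C, S.γ c x A C * S.db c x 0 C := by
  have hΩ := (S.Ω_pos c x hx).ne'
  have a0 : ang 0 = 2 := rfl
  have a1 : ang 1 = 3 := rfl
  have s1 := S.γ_symm (c := c) hx
  have s2 : ∀ μ, S.dγ c x μ 1 0 = S.dγ c x μ 0 1 := S.pd_γ_symm (c := c) hx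
  have h1 : S.inner c x (S.nablaVec c (S.LHat c) x (ang A)) (S.LbHat c x) =
      (S.Ω c x)⁻¹ * ∑ κ, S.g c x κ 0 * S.nablaVec c (S.LHat c) x (ang A) κ := by
    simp [inner, LbHat, Lb_eq, Fin.sum_univ_four]
    ring
  rw [zeta, h1]
  simp only [S.g_nablaVec hx, S.pd_LHat hx, S.pd_g_eq hx]
  simp only [LHat_apply]
  rw [S.g_eq hx, S.L_eq]
  fin_cases A <;>
    simp [Fin.sum_univ_four, a0, a1, metricDeriv, s1, s2] <;> field_simp <;> ring

theorem lieK_symm {c : Fin 2} {x : Pt} (hx : x ∈ S.dom) (μ ν : Fin 4) :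
    S.lieK c x μ ν = S.lieK c x ν μ := by
  simp only [lieK, S.pd_g_symm c hx _ μ ν]
  refine Finset.sum_congr rfl fun l _ => ?_
  rw [S.g_symm c hx l ν, S.g_symm c hx μ l]
  ring

/-- The Lie derivative of the metric along `K`, on the null frame and the angular vectors. -/
theorem lieK_eq {c : Fin 2} {x : Pt} (hx : x ∈ S.dom) (hq : DifferentiableAt ℝ S.q x)
    (hq0 : S.q x ≠ 0) (hqA : ∀ A, pd (ang A) S.q x = 0) :
    S.lieK c x 0 0 = 4 * S.Ω c x ^ 2 * pd 0 S.q x / S.q x ^ 2 ∧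
    S.lieK c x 0 1 + S.b c x 0 * S.lieK c x 0 2 + S.b c x 1 * S.lieK c x 0 3 =
      -4 * S.Ω c x * (S.q x * S.dΩ c x 0 + (S.q x)⁻¹ * (S.dΩ c x 1 + S.b c x 0 * S.dΩ c x 2 +
        S.b c x 1 * S.dΩ c x 3)) - 2 * S.Ω c x ^ 2 * (pd 0 S.q x - pd 1 S.q x / S.q x ^ 2) ∧
    S.lieK c x 1 1 + 2 * (S.b c x 0 * S.lieK c x 1 2 + S.b c x 1 * S.lieK c x 1 3) +
      S.b c x 0 ^ 2 * S.lieK c x 2 2 + 2 * (S.b c x 0 * S.b c x 1 * S.lieK c x 2 3) +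
      S.b c x 1 ^ 2 * S.lieK c x 3 3 = -4 * S.Ω c x ^ 2 * pd 1 S.q x ∧
    (∀ A, S.lieK c x 0 (ang A) = (S.q x)⁻¹ * (4 * S.Ω c x ^ 2 * S.zeta c x A)) ∧
    (∀ A, S.lieK c x 1 (ang A) + S.b c x 0 * S.lieK c x 2 (ang A) +
      S.b c x 1 * S.lieK c x 3 (ang A) = -S.q x * (4 * S.Ω c x ^ 2 * S.zeta c x A)) ∧
    ∀ A B, S.lieK c x (ang A) (ang B) = 2 * S.Ω c x *
      (S.q x * S.chib c x A B + (S.q x)⁻¹ * S.chi c x A B) := by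
  have hΩ := (S.Ω_pos c x hx).ne'
  have a0 : ang 0 = 2 := rfl
  have a1 : ang 1 = 3 := rfl
  have s1 := S.γ_symm (c := c) hx
  have s2 : ∀ μ, S.dγ c x μ 1 0 = S.dγ c x μ 0 1 := S.pd_γ_symm (c := c) hx
  have q2 : pd 2 S.q x = 0 := hqA 0
  have q3 : pd 3 S.q x = 0 := hqA 1
  have hd : ∀ μ κ, pd μ (fun y => S.K c y κ) x = pd μ S.q x * Lb x κ - pd μ S.q x / S.q x ^ 2 *
      S.L c x κ + (S.q x)⁻¹ * ![0, 0, S.db c x μ 0, S.db c x μ 1] κ := by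
    intro μ κ
    have h1 := hasDerivAt_line_single (S.differentiableAt_K c hx hq hq0 κ) μ
    have h2 := ((hasDerivAt_line_single hq μ).mul_const (kron 0 κ)).fun_add
      ((hasDerivAt_line_single (hq.fun_inv hq0) μ).fun_mul
        (hasDerivAt_line_single (S.differentiableAt_L (c := c) hx κ) μ))
    rw [h1.unique h2, pd_inv hq hq0, S.pd_L]
    simp only [Lb, zero_smul, add_zero]
    ring
  have hK : S.K c x = ![S.q x, (S.q x)⁻¹, (S.q x)⁻¹ * S.b c x 0, (S.q x)⁻¹ * S.b c x 1] := by
    funext κ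
    simp only [K, S.L_eq, Lb_eq]
    fin_cases κ <;> simp
  have hl : ∀ μ ν, S.lieK c x μ ν = ∑ l, (S.K c x l *
      metricDeriv (S.Ω c x) (S.b c x) (S.γ c x) (S.dΩ c x l) (S.db c x l) (S.dγ c x l) μ ν +
      S.g c x l ν * (pd μ S.q x * Lb x l - pd μ S.q x / S.q x ^ 2 * S.L c x l +
        (S.q x)⁻¹ * ![0, 0, S.db c x μ 0, S.db c x μ 1] l) +
      S.g c x μ l * (pd ν S.q x * Lb x l - pd ν S.q x / S.q x ^ 2 * S.L c x l +
        (S.q x)⁻¹ * ![0, 0, S.db c x ν 0, S.db c x ν 1] l)) := by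
    intro μ ν
    simp only [lieK, S.pd_g_eq hx, hd]
  rw [S.g_eq hx, S.L_eq, Lb_eq, hK] at hl
  simp only [Fin.sum_univ_four] at hl
  refine ⟨?_, ?_, ?_, fun A => ?_, fun A => ?_, fun A B => ?_⟩
  · rw [hl]
    simp [metricDeriv]
    field_simp
    ring
  · simp only [hl]
    simp [metricDeriv, q2, q3]
    field_simp
    ring
  · simp only [hl]
    simp [metricDeriv, q2, q3]
    field_simp
    ring
  · rw [hl, S.zeta_eq hx]
    fin_cases A <;> simp [metricDeriv, q2, q3, a0, a1, Fin.sum_univ_two, s1] <;> field_simp <;> ring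
  · simp only [hl, S.zeta_eq hx]
    fin_cases A <;> simp [metricDeriv, q2, q3, a0, a1, Fin.sum_univ_two, s1] <;> field_simp <;> ring
  · rw [hl, S.chib_eq hx, S.chi_eq hx]
    fin_cases A <;> fin_cases B <;>
      simp [metricDeriv, q2, q3, a0, a1, Fin.sum_univ_two, s1, s2] <;> field_simp <;> ring

end Spacetime

/-! ### Orthonormal frames along K and the bounds for the current -/

/-- The orthonormal frame adapted to the null vectors `(q / Ω) Lb` and `(1 / (q Ω)) L`, with the
columns of `m` as angular frame. -/
def nullFrame (q Ω : ℝ) (b : Fin 2 → ℝ) (m : Matrix (Fin 2) (Fin 2) ℝ) : Matrix (Fin 4) (Fin 4) ℝ :=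
  !![q / (2 * Ω), q / (2 * Ω), 0, 0;
    1 / (2 * q * Ω), -(1 / (2 * q * Ω)), 0, 0;
    b 0 / (2 * q * Ω), -(b 0 / (2 * q * Ω)), m 0 0, m 0 1;
    b 1 / (2 * q * Ω), -(b 1 / (2 * q * Ω)), m 1 0, m 1 1]

theorem inv_fin_two {γ : Matrix (Fin 2) (Fin 2) ℝ} (hγ : γ 1 0 = γ 0 1) : γ⁻¹ =
    !![γ 1 1 / γ.det, -(γ 0 1 / γ.det); -(γ 0 1 / γ.det), γ 0 0 / γ.det] := by
  rw [Matrix.inv_def, Ring.inverse_eq_inv', Matrix.adjugate_fin_two]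
  ext i j
  fin_cases i <;> fin_cases j <;> simp [hγ] <;> field_simp

/-- Gram-Schmidt applied to the coordinate vectors of the sphere: the columns of m are a
γ-orthonormal frame. A factorisation at a single point suffices, because all estimates that use the
frame are pointwise. -/
theorem exists_mul_transpose_eq_inv {γ : Matrix (Fin 2) (Fin 2) ℝ} (hγ : γ.PosDef) :
    ∃ m : Matrix (Fin 2) (Fin 2) ℝ, m * mᵀ = γ⁻¹ := by
  have hs : γ 1 0 = γ 0 1 := by simpa using hγ.isHermitian.apply 0 1
  have h0 : 0 < γ 0 0 := hγ.diag_pos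
  have hd := hγ.det_pos
  have e1 := Real.mul_self_sqrt h0.le
  have e2 := Real.mul_self_sqrt hd.le
  have p1 := Real.sqrt_pos.2 h0
  have p2 := Real.sqrt_pos.2 hd
  have hdet : γ.det = γ 0 0 * γ 1 1 - γ 0 1 * γ 0 1 := by rw [Matrix.det_fin_two, hs]
  refine ⟨!![1 / √(γ 0 0), -(γ 0 1 / (√(γ 0 0) * √γ.det)); 0, √(γ 0 0) / √γ.det], ?_⟩
  rw [inv_fin_two hs]
  set s := √(γ 0 0)
  set t := √γ.det
  have e3 : t * t = γ 0 0 * γ 1 1 - γ 0 1 * γ 0 1 := by rw [e2, hdet]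
  rw [← e2]
  rw [← e1] at e3 ⊢
  ext i j
  fin_cases i <;> fin_cases j <;> simp [Matrix.mul_apply, Fin.sum_univ_two] <;> field_simp
  linear_combination e3

theorem nullFrame_mul {q Ω : ℝ} (hq : q ≠ 0) (hΩ : Ω ≠ 0) (b : Fin 2 → ℝ)
    {γ m : Matrix (Fin 2) (Fin 2) ℝ} (hγ : γ 1 0 = γ 0 1) (hm : m * mᵀ = γ⁻¹) :
    nullFrame q Ω b m * mink * (nullFrame q Ω b m)ᵀ = doubleNullInv Ω b γ := by
  rw [inv_fin_two hγ] at hm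
  have m00 := congrFun (congrFun hm 0) 0
  have m01 := congrFun (congrFun hm 0) 1
  have m11 := congrFun (congrFun hm 1) 1
  simp only [Matrix.mul_apply, Fin.sum_univ_two, Matrix.transpose_apply, Matrix.of_apply,
    Matrix.cons_val', Matrix.cons_val_zero, Matrix.cons_val_one, Matrix.cons_val_fin_one]
    at m00 m01 m11
  ext i j
  rw [Matrix.mul_apply]
  simp only [mink, Matrix.mul_diagonal, Matrix.transpose_apply, Fin.sum_univ_four]
  fin_cases i <;> fin_cases j <;> simp [nullFrame, doubleNullInv, sgn] <;>
    first
    | linear_combination m00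
    | linear_combination m01
    | linear_combination m11
    | (field_simp; ring)

/-- Components of a two-tensor in a frame. -/
theorem frame_apply (m h : Matrix (Fin 2) (Fin 2) ℝ) (a b : Fin 2) :
    (mᵀ * h * m) a b = ∑ A, ∑ B, m A a * m B b * h A B := by
  simp [Matrix.mul_apply, Fin.sum_univ_two]
  ring

namespace Spacetime

variable (S : Spacetime)

theorem abs_frame_le_norm2 {c : Fin 2} {x : Pt} {m : Matrix (Fin 2) (Fin 2) ℝ}
    (hm : m * mᵀ = (S.γ c x)⁻¹) (h : Matrix (Fin 2) (Fin 2) ℝ) (a b : Fin 2) :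
    |(mᵀ * h * m) a b| ≤ S.norm2 c x h := by
  have e : ∑ A, ∑ B, ∑ C, ∑ D, (S.γ c x)⁻¹ A C * (S.γ c x)⁻¹ B D * h A B * h C D =
      ∑ a, ∑ b, (mᵀ * h * m) a b ^ 2 := by
    rw [← hm]
    simp [Matrix.mul_apply, Fin.sum_univ_two]
    ring
  rw [norm2, e]
  refine Real.abs_le_sqrt ?_
  refine (Finset.single_le_sum (f := fun b => (mᵀ * h * m) a b ^ 2) (fun _ _ => sq_nonneg _)
    (Finset.mem_univ b)).trans ?_
  exact Finset.single_le_sum (f := fun a => ∑ b, (mᵀ * h * m) a b ^ 2)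
    (fun _ _ => Finset.sum_nonneg fun _ _ => sq_nonneg _) (Finset.mem_univ a)

theorem abs_frame_le_norm1 {c : Fin 2} {x : Pt} {m : Matrix (Fin 2) (Fin 2) ℝ}
    (hm : m * mᵀ = (S.γ c x)⁻¹) (ξ : Fin 2 → ℝ) (a : Fin 2) :
    |∑ A, m A a * ξ A| ≤ S.norm1 c x ξ := by
  have e : ∑ A, ∑ B, (S.γ c x)⁻¹ A B * ξ A * ξ B = ∑ a, (∑ A, m A a * ξ A) ^ 2 := by
    rw [← hm]
    simp [Matrix.mul_apply, Fin.sum_univ_two]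
    ring
  rw [norm1, e]
  refine Real.abs_le_sqrt ?_
  exact Finset.single_le_sum (f := fun a => (∑ A, m A a * ξ A) ^ 2) (fun _ _ => sq_nonneg _)
    (Finset.mem_univ a)

theorem frame_traceFree {c : Fin 2} {x : Pt} (hx : x ∈ S.dom) {m : Matrix (Fin 2) (Fin 2) ℝ}
    (hm : m * mᵀ = (S.γ c x)⁻¹) (h : Matrix (Fin 2) (Fin 2) ℝ) :
    mᵀ * h * m = mᵀ * S.traceFree c x h * m +
      ((1 / 2) * S.trγ c x h) • (1 : Matrix (Fin 2) (Fin 2) ℝ) := by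
  have h1 : mᵀ * S.γ c x * m = 1 := by
    have hu : IsUnit (S.γ c x).det := isUnit_iff_ne_zero.2 (S.γ_det_pos hx).ne'
    have : m * (mᵀ * S.γ c x) = 1 := by
      rw [← Matrix.mul_assoc, hm, Matrix.nonsing_inv_mul _ hu]
    exact mul_eq_one_comm.1 this
  rw [traceFree, Matrix.mul_sub, Matrix.sub_mul, Matrix.mul_smul, Matrix.smul_mul, h1,
    sub_add_cancel]

/-- The combination `q tr χb + q⁻¹ tr χ`. -/
def expansion (c : Fin 2) (x : Pt) : ℝ := S.q x * S.trChib c x + (S.q x)⁻¹ * S.trChi c x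

/-- The trace-free part of the deformation tensor of `K`, in an orthonormal frame, is bounded. -/
theorem abs_lieK_frame_le {ε₀ C₀ : ℝ} (hS : S.BAI ε₀ C₀) {c : Fin 2} {x : Pt} (hx : x ∈ S.dom)
    (hq : DifferentiableAt ℝ S.q x) (hq0 : 0 < S.q x) (hqA : ∀ A, pd (ang A) S.q x = 0)
    {m : Matrix (Fin 2) (Fin 2) ℝ} (hm : m * mᵀ = (S.γ c x)⁻¹)
    {e : Matrix (Fin 4) (Fin 4) ℝ} (he : e = nullFrame (S.q x) (S.Ω c x) (S.b c x) m)
    (a b : Fin 4) : |(∑ μ, ∑ ν, e μ a * e ν b * S.lieK c x μ ν) -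
      (if a = b then S.Ω c x * S.expansion c x * sgn a else 0)| ≤ 4 * (C₀ * S.expansion c x) := by
  obtain ⟨l1, l2, l3, l4, l5, l6⟩ := S.lieK_eq (c := c) hx hq hq0.ne' hqA
  have ls := S.lieK_symm (c := c) hx
  have hΩ := S.Ω_pos c x hx
  have hΩ' := hΩ.ne'
  have hq' := hq0.ne'
  have a0 : ang 0 = 2 := rfl
  have a1 : ang 1 = 3 := rfl
  have q2 : pd 2 S.q x = 0 := hqA 0
  have q3 : pd 3 S.q x = 0 := hqA 1
  have hlog : ∀ {f : Pt → ℝ}, DifferentiableAt ℝ f x → f x ≠ 0 → ∀ μ,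
      pd μ (fun y => Real.log (f y)) x = pd μ f x / f x := by
    intro f hf h0 μ
    have := (hasDerivAt_line_single (hf.log h0) μ).unique
      ((hasDerivAt_line_single hf μ).log (by simpa using h0))
    simpa using this
  have dΩe := S.differentiableAt_Ω c hx
  -- the assumptions
  have b1 := hS.omega c x hx
  have b2 := hS.omegab c x hx
  have b3 := hS.dq c x hx
  have b4 := hS.dqb c x hx
  have b5 := hS.torsion c x hx
  have b6 := hS.shear c x hx
  have b7 := hS.shearb c x hx
  have ω1 : S.omegaHat c x = (S.Ω c x)⁻¹ * ((S.dΩ c x 1 + S.b c x 0 * S.dΩ c x 2 +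
      S.b c x 1 * S.dΩ c x 3) / S.Ω c x) := by
    simp only [omegaHat, deriv, Fin.sum_univ_four, hlog dΩe hΩ', LHat, L_eq]
    simp [dΩ]
    field_simp
  have ω2 : S.omegabHat c x = (S.Ω c x)⁻¹ * (S.dΩ c x 0 / S.Ω c x) := by
    simp only [omegabHat, deriv, Fin.sum_univ_four, hlog dΩe hΩ', LbHat, Lb_eq]
    simp [dΩ]
  have d1 : deriv (S.L c) (fun y => Real.log (S.q y)) x = pd 1 S.q x / S.q x := by
    simp only [deriv, Fin.sum_univ_four, hlog hq hq', L_eq]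
    simp [q2, q3]
  have d2 : deriv Lb (fun y => Real.log (S.q y)) x = pd 0 S.q x / S.q x := by
    simp only [deriv, Fin.sum_univ_four, hlog hq hq', Lb_eq]
    simp
  rw [d1] at b3
  rw [d2] at b4
  set T := S.expansion c x with hT
  have hT' : T = S.q x * S.trChib c x + (S.q x)⁻¹ * S.trChi c x := rfl
  obtain ⟨t1, t2⟩ := hS.expansion c x hx
  have hC₀ : 0 ≤ C₀ := by
    by_contra hneg
    have := mul_neg_of_neg_of_pos (not_le.1 hneg) t1
    linarith [abs_nonneg (pd 1 S.q x / S.q x)]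
  have hTpos : 0 ≤ T := by rw [hT']; positivity
  have hCT : 0 ≤ C₀ * T := by positivity
  have hqi : 0 < (S.q x)⁻¹ := by positivity
  have eCT : C₀ * T = S.q x * (C₀ * S.trChib c x) + (S.q x)⁻¹ * (C₀ * S.trChi c x) := by
    rw [hT']; ring
  -- the lapse terms
  have k1 : |2 * (S.q x * S.dΩ c x 0 + (S.q x)⁻¹ * (S.dΩ c x 1 + S.b c x 0 * S.dΩ c x 2 +
      S.b c x 1 * S.dΩ c x 3)) / S.Ω c x - S.Ω c x * T| ≤ C₀ * T := by
    have : 2 * (S.q x * S.dΩ c x 0 + (S.q x)⁻¹ * (S.dΩ c x 1 + S.b c x 0 * S.dΩ c x 2 +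
      S.b c x 1 * S.dΩ c x 3)) / S.Ω c x - S.Ω c x * T =
      S.q x * (S.Ω c x * (2 * S.omegabHat c x - S.trChib c x)) +
      (S.q x)⁻¹ * (S.Ω c x * (2 * S.omegaHat c x - S.trChi c x)) := by
      rw [ω1, ω2, hT']
      field_simp
      ring
    rw [this, eCT]
    refine (abs_add_le _ _).trans ?_
    simp only [abs_mul, abs_of_pos hΩ, abs_of_pos hq0, abs_of_pos hqi]
    gcongr
  have k2 : |pd 0 S.q x| ≤ S.q x * (C₀ * S.trChib c x) := by
    rw [abs_div, abs_of_pos hq0, div_le_iff₀ hq0] at b4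
    linarith
  have k3 : |pd 1 S.q x / S.q x ^ 2| ≤ (S.q x)⁻¹ * (C₀ * S.trChi c x) := by
    have : pd 1 S.q x / S.q x ^ 2 = (S.q x)⁻¹ * (pd 1 S.q x / S.q x) := by field_simp
    rw [this, abs_mul, abs_of_pos hqi]
    gcongr
  -- Since ζ = (η - ηb) / 2, the bounds on Ω|η| and Ω|ηb| control Ω|ζ|.
  have kζ : ∀ a, |4 * S.Ω c x * ∑ A, m A a * S.zeta c x A| ≤ 4 * (C₀ * T) := by
    intro a
    have e1 : ∑ A, m A a * S.zeta c x A =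
        (1 / 2) * ((∑ A, m A a * S.eta c x A) - ∑ A, m A a * S.etab c x A) := by
      simp only [eta, etab, Fin.sum_univ_two]
      ring
    have n1 := S.abs_frame_le_norm1 hm (S.eta c x) a
    have n2 := S.abs_frame_le_norm1 hm (S.etab c x) a
    have n3 : 0 ≤ S.Ω c x * S.norm1 c x (dSph (fun y => Real.log (S.q y)) x) := by
      have : 0 ≤ S.norm1 c x (dSph (fun y => Real.log (S.q y)) x) := Real.sqrt_nonneg _
      positivity
    have n4 := abs_sub (∑ A, m A a * S.eta c x A) (∑ A, m A a * S.etab c x A)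
    have n6 : 4 * S.Ω c x * ∑ A, m A a * S.zeta c x A = (2 * S.Ω c x) *
        ((∑ A, m A a * S.eta c x A) - ∑ A, m A a * S.etab c x A) := by
      rw [e1]; ring
    rw [n6, abs_mul, abs_of_pos (by positivity : 0 < 2 * S.Ω c x)]
    have n5 : S.Ω c x * |(∑ A, m A a * S.eta c x A) - ∑ A, m A a * S.etab c x A| ≤
        S.Ω c x * S.norm1 c x (S.eta c x) + S.Ω c x * S.norm1 c x (S.etab c x) := by
      rw [← mul_add]
      gcongr
      linarith
    rw [← hT'] at b5
    linarith
  have kχ : ∀ a b : Fin 2, |2 * S.Ω c x * (S.q x * (mᵀ * S.chib c x * m) a b + (S.q x)⁻¹ *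
      (mᵀ * S.chi c x * m) a b) - (if a = b then S.Ω c x * T else 0)| ≤ 4 * (C₀ * T) := by
    intro a b
    rw [S.frame_traceFree hx hm (S.chib c x), S.frame_traceFree hx hm (S.chi c x)]
    have n1 := S.abs_frame_le_norm2 hm (S.traceFree c x (S.chib c x)) a b
    have n2 := S.abs_frame_le_norm2 hm (S.traceFree c x (S.chi c x)) a b
    set H1 := mᵀ * S.traceFree c x (S.chib c x) * m
    set H2 := mᵀ * S.traceFree c x (S.chi c x) * m
    have : 2 * S.Ω c x * (S.q x * (H1 + (1 / 2 * S.trγ c x (S.chib c x)) • 1) a b +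
        (S.q x)⁻¹ * (H2 + (1 / 2 * S.trγ c x (S.chi c x)) • 1) a b) -
        (if a = b then S.Ω c x * T else 0) =
        2 * (S.q x * (S.Ω c x * H1 a b) + (S.q x)⁻¹ * (S.Ω c x * H2 a b)) := by
      rw [hT', trChi, trChib]
      simp only [Matrix.add_apply, Matrix.smul_apply, Matrix.one_apply, smul_eq_mul]
      split_ifs <;> ring
    rw [this, abs_mul, abs_of_pos (by norm_num : (0 : ℝ) < 2)]
    have n3 : |S.q x * (S.Ω c x * H1 a b) + (S.q x)⁻¹ * (S.Ω c x * H2 a b)| ≤ C₀ * T := by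
      rw [eCT]
      refine (abs_add_le _ _).trans ?_
      simp only [abs_mul, abs_of_pos hΩ, abs_of_pos hq0, abs_of_pos hqi]
      refine add_le_add (mul_le_mul_of_nonneg_left ?_ hq0.le) (mul_le_mul_of_nonneg_left ?_ hqi.le)
      · exact (mul_le_mul_of_nonneg_left n1 hΩ.le).trans b7
      · exact (mul_le_mul_of_nonneg_left n2 hΩ.le).trans b6
    linarith
  obtain ⟨k1a, k1b⟩ := abs_le.1 k1
  obtain ⟨k2a, k2b⟩ := abs_le.1 k2
  obtain ⟨k3a, k3b⟩ := abs_le.1 k3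
  have hsymm : ∀ a b, ∑ μ, ∑ ν, e μ a * e ν b * S.lieK c x μ ν =
      ∑ μ, ∑ ν, e μ b * e ν a * S.lieK c x μ ν := by
    intro a b
    rw [Finset.sum_comm]
    exact Finset.sum_congr rfl fun _ _ => Finset.sum_congr rfl fun _ _ => by rw [ls]; ring
  set U := pd 0 S.q x
  set V := pd 1 S.q x / S.q x ^ 2 with hV
  set G := 2 * (S.q x * S.dΩ c x 0 + (S.q x)⁻¹ * (S.dΩ c x 1 + S.b c x 0 * S.dΩ c x 2 +
      S.b c x 1 * S.dΩ c x 3)) / S.Ω c x with hG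
  set F : Fin 4 → Fin 4 → ℝ := fun a b => ∑ μ, ∑ ν, e μ a * e ν b * S.lieK c x μ ν with hF
  have hFe : ∀ a b, F a b = ∑ μ, ∑ ν, nullFrame (S.q x) (S.Ω c x) (S.b c x) m μ a *
      nullFrame (S.q x) (S.Ω c x) (S.b c x) m ν b * S.lieK c x μ ν := by
    intro a b
    rw [hF, he]
  simp only [Fin.sum_univ_four] at hFe
  rw [ls 1 0, ls 2 0, ls 2 1, ls 3 0, ls 3 1, ls 3 2] at hFe
  -- The conformal structure appears here. With G = 2 K log Ω one has F₀₀ = -G and F₁₁ = G + 2(U -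
  -- V), and the assumptions on the lapse say that G = ΩT up to C₀T. In the angular block the traces
  -- of χ and χb produce the same ΩT. Everything else, namely derivatives of q, shears and ζ, is of
  -- size C₀T.
  have f00 : F 0 0 = -G := by
    have : F 0 0 = (S.q x / (2 * S.Ω c x)) ^ 2 * S.lieK c x 0 0 + 1 / (2 * S.Ω c x ^ 2) *
        (S.lieK c x 0 1 + S.b c x 0 * S.lieK c x 0 2 + S.b c x 1 * S.lieK c x 0 3) +
        (1 / (2 * S.q x * S.Ω c x)) ^ 2 * (S.lieK c x 1 1 + 2 * (S.b c x 0 * S.lieK c x 1 2 +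
          S.b c x 1 * S.lieK c x 1 3) + S.b c x 0 ^ 2 * S.lieK c x 2 2 +
          2 * (S.b c x 0 * S.b c x 1 * S.lieK c x 2 3) + S.b c x 1 ^ 2 * S.lieK c x 3 3) := by
      rw [hFe]
      simp [nullFrame]
      field_simp
      ring
    rw [this, l1, l2, l3, hG, hV]
    field_simp
    ring
  have f11 : F 1 1 = 2 * (U - V) + G := by
    have : F 1 1 = (S.q x / (2 * S.Ω c x)) ^ 2 * S.lieK c x 0 0 - 1 / (2 * S.Ω c x ^ 2) *
        (S.lieK c x 0 1 + S.b c x 0 * S.lieK c x 0 2 + S.b c x 1 * S.lieK c x 0 3) +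
        (1 / (2 * S.q x * S.Ω c x)) ^ 2 * (S.lieK c x 1 1 + 2 * (S.b c x 0 * S.lieK c x 1 2 +
          S.b c x 1 * S.lieK c x 1 3) + S.b c x 0 ^ 2 * S.lieK c x 2 2 +
          2 * (S.b c x 0 * S.b c x 1 * S.lieK c x 2 3) + S.b c x 1 ^ 2 * S.lieK c x 3 3) := by
      rw [hFe]
      simp [nullFrame]
      field_simp
      ring
    rw [this, l1, l2, l3, hG, hV]
    field_simp
    ring
  have f01 : F 0 1 = U + V := by
    have : F 0 1 = (S.q x / (2 * S.Ω c x)) ^ 2 * S.lieK c x 0 0 -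
        (1 / (2 * S.q x * S.Ω c x)) ^ 2 * (S.lieK c x 1 1 + 2 * (S.b c x 0 * S.lieK c x 1 2 +
          S.b c x 1 * S.lieK c x 1 3) + S.b c x 0 ^ 2 * S.lieK c x 2 2 +
          2 * (S.b c x 0 * S.b c x 1 * S.lieK c x 2 3) + S.b c x 1 ^ 2 * S.lieK c x 3 3) := by
      rw [hFe]
      simp [nullFrame]
      field_simp
      ring
    rw [this, l1, l3, hV]
    field_simp
    ring
  have l40 := l4 0
  have l41 := l4 1
  have l50 := l5 0
  have l51 := l5 1
  rw [a0] at l40 l50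
  rw [a1] at l41 l51
  rw [ls 3 2] at l50
  -- The torsion enters the components along Lb and along L with opposite signs. It therefore
  -- cancels in the time-angular components and doubles in the components along the first spatial
  -- vector.
  have f0 : ∀ k : Fin 4, ∀ a, (∀ μ, nullFrame (S.q x) (S.Ω c x) (S.b c x) m μ k =
      ![0, 0, m 0 a, m 1 a] μ) → F 0 k = 0 ∧ F 1 k = 4 * S.Ω c x * ∑ A, m A a * S.zeta c x A := by
    intro k a hk
    have h1 : F 0 k = S.q x / (2 * S.Ω c x) * (m 0 a * S.lieK c x 0 2 + m 1 a * S.lieK c x 0 3) +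
        1 / (2 * S.q x * S.Ω c x) * (m 0 a * (S.lieK c x 1 2 + S.b c x 0 * S.lieK c x 2 2 +
          S.b c x 1 * S.lieK c x 2 3) + m 1 a * (S.lieK c x 1 3 + S.b c x 0 * S.lieK c x 2 3 +
          S.b c x 1 * S.lieK c x 3 3)) := by
      rw [hFe]
      simp only [hk]
      simp [nullFrame]
      ring
    have h2 : F 1 k = S.q x / (2 * S.Ω c x) * (m 0 a * S.lieK c x 0 2 + m 1 a * S.lieK c x 0 3) -
        1 / (2 * S.q x * S.Ω c x) * (m 0 a * (S.lieK c x 1 2 + S.b c x 0 * S.lieK c x 2 2 +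
          S.b c x 1 * S.lieK c x 2 3) + m 1 a * (S.lieK c x 1 3 + S.b c x 0 * S.lieK c x 2 3 +
          S.b c x 1 * S.lieK c x 3 3)) := by
      rw [hFe]
      simp only [hk]
      simp [nullFrame]
      ring
    rw [h1, h2, l40, l41, l50, l51, Fin.sum_univ_two]
    constructor <;> field_simp <;> ring
  have fAB : ∀ k l : Fin 4, ∀ a b, (∀ μ, nullFrame (S.q x) (S.Ω c x) (S.b c x) m μ k =
      ![0, 0, m 0 a, m 1 a] μ) → (∀ μ, nullFrame (S.q x) (S.Ω c x) (S.b c x) m μ l =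
      ![0, 0, m 0 b, m 1 b] μ) → F k l = 2 * S.Ω c x * (S.q x * (mᵀ * S.chib c x * m) a b +
        (S.q x)⁻¹ * (mᵀ * S.chi c x * m) a b) := by
    intro k l a b hk hl
    have l600 := l6 0 0
    have l601 := l6 0 1
    have l610 := l6 1 0
    have l611 := l6 1 1
    rw [a0] at l600 l601 l610
    rw [a1] at l601 l610 l611
    have h1 : F k l = m 0 a * m 0 b * S.lieK c x 2 2 + m 0 a * m 1 b * S.lieK c x 2 3 +
        m 1 a * m 0 b * S.lieK c x 3 2 + m 1 a * m 1 b * S.lieK c x 3 3 := by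
      rw [hFe, ls 3 2]
      simp only [hk, hl]
      simp
      ring
    rw [h1, l600, l601, l610, l611, frame_apply, frame_apply]
    simp only [Fin.sum_univ_two]
    ring
  have hc2 : ∀ μ, nullFrame (S.q x) (S.Ω c x) (S.b c x) m μ 2 = ![0, 0, m 0 0, m 1 0] μ := by
    intro μ
    fin_cases μ <;> rfl
  have hc3 : ∀ μ, nullFrame (S.q x) (S.Ω c x) (S.b c x) m μ 3 = ![0, 0, m 0 1, m 1 1] μ := by
    intro μ
    fin_cases μ <;> rfl
  obtain ⟨f02, f12⟩ := f0 2 0 hc2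
  obtain ⟨f03, f13⟩ := f0 3 1 hc3
  have s0 : sgn 0 = -1 := rfl
  have s1 : sgn 1 = 1 := rfl
  have s2 : sgn 2 = 1 := rfl
  have s3 : sgn 3 = 1 := rfl
  have g00 := kχ 0 0
  have g01 := kχ 0 1
  have g10 := kχ 1 0
  have g11 := kχ 1 1
  rw [← fAB 2 2 0 0 hc2 hc2] at g00
  rw [← fAB 2 3 0 1 hc2 hc3] at g01
  rw [← fAB 3 2 1 0 hc3 hc2] at g10
  rw [← fAB 3 3 1 1 hc3 hc3] at g11
  have z0 := kζ 0
  have z1 := kζ 1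
  rw [← f12] at z0
  rw [← f13] at z1
  have hall : ∀ a b : Fin 4, |F a b - (if a = b then S.Ω c x * T * sgn a else 0)| ≤
      4 * (C₀ * T) := by
    have f10 : F 1 0 = F 0 1 := hsymm 1 0
    have f20 : F 2 0 = F 0 2 := hsymm 2 0
    have f30 : F 3 0 = F 0 3 := hsymm 3 0
    have f21 : F 2 1 = F 1 2 := hsymm 2 1
    have f31 : F 3 1 = F 1 3 := hsymm 3 1
    have h00 : |F 0 0 - S.Ω c x * T * sgn 0| ≤ 4 * (C₀ * T) := by
      rw [f00, s0, abs_le]; constructor <;> linarith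
    have h11 : |F 1 1 - S.Ω c x * T * sgn 1| ≤ 4 * (C₀ * T) := by
      rw [f11, s1, abs_le]; constructor <;> linarith
    have h01 : |F 0 1| ≤ 4 * (C₀ * T) := by
      rw [f01, abs_le]; constructor <;> linarith
    have h02 : |F 0 2| ≤ 4 * (C₀ * T) := by rw [f02, abs_zero]; linarith
    have h03 : |F 0 3| ≤ 4 * (C₀ * T) := by rw [f03, abs_zero]; linarith
    intro a b
    fin_cases a <;> fin_cases b <;> simp only [Fin.isValue, Fin.zero_eta, Fin.mk_one,
      Fin.reduceFinMk, Fin.reduceEq, ↓reduceIte, sub_zero, f10, f20, f30, f21, f31, h01, h02, h03,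
      h00, h11, z0, z1, s2, s3, mul_one]
    · simpa using g00
    · simpa using g01
    · simpa using g10
    · simpa using g11
  exact hall a b

end Spacetime

/-- The current in an orthonormal frame whose time direction is proportional to `k`. -/
theorem curOf_eq_frame {h e : Matrix (Fin 4) (Fin 4) ℝ} {k : Fin 4 → ℝ} {κ : ℝ} (W : Tensor4)
    (hdet : e.det ≠ 0) (he : e * mink * eᵀ = h) (hk : k = e *ᵥ Pi.single 0 κ) (μ : Fin 4) :
    curOf h W k μ = κ ^ 3 * ∑ a, e μ a * sgn a * belRob mink 1 (act e W) (act e W) a 0 0 0 ∧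
    ∑ α, contract3 (belRob h (-(h.det)⁻¹) W W) k α * k α =
      κ ^ 4 * belRob mink 1 (act e W) (act e W) 0 0 0 0 := by
  have hd : -(h.det)⁻¹ * e.det ^ 2 = 1 := by
    have : h.det = -e.det ^ 2 := by
      rw [← he, Matrix.det_mul, Matrix.det_mul, Matrix.det_transpose, det_mink]
      ring
    rw [this]
    field_simp
  have h1 : act e (belRob h (-(h.det)⁻¹) W W) = belRob mink 1 (act e W) (act e W) := by
    have := belRob_act mink e (-(h.det)⁻¹) W W
    rw [he, hd] at this
    exact this
  have h2 : ∀ a, ∑ α, e α a * contract3 (belRob h (-(h.det)⁻¹) W W) k α =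
      κ ^ 3 * belRob mink 1 (act e W) (act e W) a 0 0 0 := by
    intro a
    rw [hk, ← contract3_act, h1, contract3]
    simp only [Fin.sum_univ_four, Pi.single_apply]
    simp
    ring
  constructor
  · rw [curOf]
    have h3 : ∀ α, h μ α = ∑ a, e μ a * sgn a * e α a := by
      intro α
      rw [← he, Matrix.mul_apply]
      refine Finset.sum_congr rfl fun a _ => ?_
      rw [mink, Matrix.mul_diagonal, Matrix.transpose_apply]
    simp only [h3, Finset.sum_mul]
    rw [Finset.sum_comm, Finset.mul_sum]
    refine Finset.sum_congr rfl fun a _ => ?_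
    have h4 := h2 a
    have h5 : ∑ α, e μ a * sgn a * e α a * contract3 (belRob h (-(h.det)⁻¹) W W) k α =
        e μ a * sgn a * ∑ α, e α a * contract3 (belRob h (-(h.det)⁻¹) W W) k α := by
      rw [Finset.mul_sum]
      exact Finset.sum_congr rfl fun _ _ => by ring
    rw [h5, h4]
    ring
  · have h4 := h2 0
    have h5 : ∀ α, k α = e α 0 * κ := by
      intro α
      rw [hk]
      simp [Matrix.mulVec, dotProduct, Pi.single_apply]
    simp only [h5]
    have h6 : ∑ α, contract3 (belRob h (-(h.det)⁻¹) W W) k α * (e α 0 * κ) =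
        κ * ∑ α, e α 0 * contract3 (belRob h (-(h.det)⁻¹) W W) k α := by
      rw [Finset.mul_sum]
      exact Finset.sum_congr rfl fun _ _ => by ring
    rw [h6, h4]
    ring

namespace Spacetime

variable (S : Spacetime)

/-- The energy density `Q(K, K, K, K)`. -/
def belK (c : Fin 2) (W : Pt → Tensor4) (x : Pt) : ℝ :=
  ∑ α, contract3 (S.belRobinson c W x) (S.K c x) α * S.K c x α

/-- Positivity of the current, and the bound for its divergence. -/
theorem cur_estimate {ε₀ C₀ : ℝ} (hS : S.BAI ε₀ C₀) {W : Fin 2 → Pt → Tensor4}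
    (hW : S.IsWeylField W) (hB : S.Bianchi W) (c : Fin 2) {x : Pt} (hx : x ∈ S.dom)
    (hq : DifferentiableAt ℝ S.q x) (hq0 : 0 < S.q x) (hqA : ∀ A, pd (ang A) S.q x = 0) :
    0 ≤ S.belK c (W c) x ∧ S.cur c (W c) x 0 ≤ 0 ∧ S.cur c (W c) x 1 ≤ 0 ∧
    -((S.q x)⁻¹ * S.cur c (W c) x 0 + S.q x * S.cur c (W c) x 1) =
      S.belK c (W c) x / (2 * S.Ω c x ^ 2) ∧
    |∑ μ, pd μ (fun y => S.dens c y * S.cur c (W c) y μ) x| ≤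
      1536 * C₀ * S.expansion c x * (S.dens c x * (S.belK c (W c) x / (2 * S.Ω c x ^ 2))) := by
  obtain ⟨m, hm⟩ := exists_mul_transpose_eq_inv (S.γ_posDef c x hx)
  have hΩ := S.Ω_pos c x hx
  set e := nullFrame (S.q x) (S.Ω c x) (S.b c x) m with he
  have h1 : e * mink * eᵀ = S.gInv c x := by
    rw [S.gInv_eq hx]
    exact nullFrame_mul hq0.ne' hΩ.ne' _ (S.γ_symm hx) hm
  -- The time vector of the frame is (q Lb + q⁻¹ L) / (2Ω), so K is 2Ω times a unit vector.
  have hK : S.K c x = e *ᵥ Pi.single 0 (2 * S.Ω c x) := by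
    funext κ
    simp only [K, S.L_eq, Lb_eq, Matrix.mulVec, dotProduct, Fin.sum_univ_four, he]
    fin_cases κ <;> simp [nullFrame] <;> field_simp
  have hdet : e.det ≠ 0 := by
    intro h0
    have := congrArg Matrix.det h1
    rw [Matrix.det_mul, Matrix.det_mul, h0, zero_mul, zero_mul] at this
    exact S.det_gInv_ne_zero hx this.symm
  have hc := fun μ => (curOf_eq_frame (W c x) hdet h1 hK μ).1
  have hb : S.belK c (W c) x = (2 * S.Ω c x) ^ 4 *
      belRob mink 1 (act e (W c x)) (act e (W c x)) 0 0 0 0 := by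
    rw [belK, S.belRobinson_eq hx]
    exact (curOf_eq_frame (W c x) hdet h1 hK 0).2
  have hw : IsWeyl mink (act e (W c x)) := (S.isWeyl_field hW c hx).act h1.symm
  have hdiv := S.divergence_cur hW hB c hx hq hq0.ne' h1 hK
  set Qf := belRob mink 1 (act e (W c x)) (act e (W c x)) with hQf
  have hQ : Qf = belRob mink 1 (weylOf (weylPar (act e (W c x))))
      (weylOf (weylPar (act e (W c x)))) := by rw [hQf, ← hw.eq_weylOf]
  have p0 : 0 ≤ Qf 0 0 0 0 := by rw [hQ]; exact belRob_weylOf_time_nonneg _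
  have p1 : |Qf 1 0 0 0| ≤ Qf 0 0 0 0 := by rw [hQ]; exact abs_belRob_weylOf_flux_le _
  have p2 : ∀ a b c d, |Qf a b c d| ≤ 32 * Qf 0 0 0 0 := by rw [hQ]; exact abs_belRob_weylOf_le _
  have p3 : ∑ a, sgn a * belSym Qf a a = 0 := by rw [hQ]; exact belSym_trace _
  clear_value Qf
  obtain ⟨p1a, p1b⟩ := abs_le.1 p1
  -- The u- and v-components of the current are null components of Q; their signs express the
  -- dominance of the density over the flux.
  have c0 : S.cur c (W c) x 0 = -(4 * S.Ω c x ^ 2 * S.q x * (Qf 0 0 0 0 - Qf 1 0 0 0)) := by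
    rw [cur, hc 0]
    simp [Fin.sum_univ_four, he, nullFrame, sgn]
    field_simp
    ring
  have c1 : S.cur c (W c) x 1 = -(4 * S.Ω c x ^ 2 * (S.q x)⁻¹ * (Qf 0 0 0 0 + Qf 1 0 0 0)) := by
    rw [cur, hc 1]
    simp [Fin.sum_univ_four, he, nullFrame, sgn]
    field_simp
    ring
  refine ⟨?_, ?_, ?_, ?_, ?_⟩
  · rw [hb]; positivity
  · rw [c0, neg_nonpos]
    have : 0 ≤ Qf 0 0 0 0 - Qf 1 0 0 0 := by linarith
    positivity
  · rw [c1, neg_nonpos]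
    have : 0 ≤ Qf 0 0 0 0 + Qf 1 0 0 0 := by linarith
    positivity
  · rw [c0, c1, hb]
    field_simp
    ring
  · rw [hdiv, hb]
    set F : Fin 4 → Fin 4 → ℝ := fun a b => ∑ μ, ∑ ν, e μ a * e ν b * S.lieK c x μ ν with hF
    set D : Fin 4 → Fin 4 → ℝ := fun a b =>
      if a = b then S.Ω c x * S.expansion c x * sgn a else 0 with hD
    have hFD : ∀ a b, |F a b - D a b| ≤ 4 * (C₀ * S.expansion c x) := fun a b =>
      S.abs_lieK_frame_le hS hx hq hq0 hqA hm he a b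
    have hB0 : 0 ≤ C₀ * S.expansion c x := by
      have := (abs_nonneg _).trans (hFD 0 0)
      linarith
    have hsum : ∑ a, ∑ b, sgn a * sgn b * belSym Qf a b * F a b =
        ∑ a, ∑ b, sgn a * sgn b * belSym Qf a b * (F a b - D a b) := by
      have : ∑ a, ∑ b, sgn a * sgn b * belSym Qf a b * D a b = 0 := by
        have h2 : ∀ a, ∑ b, sgn a * sgn b * belSym Qf a b * D a b =
            S.Ω c x * S.expansion c x * (sgn a * belSym Qf a a) := by
          intro a
          rw [Finset.sum_eq_single a]
          · simp only [hD, if_true]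
            have : sgn a * sgn a = 1 := by fin_cases a <;> simp [sgn]
            linear_combination (sgn a * belSym Qf a a * (S.Ω c x * S.expansion c x)) * this
          · intro b _ hb
            simp only [hD, if_neg hb.symm, mul_zero]
          · simp
        simp only [h2, ← Finset.mul_sum, p3, mul_zero]
      simp only [mul_sub, Finset.sum_sub_distrib, this, sub_zero]
    -- There are 16 index pairs; three components of Q, each at most 32 times the density, give 96;
    -- each entry of F - D is at most 4 C₀T. Normalising by `belK` = (2Ω)⁴ times the density turns
    -- the total 16 · 96 · 4 into the stated 1536.
    have hbd : |∑ a, ∑ b, sgn a * sgn b * belSym Qf a b * F a b| ≤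
        16 * (96 * Qf 0 0 0 0 * (4 * (C₀ * S.expansion c x))) := by
      rw [hsum]
      have hs : ∀ a b, |sgn a * sgn b * belSym Qf a b * (F a b - D a b)| ≤
          96 * Qf 0 0 0 0 * (4 * (C₀ * S.expansion c x)) := by
        intro a b
        rw [abs_mul, abs_mul, abs_mul, abs_sgn, abs_sgn, one_mul, one_mul]
        have : |belSym Qf a b| ≤ 96 * Qf 0 0 0 0 := by
          rw [belSym]
          have h1 := p2 a b 0 0
          have h2 := p2 a 0 b 0
          have h3 := p2 a 0 0 b
          refine (abs_add_three _ _ _).trans ?_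
          linarith
        exact mul_le_mul this (hFD a b) (abs_nonneg _) (by positivity)
      calc _ ≤ ∑ a, ∑ b, |sgn a * sgn b * belSym Qf a b * (F a b - D a b)| :=
            (Finset.abs_sum_le_sum_abs _ _).trans
              (Finset.sum_le_sum fun _ _ => Finset.abs_sum_le_sum_abs _ _)
        _ ≤ ∑ _a : Fin 4, ∑ _b : Fin 4, 96 * Qf 0 0 0 0 * (4 * (C₀ * S.expansion c x)) :=
            Finset.sum_le_sum fun a _ => Finset.sum_le_sum fun b _ => hs a b
        _ = _ := by simp; ring
    have hdp := S.dens_pos (c := c) hx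
    rw [abs_mul, abs_mul, abs_of_pos hdp, abs_of_pos (by positivity : 0 < (2 * S.Ω c x) ^ 2 / 2)]
    calc _ ≤ S.dens c x * ((2 * S.Ω c x) ^ 2 / 2 *
          (16 * (96 * Qf 0 0 0 0 * (4 * (C₀ * S.expansion c x))))) := by gcongr
      _ ≤ _ := le_of_eq (by field_simp; ring)

end Spacetime

/-! ### The transition between the two charts -/

/-- `|ϑ|²`. -/
def angSq (x : Pt) : ℝ := x 2 ^ 2 + x 3 ^ 2

theorem angSq_pos {x : Pt} (h : (x 2, x 3) ≠ (0, 0)) : 0 < angSq x := by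
  by_contra hn
  have h2 := sq_nonneg (x 2)
  have h3 := sq_nonneg (x 3)
  rw [angSq] at hn
  have e2 : x 2 = 0 := pow_eq_zero_iff (two_ne_zero) |>.1 (by linarith)
  have e3 : x 3 = 0 := pow_eq_zero_iff (two_ne_zero) |>.1 (by linarith)
  exact h (by rw [e2, e3])

/-- The Jacobian matrix of the transition map. -/
def jacMat (x : Pt) : Matrix (Fin 4) (Fin 4) ℝ :=
  !![1, 0, 0, 0;
    0, 1, 0, 0;
    0, 0, (x 3 ^ 2 - x 2 ^ 2) / angSq x ^ 2, -(2 * x 2 * x 3) / angSq x ^ 2;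
    0, 0, 2 * x 2 * x 3 / angSq x ^ 2, (x 3 ^ 2 - x 2 ^ 2) / angSq x ^ 2]

/-- The inverse of the Jacobian matrix of the transition map. -/
def jacMatInv (x : Pt) : Matrix (Fin 4) (Fin 4) ℝ :=
  !![1, 0, 0, 0;
    0, 1, 0, 0;
    0, 0, x 3 ^ 2 - x 2 ^ 2, 2 * x 2 * x 3;
    0, 0, -(2 * x 2 * x 3), x 3 ^ 2 - x 2 ^ 2]

theorem differentiableAt_coord (x : Pt) (μ : Fin 4) : DifferentiableAt ℝ (fun y : Pt => y μ) x := by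
  fun_prop

theorem jac_eq {x : Pt} (h : (x 2, x 3) ≠ (0, 0)) : Matrix.of (jac x) = jacMat x := by
  have hs := (angSq_pos h).ne'
  have hs' : x 2 ^ 2 + x 3 ^ 2 ≠ 0 := hs
  have hc : ∀ ν μ : Fin 4, HasDerivAt (fun t : ℝ => (x + t • (Pi.single μ 1 : Pt)) ν)
      ((Pi.single μ 1 : Pt) ν) 0 := by
    intro ν μ
    have := ((hasDerivAt_id (0 : ℝ)).mul_const ((Pi.single μ 1 : Pt) ν)).const_add (x ν)
    simpa using this
  have hpd : ∀ {f : Pt → ℝ} {d : ℝ} (μ : Fin 4), DifferentiableAt ℝ f x →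
      HasDerivAt (fun t : ℝ => f (x + t • (Pi.single μ 1 : Pt))) d 0 → pd μ f x = d :=
    fun μ hf hd => (hasDerivAt_line_single hf μ).unique hd
  have hz : ∀ μ : Fin 4, (x + (0 : ℝ) • (Pi.single μ 1 : Pt)) = x := by simp
  have h0 := differentiableAt_coord x
  have d2 : DifferentiableAt ℝ (fun y : Pt => y 2 / (y 2 ^ 2 + y 3 ^ 2)) x :=
    by fun_prop (disch := exact hs')
  have d3 : DifferentiableAt ℝ (fun y : Pt => -y 3 / (y 2 ^ 2 + y 3 ^ 2)) x :=
    by fun_prop (disch := exact hs')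
  have e2 := fun μ => hpd μ d2 ((hc 2 μ).fun_div (((hc 2 μ).fun_pow 2).fun_add ((hc 3 μ).fun_pow 2))
    (by rw [hz]; exact hs'))
  have e3 := fun μ => hpd μ d3 ((hc 3 μ).fun_neg.fun_div
    (((hc 2 μ).fun_pow 2).fun_add ((hc 3 μ).fun_pow 2)) (by rw [hz]; exact hs'))
  have e0 := fun μ => hpd μ (h0 0) (hc 0 μ)
  have e1 := fun μ => hpd μ (h0 1) (hc 1 μ)
  ext α μ
  rw [Matrix.of_apply, jac]
  fin_cases α
  · refine (e0 μ).trans ?_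
    fin_cases μ <;> simp [jacMat]
  · refine (e1 μ).trans ?_
    fin_cases μ <;> simp [jacMat]
  · refine (e2 μ).trans ?_
    rw [hz]
    fin_cases μ <;> simp [jacMat, angSq] <;> ring
  · refine (e3 μ).trans ?_
    rw [hz]
    fin_cases μ <;> simp [jacMat, angSq] <;> ring

theorem jacMatInv_mul {x : Pt} (h : (x 2, x 3) ≠ (0, 0)) : jacMatInv x * jacMat x = 1 := by
  have hs := (angSq_pos h).ne'
  ext i j
  fin_cases i <;> fin_cases j <;>
    simp [Matrix.mul_apply, Fin.sum_univ_four, jacMat, jacMatInv] <;> field_simp <;>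
    simp only [angSq] <;> ring

theorem det_jacMat {x : Pt} (h : (x 2, x 3) ≠ (0, 0)) : (jacMat x).det = (angSq x ^ 2)⁻¹ := by
  have hs := (angSq_pos h).ne'
  rw [Matrix.det_succ_row_zero]
  simp [Fin.sum_univ_succ, Matrix.det_fin_three, Fin.succAbove, jacMat]
  field_simp
  simp only [angSq]
  ring

namespace Spacetime

variable (S : Spacetime)

theorem trans_mem {x : Pt} (hx : x ∈ S.dom) : trans x ∈ S.dom := hx

theorem g_trans {x : Pt} (hx : x ∈ S.dom) (h : (x 2, x 3) ≠ (0, 0)) :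
    S.g 0 x = (jacMat x)ᵀ * S.g 1 (trans x) * jacMat x := by
  ext μ ν
  rw [← jac_eq h, Matrix.mul_apply]
  simp only [Matrix.mul_apply, Matrix.transpose_apply, Matrix.of_apply, Finset.sum_mul]
  rw [Finset.sum_comm]
  refine (S.glue x hx h μ ν).trans ?_
  exact Finset.sum_congr rfl fun _ _ => Finset.sum_congr rfl fun _ _ => by
    change jac x _ μ * jac x _ ν * S.g 1 (trans x) _ _ = _
    ring

theorem gInv_trans {x : Pt} (hx : x ∈ S.dom) (h : (x 2, x 3) ≠ (0, 0)) :
    S.gInv 1 (trans x) = jacMat x * S.gInv 0 x * (jacMat x)ᵀ := by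
  refine Matrix.inv_eq_right_inv ?_
  have h1 := S.g_mul_gInv (c := 0) hx
  have h2 : (jacMat x)ᵀ * (jacMatInv x)ᵀ = 1 := by
    rw [← Matrix.transpose_mul, jacMatInv_mul h, Matrix.transpose_one]
  rw [S.g_trans hx h] at h1
  have h3 : S.g 1 (trans x) * (jacMat x * S.gInv 0 x * (jacMat x)ᵀ) =
      (jacMatInv x)ᵀ * ((jacMat x)ᵀ * S.g 1 (trans x) * jacMat x * S.gInv 0 x) * (jacMat x)ᵀ := by
    simp only [← Matrix.mul_assoc, mul_eq_one_comm.1 h2, Matrix.one_mul]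
  rw [h3, h1, Matrix.mul_one, mul_eq_one_comm.1 h2]

/-- The gradient of u is -L / (2Ω²), and the transition map fixes u and v. Its v-component, in which
L is normalised to 1, gives the invariance of Ω², and then L transforms as a vector. -/
theorem Ω_L_trans {x : Pt} (hx : x ∈ S.dom) (h : (x 2, x 3) ≠ (0, 0)) :
    S.Ω 1 (trans x) ^ 2 = S.Ω 0 x ^ 2 ∧ S.L 1 (trans x) = jacMat x *ᵥ S.L 0 x := by
  have hΩ0 := S.Ω_pos 0 x hx
  have hΩ1 := S.Ω_pos 1 (trans x) hx
  have key : ∀ c : Fin 2, ∀ {y : Pt}, y ∈ S.dom → ∀ μ, S.gInv c y μ 0 =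
      -(1 / (2 * S.Ω c y ^ 2)) * S.L c y μ := by
    intro c y hy μ
    rw [S.gInv_eq hy, S.L_eq]
    fin_cases μ <;> simp [doubleNullInv]
    all_goals ring
  have hcol : ∀ μ, S.gInv 1 (trans x) μ 0 = ∑ α, jacMat x μ α * S.gInv 0 x α 0 := by
    intro μ
    rw [S.gInv_trans hx h, Matrix.mul_apply]
    simp only [Matrix.transpose_apply, Fin.sum_univ_four]
    simp [jacMat, Matrix.mul_apply, Fin.sum_univ_four]
  have e : ∀ μ, -(1 / (2 * S.Ω 1 (trans x) ^ 2)) * S.L 1 (trans x) μ =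
      -(1 / (2 * S.Ω 0 x ^ 2)) * (jacMat x *ᵥ S.L 0 x) μ := by
    intro μ
    rw [← key 1 (S.trans_mem hx), hcol]
    simp only [key 0 hx, Matrix.mulVec, dotProduct, Finset.mul_sum]
    exact Finset.sum_congr rfl fun _ _ => by ring
  have e1 := e 1
  have l1 : S.L 1 (trans x) 1 = 1 := by rw [L_eq]; rfl
  have l0 : (jacMat x *ᵥ S.L 0 x) 1 = 1 := by
    simp [Matrix.mulVec, dotProduct, Fin.sum_univ_four, jacMat, L_eq]
  rw [l1, l0] at e1
  have hΩ : S.Ω 1 (trans x) ^ 2 = S.Ω 0 x ^ 2 := by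
    field_simp at e1
    linarith
  refine ⟨hΩ, ?_⟩
  funext μ
  have := e μ
  rw [hΩ] at this
  exact mul_left_cancel₀ (neg_ne_zero.2 (by positivity)) this

theorem K_trans {x : Pt} (hx : x ∈ S.dom) (h : (x 2, x 3) ≠ (0, 0)) :
    S.K 1 (trans x) = jacMat x *ᵥ S.K 0 x := by
  have h1 := (S.Ω_L_trans hx h).2
  have h2 : S.K 0 x = S.q x • Lb x + (S.q x)⁻¹ • S.L 0 x := rfl
  have h3 : S.K 1 (trans x) = S.q x • Lb (trans x) + (S.q x)⁻¹ • S.L 1 (trans x) := rfl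
  have h4 : jacMat x *ᵥ Lb x = Lb (trans x) := by
    rw [Lb_eq, Lb_eq]
    funext μ
    fin_cases μ <;> simp [Matrix.mulVec, dotProduct, Fin.sum_univ_four, jacMat]
  rw [h2, h3, Matrix.mulVec_add, Matrix.mulVec_smul, Matrix.mulVec_smul, h4, h1]

theorem dens_trans {x : Pt} (hx : x ∈ S.dom) (h : (x 2, x 3) ≠ (0, 0)) :
    S.dens 0 x = (angSq x ^ 2)⁻¹ * S.dens 1 (trans x) := by
  have hs := angSq_pos h
  rw [dens, dens, S.g_trans hx h, Matrix.det_mul, Matrix.det_mul, Matrix.det_transpose, det_jacMat h,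
    show (angSq x ^ 2)⁻¹ * (S.g 1 (trans x)).det * (angSq x ^ 2)⁻¹ =
      ((angSq x ^ 2)⁻¹) ^ 2 * (S.g 1 (trans x)).det by ring, abs_mul,
    abs_of_nonneg (by positivity : (0 : ℝ) ≤ ((angSq x ^ 2)⁻¹) ^ 2), Real.sqrt_mul (by positivity),
    Real.sqrt_sq (by positivity)]

theorem field_trans {W : Fin 2 → Pt → Tensor4} (hW : S.IsWeylField W) {x : Pt} (hx : x ∈ S.dom)
    (h : (x 2, x 3) ≠ (0, 0)) : W 0 x = act (jacMat x) (W 1 (trans x)) := by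
  funext α β γ δ
  rw [← jac_eq h]
  exact hW.glue x hx h α β γ δ

theorem contract_trans {W : Fin 2 → Pt → Tensor4} (hW : S.IsWeylField W) {x : Pt} (hx : x ∈ S.dom)
    (h : (x 2, x 3) ≠ (0, 0)) (a : Fin 4) :
    contract3 (belRob (S.gInv 0 x) (-((S.gInv 0 x).det)⁻¹) (W 0 x) (W 0 x)) (S.K 0 x) a =
      ∑ α, jacMat x α a * contract3 (belRob (S.gInv 1 (trans x)) (-((S.gInv 1 (trans x)).det)⁻¹)
        (W 1 (trans x)) (W 1 (trans x))) (S.K 1 (trans x)) α := by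
  rw [S.K_trans hx h, ← contract3_act]
  congr 1
  have hJ : (jacMat x).det ≠ 0 := by
    rw [det_jacMat h]
    have := angSq_pos h
    positivity
  have h0 := S.det_gInv_ne_zero (c := 0) hx
  rw [S.gInv_trans hx h, belRob_act, ← S.field_trans hW hx h, Matrix.det_mul, Matrix.det_mul,
    Matrix.det_transpose]
  congr 1
  field_simp

theorem cur_trans {W : Fin 2 → Pt → Tensor4} (hW : S.IsWeylField W) {x : Pt} (hx : x ∈ S.dom)
    (h : (x 2, x 3) ≠ (0, 0)) : S.cur 1 (W 1) (trans x) = jacMat x *ᵥ S.cur 0 (W 0) x := by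
  have h1 := S.contract_trans hW hx h
  set c1 := contract3 (belRob (S.gInv 1 (trans x)) (-((S.gInv 1 (trans x)).det)⁻¹)
        (W 1 (trans x)) (W 1 (trans x))) (S.K 1 (trans x)) with hc1
  set c0 := contract3 (belRob (S.gInv 0 x) (-((S.gInv 0 x).det)⁻¹) (W 0 x) (W 0 x)) (S.K 0 x)
    with hc0
  have h2 : c0 = (jacMat x)ᵀ *ᵥ c1 := funext h1
  have h3 : S.cur 1 (W 1) (trans x) = S.gInv 1 (trans x) *ᵥ c1 := rfl
  have h4 : S.cur 0 (W 0) x = S.gInv 0 x *ᵥ c0 := rfl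
  rw [h3, h4, h2, S.gInv_trans hx h]
  simp only [Matrix.mulVec_mulVec, Matrix.mul_assoc]

theorem det_γ_trans {x : Pt} (hx : x ∈ S.dom) (h : (x 2, x 3) ≠ (0, 0)) :
    √(S.γ 0 x).det = (angSq x ^ 2)⁻¹ * √(S.γ 1 (trans x)).det := by
  have h1 := S.dens_trans hx h
  rw [S.dens_eq hx, S.dens_eq (S.trans_mem hx), (S.Ω_L_trans hx h).1] at h1
  have := S.Ω_pos 0 x hx
  have h2 : 2 * S.Ω 0 x ^ 2 ≠ 0 := by positivity
  refine mul_left_cancel₀ h2 (h1.trans (by ring))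

end Spacetime

/-! ### Integrals over the spheres -/

/-- The decay of scalar densities in a chart. -/
def decay (θ : Fin 2 → ℝ) : ℝ := ((1 + (θ 0 ^ 2 + θ 1 ^ 2)) ^ 2)⁻¹

theorem decay_pos (θ : Fin 2 → ℝ) : 0 < decay θ := by
  unfold decay
  positivity

theorem integrable_decay : Integrable decay := by
  have h1 : Integrable fun θ : Fin 2 → ℝ => ∏ i, (1 + θ i ^ 2)⁻¹ :=
    Integrable.fintype_prod fun _ => integrable_inv_one_add_sq
  refine h1.mono' ?_ (Filter.Eventually.of_forall fun θ => ?_)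
  · refine Continuous.aestronglyMeasurable ?_
    unfold decay
    exact Continuous.inv₀ (by fun_prop) fun θ => by positivity
  · rw [Real.norm_of_nonneg (decay_pos θ).le, Fin.prod_univ_two, ← mul_inv, decay]
    refine inv_anti₀ (by positivity) ?_
    nlinarith [sq_nonneg (θ 0), sq_nonneg (θ 1), sq_nonneg (θ 0 ^ 2 - θ 1 ^ 2),
      mul_nonneg (sq_nonneg (θ 0)) (sq_nonneg (θ 1))]

theorem angSq_pt (u v : ℝ) (θ : Fin 2 → ℝ) : angSq (pt u v θ) = θ 0 ^ 2 + θ 1 ^ 2 := rfl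

theorem continuous_pt : Continuous fun z : (ℝ × ℝ) × (Fin 2 → ℝ) => pt z.1.1 z.1.2 z.2 := by
  refine continuous_pi fun i => ?_
  fin_cases i <;> simp [pt] <;> fun_prop

theorem pt_eta (x : Pt) : pt (x 0) (x 1) ![x 2, x 3] = x := by
  funext i
  fin_cases i <;> rfl

/-- The integral over the sphere. -/
def sphInt (f : Pt → ℝ) (p : ℝ × ℝ) : ℝ := ∫ θ : Fin 2 → ℝ, f (pt p.1 p.2 θ)

theorem hasFDerivAt_comp_pt {f : Pt → ℝ} {p : ℝ × ℝ} {θ : Fin 2 → ℝ}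
    (hf : DifferentiableAt ℝ f (pt p.1 p.2 θ)) :
    HasFDerivAt (fun p : ℝ × ℝ => f (pt p.1 p.2 θ))
      (pd 0 f (pt p.1 p.2 θ) • ContinuousLinearMap.fst ℝ ℝ ℝ +
        pd 1 f (pt p.1 p.2 θ) • ContinuousLinearMap.snd ℝ ℝ ℝ) p := by
  have h1 : HasFDerivAt (fun p : ℝ × ℝ => pt p.1 p.2 θ) (ContinuousLinearMap.pi
      ![ContinuousLinearMap.fst ℝ ℝ ℝ, ContinuousLinearMap.snd ℝ ℝ ℝ, 0, 0]) p := by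
    refine hasFDerivAt_pi'' fun i => ?_
    fin_cases i
    · exact hasFDerivAt_fst
    · exact hasFDerivAt_snd
    · exact hasFDerivAt_const _ _
    · exact hasFDerivAt_const _ _
  refine (hf.hasFDerivAt.comp p h1).congr_fderiv ?_
  ext <;> simp [fderiv_eq_sum_pd, Fin.sum_univ_four]

namespace Spacetime

variable (S : Spacetime)

theorem pt_mem {p : ℝ × ℝ} (hp : p ∈ S.Q) (θ : Fin 2 → ℝ) : pt p.1 p.2 θ ∈ S.dom := hp

/-- The closed unit discs of the two charts cover the sphere. On the disc of the first chart F is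
bounded by compactness; outside it the transition leads into the disc of the second chart, where G
is bounded. The factor 2^k comes from 1 + |ϑ|² being at most twice the larger of 1 and |ϑ|². -/
theorem exists_decay {F G : Pt → ℝ} (hF : ContinuousOn F S.dom) (hG : ContinuousOn G S.dom) (k : ℕ)
    (h : ∀ x ∈ S.dom, (x 2, x 3) ≠ (0, 0) → |F x| ≤ (angSq x ^ k)⁻¹ * |G (trans x)|)
    {s : Set (ℝ × ℝ)} (hs : IsCompact s) (hsQ : s ⊆ S.Q) :
    ∃ M, 0 ≤ M ∧ ∀ x : Pt, (x 0, x 1) ∈ s → |F x| ≤ M * ((1 + angSq x) ^ k)⁻¹ := by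
  set B : Set (Fin 2 → ℝ) := Set.Icc (fun _ => -1) (fun _ => 1) with hB
  have hc : IsCompact ((fun z : (ℝ × ℝ) × (Fin 2 → ℝ) => pt z.1.1 z.1.2 z.2) '' (s ×ˢ B)) :=
    (hs.prod isCompact_Icc).image continuous_pt
  set T := (fun z : (ℝ × ℝ) × (Fin 2 → ℝ) => pt z.1.1 z.1.2 z.2) '' (s ×ˢ B) with hT
  have hTd : T ⊆ S.dom := by
    rintro _ ⟨z, hz, rfl⟩
    exact S.pt_mem (hsQ hz.1) _
  have hmem : ∀ x : Pt, (x 0, x 1) ∈ s → |x 2| ≤ 1 → |x 3| ≤ 1 → x ∈ T := by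
    intro x hx h2 h3
    refine ⟨((x 0, x 1), ![x 2, x 3]), ⟨hx, ?_⟩, pt_eta x⟩
    rw [abs_le] at h2 h3
    constructor <;> intro i <;> fin_cases i <;> simp [h2, h3]
  obtain ⟨M1, hM1⟩ := hc.exists_bound_of_continuousOn (hF.mono hTd)
  obtain ⟨M2, hM2⟩ := hc.exists_bound_of_continuousOn (hG.mono hTd)
  refine ⟨2 ^ k * (|M1| + |M2|), by positivity, fun x hx => ?_⟩
  have hs0 : 0 ≤ angSq x := by unfold angSq; positivity
  have habs : ∀ a b : ℝ, a ^ 2 + b ^ 2 ≤ 1 → |a| ≤ 1 ∧ |b| ≤ 1 := by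
    intro a b hab
    constructor
    · exact (sq_le_one_iff_abs_le_one a).1 (by nlinarith [sq_nonneg b])
    · exact (sq_le_one_iff_abs_le_one b).1 (by nlinarith [sq_nonneg a])
  rcases le_total (angSq x) 1 with h1 | h1
  · obtain ⟨h2, h3⟩ := habs _ _ h1
    have h4 := hM1 x (hmem x hx h2 h3)
    have h5 : (1 : ℝ) ≤ 2 ^ k * ((1 + angSq x) ^ k)⁻¹ := by
      rw [← div_eq_mul_inv, one_le_div (by positivity)]
      exact pow_le_pow_left₀ (by positivity) (by linarith) k
    calc |F x| ≤ M1 := h4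
      _ ≤ (|M1| + |M2|) * 1 := by rw [mul_one]; linarith [le_abs_self M1, abs_nonneg M2]
      _ ≤ (|M1| + |M2|) * (2 ^ k * ((1 + angSq x) ^ k)⁻¹) := by gcongr
      _ = _ := by ring
  · have hne : (x 2, x 3) ≠ (0, 0) := by
      intro h0
      have e2 : x 2 = 0 := congrArg Prod.fst h0
      have e3 : x 3 = 0 := congrArg Prod.snd h0
      rw [angSq, e2, e3] at h1
      norm_num at h1
    have hpos := angSq_pos hne
    have ht : trans x 2 ^ 2 + trans x 3 ^ 2 ≤ 1 := by
      have : trans x 2 ^ 2 + trans x 3 ^ 2 = (angSq x)⁻¹ := by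
        have e2 : trans x 2 = x 2 / angSq x := rfl
        have e3 : trans x 3 = -x 3 / angSq x := rfl
        rw [e2, e3]
        field_simp
        rw [angSq]
      rw [this]
      exact inv_le_one_of_one_le₀ h1
    obtain ⟨h2, h3⟩ := habs _ _ ht
    have h4 := hM2 (trans x) (hmem (trans x) hx h2 h3)
    have h5 : (angSq x ^ k)⁻¹ ≤ 2 ^ k * ((1 + angSq x) ^ k)⁻¹ := by
      rw [← div_eq_mul_inv, le_div_iff₀ (by positivity), inv_mul_le_iff₀ (by positivity), ← mul_pow]
      exact pow_le_pow_left₀ (by positivity) (by linarith) k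
    calc |F x| ≤ (angSq x ^ k)⁻¹ * |G (trans x)| := h x (hsQ hx) hne
      _ ≤ (2 ^ k * ((1 + angSq x) ^ k)⁻¹) * (|M1| + |M2|) := by
        refine mul_le_mul h5 ?_ (abs_nonneg _) (by positivity)
        have : |G (trans x)| ≤ M2 := h4
        linarith [le_abs_self M2, abs_nonneg M1]
      _ = _ := by ring

/-- Scalar densities on the spheres, of class `C^n`. -/
structure IsDensity (n : ℕ∞) (f : Fin 2 → Pt → ℝ) : Prop where
  contDiffOn : ∀ c, ContDiffOn ℝ n (f c) S.dom
  glue : ∀ x ∈ S.dom, (x 2, x 3) ≠ (0, 0) → f 0 x = (angSq x ^ 2)⁻¹ * f 1 (trans x)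

variable {S}

theorem contDiffOn_pd {f : Pt → ℝ} {n m : ℕ∞} (hf : ContDiffOn ℝ n f S.dom) (hm : m + 1 ≤ n)
    (μ : Fin 4) : ContDiffOn ℝ m (pd μ f) S.dom := by
  have h1 : ContDiffOn ℝ m (fun x => fderiv ℝ f x) S.dom :=
    hf.fderiv_of_isOpen S.isOpen_dom (by exact_mod_cast hm)
  exact h1.clm_apply contDiffOn_const

theorem differentiableAt_of_contDiffOn {f : Pt → ℝ} {n : ℕ∞} (hf : ContDiffOn ℝ n f S.dom)
    (hn : 1 ≤ n) {x : Pt} (hx : x ∈ S.dom) : DifferentiableAt ℝ f x :=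
  (hf.contDiffAt (S.isOpen_dom.mem_nhds hx)).differentiableAt
    (by have : n ≠ 0 := by rintro rfl; simp at hn
        exact_mod_cast this)

/-- The angular part of the transition map and its Jacobian do not involve u and v, so these
derivatives preserve the gluing law; angular derivatives would not. -/
theorem IsDensity.pd {n m : ℕ∞} {f : Fin 2 → Pt → ℝ} (hf : S.IsDensity n f) (hm : m + 1 ≤ n)
    {μ : Fin 4} (hμ : μ = 0 ∨ μ = 1) : S.IsDensity m fun c => pd μ (f c) where
  contDiffOn c := contDiffOn_pd (hf.contDiffOn c) hm μ
  glue x hx h := by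
    have hn : 1 ≤ n := le_trans (by simp) hm
    have h0 := hasDerivAt_line_single (differentiableAt_of_contDiffOn (hf.contDiffOn 0) hn hx) μ
    have h1 := hasDerivAt_line_single
      (differentiableAt_of_contDiffOn (hf.contDiffOn 1) hn (S.trans_mem hx)) μ
    refine h0.unique ((h1.const_mul ((angSq x ^ 2)⁻¹)).congr_of_eventuallyEq ?_)
    filter_upwards [S.line_mem hx (Pi.single μ 1)] with t ht
    have e : ∀ i : Fin 4, i = 2 ∨ i = 3 → (x + t • (Pi.single μ 1 : Pt)) i = x i := by
      intro i hi
      rcases hμ with rfl | rfl <;> rcases hi with rfl | rfl <;> simp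
    have e1 : angSq (x + t • (Pi.single μ 1 : Pt)) = angSq x := by
      rw [angSq, e 2 (.inl rfl), e 3 (.inr rfl), angSq]
    have e2 : trans (x + t • (Pi.single μ 1 : Pt)) = trans x + t • (Pi.single μ 1 : Pt) := by
      unfold trans
      rw [e 2 (.inl rfl), e 3 (.inr rfl)]
      funext i
      rcases hμ with rfl | rfl <;> fin_cases i <;> simp
    rw [hf.glue _ ht (by rw [e 2 (.inl rfl), e 3 (.inr rfl)]; exact h), e1, e2]

theorem exists_compact_nhds {p : ℝ × ℝ} (hp : p ∈ S.Q) :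
    ∃ s : Set (ℝ × ℝ), IsCompact s ∧ s ∈ 𝓝 p ∧ s ⊆ S.Q := by
  obtain ⟨s, h1, h2, h3⟩ := local_compact_nhds (S.isOpen_Q.mem_nhds hp)
  exact ⟨s, h3, h1, h2⟩

/-- Densities decay, locally uniformly. -/
theorem IsDensity.exists_bound {n : ℕ∞} {f : Fin 2 → Pt → ℝ} (hf : S.IsDensity n f) {p : ℝ × ℝ}
    (hp : p ∈ S.Q) : ∃ M, ∃ s ∈ 𝓝 p, s ⊆ S.Q ∧
      ∀ p' ∈ s, ∀ θ, |f 0 (pt p'.1 p'.2 θ)| ≤ M * decay θ := by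
  obtain ⟨s, hs, hsp, hsQ⟩ := exists_compact_nhds hp
  obtain ⟨M, -, h⟩ := S.exists_decay (hf.contDiffOn 0).continuousOn (hf.contDiffOn 1).continuousOn 2
    (fun x hx h => by
      have hs := angSq_pos h
      rw [hf.glue x hx h, abs_mul, abs_of_nonneg (by positivity)]) hs hsQ
  exact ⟨M, s, hsp, hsQ, fun p' hp' θ => h (pt p'.1 p'.2 θ) hp'⟩

theorem continuous_comp_pt {f : Pt → ℝ} (hf : ContinuousOn f S.dom) {p : ℝ × ℝ} (hp : p ∈ S.Q) :
    Continuous fun θ : Fin 2 → ℝ => f (pt p.1 p.2 θ) :=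
  hf.comp_continuous (continuous_pt.comp (by fun_prop : Continuous fun θ : Fin 2 → ℝ => (p, θ)))
    fun θ => S.pt_mem hp θ

theorem IsDensity.integrable {n : ℕ∞} {f : Fin 2 → Pt → ℝ} (hf : S.IsDensity n f) {p : ℝ × ℝ}
    (hp : p ∈ S.Q) : Integrable fun θ : Fin 2 → ℝ => f 0 (pt p.1 p.2 θ) := by
  obtain ⟨M, s, hs, -, h⟩ := hf.exists_bound hp
  exact (integrable_decay.const_mul M).mono'
    (continuous_comp_pt (hf.contDiffOn 0).continuousOn hp).aestronglyMeasurable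
    (Filter.Eventually.of_forall fun θ => h p (mem_of_mem_nhds hs) θ)

theorem IsDensity.continuousOn {n : ℕ∞} {f : Fin 2 → Pt → ℝ} (hf : S.IsDensity n f) :
    ContinuousOn (sphInt (f 0)) S.Q := by
  intro p hp
  obtain ⟨M, s, hs, hsQ, h⟩ := hf.exists_bound hp
  refine ContinuousAt.continuousWithinAt ?_
  refine continuousAt_of_dominated (bound := fun θ => M * decay θ) ?_ ?_
    (integrable_decay.const_mul M) ?_
  · filter_upwards [hs] with p' hp'
    exact (continuous_comp_pt (hf.contDiffOn 0).continuousOn (hsQ hp')).aestronglyMeasurable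
  · filter_upwards [hs] with p' hp'
    exact Filter.Eventually.of_forall fun θ => h p' hp' θ
  · refine Filter.Eventually.of_forall fun θ => ?_
    have h1 : ContinuousAt (f 0) (pt p.1 p.2 θ) :=
      (hf.contDiffOn 0).continuousOn.continuousAt (S.isOpen_dom.mem_nhds (S.pt_mem hp θ))
    exact ContinuousAt.comp (f := fun p : ℝ × ℝ => pt p.1 p.2 θ) h1
      (continuous_pt.comp (by fun_prop : Continuous fun p : ℝ × ℝ => (p, θ))).continuousAt

theorem IsDensity.hasFDerivAt {n : ℕ∞} {f : Fin 2 → Pt → ℝ} (hf : S.IsDensity n f) (hn : 1 ≤ n)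
    {p : ℝ × ℝ} (hp : p ∈ S.Q) : HasFDerivAt (sphInt (f 0))
      (sphInt (DoubleNull.pd 0 (f 0)) p • ContinuousLinearMap.fst ℝ ℝ ℝ +
        sphInt (DoubleNull.pd 1 (f 0)) p • ContinuousLinearMap.snd ℝ ℝ ℝ) p := by
  have hn' : (0 : ℕ∞) + 1 ≤ n := by simpa using hn
  have g0 := hf.pd hn' (.inl rfl : (0 : Fin 4) = 0 ∨ (0 : Fin 4) = 1)
  have g1 := hf.pd hn' (.inr rfl : (1 : Fin 4) = 0 ∨ (1 : Fin 4) = 1)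
  obtain ⟨M0, s0, hs0, hsQ0, h0⟩ := g0.exists_bound hp
  obtain ⟨M1, s1, hs1, hsQ1, h1⟩ := g1.exists_bound hp
  have key := hasFDerivAt_integral_of_dominated_of_fderiv_le (𝕜 := ℝ) (μ := volume)
    (F := fun (p : ℝ × ℝ) (θ : Fin 2 → ℝ) => f 0 (pt p.1 p.2 θ))
    (F' := fun (p : ℝ × ℝ) (θ : Fin 2 → ℝ) =>
      DoubleNull.pd 0 (f 0) (pt p.1 p.2 θ) • ContinuousLinearMap.fst ℝ ℝ ℝ +
        DoubleNull.pd 1 (f 0) (pt p.1 p.2 θ) • ContinuousLinearMap.snd ℝ ℝ ℝ)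
    (bound := fun θ => M0 * decay θ + M1 * decay θ) (x₀ := p) (s := s0 ∩ s1)
    (Filter.inter_mem hs0 hs1) ?_ (hf.integrable hp) ?_ ?_ ?_ ?_
  · refine key.congr_fderiv ?_
    rw [integral_add ((g0.integrable hp).smul_const _) ((g1.integrable hp).smul_const _),
      integral_smul_const, integral_smul_const]
    rfl
  · filter_upwards [hs0] with p' hp'
    exact (continuous_comp_pt (hf.contDiffOn 0).continuousOn (hsQ0 hp')).aestronglyMeasurable
  · refine Continuous.aestronglyMeasurable ?_
    exact ((continuous_comp_pt (g0.contDiffOn 0).continuousOn hp).smul continuous_const).add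
      ((continuous_comp_pt (g1.contDiffOn 0).continuousOn hp).smul continuous_const)
  · refine Filter.Eventually.of_forall fun θ p' hp' => ?_
    refine (norm_add_le _ _).trans (add_le_add ?_ ?_)
    · rw [norm_smul]
      refine (mul_le_of_le_one_right (norm_nonneg _) (ContinuousLinearMap.norm_fst_le ..)).trans ?_
      exact h0 p' hp'.1 θ
    · rw [norm_smul]
      refine (mul_le_of_le_one_right (norm_nonneg _) (ContinuousLinearMap.norm_snd_le ..)).trans ?_
      exact h1 p' hp'.2 θ
  · exact (integrable_decay.const_mul M0).add (integrable_decay.const_mul M1)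
  · refine Filter.Eventually.of_forall fun θ p' hp' => hasFDerivAt_comp_pt ?_
    exact differentiableAt_of_contDiffOn (hf.contDiffOn 0) hn (S.pt_mem (hsQ0 hp'.1) θ)

theorem IsDensity.contDiffOn_sphInt (n : ℕ) :
    ∀ {f : Fin 2 → Pt → ℝ}, S.IsDensity n f → ContDiffOn ℝ n (sphInt (f 0)) S.Q := by
  induction n with
  | zero =>
    intro f hf
    exact contDiffOn_zero.2 hf.continuousOn
  | succ n ih =>
    intro f hf
    have hn : (1 : ℕ∞) ≤ ((n + 1 : ℕ) : ℕ∞) := by simp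
    have hn' : ((n : ℕ) : ℕ∞) + 1 ≤ ((n + 1 : ℕ) : ℕ∞) := by simp
    have d : ∀ p ∈ S.Q, _ := fun p hp => hf.hasFDerivAt hn hp
    have g0 := ih (hf.pd hn' (.inl rfl : (0 : Fin 4) = 0 ∨ (0 : Fin 4) = 1))
    have g1 := ih (hf.pd hn' (.inr rfl : (1 : Fin 4) = 0 ∨ (1 : Fin 4) = 1))
    have : ContDiffOn ℝ ((n : ℕ∞ω) + 1) (sphInt (f 0)) S.Q := by
      rw [contDiffOn_succ_iff_fderiv_of_isOpen S.isOpen_Q]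
      refine ⟨fun p hp => (d p hp).differentiableAt.differentiableWithinAt, by simp, ?_⟩
      refine ContDiffOn.congr ((g0.smul contDiffOn_const).add (g1.smul contDiffOn_const))
        fun p hp => (d p hp).fderiv
    exact_mod_cast this

end Spacetime

/-! ### The divergence theorem on the sphere, in one chart -/

/-- The integral of a divergence over the plane vanishes, for vector fields that decay. -/
theorem integral_divergence_plane_eq_zero {f g : ℝ × ℝ → ℝ} {f' g' : ℝ × ℝ → ℝ × ℝ →L[ℝ] ℝ}
    (hf : ∀ x, HasFDerivAt f (f' x) x) (hg : ∀ x, HasFDerivAt g (g' x) x) {M : ℝ}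
    (hfM : ∀ x, |f x| ≤ M / (1 + ‖x‖) ^ 2) (hgM : ∀ x, |g x| ≤ M / (1 + ‖x‖) ^ 2)
    (hi : Integrable fun x => f' x (1, 0) + g' x (0, 1)) :
    ∫ x, (f' x (1, 0) + g' x (0, 1)) = 0 := by
  have hM : 0 ≤ M := by
    have := (abs_nonneg _).trans (hfM 0)
    simpa using this
  set D := fun x => f' x (1, 0) + g' x (0, 1) with hD
  have hmono : Monotone fun n : ℕ => Set.Icc ((-(n : ℝ), -(n : ℝ)) : ℝ × ℝ) ((n : ℝ), (n : ℝ)) := by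
    intro m n hmn
    have : (m : ℝ) ≤ n := by exact_mod_cast hmn
    exact Set.Icc_subset_Icc ⟨by simpa using this, by simpa using this⟩ ⟨this, this⟩
  have hU : ⋃ n : ℕ, Set.Icc ((-(n : ℝ), -(n : ℝ)) : ℝ × ℝ) ((n : ℝ), (n : ℝ)) = Set.univ := by
    refine Set.eq_univ_of_forall fun x => Set.mem_iUnion.2 ?_
    obtain ⟨n, hn⟩ := exists_nat_ge (max |x.1| |x.2|)
    obtain ⟨h1, h2⟩ := max_le_iff.1 hn
    exact ⟨n, ⟨(abs_le.1 h1).1, (abs_le.1 h2).1⟩, ⟨(abs_le.1 h1).2, (abs_le.1 h2).2⟩⟩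
  have hlim := tendsto_setIntegral_of_monotone (μ := volume) (f := D)
    (fun n : ℕ => (measurableSet_Icc : MeasurableSet
      (Set.Icc ((-(n : ℝ), -(n : ℝ)) : ℝ × ℝ) ((n : ℝ), (n : ℝ))))) hmono hi.integrableOn
  rw [hU, setIntegral_univ] at hlim
  -- The four sides of the square have length 2n and the field there is at most M / (1 + n)².
  -- Quadratic decay thus beats the linear growth of the boundary.
  have hbd : ∀ n : ℕ, |∫ x in Set.Icc ((-(n : ℝ), -(n : ℝ)) : ℝ × ℝ) ((n : ℝ), (n : ℝ)), D x| ≤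
      8 * M * (1 / ((n : ℝ) + 1)) := by
    intro n
    have hn : (0 : ℝ) ≤ n := Nat.cast_nonneg n
    have hle : ((-(n : ℝ), -(n : ℝ)) : ℝ × ℝ) ≤ ((n : ℝ), (n : ℝ)) := ⟨by simp, by simp⟩
    have e := integral_divergence_prod_Icc_of_hasFDerivAt_of_le f g f' g'
      (-(n : ℝ), -(n : ℝ)) ((n : ℝ), (n : ℝ)) hle
      (fun x _ => (hf x).continuousAt.continuousWithinAt)
      (fun x _ => (hg x).continuousAt.continuousWithinAt)
      (fun x _ => hf x) (fun x _ => hg x) hi.integrableOn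
    rw [hD, e]
    have hb : ∀ (h : ℝ × ℝ → ℝ), (∀ x, |h x| ≤ M / (1 + ‖x‖) ^ 2) → ∀ (k : ℝ → ℝ × ℝ),
        (∀ t, (n : ℝ) ≤ ‖k t‖) → |∫ t in (-(n : ℝ))..n, h (k t)| ≤ 2 * M * (1 / ((n : ℝ) + 1)) := by
      intro h hh k hk
      have h1 : ∀ t ∈ Set.uIoc (-(n : ℝ)) n, ‖h (k t)‖ ≤ M / (1 + n) ^ 2 := by
        intro t _
        refine (hh (k t)).trans ?_
        have := hk t
        gcongr
      have h2 := intervalIntegral.norm_integral_le_of_norm_le_const h1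
      refine h2.trans ?_
      rw [show (n : ℝ) - -n = 2 * n by ring, abs_of_nonneg (by positivity : (0 : ℝ) ≤ 2 * n)]
      rw [div_mul_eq_mul_div, mul_one_div, div_le_div_iff₀ (by positivity) (by positivity)]
      nlinarith [mul_nonneg hM hn, mul_nonneg (mul_nonneg hM hn) hn]
    have n1 : ∀ t : ℝ, (n : ℝ) ≤ ‖((t, (n : ℝ)) : ℝ × ℝ)‖ := fun t => by
      rw [Prod.norm_def]; exact le_max_of_le_right (by simp)
    have n2 : ∀ t : ℝ, (n : ℝ) ≤ ‖((t, -(n : ℝ)) : ℝ × ℝ)‖ := fun t => by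
      rw [Prod.norm_def]; exact le_max_of_le_right (by simp)
    have n3 : ∀ t : ℝ, (n : ℝ) ≤ ‖(((n : ℝ), t) : ℝ × ℝ)‖ := fun t => by
      rw [Prod.norm_def]; exact le_max_of_le_left (by simp)
    have n4 : ∀ t : ℝ, (n : ℝ) ≤ ‖((-(n : ℝ), t) : ℝ × ℝ)‖ := fun t => by
      rw [Prod.norm_def]; exact le_max_of_le_left (by simp)
    have b1 := abs_le.1 (hb g hgM (fun t => (t, (n : ℝ))) n1)
    have b2 := abs_le.1 (hb g hgM (fun t => (t, -(n : ℝ))) n2)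
    have b3 := abs_le.1 (hb f hfM (fun t => ((n : ℝ), t)) n3)
    have b4 := abs_le.1 (hb f hfM (fun t => (-(n : ℝ), t)) n4)
    simp only
    rw [abs_le]
    constructor <;> linarith [b1.1, b1.2, b2.1, b2.2, b3.1, b3.2, b4.1, b4.2]
  have hz : Filter.Tendsto (fun n : ℕ => 8 * M * (1 / ((n : ℝ) + 1))) Filter.atTop (𝓝 0) := by
    simpa using tendsto_one_div_add_atTop_nhds_zero_nat.const_mul (8 * M)
  exact tendsto_nhds_unique hlim (squeeze_zero_norm hbd hz)

theorem integral_fin_two (F : (Fin 2 → ℝ) → ℝ) : ∫ θ, F θ = ∫ z : ℝ × ℝ, F ![z.1, z.2] := by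
  have h := (volume_preserving_finTwoArrow ℝ).symm
  rw [← h.integral_comp' F]
  rfl

theorem integrable_fin_two {F : (Fin 2 → ℝ) → ℝ} (hF : Integrable F) :
    Integrable fun z : ℝ × ℝ => F ![z.1, z.2] := by
  have h := (volume_preserving_finTwoArrow ℝ).symm
  exact (h.integrable_comp_emb (MeasurableEquiv.measurableEmbedding _)).2 hF

theorem hasFDerivAt_comp_ang {f : Pt → ℝ} {p z : ℝ × ℝ}
    (hf : DifferentiableAt ℝ f (pt p.1 p.2 ![z.1, z.2])) :
    HasFDerivAt (fun z : ℝ × ℝ => f (pt p.1 p.2 ![z.1, z.2]))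
      (pd 2 f (pt p.1 p.2 ![z.1, z.2]) • ContinuousLinearMap.fst ℝ ℝ ℝ +
        pd 3 f (pt p.1 p.2 ![z.1, z.2]) • ContinuousLinearMap.snd ℝ ℝ ℝ) z := by
  have h1 : HasFDerivAt (fun z : ℝ × ℝ => pt p.1 p.2 ![z.1, z.2]) (ContinuousLinearMap.pi
      ![0, 0, ContinuousLinearMap.fst ℝ ℝ ℝ, ContinuousLinearMap.snd ℝ ℝ ℝ]) z := by
    refine hasFDerivAt_pi'' fun i => ?_
    fin_cases i
    · exact hasFDerivAt_const _ _
    · exact hasFDerivAt_const _ _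
    · exact hasFDerivAt_fst
    · exact hasFDerivAt_snd
  refine (hf.hasFDerivAt.comp z h1).congr_fderiv ?_
  ext <;> simp [fderiv_eq_sum_pd, Fin.sum_univ_four]

namespace Spacetime

variable {S : Spacetime}

variable (S) in
/-- Vector densities on the spheres. -/
structure IsVectorDensity (n : ℕ∞) (X : Fin 2 → Pt → Fin 4 → ℝ) : Prop where
  contDiffOn : ∀ c A, ContDiffOn ℝ n (fun x => X c x A) S.dom
  glue : ∀ x ∈ S.dom, (x 2, x 3) ≠ (0, 0) →
    X 0 x = (angSq x ^ 2)⁻¹ • (jacMatInv x *ᵥ X 1 (trans x))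

theorem IsVectorDensity.isDensity {n : ℕ∞} {X : Fin 2 → Pt → Fin 4 → ℝ} (hX : S.IsVectorDensity n X)
    {μ : Fin 4} (hμ : μ = 0 ∨ μ = 1) : S.IsDensity n fun c x => X c x μ where
  contDiffOn c := hX.contDiffOn c μ
  glue x hx h := by
    rw [hX.glue x hx h]
    rcases hμ with rfl | rfl <;>
      simp [Matrix.mulVec, dotProduct, Fin.sum_univ_four, jacMatInv]

/-- The density factor |ϑ|⁻⁴ competes with the inverse Jacobian, which grows like |ϑ|². What remains
is |ϑ|⁻², still enough for the boundary terms at the omitted point to vanish. -/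
theorem IsVectorDensity.exists_bound {n : ℕ∞} {X : Fin 2 → Pt → Fin 4 → ℝ}
    (hX : S.IsVectorDensity n X) {p : ℝ × ℝ} (hp : p ∈ S.Q) :
    ∃ M, 0 ≤ M ∧ ∀ A, ∀ θ, |X 0 (pt p.1 p.2 θ) (ang A)| ≤ M * (1 + (θ 0 ^ 2 + θ 1 ^ 2))⁻¹ := by
  have key : ∀ A : Fin 2, ∃ M, 0 ≤ M ∧ ∀ θ : Fin 2 → ℝ, |X 0 (pt p.1 p.2 θ) (ang A)| ≤
      M * (1 + (θ 0 ^ 2 + θ 1 ^ 2))⁻¹ := by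
    intro A
    have hG : ContinuousOn (fun x => |X 1 x 2| + |X 1 x 3|) S.dom :=
      (hX.contDiffOn 1 2).continuousOn.abs.add (hX.contDiffOn 1 3).continuousOn.abs
    obtain ⟨M, hM, h⟩ := S.exists_decay (hX.contDiffOn 0 (ang A)).continuousOn hG 1 (fun x hx h => by
      have hs := angSq_pos h
      have h1 : |x 3 ^ 2 - x 2 ^ 2| ≤ angSq x := by
        rw [abs_le, angSq]; constructor <;> nlinarith [sq_nonneg (x 2), sq_nonneg (x 3)]
      have h2 : |2 * x 2 * x 3| ≤ angSq x := by
        rw [abs_le, angSq]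
        constructor <;> nlinarith [sq_nonneg (x 2 - x 3), sq_nonneg (x 2 + x 3)]
      have h3 : |(jacMatInv x *ᵥ X 1 (trans x)) (ang A)| ≤
          angSq x * (|X 1 (trans x) 2| + |X 1 (trans x) 3|) := by
        have a0 : ang 0 = 2 := rfl
        have a1 : ang 1 = 3 := rfl
        have h4 : ∀ a b y z : ℝ, |a| ≤ angSq x → |b| ≤ angSq x → |a * y + b * z| ≤
            angSq x * (|y| + |z|) := by
          intro a b y z ha hb
          refine (abs_add_le _ _).trans ?_
          rw [abs_mul, abs_mul, mul_add]
          gcongr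
        fin_cases A
        · have : (jacMatInv x *ᵥ X 1 (trans x)) (ang 0) = (x 3 ^ 2 - x 2 ^ 2) * X 1 (trans x) 2 +
              2 * x 2 * x 3 * X 1 (trans x) 3 := by
            simp [Matrix.mulVec, dotProduct, Fin.sum_univ_four, jacMatInv, a0]
          refine (congrArg abs this).trans_le (h4 _ _ _ _ h1 h2)
        · have : (jacMatInv x *ᵥ X 1 (trans x)) (ang 1) = -(2 * x 2 * x 3) * X 1 (trans x) 2 +
              (x 3 ^ 2 - x 2 ^ 2) * X 1 (trans x) 3 := by
            simp [Matrix.mulVec, dotProduct, Fin.sum_univ_four, jacMatInv, a1]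
          refine (congrArg abs this).trans_le (h4 _ _ _ _ ((abs_neg _).trans_le h2) h1)
      have h5 : 0 ≤ |X 1 (trans x) 2| + |X 1 (trans x) 3| := by positivity
      rw [hX.glue x hx h, Pi.smul_apply, smul_eq_mul, abs_mul, abs_of_nonneg (by positivity),
        abs_of_nonneg h5]
      calc _ ≤ (angSq x ^ 2)⁻¹ * (angSq x * (|X 1 (trans x) 2| + |X 1 (trans x) 3|)) := by gcongr
        _ = _ := by field_simp) (isCompact_singleton (x := p)) (by simpa using hp)
    exact ⟨M, hM, fun θ => by simpa [angSq_pt] using h (pt p.1 p.2 θ) rfl⟩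
  obtain ⟨M0, hM0, h0⟩ := key 0
  obtain ⟨M1, hM1, h1⟩ := key 1
  refine ⟨M0 + M1, by positivity, fun A θ => ?_⟩
  have hpos : 0 ≤ (1 + (θ 0 ^ 2 + θ 1 ^ 2))⁻¹ := by positivity
  fin_cases A
  · exact (h0 θ).trans (by gcongr; linarith)
  · exact (h1 θ).trans (by gcongr; linarith)

/-- The integral of a divergence over a sphere vanishes. -/
theorem IsVectorDensity.integral_eq_zero {n : ℕ∞} {X : Fin 2 → Pt → Fin 4 → ℝ}
    (hX : S.IsVectorDensity n X) (hn : 1 ≤ n) {p : ℝ × ℝ} (hp : p ∈ S.Q)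
    (hi : Integrable fun θ : Fin 2 → ℝ => pd 2 (fun x => X 0 x 2) (pt p.1 p.2 θ) +
      pd 3 (fun x => X 0 x 3) (pt p.1 p.2 θ)) :
    ∫ θ : Fin 2 → ℝ, (pd 2 (fun x => X 0 x 2) (pt p.1 p.2 θ) +
      pd 3 (fun x => X 0 x 3) (pt p.1 p.2 θ)) = 0 := by
  obtain ⟨M, hM, hb⟩ := hX.exists_bound hp
  have hd : ∀ (μ : Fin 4) (z : ℝ × ℝ),
      DifferentiableAt ℝ (fun x => X 0 x μ) (pt p.1 p.2 ![z.1, z.2]) := fun μ z =>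
    differentiableAt_of_contDiffOn (hX.contDiffOn 0 μ) hn (S.pt_mem hp _)
  have hbd : ∀ A, ∀ z : ℝ × ℝ, |X 0 (pt p.1 p.2 ![z.1, z.2]) (ang A)| ≤
      2 * M / (1 + ‖z‖) ^ 2 := by
    intro A z
    refine (hb A ![z.1, z.2]).trans ?_
    simp only [Matrix.cons_val_zero, Matrix.cons_val_one]
    rw [← div_eq_mul_inv, div_le_div_iff₀ (by positivity) (by positivity)]
    have h1 : ‖z‖ ^ 2 ≤ z.1 ^ 2 + z.2 ^ 2 := by
      rw [Prod.norm_def]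
      rcases max_cases ‖z.1‖ ‖z.2‖ with ⟨h, -⟩ | ⟨h, -⟩ <;> rw [h, Real.norm_eq_abs, sq_abs] <;>
        nlinarith [sq_nonneg z.1, sq_nonneg z.2]
    have h2 : (1 + ‖z‖) ^ 2 ≤ 2 * (1 + (z.1 ^ 2 + z.2 ^ 2)) := by nlinarith [sq_nonneg (1 - ‖z‖)]
    nlinarith
  rw [integral_fin_two]
  have hi' := integrable_fin_two hi
  have := integral_divergence_plane_eq_zero
    (f := fun z => X 0 (pt p.1 p.2 ![z.1, z.2]) 2) (g := fun z => X 0 (pt p.1 p.2 ![z.1, z.2]) 3)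
    (fun z => hasFDerivAt_comp_ang (f := fun x => X 0 x 2) (hd 2 z))
    (fun z => hasFDerivAt_comp_ang (f := fun x => X 0 x 3) (hd 3 z))
    (hbd 0) (hbd 1) (by simpa using hi')
  simpa using this

end Spacetime

namespace Spacetime

/-! ### The area radius -/

/-- The area element in both charts. -/
def area (S : Spacetime) (c : Fin 2) (x : Pt) : ℝ := √(S.γ c x).det

variable {S : Spacetime}

theorem area_pos {c : Fin 2} {x : Pt} (hx : x ∈ S.dom) : 0 < S.area c x :=
  Real.sqrt_pos.2 (S.γ_det_pos hx)

theorem isDensity_area (n : ℕ∞) : S.IsDensity n S.area where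
  contDiffOn c := ((S.contDiffOn_det_γ c).sqrt fun _ hx => (S.γ_det_pos hx).ne').of_le
    (by exact_mod_cast le_top)
  glue x hx h := S.det_γ_trans hx h

theorem differentiableAt_area {c : Fin 2} {x : Pt} (hx : x ∈ S.dom) :
    DifferentiableAt ℝ (S.area c) x :=
  differentiableAt_of_contDiffOn ((isDensity_area 1).contDiffOn c) le_rfl hx

theorem pd_area {c : Fin 2} {x : Pt} (hx : x ∈ S.dom) (μ : Fin 4) :
    pd μ (S.area c) x = S.area c x / 2 * S.trγ c x (S.dγ c x μ) := by
  have s1 := S.γ_symm (c := c) hx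
  have s2 : S.dγ c x μ 1 0 = S.dγ c x μ 0 1 := S.pd_γ_symm (c := c) hx μ
  have hd := S.γ_det_pos (c := c) hx
  have hγ := fun A B => hasDerivAt_line_single (S.differentiableAt_γ c hx A B) μ
  have h1 := ((hγ 0 0).fun_mul (hγ 1 1)).fun_sub ((hγ 0 1).fun_mul (hγ 1 0))
  simp only [← Matrix.det_fin_two] at h1
  have h2 := h1.sqrt (by simpa using hd.ne')
  rw [(hasDerivAt_line_single (differentiableAt_area hx) μ).unique h2]
  simp only [zero_smul, add_zero]
  have e1 := Real.mul_self_sqrt hd.le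
  have hp : 0 < √(S.γ c x).det := Real.sqrt_pos.2 hd
  have e3 : ∀ A B, pd μ (fun y => S.γ c y A B) x = S.dγ c x μ A B := fun _ _ => rfl
  rw [trγ, inv_fin_two s1, area]
  simp only [e3, Fin.sum_univ_two]
  set d := (S.γ c x).det
  set t := √d
  rw [← e1]
  simp [s1, s2]
  field_simp
  ring

theorem pd_area_zero {c : Fin 2} {x : Pt} (hx : x ∈ S.dom) :
    pd 0 (S.area c) x = S.Ω c x * S.trChib c x * S.area c x := by
  have hΩ := (S.Ω_pos c x hx).ne'
  rw [pd_area hx, trChib, S.chib_eq hx]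
  simp only [trγ, Fin.sum_univ_two, Matrix.smul_apply, smul_eq_mul]
  field_simp

/-- L differs from ∂_v by the shift, so the variation of the area element along L contains an extra
tangential divergence. It integrates to zero over the sphere. -/
theorem pd_area_one {c : Fin 2} {x : Pt} (hx : x ∈ S.dom) :
    pd 1 (S.area c) x + (pd 2 (fun y => S.area c y * S.L c y 2) x +
      pd 3 (fun y => S.area c y * S.L c y 3) x) = S.Ω c x * S.trChi c x * S.area c x := by
  have hΩ := (S.Ω_pos c x hx).ne'
  have a0 : ang 0 = 2 := rfl
  have a1 : ang 1 = 3 := rfl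
  have s1 := S.γ_symm (c := c) hx
  have s2 : ∀ μ, S.dγ c x μ 1 0 = S.dγ c x μ 0 1 := S.pd_γ_symm (c := c) hx
  have hd := S.γ_det_pos (c := c) hx
  have hdet : (S.γ c x).det = S.γ c x 0 0 * S.γ c x 1 1 - S.γ c x 0 1 * S.γ c x 0 1 := by
    rw [Matrix.det_fin_two, s1]
  rw [pd_mul (differentiableAt_area hx) (S.differentiableAt_L hx 2),
    pd_mul (differentiableAt_area hx) (S.differentiableAt_L hx 3), S.pd_L, S.pd_L]
  simp only [pd_area hx, trChi, trγ, S.chi_eq hx, Fin.sum_univ_two, a0, a1, S.L_eq, inv_fin_two s1,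
    s1, s2]
  have hd' := hd.ne'
  simp
  field_simp
  linear_combination 2 * S.area c x * (S.db c x 2 0 + S.db c x 3 1) * hdet

theorem isVectorDensity_shift (n : ℕ∞) :
    S.IsVectorDensity n fun c x μ => S.area c x * S.L c x μ where
  contDiffOn c A := by
    refine ((isDensity_area n).contDiffOn c).mul ?_
    simp only [L]
    exact contDiffOn_const.add (ContDiffOn.sum fun B _ =>
      (ContDiffOn.of_le (S.smooth_b c B) (by exact_mod_cast le_top)).mul contDiffOn_const)
  glue x hx h := by
    have h1 := (S.Ω_L_trans hx h).2
    have h2 := (isDensity_area (S := S) 0).glue x hx h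
    funext μ
    have h3 : jacMatInv x *ᵥ (fun μ => S.area 1 (trans x) * S.L 1 (trans x) μ) =
        S.area 1 (trans x) • S.L 0 x := by
      change jacMatInv x *ᵥ (S.area 1 (trans x) • S.L 1 (trans x)) = _
      rw [Matrix.mulVec_smul, h1, Matrix.mulVec_mulVec, jacMatInv_mul h, Matrix.one_mulVec]
    rw [h3, h2]
    simp only [Pi.smul_apply, smul_eq_mul]
    ring

theorem areaRadius_eq (p : ℝ × ℝ) :
    S.areaRadius p.1 p.2 = √(sphInt (S.area 0) p / (4 * Real.pi)) := rfl

variable {ε₀ C₀ : ℝ}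

/-- The pointwise comparison with the average forces the sign: its right side must be nonnegative,
and a zero average would make Ω tr χ vanish. No integrability is required, which matters because the
integral of a nonintegrable function is zero by convention. -/
theorem avgTrChi_pos (hε₀ : 0 < ε₀) (hS : S.BAI ε₀ C₀) {p : ℝ × ℝ} (hp : p ∈ S.Q) :
    0 < S.avgTrChi p.1 p.2 := by
  have hx := S.pt_mem hp 0
  have h1 := hS.mean 0 _ hx
  have h2 := mul_pos (S.Ω_pos 0 _ hx) (hS.expansion 0 _ hx).1
  have e0 : (pt p.1 p.2 0) 0 = p.1 := rfl
  have e1 : (pt p.1 p.2 0) 1 = p.2 := rfl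
  rw [e0, e1] at h1
  by_contra hn
  have h3 := (abs_nonneg _).trans h1
  have h4 : S.avgTrChi p.1 p.2 = 0 := le_antisymm (not_lt.1 hn) ((mul_nonneg_iff_of_pos_left hε₀).1 h3)
  rw [h4, sub_zero, mul_zero, abs_of_pos h2] at h1
  linarith

theorem avgTrChib_pos (hε₀ : 0 < ε₀) (hS : S.BAI ε₀ C₀) {p : ℝ × ℝ} (hp : p ∈ S.Q) :
    0 < S.avgTrChib p.1 p.2 := by
  have hx := S.pt_mem hp 0
  have h1 := hS.meanb 0 _ hx
  have h2 := mul_pos (S.Ω_pos 0 _ hx) (hS.expansion 0 _ hx).2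
  have e0 : (pt p.1 p.2 0) 0 = p.1 := rfl
  have e1 : (pt p.1 p.2 0) 1 = p.2 := rfl
  rw [e0, e1] at h1
  by_contra hn
  have h3 := (abs_nonneg _).trans h1
  have h4 : S.avgTrChib p.1 p.2 = 0 := le_antisymm (not_lt.1 hn) ((mul_nonneg_iff_of_pos_left hε₀).1 h3)
  rw [h4, sub_zero, mul_zero, abs_of_pos h2] at h1
  linarith

/-- If the area were not positive, then r = 0, and the average would be 0 because division by zero
gives 0. This contradicts `avgTrChi_pos`. -/
theorem sphInt_area_pos (hε₀ : 0 < ε₀) (hS : S.BAI ε₀ C₀) {p : ℝ × ℝ} (hp : p ∈ S.Q) :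
    0 < sphInt (S.area 0) p := by
  by_contra hn
  have h1 : S.areaRadius p.1 p.2 = 0 := by
    rw [areaRadius_eq]
    exact Real.sqrt_eq_zero_of_nonpos (div_nonpos_of_nonpos_of_nonneg (not_lt.1 hn) (by positivity))
  have h2 := avgTrChi_pos hε₀ hS hp
  rw [avgTrChi, average, h1] at h2
  simp at h2

theorem sq_areaRadius (hε₀ : 0 < ε₀) (hS : S.BAI ε₀ C₀) {p : ℝ × ℝ} (hp : p ∈ S.Q) :
    4 * Real.pi * S.areaRadius p.1 p.2 ^ 2 = sphInt (S.area 0) p := by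
  have h := sphInt_area_pos hε₀ hS hp
  have := Real.pi_pos
  rw [areaRadius_eq, Real.sq_sqrt (by positivity)]
  field_simp

/-- The first variation of area along `Lb`. -/
theorem sphInt_pd_area_zero (hε₀ : 0 < ε₀) (hS : S.BAI ε₀ C₀) {p : ℝ × ℝ} (hp : p ∈ S.Q) :
    sphInt (pd 0 (S.area 0)) p = sphInt (S.area 0) p * S.avgTrChib p.1 p.2 := by
  have hA := sphInt_area_pos hε₀ hS hp
  have h1 : sphInt (pd 0 (S.area 0)) p = ∫ θ : Fin 2 → ℝ,
      S.Ω 0 (pt p.1 p.2 θ) * S.trChib 0 (pt p.1 p.2 θ) * S.areaElement (pt p.1 p.2 θ) :=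
    integral_congr_ae (Filter.Eventually.of_forall fun θ => pd_area_zero (S.pt_mem hp θ))
  rw [avgTrChib, average, sq_areaRadius hε₀ hS hp, h1]
  field_simp

/-- The first variation of area along `L`. -/
theorem sphInt_pd_area_one (hε₀ : 0 < ε₀) (hS : S.BAI ε₀ C₀) {p : ℝ × ℝ} (hp : p ∈ S.Q) :
    sphInt (pd 1 (S.area 0)) p = sphInt (S.area 0) p * S.avgTrChi p.1 p.2 := by
  have hA := sphInt_area_pos hε₀ hS hp
  have i1 := ((isDensity_area (S := S) 1).pd (m := 0) (by simp)
    (.inr rfl : (1 : Fin 4) = 0 ∨ (1 : Fin 4) = 1)).integrable hp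
  have i0 := (isDensity_area (S := S) 1).integrable hp
  have hV := isVectorDensity_shift (S := S) 1
  have c2 := continuous_comp_pt (contDiffOn_pd (hV.contDiffOn 0 2) (m := 0) (by simp) 2).continuousOn hp
  have c3 := continuous_comp_pt (contDiffOn_pd (hV.contDiffOn 0 3) (m := 0) (by simp) 3).continuousOn hp
  have c1 := continuous_comp_pt (((isDensity_area (S := S) 1).pd (m := 0) (by simp)
    (.inr rfl : (1 : Fin 4) = 0 ∨ (1 : Fin 4) = 1)).contDiffOn 0).continuousOn hp
  -- Integrability of Ω tr χ follows from its bound by (1 + ε₀) times the average. The tangential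
  -- divergence is then integrable as a difference of integrable functions.
  have hi : Integrable fun θ : Fin 2 → ℝ =>
      S.Ω 0 (pt p.1 p.2 θ) * S.trChi 0 (pt p.1 p.2 θ) * S.area 0 (pt p.1 p.2 θ) := by
    refine (i0.const_mul ((1 + ε₀) * S.avgTrChi p.1 p.2)).mono' ?_
      (Filter.Eventually.of_forall fun θ => ?_)
    · simp only [← pd_area_one (S.pt_mem hp _)]
      exact (c1.add (c2.add c3)).aestronglyMeasurable
    · have hx := S.pt_mem hp θ
      have h1 := (abs_le.1 (hS.mean 0 _ hx)).2
      have e0 : (pt p.1 p.2 θ) 0 = p.1 := rfl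
      have e1 : (pt p.1 p.2 θ) 1 = p.2 := rfl
      rw [e0, e1] at h1
      have h2 := mul_pos (S.Ω_pos 0 _ hx) (hS.expansion 0 _ hx).1
      have h3 := area_pos (c := 0) hx
      rw [Real.norm_of_nonneg (mul_pos h2 h3).le]
      exact mul_le_mul_of_nonneg_right (by linarith) h3.le
  have hi2 : Integrable fun θ : Fin 2 → ℝ =>
      pd 2 (fun x => S.area 0 x * S.L 0 x 2) (pt p.1 p.2 θ) +
        pd 3 (fun x => S.area 0 x * S.L 0 x 3) (pt p.1 p.2 θ) := by
    refine (hi.sub i1).congr (Filter.Eventually.of_forall fun θ => ?_)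
    simp only [Pi.sub_apply, ← pd_area_one (S.pt_mem hp _)]
    ring
  have h0 := hV.integral_eq_zero le_rfl hp hi2
  have h1 : sphInt (pd 1 (S.area 0)) p = ∫ θ : Fin 2 → ℝ,
      S.Ω 0 (pt p.1 p.2 θ) * S.trChi 0 (pt p.1 p.2 θ) * S.areaElement (pt p.1 p.2 θ) := by
    have h2 := integral_add i1 hi2
    rw [h0, add_zero] at h2
    refine h2.symm.trans (integral_congr_ae (Filter.Eventually.of_forall fun θ => ?_))
    exact pd_area_one (S.pt_mem hp θ)
  rw [avgTrChi, average, sq_areaRadius hε₀ hS hp, h1]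
  field_simp

/-- The area radius on `Q`. -/
def rad (S : Spacetime) (p : ℝ × ℝ) : ℝ := S.areaRadius p.1 p.2

/-- The factor `q` on `Q`. -/
def fac (S : Spacetime) (p : ℝ × ℝ) : ℝ := √(S.avgTrChi p.1 p.2 / S.avgTrChib p.1 p.2)

theorem rad_pos (hε₀ : 0 < ε₀) (hS : S.BAI ε₀ C₀) {p : ℝ × ℝ} (hp : p ∈ S.Q) : 0 < S.rad p := by
  have := sphInt_area_pos hε₀ hS hp
  exact Real.sqrt_pos.2 (div_pos this (by positivity))

theorem fac_pos (hε₀ : 0 < ε₀) (hS : S.BAI ε₀ C₀) {p : ℝ × ℝ} (hp : p ∈ S.Q) : 0 < S.fac p :=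
  Real.sqrt_pos.2 (div_pos (avgTrChi_pos hε₀ hS hp) (avgTrChib_pos hε₀ hS hp))

theorem contDiffOn_rad (hε₀ : 0 < ε₀) (hS : S.BAI ε₀ C₀) : ContDiffOn ℝ 2 S.rad S.Q := by
  have h1 := IsDensity.contDiffOn_sphInt 2 (isDensity_area (S := S) ((2 : ℕ) : ℕ∞))
  have h2 : ContDiffOn ℝ 2 (fun p => sphInt (S.area 0) p / (4 * Real.pi)) S.Q :=
    ContDiffOn.div_const h1 _
  exact h2.sqrt fun p hp => (div_pos (sphInt_area_pos hε₀ hS hp) (by positivity)).ne'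

theorem fderiv_rad (hε₀ : 0 < ε₀) (hS : S.BAI ε₀ C₀) {p : ℝ × ℝ} (hp : p ∈ S.Q) :
    fderiv ℝ S.rad p (1, 0) = S.rad p / 2 * S.avgTrChib p.1 p.2 ∧
    fderiv ℝ S.rad p (0, 1) = S.rad p / 2 * S.avgTrChi p.1 p.2 := by
  have hA := sphInt_area_pos hε₀ hS hp
  have h1 := (isDensity_area (S := S) 1).hasFDerivAt le_rfl hp
  have hr : HasFDerivAt S.rad (fderiv ℝ S.rad p) p :=
    (((contDiffOn_rad hε₀ hS).contDiffAt (S.isOpen_Q.mem_nhds hp)).differentiableAt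
      (by simp)).hasFDerivAt
  have h2 := (hr.pow 2).const_mul (4 * Real.pi)
  have h3 : (fun p => 4 * Real.pi * S.rad p ^ 2) =ᶠ[𝓝 p] sphInt (S.area 0) := by
    filter_upwards [S.isOpen_Q.mem_nhds hp] with p' hp' using sq_areaRadius hε₀ hS hp'
  have h4 := (h1.congr_of_eventuallyEq h3).unique h2
  rw [sphInt_pd_area_zero hε₀ hS hp, sphInt_pd_area_one hε₀ hS hp, ← sq_areaRadius hε₀ hS hp] at h4
  have hr0 := rad_pos hε₀ hS hp
  have e : S.areaRadius p.1 p.2 = S.rad p := rfl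
  have := Real.pi_pos
  have k0 := congrArg (fun l => l (1, 0)) h4
  have k1 := congrArg (fun l => l (0, 1)) h4
  simp [e] at k0 k1
  constructor
  · field_simp at k0 ⊢
    linarith
  · field_simp at k1 ⊢
    linarith

/-- By the first variation formulas q² is the quotient of the v- and u-derivatives of the area, and
the area is smooth. The averages themselves never have to be differentiated. -/
theorem contDiffOn_fac (hε₀ : 0 < ε₀) (hS : S.BAI ε₀ C₀) : ContDiffOn ℝ 1 S.fac S.Q := by
  have g := isDensity_area (S := S) 2
  have h0 := IsDensity.contDiffOn_sphInt 1 (g.pd (m := ((1 : ℕ) : ℕ∞)) (by norm_num)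
    (.inl rfl : (0 : Fin 4) = 0 ∨ (0 : Fin 4) = 1))
  have h1 := IsDensity.contDiffOn_sphInt 1 (g.pd (m := ((1 : ℕ) : ℕ∞)) (by norm_num)
    (.inr rfl : (1 : Fin 4) = 0 ∨ (1 : Fin 4) = 1))
  have p0 : ∀ p ∈ S.Q, 0 < sphInt (pd 0 (S.area 0)) p := fun p hp => by
    rw [sphInt_pd_area_zero hε₀ hS hp]
    exact mul_pos (sphInt_area_pos hε₀ hS hp) (avgTrChib_pos hε₀ hS hp)
  have p1 : ∀ p ∈ S.Q, 0 < sphInt (pd 1 (S.area 0)) p := fun p hp => by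
    rw [sphInt_pd_area_one hε₀ hS hp]
    exact mul_pos (sphInt_area_pos hε₀ hS hp) (avgTrChi_pos hε₀ hS hp)
  refine ContDiffOn.congr ((ContDiffOn.div h1 h0 fun p hp => (p0 p hp).ne').sqrt
    fun p hp => (div_pos (p1 p hp) (p0 p hp)).ne') fun p hp => ?_
  rw [fac, Pi.div_apply, sphInt_pd_area_zero hε₀ hS hp, sphInt_pd_area_one hε₀ hS hp,
    mul_div_mul_left _ _ (sphInt_area_pos hε₀ hS hp).ne']

theorem pd_comp_base {f : ℝ × ℝ → ℝ} {x : Pt} (hf : DifferentiableAt ℝ f (x 0, x 1)) :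
    DifferentiableAt ℝ (fun y : Pt => f (y 0, y 1)) x ∧
    pd 0 (fun y : Pt => f (y 0, y 1)) x = fderiv ℝ f (x 0, x 1) (1, 0) ∧
    pd 1 (fun y : Pt => f (y 0, y 1)) x = fderiv ℝ f (x 0, x 1) (0, 1) ∧
    ∀ A, pd (ang A) (fun y : Pt => f (y 0, y 1)) x = 0 := by
  have h1 : HasFDerivAt (fun y : Pt => (y 0, y 1)) ((ContinuousLinearMap.proj (R := ℝ)
      (φ := fun _ : Fin 4 => ℝ) 0).prod (ContinuousLinearMap.proj 1)) x :=
    ((ContinuousLinearMap.proj (R := ℝ) (φ := fun _ : Fin 4 => ℝ) 0).prod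
      (ContinuousLinearMap.proj 1)).hasFDerivAt
  have h2 := hf.hasFDerivAt.comp x h1
  refine ⟨h2.differentiableAt, ?_, ?_, fun A => ?_⟩ <;> unfold pd <;> 
    rw [show (fun y : Pt => f (y 0, y 1)) = f ∘ fun y : Pt => (y 0, y 1) from rfl, h2.fderiv]
  · simp
  · simp
  · fin_cases A <;> simp [ang] <;> exact map_zero _

end Spacetime

/-! ### The energy current and its integrals over the spheres -/

theorem contDiffOn_sqT {E : Type*} [NormedAddCommGroup E] [NormedSpace ℝ E] {s : Set E}
    {n : ℕ∞ω} {h : E → Matrix (Fin 4) (Fin 4) ℝ} {T U : E → Tensor4}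
    (hh : ∀ i j, ContDiffOn ℝ n (fun z => h z i j) s)
    (hT : ∀ α β γ δ, ContDiffOn ℝ n (fun z => T z α β γ δ) s)
    (hU : ∀ α β γ δ, ContDiffOn ℝ n (fun z => U z α β γ δ) s) (α β γ δ : Fin 4) :
    ContDiffOn ℝ n (fun z => sqT (h z) (T z) (U z) α β γ δ) s := by
  unfold sqT
  exact ContDiffOn.sum fun a _ => ContDiffOn.sum fun b _ =>
    ContDiffOn.sum fun c _ => ContDiffOn.sum fun d _ =>
      (((hh _ _).mul (hh _ _)).mul (hT _ _ _ _)).mul (hU _ _ _ _)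

theorem contDiffOn_dualT {E : Type*} [NormedAddCommGroup E] [NormedSpace ℝ E] {s : Set E}
    {n : ℕ∞ω} {h : E → Matrix (Fin 4) (Fin 4) ℝ} {T : E → Tensor4}
    (hh : ∀ i j, ContDiffOn ℝ n (fun z => h z i j) s)
    (hT : ∀ α β γ δ, ContDiffOn ℝ n (fun z => T z α β γ δ) s) (α β γ δ : Fin 4) :
    ContDiffOn ℝ n (fun z => dualT (h z) (T z) α β γ δ) s := by
  unfold dualT
  exact contDiffOn_const.mul (ContDiffOn.sum fun a _ => ContDiffOn.sum fun b _ =>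
    ContDiffOn.sum fun c _ => ContDiffOn.sum fun d _ =>
      (((hh _ _).mul (hh _ _)).mul (hT _ _ _ _)).mul contDiffOn_const)

theorem contDiffOn_contract3_belRob {E : Type*} [NormedAddCommGroup E] [NormedSpace ℝ E]
    {s : Set E} {n : ℕ∞ω} {h : E → Matrix (Fin 4) (Fin 4) ℝ} {t : E → ℝ} {T : E → Tensor4}
    {k : E → Fin 4 → ℝ} (hh : ∀ i j, ContDiffOn ℝ n (fun z => h z i j) s) (ht : ContDiffOn ℝ n t s)
    (hT : ∀ α β γ δ, ContDiffOn ℝ n (fun z => T z α β γ δ) s)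
    (hk : ∀ a, ContDiffOn ℝ n (fun z => k z a) s) (a : Fin 4) :
    ContDiffOn ℝ n (fun z => contract3 (belRob (h z) (t z) (T z) (T z)) (k z) a) s := by
  unfold contract3 belRob
  exact ContDiffOn.sum fun b _ => ContDiffOn.sum fun c _ =>
    ContDiffOn.sum fun d _ => ((((contDiffOn_sqT hh hT hT _ _ _ _).add
      (ht.mul (contDiffOn_sqT hh (contDiffOn_dualT hh hT)
        (contDiffOn_dualT hh hT) _ _ _ _))).mul (hk _)).mul (hk _)).mul (hk _)

namespace Spacetime

variable {S : Spacetime} {ε₀ C₀ : ℝ} {W : Fin 2 → Pt → Tensor4}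

theorem contDiffOn_q (hε₀ : 0 < ε₀) (hS : S.BAI ε₀ C₀) : ContDiffOn ℝ 1 S.q S.dom := by
  have h : ContDiff ℝ 1 fun y : Pt => (y 0, y 1) :=
    (contDiff_apply ℝ ℝ 0).prodMk (contDiff_apply ℝ ℝ 1)
  have e : S.q = S.fac ∘ fun y : Pt => (y 0, y 1) := by
    funext x
    simp only [q, fac, Function.comp_apply]
  rw [e]
  exact (contDiffOn_fac hε₀ hS).comp h.contDiffOn fun x hx => hx

theorem q_pos (hε₀ : 0 < ε₀) (hS : S.BAI ε₀ C₀) {x : Pt} (hx : x ∈ S.dom) : 0 < S.q x :=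
  fac_pos hε₀ hS (p := (x 0, x 1)) hx

theorem contDiffOn_K (hε₀ : 0 < ε₀) (hS : S.BAI ε₀ C₀) (c : Fin 2) (μ : Fin 4) :
    ContDiffOn ℝ 1 (fun y => S.K c y μ) S.dom := by
  have hq := contDiffOn_q hε₀ hS
  simp only [K, L, Lb]
  refine (hq.mul contDiffOn_const).add ((hq.inv fun x hx => (q_pos hε₀ hS hx).ne').mul
    (contDiffOn_const.add (ContDiffOn.sum fun A _ => ContDiffOn.mul ?_ contDiffOn_const)))
  exact ContDiffOn.of_le (S.smooth_b c A) (by exact_mod_cast le_top)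

theorem contDiffOn_det_gInv (c : Fin 2) : ContDiffOn ℝ 1 (fun y => (S.gInv c y).det) S.dom := by
  simp only [Matrix.det_apply']
  exact ContDiffOn.sum fun σ _ => contDiffOn_const.mul (contDiffOn_prod fun i _ =>
    (S.contDiffOn_gInv c _ _).of_le (by exact_mod_cast le_top))

theorem contDiffOn_cur (hε₀ : 0 < ε₀) (hS : S.BAI ε₀ C₀) (hW : S.IsWeylField W) (c : Fin 2)
    (μ : Fin 4) : ContDiffOn ℝ 1 (fun y => S.cur c (W c) y μ) S.dom := by
  have hg : ∀ i j, ContDiffOn ℝ 1 (fun y => S.gInv c y i j) S.dom := fun i j =>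
    (S.contDiffOn_gInv c i j).of_le (by exact_mod_cast le_top)
  simp only [cur, curOf]
  exact ContDiffOn.sum fun α _ => (hg μ α).mul (contDiffOn_contract3_belRob hg
    ((contDiffOn_det_gInv c).inv fun x hx => S.det_gInv_ne_zero hx).neg (hW.contDiff c)
    (contDiffOn_K hε₀ hS c) α)

/-- The energy current, as a vector density. -/
def flux (S : Spacetime) (W : Fin 2 → Pt → Tensor4) (c : Fin 2) (x : Pt) (μ : Fin 4) : ℝ :=
  -(S.dens c x * S.cur c (W c) x μ)

theorem isVectorDensity_flux (hε₀ : 0 < ε₀) (hS : S.BAI ε₀ C₀) (hW : S.IsWeylField W) :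
    S.IsVectorDensity 1 (S.flux W) where
  contDiffOn c A := (((S.contDiffOn_dens c).of_le (by exact_mod_cast le_top)).mul
    (contDiffOn_cur hε₀ hS hW c A)).neg
  glue x hx h := by
    have h1 := S.cur_trans hW hx h
    have h2 := S.dens_trans hx h
    have h3 : S.flux W 1 (trans x) = -S.dens 1 (trans x) • S.cur 1 (W 1) (trans x) := by
      funext μ
      simp [flux]
    rw [h3, h1, Matrix.mulVec_smul, Matrix.mulVec_mulVec, jacMatInv_mul h, Matrix.one_mulVec]
    funext μ
    simp only [flux, h2, Pi.smul_apply, smul_eq_mul]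
    ring

theorem pd_q (hε₀ : 0 < ε₀) (hS : S.BAI ε₀ C₀) {x : Pt} (hx : x ∈ S.dom) :
    DifferentiableAt ℝ S.q x ∧ ∀ A, pd (ang A) S.q x = 0 := by
  have h := pd_comp_base (f := S.fac) (x := x) (((contDiffOn_fac hε₀ hS).contDiffAt
    (S.isOpen_Q.mem_nhds hx)).differentiableAt (by simp))
  exact ⟨h.1, h.2.2.2⟩

theorem flux_nonneg (hε₀ : 0 < ε₀) (hS : S.BAI ε₀ C₀) (hW : S.IsWeylField W) (hB : S.Bianchi W)
    {x : Pt} (hx : x ∈ S.dom) : 0 ≤ S.flux W 0 x 0 ∧ 0 ≤ S.flux W 0 x 1 := by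
  obtain ⟨-, h0, h1, -⟩ := S.cur_estimate hS hW hB 0 hx (pd_q hε₀ hS hx).1 (q_pos hε₀ hS hx)
    (pd_q hε₀ hS hx).2
  have := S.dens_pos (c := 0) hx
  constructor <;> simp only [flux] <;> nlinarith

theorem flux_sum (hε₀ : 0 < ε₀) (hS : S.BAI ε₀ C₀) (hW : S.IsWeylField W) (hB : S.Bianchi W)
    {x : Pt} (hx : x ∈ S.dom) : (S.q x)⁻¹ * S.flux W 0 x 0 + S.q x * S.flux W 0 x 1 =
      S.dens 0 x * (S.belK 0 (W 0) x / (2 * S.Ω 0 x ^ 2)) := by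
  obtain ⟨-, -, -, h, -⟩ := S.cur_estimate hS hW hB 0 hx (pd_q hε₀ hS hx).1 (q_pos hε₀ hS hx)
    (pd_q hε₀ hS hx).2
  rw [← h]
  simp only [flux]
  ring

/-- The flux through the level sets of the area radius. -/
theorem fderiv_rad_mul_flux (hε₀ : 0 < ε₀) (hS : S.BAI ε₀ C₀) {x : Pt} (hx : x ∈ S.dom) (a b : ℝ) :
    fderiv ℝ S.rad (x 0, x 1) (1, 0) * a + fderiv ℝ S.rad (x 0, x 1) (0, 1) * b =
      S.rad (x 0, x 1) / 2 * (S.q x * S.avgTrChib (x 0) (x 1)) * ((S.q x)⁻¹ * a + S.q x * b) := by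
  have hq := q_pos hε₀ hS hx
  have h1 := avgTrChi_pos hε₀ hS hx
  have h2 := avgTrChib_pos hε₀ hS hx
  obtain ⟨e0, e1⟩ := fderiv_rad hε₀ hS (p := (x 0, x 1)) hx
  have h3 : S.avgTrChi (x 0) (x 1) = S.q x ^ 2 * S.avgTrChib (x 0) (x 1) := by
    rw [q, Real.sq_sqrt (div_pos h1 h2).le]
    field_simp
  rw [e0, e1, h3]
  field_simp

/-- The averages control Ω T rather than T, and Ω ≥ r / C₀ converts this into a gain of 1/r. This
gain makes the error integrable in r. The terms with tr χ and tr χb contribute equally, because q²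
times the average of Ω tr χb is the average of Ω tr χ. -/
theorem expansion_le (hε₀ : 0 < ε₀) (hC₀ : 0 < C₀) (hS : S.BAI ε₀ C₀) (hΩ : S.LapseComparable C₀)
    {x : Pt} (hx : x ∈ S.dom) : S.expansion 0 x ≤
      2 * (1 + ε₀) * C₀ / S.rad (x 0, x 1) * (S.q x * S.avgTrChib (x 0) (x 1)) := by
  have hq := q_pos hε₀ hS hx
  have h1 := avgTrChi_pos hε₀ hS hx
  have h2 := avgTrChib_pos hε₀ hS hx
  have h3 : S.avgTrChi (x 0) (x 1) = S.q x ^ 2 * S.avgTrChib (x 0) (x 1) := by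
    rw [q, Real.sq_sqrt (div_pos h1 h2).le]
    field_simp
  have m1 := (abs_le.1 (hS.mean 0 x hx)).2
  have m2 := (abs_le.1 (hS.meanb 0 x hx)).2
  have hr : 0 < S.rad (x 0, x 1) := rad_pos hε₀ hS hx
  have hl : C₀⁻¹ * S.rad (x 0, x 1) ≤ S.Ω 0 x := (hΩ 0 x hx).1
  have hpos := S.Ω_pos 0 x hx
  have hE : S.Ω 0 x * S.expansion 0 x ≤
      2 * (1 + ε₀) * (S.q x * S.avgTrChib (x 0) (x 1)) := by
    have k1 : (S.q x)⁻¹ * (S.Ω 0 x * S.trChi 0 x) ≤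
        (S.q x)⁻¹ * ((1 + ε₀) * (S.q x ^ 2 * S.avgTrChib (x 0) (x 1))) := by
      rw [h3] at m1
      exact mul_le_mul_of_nonneg_left (by linarith) (inv_pos.2 hq).le
    have k2 : S.q x * (S.Ω 0 x * S.trChib 0 x) ≤ S.q x * ((1 + ε₀) * S.avgTrChib (x 0) (x 1)) := by
      exact mul_le_mul_of_nonneg_left (by linarith) hq.le
    have k3 : (S.q x)⁻¹ * ((1 + ε₀) * (S.q x ^ 2 * S.avgTrChib (x 0) (x 1))) =
        (1 + ε₀) * (S.q x * S.avgTrChib (x 0) (x 1)) := by field_simp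
    rw [k3] at k1
    rw [expansion]
    linarith
  have hT : 0 ≤ S.expansion 0 x := by
    have := hS.expansion 0 x hx
    exact add_nonneg (mul_pos hq this.2).le (mul_pos (inv_pos.2 hq) this.1).le
  have h4 := (mul_le_mul_of_nonneg_right hl hT).trans hE
  rw [div_mul_eq_mul_div, le_div_iff₀ hr]
  calc _ = C₀ * (C₀⁻¹ * S.rad (x 0, x 1) * S.expansion 0 x) := by field_simp
    _ ≤ C₀ * (2 * (1 + ε₀) * (S.q x * S.avgTrChib (x 0) (x 1))) := by gcongr
    _ = _ := by ring

/-- The error is measured against dr(J), which equals (r/2) q avg(Ω tr χb) times the same density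
that bounds the divergence. Dividing `expansion_le` by this r/2 gives the coefficient r⁻² and the
constant 1536 · 2 · 2 = 6144. -/
theorem divergence_flux_le (hε₀ : 0 < ε₀) (hC₀ : 0 < C₀) (hS : S.BAI ε₀ C₀)
    (hΩ : S.LapseComparable C₀) (hW : S.IsWeylField W) (hB : S.Bianchi W) {x : Pt}
    (hx : x ∈ S.dom) : |∑ μ, pd μ (fun y => S.flux W 0 y μ) x| ≤
      6144 * (1 + ε₀) * C₀ ^ 2 / S.rad (x 0, x 1) ^ 2 *
        (fderiv ℝ S.rad (x 0, x 1) (1, 0) * S.flux W 0 x 0 +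
          fderiv ℝ S.rad (x 0, x 1) (0, 1) * S.flux W 0 x 1) := by
  obtain ⟨hb, -, -, -, h⟩ := S.cur_estimate hS hW hB 0 hx (pd_q hε₀ hS hx).1 (q_pos hε₀ hS hx)
    (pd_q hε₀ hS hx).2
  have e : ∑ μ, pd μ (fun y => S.flux W 0 y μ) x =
      -∑ μ, pd μ (fun y => S.dens 0 y * S.cur 0 (W 0) y μ) x := by
    rw [← Finset.sum_neg_distrib]
    refine Finset.sum_congr rfl fun μ _ => ?_
    simp only [pd, flux, fderiv_fun_neg]
    rfl
  have hd := S.dens_pos (c := 0) hx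
  have hr : 0 < S.rad (x 0, x 1) := rad_pos hε₀ hS hx
  rw [e, abs_neg, fderiv_rad_mul_flux hε₀ hS hx, flux_sum hε₀ hS hW hB hx]
  refine h.trans ?_
  have h5 := expansion_le hε₀ hC₀ hS hΩ hx
  have h6 : 0 ≤ S.dens 0 x * (S.belK 0 (W 0) x / (2 * S.Ω 0 x ^ 2)) := by positivity
  calc _ ≤ 1536 * C₀ * (2 * (1 + ε₀) * C₀ / S.rad (x 0, x 1) *
        (S.q x * S.avgTrChib (x 0) (x 1))) *
        (S.dens 0 x * (S.belK 0 (W 0) x / (2 * S.Ω 0 x ^ 2))) := by gcongr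
    _ = _ := by
      field_simp
      ring

/-- The energy current, integrated over the spheres. -/
def mass (S : Spacetime) (W : Fin 2 → Pt → Tensor4) (μ : Fin 4) : ℝ × ℝ → ℝ :=
  sphInt fun x => S.flux W 0 x μ

theorem contDiffOn_mass (hε₀ : 0 < ε₀) (hS : S.BAI ε₀ C₀) (hW : S.IsWeylField W) {μ : Fin 4}
    (hμ : μ = 0 ∨ μ = 1) : ContDiffOn ℝ 1 (S.mass W μ) S.Q :=
  IsDensity.contDiffOn_sphInt 1 ((isVectorDensity_flux hε₀ hS hW).isDensity hμ)

theorem mass_nonneg (hε₀ : 0 < ε₀) (hS : S.BAI ε₀ C₀) (hW : S.IsWeylField W) (hB : S.Bianchi W)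
    {p : ℝ × ℝ} (hp : p ∈ S.Q) : 0 ≤ S.mass W 0 p ∧ 0 ≤ S.mass W 1 p :=
  ⟨integral_nonneg fun θ => (flux_nonneg hε₀ hS hW hB (S.pt_mem hp θ)).1,
    integral_nonneg fun θ => (flux_nonneg hε₀ hS hW hB (S.pt_mem hp θ)).2⟩

theorem divergence_mass_le (hε₀ : 0 < ε₀) (hC₀ : 0 < C₀) (hS : S.BAI ε₀ C₀)
    (hΩ : S.LapseComparable C₀) (hW : S.IsWeylField W) (hB : S.Bianchi W) {p : ℝ × ℝ}
    (hp : p ∈ S.Q) : fderiv ℝ (S.mass W 0) p (1, 0) + fderiv ℝ (S.mass W 1) p (0, 1) ≤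
      6144 * (1 + ε₀) * C₀ ^ 2 / S.rad p ^ 2 *
        (fderiv ℝ S.rad p (1, 0) * S.mass W 0 p + fderiv ℝ S.rad p (0, 1) * S.mass W 1 p) := by
  have hV := isVectorDensity_flux hε₀ hS hW
  have g0 := hV.isDensity (.inl rfl : (0 : Fin 4) = 0 ∨ (0 : Fin 4) = 1)
  have g1 := hV.isDensity (.inr rfl : (1 : Fin 4) = 0 ∨ (1 : Fin 4) = 1)
  have d0 := (g0.pd (m := 0) (by simp) (.inl rfl : (0 : Fin 4) = 0 ∨ (0 : Fin 4) = 1))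
  have d1 := (g1.pd (m := 0) (by simp) (.inr rfl : (1 : Fin 4) = 0 ∨ (1 : Fin 4) = 1))
  have i0 := d0.integrable hp
  have i1 := d1.integrable hp
  have c : ∀ μ, Continuous fun θ : Fin 2 → ℝ => pd μ (fun y => S.flux W 0 y μ) (pt p.1 p.2 θ) :=
    fun μ => continuous_comp_pt (contDiffOn_pd (hV.contDiffOn 0 μ) (m := 0) (by simp) μ).continuousOn
      hp
  have ib := (((g0.integrable hp).const_mul (fderiv ℝ S.rad p (1, 0))).add
    ((g1.integrable hp).const_mul (fderiv ℝ S.rad p (0, 1)))).const_mul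
      (6144 * (1 + ε₀) * C₀ ^ 2 / S.rad p ^ 2)
  have hle := fun θ : Fin 2 → ℝ => divergence_flux_le hε₀ hC₀ hS hΩ hW hB (S.pt_mem hp θ)
  -- The pointwise bound itself makes the full divergence integrable. The u- and v-parts are
  -- integrable as derivatives of densities, so the angular part is integrable by difference and
  -- integrates to zero.
  have hi : Integrable fun θ : Fin 2 → ℝ =>
      ∑ μ, pd μ (fun y => S.flux W 0 y μ) (pt p.1 p.2 θ) :=
    ib.mono' (continuous_finsetSum _ fun μ _ => c μ).aestronglyMeasurable
      (Filter.Eventually.of_forall hle)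
  have hi2 : Integrable fun θ : Fin 2 → ℝ => pd 2 (fun y => S.flux W 0 y 2) (pt p.1 p.2 θ) +
      pd 3 (fun y => S.flux W 0 y 3) (pt p.1 p.2 θ) := by
    refine ((hi.sub i0).sub i1).congr (Filter.Eventually.of_forall fun θ => ?_)
    simp only [Pi.sub_apply, Fin.sum_univ_four]
    ring
  have h0 := hV.integral_eq_zero le_rfl hp hi2
  have e0 : fderiv ℝ (S.mass W 0) p (1, 0) =
      ∫ θ : Fin 2 → ℝ, pd 0 (fun y => S.flux W 0 y 0) (pt p.1 p.2 θ) := by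
    rw [show S.mass W 0 = sphInt _ from rfl, (g0.hasFDerivAt le_rfl hp).fderiv]
    simp [sphInt]
  have e1 : fderiv ℝ (S.mass W 1) p (0, 1) =
      ∫ θ : Fin 2 → ℝ, pd 1 (fun y => S.flux W 0 y 1) (pt p.1 p.2 θ) := by
    rw [show S.mass W 1 = sphInt _ from rfl, (g1.hasFDerivAt le_rfl hp).fderiv]
    simp [sphInt]
  have e2 : fderiv ℝ (S.mass W 0) p (1, 0) + fderiv ℝ (S.mass W 1) p (0, 1) =
      ∫ θ : Fin 2 → ℝ, ∑ μ, pd μ (fun y => S.flux W 0 y μ) (pt p.1 p.2 θ) := by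
    have h2 := integral_add (i0.add i1) hi2
    have h3 := integral_add i0 i1
    simp only [Pi.add_apply] at h2 h3
    rw [h0, add_zero, h3, ← e0, ← e1] at h2
    rw [← h2]
    refine integral_congr_ae (Filter.Eventually.of_forall fun θ => ?_)
    simp only [Fin.sum_univ_four]
    ring
  have e3 := integral_mono hi ib fun θ => (le_abs_self _).trans (hle θ)
  simp only [Pi.add_apply] at e3
  rw [e2]
  refine e3.trans_eq ?_
  rw [integral_const_mul, integral_add ((g0.integrable hp).const_mul _)
    ((g1.integrable hp).const_mul _), integral_const_mul, integral_const_mul]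
  rfl

end Spacetime

/-! ### Level points of an increasing function on a line -/

section Line

variable {ϱ ϱ' h h' : ℝ → ℝ} {O K : Set ℝ} {ρ : ℝ}

/-- An accumulation point in K would be a point with nonzero derivative near which the value ρ is
attained infinitely often. -/
theorem finite_level (hK : IsCompact K) (hKO : K ⊆ O) (hϱ : ∀ x ∈ O, HasDerivAt ϱ (ϱ' x) x)
    (hpos : ∀ x ∈ O, 0 < ϱ' x) (ρ : ℝ) : {x | x ∈ K ∧ ϱ x = ρ}.Finite := by
  by_contra hinf
  obtain ⟨x, hx, hacc⟩ := Set.Infinite.exists_accPt_of_subset_isCompact hinf hK fun x hx => hx.1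
  have h1 : ∀ᶠ z in 𝓝[≠] x, ϱ z ≠ ρ := (hϱ x (hKO hx)).eventually_ne (hpos x (hKO hx)).ne'
  rw [accPt_iff_frequently_nhdsNE] at hacc
  exact hacc (h1.mono fun z hz hz' => hz hz'.2)

theorem eventually_lt_of_hasDerivAt {x d : ℝ} (hd : HasDerivAt ϱ d x) (hpos : 0 < d) :
    ∀ᶠ y in 𝓝 x, (x < y → ϱ x < ϱ y) ∧ (y < x → ϱ y < ϱ x) := by
  have h1 := (hasDerivAt_iff_tendsto_slope.1 hd).eventually (lt_mem_nhds hpos)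
  rw [eventually_nhdsWithin_iff] at h1
  filter_upwards [h1] with y hy
  constructor
  · intro hxy
    have := hy hxy.ne'
    rw [slope_def_field, div_pos_iff_of_pos_right (by linarith)] at this
    linarith
  · intro hxy
    have := hy hxy.ne
    rw [slope_def_field] at this
    by_contra hn
    have := div_nonpos_of_nonneg_of_nonpos (a := ϱ y - ϱ x) (b := y - x) (by linarith) (by linarith)
    linarith

/-- The fundamental theorem of calculus on a superlevel set of an increasing function. -/
theorem integral_superlevel_eq_neg_sum (hO : IsOpen O) (hK : IsCompact K) (hKO : K ⊆ O)
    (hϱ : ∀ x ∈ O, HasDerivAt ϱ (ϱ' x) x) (hpos : ∀ x ∈ O, 0 < ϱ' x)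
    (hh : ∀ x ∈ O, HasDerivAt h (h' x) x) (hc : ContinuousOn h' O)
    (h0 : ∀ x ∈ O, ρ ≤ ϱ x → x ∉ K → h x = 0) (P : Finset ℝ)
    (hP : ∀ x, x ∈ P ↔ x ∈ K ∧ ϱ x = ρ) :
    ∫ v, {v | v ∈ O ∧ ρ < ϱ v}.indicator h' v = -∑ a ∈ P, h a := by
  classical
  have hϱc : ContinuousOn ϱ O := fun x hx => (hϱ x hx).continuousAt.continuousWithinAt
  set E := {v | v ∈ O ∧ ρ < ϱ v} with hE
  have hEo : IsOpen E := hϱc.isOpen_inter_preimage hO isOpen_Ioi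
  set G := E.indicator h with hG
  -- The level is crossed upwards at every point of P, so the truncated function G jumps there by `h
  -- a`. The step function T collects these jumps: G - T is continuous, with derivative `E.indicator
  -- h'` off the finite set P. This covers an open set O with several components, hence several
  -- crossings.
  set T : ℝ → ℝ := fun v => ∑ a ∈ P, if a < v then h a else 0 with hT
  have hGK : ∀ x, x ∉ K → G x = 0 := by
    intro x hx
    by_cases hxE : x ∈ E
    · rw [hG, Set.indicator_of_mem hxE, h0 x hxE.1 hxE.2.le hx]
    · exact Set.indicator_of_notMem hxE _
  have hgK : ∀ x, x ∉ K → E.indicator h' x = 0 := by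
    intro x hx
    by_cases hxE : x ∈ E
    · rw [Set.indicator_of_mem hxE]
      refine (hh x hxE.1).unique ((hasDerivAt_const x (0 : ℝ)).congr_of_eventuallyEq ?_)
      filter_upwards [hEo.mem_nhds hxE, hK.isClosed.isOpen_compl.mem_nhds hx] with y hy hy'
      exact h0 y hy.1 hy.2.le hy'
    · exact Set.indicator_of_notMem hxE _
  have hstep : ∀ (Q : Finset ℝ) x, x ∉ Q →
      (fun v => ∑ a ∈ Q, if a < v then h a else 0) =ᶠ[𝓝 x]
        fun _ => ∑ a ∈ Q, if a < x then h a else 0 := by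
    intro Q x hx
    have : ∀ᶠ v in 𝓝 x, ∀ a ∈ Q, (a < v ↔ a < x) := by
      rw [Filter.eventually_all_finset]
      intro a ha
      rcases lt_or_gt_of_ne (show a ≠ x by rintro rfl; exact hx ha) with h1 | h1
      · filter_upwards [lt_mem_nhds h1] with v hv using by simp [hv, h1]
      · filter_upwards [gt_mem_nhds h1] with v hv using by simp [hv.not_gt, h1.not_gt]
    filter_upwards [this] with v hv
    exact Finset.sum_congr rfl fun a ha => by simp [hv a ha]
  have hder : ∀ x, x ∉ P → HasDerivAt (fun v => G v - T v) (E.indicator h' x) x := by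
    intro x hx
    have hTd : HasDerivAt T 0 x := (hasDerivAt_const x _).congr_of_eventuallyEq (hstep P x hx)
    have hGd : HasDerivAt G (E.indicator h' x) x := by
      by_cases hxK : x ∈ K
      · have hxO := hKO hxK
        have hne : ϱ x ≠ ρ := fun he => hx ((hP x).2 ⟨hxK, he⟩)
        rcases lt_or_gt_of_ne hne with h1 | h1
        · have hxE : x ∉ E := fun hm => by have := hm.2; linarith
          rw [Set.indicator_of_notMem hxE]
          refine (hasDerivAt_const x (0 : ℝ)).congr_of_eventuallyEq ?_
          filter_upwards [(hϱ x hxO).continuousAt.eventually (gt_mem_nhds h1)] with v hv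
          exact Set.indicator_of_notMem (fun hm : v ∈ E => by have := hm.2; linarith) _
        · have hxE : x ∈ E := ⟨hxO, h1⟩
          rw [Set.indicator_of_mem hxE]
          refine (hh x hxO).congr_of_eventuallyEq ?_
          filter_upwards [hEo.mem_nhds hxE] with v hv
          exact Set.indicator_of_mem hv _
      · rw [hgK x hxK]
        refine (hasDerivAt_const x (0 : ℝ)).congr_of_eventuallyEq ?_
        filter_upwards [hK.isClosed.isOpen_compl.mem_nhds hxK] with y hy using hGK y hy
    simpa using hGd.fun_sub hTd
  have hcont : Continuous fun v => G v - T v := by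
    rw [continuous_iff_continuousAt]
    intro x
    by_cases hx : x ∈ P
    · obtain ⟨hxK, he⟩ := (hP x).1 hx
      have hxO := hKO hxK
      have hev : (fun v => G v - T v) =ᶠ[𝓝 x] fun v => (if x < v then h v - h x else 0) -
          ∑ a ∈ P.erase x, if a < x then h a else 0 := by
        filter_upwards [eventually_lt_of_hasDerivAt (hϱ x hxO) (hpos x hxO), hO.mem_nhds hxO,
          hstep (P.erase x) x (Finset.notMem_erase x P)] with v hv hvO hs
        have e1 : T v = (if x < v then h x else 0) + ∑ a ∈ P.erase x, if a < v then h a else 0 :=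
          (Finset.add_sum_erase P (fun a => if a < v then h a else 0) hx).symm
        rw [e1, hs]
        by_cases hxv : x < v
        · rw [if_pos hxv, if_pos hxv, hG, Set.indicator_of_mem (show v ∈ E from ⟨hvO, he ▸ hv.1 hxv⟩)]
          ring
        · have hvE : v ∉ E := fun hm => by
            rcases lt_or_eq_of_le (not_lt.1 hxv) with h1 | h1
            · have := hv.2 h1; have := hm.2; linarith
            · have := hm.2; rw [h1] at this; linarith
          rw [if_neg hxv, if_neg hxv, hG, Set.indicator_of_notMem hvE]
          ring
      refine ContinuousAt.congr ?_ hev.symm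
      refine ContinuousAt.sub ?_ continuousAt_const
      rw [ContinuousAt, if_neg (lt_irrefl x)]
      have h1 : Filter.Tendsto (fun v => |h v - h x|) (𝓝 x) (𝓝 0) := by
        have := ((hh x hxO).continuousAt.sub (continuousAt_const (y := h x))).abs
        simpa [ContinuousAt] using this
      refine squeeze_zero_norm (fun v => ?_) h1
      split_ifs
      · exact le_rfl
      · simp
    · exact (hder x hx).continuousAt
  obtain ⟨B, hB⟩ := hK.isBounded.subset_ball 0
  have hB' : ∀ x ∈ K, -|B| - 1 < x ∧ x < |B| + 1 := by
    intro x hx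
    have h1 := hB hx
    rw [Metric.mem_ball, Real.dist_eq, sub_zero] at h1
    have h2 := abs_lt.1 (h1.trans_le (le_abs_self B))
    constructor <;> linarith [h2.1, h2.2]
  have hle : -|B| - 1 ≤ |B| + 1 := by linarith [abs_nonneg B]
  have hint : Integrable (E.indicator h') := by
    have h1 : IntegrableOn h' K := (hc.mono hKO).integrableOn_compact hK
    have h2 : E.indicator h' = E.indicator (K.indicator h') := by
      funext x
      by_cases hxE : x ∈ E
      · by_cases hxK : x ∈ K
        · simp [hxE, hxK]
        · have := hgK x hxK
          simpa [hxE, hxK] using this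
      · simp [hxE]
    rw [h2]
    exact ((integrable_indicator_iff hK.measurableSet).2 h1).indicator hEo.measurableSet
  -- The interval contains K in its interior. At its ends G vanishes, while T runs from 0 to the
  -- full sum; this accounts for the minus sign.
  have hFTC := integral_eq_of_hasDerivAt_off_countable_of_le (fun v => G v - T v)
    (E.indicator h') hle P.countable_toSet hcont.continuousOn
    (fun x hx => hder x (by simpa using hx.2)) hint.intervalIntegrable
  have hout : ∀ x, x ∉ Set.Ioc (-|B| - 1) (|B| + 1) → E.indicator h' x = 0 := fun x hx =>
    hgK x fun hxK => hx ⟨(hB' x hxK).1, (hB' x hxK).2.le⟩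
  rw [← setIntegral_eq_integral_of_forall_compl_eq_zero hout, ← intervalIntegral.integral_of_le hle,
    hFTC, hGK _ fun hm => lt_irrefl _ (hB' _ hm).1, hGK _ fun hm => lt_irrefl _ (hB' _ hm).2]
  have t1 : T (|B| + 1) = ∑ a ∈ P, h a :=
    Finset.sum_congr rfl fun a ha => if_pos (hB' a ((hP a).1 ha).1).2
  have t2 : T (-|B| - 1) = 0 :=
    Finset.sum_eq_zero fun a ha => if_neg (hB' a ((hP a).1 ha).1).1.not_gt
  rw [t1, t2]
  ring

theorem tsum_level_eq (hO : IsOpen O) (hK : IsCompact K) (hKO : K ⊆ O)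
    (hϱ : ∀ x ∈ O, HasDerivAt ϱ (ϱ' x) x) (hpos : ∀ x ∈ O, 0 < ϱ' x)
    (hh : ∀ x ∈ O, HasDerivAt h (h' x) x) (hc : ContinuousOn h' O)
    (h0 : ∀ x ∈ O, ρ ≤ ϱ x → x ∉ K → h x = 0) (hn : ∀ x ∈ O, 0 ≤ h x) :
    0 ≤ -∫ v, {v | v ∈ O ∧ ρ < ϱ v}.indicator h' v ∧
    ∑' v : {v // v ∈ O ∧ ϱ v = ρ}, ENNReal.ofReal (h v) =
      ENNReal.ofReal (-∫ v, {v | v ∈ O ∧ ρ < ϱ v}.indicator h' v) := by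
  set P := (finite_level hK hKO hϱ hpos ρ).toFinset with hPd
  have hP : ∀ x, x ∈ P ↔ x ∈ K ∧ ϱ x = ρ := fun x => by simp [hPd]
  have hPn : ∀ a ∈ P, 0 ≤ h a := fun a ha => hn a (hKO ((hP a).1 ha).1)
  rw [integral_superlevel_eq_neg_sum hO hK hKO hϱ hpos hh hc h0 P hP, neg_neg,
    ENNReal.ofReal_sum_of_nonneg hPn]
  refine ⟨Finset.sum_nonneg hPn, ?_⟩
  refine (tsum_subtype {v | v ∈ O ∧ ϱ v = ρ} fun v => ENNReal.ofReal (h v)).trans ?_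
  rw [tsum_eq_sum (s := P) fun v hv => ?_]
  · refine Finset.sum_congr rfl fun a ha => Set.indicator_of_mem ?_ _
    exact ⟨hKO ((hP a).1 ha).1, ((hP a).1 ha).2⟩
  · by_cases hm : v ∈ {v | v ∈ O ∧ ϱ v = ρ}
    · rw [Set.indicator_of_mem hm, h0 v hm.1 hm.2.ge fun hvK => hv ((hP v).2 ⟨hvK, hm.2⟩)]
      simp
    · exact Set.indicator_of_notMem hm _

end Line

/-! ### The divergence theorem for compactly supported fields on an open set of the plane -/

section Plane

variable {Q D E : Set (ℝ × ℝ)} {φ ψ : ℝ × ℝ → ℝ}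

theorem hasFDerivAt_indicator (hQ : IsOpen Q) (hD : IsCompact D) (hDQ : D ⊆ Q)
    (hφ : ContDiffOn ℝ 1 φ Q) (h0 : ∀ p ∈ Q, p ∉ D → φ p = 0) (p : ℝ × ℝ) :
    HasFDerivAt (Q.indicator φ) (Q.indicator (fderiv ℝ φ) p) p := by
  by_cases hp : p ∈ Q
  · rw [Set.indicator_of_mem hp]
    refine (((hφ.contDiffAt (hQ.mem_nhds hp)).differentiableAt
      (by simp)).hasFDerivAt).congr_of_eventuallyEq ?_
    filter_upwards [hQ.mem_nhds hp] with y hy using Set.indicator_of_mem hy _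
  · rw [Set.indicator_of_notMem hp]
    refine (hasFDerivAt_const (0 : ℝ) p).congr_of_eventuallyEq ?_
    filter_upwards [hD.isClosed.isOpen_compl.mem_nhds fun h => hp (hDQ h)] with y hy
    by_cases hyQ : y ∈ Q
    · rw [Set.indicator_of_mem hyQ, h0 y hyQ hy]
    · exact Set.indicator_of_notMem hyQ _

theorem fderiv_eq_zero_of_notMem (hE : IsOpen E) (hD : IsCompact D)
    (h0 : ∀ p ∈ E, p ∉ D → φ p = 0) {p : ℝ × ℝ} (hp : p ∈ E) (hpD : p ∉ D) : fderiv ℝ φ p = 0 := by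
  refine ((hasFDerivAt_const (0 : ℝ) p).congr_of_eventuallyEq ?_).fderiv
  filter_upwards [hE.mem_nhds hp, hD.isClosed.isOpen_compl.mem_nhds hpD] with y hy hy' using h0 y hy hy'

theorem continuousOn_fderiv_apply (hQ : IsOpen Q) (hφ : ContDiffOn ℝ 1 φ Q) (e : ℝ × ℝ) :
    ContinuousOn (fun p => fderiv ℝ φ p e) Q :=
  (hφ.continuousOn_fderiv_of_isOpen hQ (by simp)).clm_apply continuousOn_const

theorem integrable_indicator_of_compact (hD : IsCompact D) (hDQ : D ⊆ Q) (hE : IsOpen E)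
    {g : ℝ × ℝ → ℝ} (hg : ContinuousOn g Q) (h0 : ∀ p ∈ E, p ∉ D → g p = 0) :
    Integrable (E.indicator g) := by
  have h1 : IntegrableOn g D := (hg.mono hDQ).integrableOn_compact hD
  have h2 : E.indicator g = E.indicator (D.indicator g) := by
    funext x
    by_cases hxE : x ∈ E
    · by_cases hxD : x ∈ D
      · simp [hxE, hxD]
      · simp [hxE, hxD, h0 x hxE hxD]
    · simp [hxE]
  rw [h2]
  exact ((integrable_indicator_iff hD.measurableSet).2 h1).indicator hE.measurableSet

theorem integral_divergence_compact (hQ : IsOpen Q) (hD : IsCompact D) (hDQ : D ⊆ Q)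
    (hφ : ContDiffOn ℝ 1 φ Q) (hψ : ContDiffOn ℝ 1 ψ Q) (hφ0 : ∀ p ∈ Q, p ∉ D → φ p = 0)
    (hψ0 : ∀ p ∈ Q, p ∉ D → ψ p = 0) :
    Integrable (Q.indicator fun p => fderiv ℝ φ p (1, 0) + fderiv ℝ ψ p (0, 1)) ∧
    ∫ p, Q.indicator (fun p => fderiv ℝ φ p (1, 0) + fderiv ℝ ψ p (0, 1)) p = 0 := by
  have hi := integrable_indicator_of_compact hD hDQ hQ
    ((continuousOn_fderiv_apply hQ hφ (1, 0)).add (continuousOn_fderiv_apply hQ hψ (0, 1)))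
    fun p hp hpD => by
      simp [fderiv_eq_zero_of_notMem hQ hD hφ0 hp hpD, fderiv_eq_zero_of_notMem hQ hD hψ0 hp hpD]
  refine ⟨hi, ?_⟩
  have hb : ∀ φ : ℝ × ℝ → ℝ, ContDiffOn ℝ 1 φ Q → (∀ p ∈ Q, p ∉ D → φ p = 0) →
      ∃ M, 0 ≤ M ∧ ∀ p, |Q.indicator φ p| ≤ M / (1 + ‖p‖) ^ 2 := by
    intro φ hφ hφ0
    have hc : ContinuousOn (fun p => φ p * (1 + ‖p‖) ^ 2) D :=
      (hφ.continuousOn.mono hDQ).mul (by fun_prop)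
    obtain ⟨M, hM⟩ := hD.exists_bound_of_continuousOn hc
    refine ⟨|M|, abs_nonneg _, fun p => ?_⟩
    by_cases hp : p ∈ Q
    · rw [Set.indicator_of_mem hp]
      by_cases hpD : p ∈ D
      · rw [le_div_iff₀ (by positivity)]
        have := hM p hpD
        rw [Real.norm_eq_abs, abs_mul, abs_of_nonneg (by positivity : 0 ≤ (1 + ‖p‖) ^ 2)] at this
        exact this.trans (le_abs_self M)
      · rw [hφ0 p hp hpD, abs_zero]
        positivity
    · rw [Set.indicator_of_notMem hp, abs_zero]
      positivity
  obtain ⟨M, hM, hM'⟩ := hb φ hφ hφ0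
  obtain ⟨N, hN, hN'⟩ := hb ψ hψ hψ0
  have e : ∀ p, Q.indicator (fderiv ℝ φ) p (1, 0) + Q.indicator (fderiv ℝ ψ) p (0, 1) =
      Q.indicator (fun p => fderiv ℝ φ p (1, 0) + fderiv ℝ ψ p (0, 1)) p := by
    intro p
    by_cases hp : p ∈ Q <;> simp [hp]
  have := integral_divergence_plane_eq_zero (M := M + N) (hasFDerivAt_indicator hQ hD hDQ hφ hφ0)
    (hasFDerivAt_indicator hQ hD hDQ hψ hψ0)
    (fun p => (hM' p).trans (by gcongr; linarith)) (fun p => (hN' p).trans (by gcongr; linarith))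
    (by simp only [e]; exact hi)
  simpa only [e] using this

end Plane

/-! ### Monotonicity of the flux through the level sets of r -/

/-- A vector field with nonpositive divergence, and a radius function increasing in `u` and `v`. -/
structure RadialFlow (Q : Set (ℝ × ℝ)) (r N₀ N₁ : ℝ × ℝ → ℝ) : Prop where
  isOpen : IsOpen Q
  contDiffOn_r : ContDiffOn ℝ 2 r Q
  r_u : ∀ p ∈ Q, 0 < fderiv ℝ r p (1, 0)
  r_v : ∀ p ∈ Q, 0 < fderiv ℝ r p (0, 1)
  contDiffOn_zero : ContDiffOn ℝ 1 N₀ Q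
  contDiffOn_one : ContDiffOn ℝ 1 N₁ Q
  nonneg : ∀ p ∈ Q, 0 ≤ N₀ p ∧ 0 ≤ N₁ p
  divergence : ∀ p ∈ Q, fderiv ℝ N₀ p (1, 0) + fderiv ℝ N₁ p (0, 1) ≤ 0

/-- A cutoff function, decreasing in `u` and `v`, with compact support in `{r₀ ≤ r}`. -/
structure RadialCutoff (Q : Set (ℝ × ℝ)) (r : ℝ × ℝ → ℝ) (r₀ : ℝ) (a : ℝ × ℝ → ℝ)
    (D : Set (ℝ × ℝ)) : Prop where
  contDiffOn : ContDiffOn ℝ 1 a Q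
  nonneg : ∀ p ∈ Q, 0 ≤ a p
  a_u : ∀ p ∈ Q, fderiv ℝ a p (1, 0) ≤ 0
  a_v : ∀ p ∈ Q, fderiv ℝ a p (0, 1) ≤ 0
  isCompact : IsCompact D
  subset : D ⊆ Q
  zero : ∀ p ∈ Q, r₀ ≤ r p → p ∉ D → a p = 0

/-- The density, with respect to `u`, of the flux of `(N₀, N₁)` through the level sets of `r`. -/
def radialFlux (r N₀ N₁ : ℝ × ℝ → ℝ) (p : ℝ × ℝ) : ℝ :=
  (fderiv ℝ r p (1, 0) * N₀ p + fderiv ℝ r p (0, 1) * N₁ p) / fderiv ℝ r p (0, 1)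

namespace RadialFlow

variable {Q D : Set (ℝ × ℝ)} {r N₀ N₁ a : ℝ × ℝ → ℝ} {r₀ : ℝ}

theorem radialFlux_nonneg (hN : RadialFlow Q r N₀ N₁) {p : ℝ × ℝ} (hp : p ∈ Q) :
    0 ≤ radialFlux r N₀ N₁ p :=
  div_nonneg (add_nonneg (mul_nonneg (hN.r_u p hp).le (hN.nonneg p hp).1)
    (mul_nonneg (hN.r_v p hp).le (hN.nonneg p hp).2)) (hN.r_v p hp).le

theorem contDiffOn_fderiv_r (hN : RadialFlow Q r N₀ N₁) (e : ℝ × ℝ) :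
    ContDiffOn ℝ 1 (fun p => fderiv ℝ r p e) Q :=
  (hN.contDiffOn_r.fderiv_of_isOpen hN.isOpen (by norm_num)).clm_apply contDiffOn_const

theorem contDiffOn_radialFlux (hN : RadialFlow Q r N₀ N₁) :
    ContDiffOn ℝ 1 (radialFlux r N₀ N₁) Q :=
  (((hN.contDiffOn_fderiv_r _).mul hN.contDiffOn_zero).add
    ((hN.contDiffOn_fderiv_r _).mul hN.contDiffOn_one)).div (hN.contDiffOn_fderiv_r _)
    fun p hp => (hN.r_v p hp).ne'

theorem differentiableAt_of_mem (hN : RadialFlow Q r N₀ N₁) {φ : ℝ × ℝ → ℝ}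
    (hφ : ContDiffOn ℝ 1 φ Q) {p : ℝ × ℝ} (hp : p ∈ Q) : DifferentiableAt ℝ φ p :=
  (hφ.contDiffAt (hN.isOpen.mem_nhds hp)).differentiableAt (by simp)

theorem isOpen_superlevel (hN : RadialFlow Q r N₀ N₁) (ρ : ℝ) : IsOpen {p | p ∈ Q ∧ ρ < r p} :=
  hN.contDiffOn_r.continuousOn.isOpen_inter_preimage hN.isOpen isOpen_Ioi

theorem contDiffOn_cutoff_flux (hN : RadialFlow Q r N₀ N₁) (ha : RadialCutoff Q r r₀ a D) :
    ContDiffOn ℝ 1 (fun p => a p * radialFlux r N₀ N₁ p) Q :=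
  ha.contDiffOn.mul hN.contDiffOn_radialFlux

theorem integrable_superlevel (hN : RadialFlow Q r N₀ N₁) (ha : RadialCutoff Q r r₀ a D) {ρ : ℝ}
    (hρ : r₀ ≤ ρ) : Integrable ({p | p ∈ Q ∧ ρ < r p}.indicator fun p =>
      fderiv ℝ (fun p => a p * radialFlux r N₀ N₁ p) p (0, 1)) := by
  refine integrable_indicator_of_compact ha.isCompact ha.subset (hN.isOpen_superlevel ρ)
    (continuousOn_fderiv_apply hN.isOpen (hN.contDiffOn_cutoff_flux ha) _) fun p hp hpD => ?_
  rw [fderiv_eq_zero_of_notMem (hN.isOpen_superlevel ρ) ha.isCompact (fun p hp hpD => ?_) hp hpD]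
  · simp
  · rw [ha.zero p hp.1 (hρ.trans hp.2.le) hpD, zero_mul]

/-- The derivative ∂_v(a · flux) is div(aN) plus the divergence of (-aN₀, aN₀ ∂_u r / ∂_v r). The
latter field is tangent to the level sets of r, so multiplying it by f(r) multiplies its divergence
by f(r), and the integral vanishes. The former divergence is nonpositive because N and a are
nonnegative and a decreases in u and v. -/
theorem integral_smooth_le (hN : RadialFlow Q r N₀ N₁) (ha : RadialCutoff Q r r₀ a D) {f : ℝ → ℝ}
    (hf : ContDiff ℝ 1 f) (hf0 : ∀ t, 0 ≤ f t) (hfr : ∀ t ≤ r₀, f t = 0) :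
    Integrable (Q.indicator fun p => f (r p) *
      fderiv ℝ (fun p => a p * radialFlux r N₀ N₁ p) p (0, 1)) ∧
    ∫ p, Q.indicator (fun p => f (r p) *
      fderiv ℝ (fun p => a p * radialFlux r N₀ N₁ p) p (0, 1)) p ≤ 0 := by
  have hfc : ContDiffOn ℝ 1 (fun p => f (r p)) Q :=
    hf.comp_contDiffOn (hN.contDiffOn_r.of_le (by norm_num))
  have hm : ContDiffOn ℝ 1 (fun p => a p * N₀ p) Q := ha.contDiffOn.mul hN.contDiffOn_zero
  have hn : ContDiffOn ℝ 1 (fun p => a p * N₁ p) Q := ha.contDiffOn.mul hN.contDiffOn_one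
  have hk : ContDiffOn ℝ 1 (fun p => fderiv ℝ r p (1, 0) / fderiv ℝ r p (0, 1)) Q :=
    (hN.contDiffOn_fderiv_r _).div (hN.contDiffOn_fderiv_r _) fun p hp => (hN.r_v p hp).ne'
  have hs : ContDiffOn ℝ 1 (fun p => a p * N₀ p *
    (fderiv ℝ r p (1, 0) / fderiv ℝ r p (0, 1))) Q := hm.mul hk
  have hz : ∀ p ∈ Q, p ∉ D → f (r p) * a p = 0 := fun p hp hpD => by
    rcases le_total (r p) r₀ with h | h
    · rw [hfr _ h, zero_mul]
    · rw [ha.zero p hp h hpD, mul_zero]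
  obtain ⟨hi, h0⟩ := integral_divergence_compact (φ := fun p => f (r p) * (a p * N₀ p))
    (ψ := fun p => -(f (r p) * (a p * N₀ p * (fderiv ℝ r p (1, 0) / fderiv ℝ r p (0, 1)))))
    hN.isOpen ha.isCompact ha.subset (hfc.mul hm) (hfc.mul hs).neg
    (fun p hp hpD => by rw [← mul_assoc, hz p hp hpD, zero_mul])
    (fun p hp hpD => by rw [← mul_assoc, ← mul_assoc, hz p hp hpD, zero_mul, zero_mul, neg_zero])
  have hi2 : Integrable (Q.indicator fun p => f (r p) *
      fderiv ℝ (fun p => a p * radialFlux r N₀ N₁ p) p (0, 1)) := by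
    refine integrable_indicator_of_compact ha.isCompact ha.subset hN.isOpen (hfc.continuousOn.mul
      (continuousOn_fderiv_apply hN.isOpen (hN.contDiffOn_cutoff_flux ha) _)) fun p hp hpD => ?_
    rcases le_or_gt (r p) r₀ with h | h
    · rw [hfr _ h, zero_mul]
    · rw [fderiv_eq_zero_of_notMem (hN.isOpen_superlevel r₀) ha.isCompact (fun p hp hpD => ?_)
        ⟨hp, h⟩ hpD]
      · simp
      · rw [ha.zero p hp.1 hp.2.le hpD, zero_mul]
  refine ⟨hi2, (integral_mono hi2 hi.neg fun p => ?_).trans_eq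
    ((integral_neg _).trans (by rw [h0, neg_zero]))⟩
  by_cases hp : p ∈ Q
  swap
  · simp [hp]
  simp only [Set.indicator_of_mem hp]
  have dr : DifferentiableAt ℝ r p := hN.differentiableAt_of_mem (hN.contDiffOn_r.of_le (by norm_num)) hp
  have hv := hN.r_v p hp
  have df : HasFDerivAt (fun p => f (r p)) (deriv f (r p) • fderiv ℝ r p) p :=
    ((hf.differentiable (by simp)) (r p)).hasDerivAt.comp_hasFDerivAt p dr.hasFDerivAt
  have dm := (hN.differentiableAt_of_mem hm hp).hasFDerivAt
  have dn := (hN.differentiableAt_of_mem hn hp).hasFDerivAt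
  have ds := (hN.differentiableAt_of_mem hs hp).hasFDerivAt
  have e1 := (df.fun_mul dm).fderiv
  have e2 := (df.fun_mul ds).fun_neg.fderiv
  have e3 : fderiv ℝ (fun p => a p * radialFlux r N₀ N₁ p) p =
      fderiv ℝ (fun p => a p * N₀ p * (fderiv ℝ r p (1, 0) / fderiv ℝ r p (0, 1))) p +
        fderiv ℝ (fun p => a p * N₁ p) p := by
    refine ((ds.add dn).congr_of_eventuallyEq ?_).fderiv
    filter_upwards [hN.isOpen.mem_nhds hp] with y hy
    have := (hN.r_v y hy).ne'
    simp only [radialFlux, Pi.add_apply]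
    field_simp
  have e4 := ((hN.differentiableAt_of_mem ha.contDiffOn hp).hasFDerivAt.fun_mul
    (hN.differentiableAt_of_mem hN.contDiffOn_zero hp).hasFDerivAt).fderiv
  have e5 := ((hN.differentiableAt_of_mem ha.contDiffOn hp).hasFDerivAt.fun_mul
    (hN.differentiableAt_of_mem hN.contDiffOn_one hp).hasFDerivAt).fderiv
  have k : fderiv ℝ (fun p => a p * N₀ p) p (1, 0) + fderiv ℝ (fun p => a p * N₁ p) p (0, 1) ≤ 0 := by
    rw [e4, e5]
    simp only [add_apply, smul_apply, smul_eq_mul]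
    have h1 := mul_nonpos_of_nonneg_of_nonpos (ha.nonneg p hp) (hN.divergence p hp)
    have h2 := mul_nonpos_of_nonneg_of_nonpos (hN.nonneg p hp).1 (ha.a_u p hp)
    have h3 := mul_nonpos_of_nonneg_of_nonpos (hN.nonneg p hp).2 (ha.a_v p hp)
    linarith
  rw [Pi.neg_apply, Set.indicator_of_mem hp, e1, e2, e3]
  simp only [add_apply, smul_apply,
    neg_apply, smul_eq_mul]
  have h1 := mul_nonpos_of_nonneg_of_nonpos (hf0 (r p)) k
  have h2 : a p * N₀ p * (fderiv ℝ r p (1, 0) / fderiv ℝ r p (0, 1)) *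
      (deriv f (r p) * fderiv ℝ r p (0, 1)) = a p * N₀ p * (deriv f (r p) * fderiv ℝ r p (1, 0)) := by
    field_simp
  linarith

/-- The integral of the derivative of the flux between two level sets has a sign. -/
theorem integral_superlevel_le (hN : RadialFlow Q r N₀ N₁) (ha : RadialCutoff Q r r₀ a D) {ρ : ℝ}
    (hρ : r₀ ≤ ρ) :
    ∫ p, {p | p ∈ Q ∧ r₀ < r p}.indicator (fun p =>
      fderiv ℝ (fun p => a p * radialFlux r N₀ N₁ p) p (0, 1)) p ≤
    ∫ p, {p | p ∈ Q ∧ ρ < r p}.indicator (fun p =>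
      fderiv ℝ (fun p => a p * radialFlux r N₀ N₁ p) p (0, 1)) p := by
  set H := fun p => fderiv ℝ (fun p => a p * radialFlux r N₀ N₁ p) p (0, 1) with hH
  set st := Real.smoothTransition
  have hi0 := hN.integrable_superlevel ha le_rfl
  have hi1 := hN.integrable_superlevel ha hρ
  -- Smooth functions with values in [0, 1] tending to the indicator of (r₀, ρ]. They vanish for t ≤
  -- r₀, as is necessary because a need not have compact support there.
  let f : ℕ → ℝ → ℝ := fun n t => st (n * (t - r₀)) - st (n * (t - ρ))
  have hf0 : ∀ n t, 0 ≤ f n t := fun n t =>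
    sub_nonneg.2 (Real.smoothTransition.monotone (by gcongr))
  have hf1 : ∀ n t, f n t ≤ 1 := fun n t => by
    have h1 := Real.smoothTransition.le_one (n * (t - r₀))
    have h2 := Real.smoothTransition.nonneg (n * (t - ρ))
    simp only [f, st]
    linarith
  have hfz : ∀ n, ∀ t ≤ r₀, f n t = 0 := fun n t ht => by
    have h1 : (n : ℝ) * (t - r₀) ≤ 0 :=
      mul_nonpos_of_nonneg_of_nonpos n.cast_nonneg (by linarith)
    have h2 : (n : ℝ) * (t - ρ) ≤ 0 :=
      mul_nonpos_of_nonneg_of_nonpos n.cast_nonneg (by linarith)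
    simp only [f, st, Real.smoothTransition.zero_of_nonpos h1,
      Real.smoothTransition.zero_of_nonpos h2, sub_zero]
  have hfs : ∀ n, ContDiff ℝ 1 (f n) := fun n =>
    (Real.smoothTransition.contDiff.comp (by fun_prop : ContDiff ℝ 1 fun t : ℝ => n * (t - r₀))).sub
      (Real.smoothTransition.contDiff.comp (by fun_prop : ContDiff ℝ 1 fun t : ℝ => n * (t - ρ)))
  have hle := fun n => hN.integral_smooth_le ha (hfs n) (hf0 n) (hfz n)
  have hst : ∀ s t : ℝ, Filter.Tendsto (fun n : ℕ => st (n * (t - s))) Filter.atTop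
      (𝓝 (if s < t then 1 else 0)) := by
    intro s t
    split_ifs with h
    · refine tendsto_const_nhds.congr' ?_
      obtain ⟨m, hm⟩ := exists_nat_ge (1 / (t - s))
      filter_upwards [Filter.eventually_ge_atTop m] with n hn
      refine (Real.smoothTransition.one_of_one_le ?_).symm
      have h1 : (m : ℝ) ≤ n := by exact_mod_cast hn
      rw [← div_le_iff₀ (by linarith)]
      linarith
    · refine tendsto_const_nhds.congr fun n => (Real.smoothTransition.zero_of_nonpos ?_).symm
      exact mul_nonpos_of_nonneg_of_nonpos n.cast_nonneg (by linarith)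
  have key := tendsto_integral_of_dominated_convergence (μ := volume)
    (F := fun n p => Q.indicator (fun p => f n (r p) * H p) p)
    (f := fun p => {p | p ∈ Q ∧ r₀ < r p}.indicator H p - {p | p ∈ Q ∧ ρ < r p}.indicator H p)
    (fun p => |{p | p ∈ Q ∧ r₀ < r p}.indicator H p|) ?_ hi0.abs ?_ ?_
  · have h1 := le_of_tendsto key (Filter.Eventually.of_forall fun n => (hle n).2)
    rw [integral_sub hi0 hi1] at h1
    linarith
  · intro n
    exact (hle n).1.aestronglyMeasurable
  · intro n
    refine Filter.Eventually.of_forall fun p => ?_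
    by_cases hp : p ∈ Q
    · rw [Set.indicator_of_mem hp]
      by_cases hr : r₀ < r p
      · rw [Set.indicator_of_mem (show p ∈ {p | p ∈ Q ∧ r₀ < r p} from ⟨hp, hr⟩), norm_mul,
          Real.norm_of_nonneg (hf0 _ _)]
        exact mul_le_of_le_one_left (norm_nonneg _) (hf1 _ _)
      · rw [hfz n _ (not_lt.1 hr), zero_mul, norm_zero]
        exact abs_nonneg _
    · rw [Set.indicator_of_notMem hp, norm_zero]
      exact abs_nonneg _
  · refine Filter.Eventually.of_forall fun p => ?_
    by_cases hp : p ∈ Q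
    · have h1 := ((hst r₀ (r p)).sub (hst ρ (r p))).mul_const (H p)
      refine (h1.congr fun n => ?_).trans_eq ?_
      · rw [Set.indicator_of_mem hp]
      · congr 1
        by_cases h2 : r₀ < r p <;> by_cases h3 : ρ < r p <;> simp [hp, h2, h3]
    · simp [hp]

/-- The integral of the flux over a level set, as an integral over a superlevel set. -/
theorem lintegral_level_eq (hN : RadialFlow Q r N₀ N₁) (ha : RadialCutoff Q r r₀ a D) {ρ : ℝ}
    (hρ : r₀ ≤ ρ) :
    AEMeasurable (fun u : ℝ => ∑' v : {v : ℝ // (u, v) ∈ Q ∧ r (u, v) = ρ},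
      ENNReal.ofReal (a (u, v) * radialFlux r N₀ N₁ (u, v))) ∧
    ∫⁻ u : ℝ, ∑' v : {v : ℝ // (u, v) ∈ Q ∧ r (u, v) = ρ},
      ENNReal.ofReal (a (u, v) * radialFlux r N₀ N₁ (u, v)) =
    ENNReal.ofReal (-∫ p, {p | p ∈ Q ∧ ρ < r p}.indicator (fun p =>
      fderiv ℝ (fun p => a p * radialFlux r N₀ N₁ p) p (0, 1)) p) := by
  set h := fun p => a p * radialFlux r N₀ N₁ p with hh
  have hhc : ContDiffOn ℝ 1 h Q := hN.contDiffOn_cutoff_flux ha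
  have hi := hN.integrable_superlevel ha hρ
  have hline : ∀ u v : ℝ, HasDerivAt (fun v : ℝ => (u, v)) ((0 : ℝ), (1 : ℝ)) v := fun u v =>
    (hasDerivAt_const v u).prodMk (hasDerivAt_id v)
  have hcl : ∀ u : ℝ, Continuous fun v : ℝ => (u, v) := fun u => by fun_prop
  have key := fun u : ℝ => tsum_level_eq (ϱ := fun v => r (u, v))
    (ϱ' := fun v => fderiv ℝ r (u, v) (0, 1)) (h := fun v => h (u, v))
    (h' := fun v => fderiv ℝ h (u, v) (0, 1)) (O := {v | (u, v) ∈ Q}) (K := {v | (u, v) ∈ D})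
    (ρ := ρ) (hN.isOpen.preimage (hcl u))
    ((ha.isCompact.image continuous_snd).of_isClosed_subset
      (ha.isCompact.isClosed.preimage (hcl u)) fun v hv => ⟨(u, v), hv, rfl⟩)
    (fun v hv => ha.subset hv)
    (fun v hv => (hN.differentiableAt_of_mem (hN.contDiffOn_r.of_le (by norm_num))
      hv).hasFDerivAt.comp_hasDerivAt v (hline u v))
    (fun v hv => hN.r_v _ hv)
    (fun v hv => (hN.differentiableAt_of_mem hhc hv).hasFDerivAt.comp_hasDerivAt v (hline u v))
    ((continuousOn_fderiv_apply hN.isOpen hhc (0, 1)).comp (hcl u).continuousOn fun v hv => hv)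
    (fun v hv hr hvD => by simp only [hh]; rw [ha.zero _ hv (hρ.trans hr) hvD, zero_mul])
    (fun v hv => mul_nonneg (ha.nonneg _ hv) (hN.radialFlux_nonneg hv))
  have hin : Integrable fun u : ℝ => -∫ v : ℝ, {v | v ∈ {v | (u, v) ∈ Q} ∧ ρ < r (u, v)}.indicator
      (fun v => fderiv ℝ h (u, v) (0, 1)) v := (Integrable.integral_prod_left hi).neg
  -- The sum over sheets has no evident measurability in u; its expression as an integral in v
  -- supplies it, and Fubini then yields the planar integral.
  have e1 : (fun u : ℝ => ∑' v : {v : ℝ // (u, v) ∈ Q ∧ r (u, v) = ρ},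
      ENNReal.ofReal (a (u, v) * radialFlux r N₀ N₁ (u, v))) = fun u : ℝ => ENNReal.ofReal
      (-∫ v : ℝ, {v | v ∈ {v | (u, v) ∈ Q} ∧ ρ < r (u, v)}.indicator
      (fun v => fderiv ℝ h (u, v) (0, 1)) v) := funext fun u => (key u).2
  rw [e1]
  refine ⟨hin.aestronglyMeasurable.aemeasurable.ennreal_ofReal, ?_⟩
  rw [← ofReal_integral_eq_lintegral_ofReal hin (Filter.Eventually.of_forall fun u => (key u).1),
    integral_neg, Measure.volume_eq_prod, integral_prod _ hi]
  rfl

theorem lintegral_level_le (hN : RadialFlow Q r N₀ N₁) (ha : RadialCutoff Q r r₀ a D) {ρ : ℝ}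
    (hρ : r₀ ≤ ρ) :
    ∫⁻ u : ℝ, ∑' v : {v : ℝ // (u, v) ∈ Q ∧ r (u, v) = ρ},
      ENNReal.ofReal (a (u, v) * radialFlux r N₀ N₁ (u, v)) ≤
    ∫⁻ u : ℝ, ∑' v : {v : ℝ // (u, v) ∈ Q ∧ r (u, v) = r₀},
      ENNReal.ofReal (a (u, v) * radialFlux r N₀ N₁ (u, v)) := by
  rw [(hN.lintegral_level_eq ha hρ).2, (hN.lintegral_level_eq ha le_rfl).2]
  exact ENNReal.ofReal_le_ofReal (neg_le_neg (hN.integral_superlevel_le ha hρ))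

end RadialFlow

/-- The running maxima of a dense sequence stay in U and eventually exceed each x in U by a fixed
amount. Membership in U makes them labels of leaves, to which the compactness assumption applies;
the lower bound by 1/n makes a cutoff of slope n equal to 1 at x. -/
theorem exists_cofinal_seq {U : Set ℝ} (hU : IsOpen U) (hne : U.Nonempty) :
    ∃ s : ℕ → ℝ, (∀ n, s n ∈ U) ∧ ∀ x ∈ U, ∀ᶠ n : ℕ in Filter.atTop, 1 ≤ n * (s n - x) := by
  have : Nonempty U := hne.to_subtype
  obtain ⟨d, hd⟩ := TopologicalSpace.exists_dense_seq U
  refine ⟨fun n => (partialSups d n : U), fun n => (partialSups d n).2, fun x hx => ?_⟩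
  obtain ⟨y, hy, hxy⟩ : ∃ y ∈ U, x < y := by
    obtain ⟨δ, hδ, hb⟩ := Metric.isOpen_iff.1 hU x hx
    refine ⟨x + δ / 2, hb ?_, by linarith⟩
    rw [Metric.mem_ball, Real.dist_eq, add_sub_cancel_left, abs_of_pos (by linarith)]
    linarith
  have ho : IsOpen {z : U | (x + y) / 2 < z} := isOpen_lt continuous_const continuous_subtype_val
  obtain ⟨k, hk⟩ := hd.exists_mem_open ho ⟨⟨y, hy⟩, show (x + y) / 2 < y by linarith⟩
  have hk' : (x + y) / 2 < (d k : ℝ) := hk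
  obtain ⟨m, hm⟩ := exists_nat_ge (1 / (d k - x))
  filter_upwards [Filter.eventually_ge_atTop k, Filter.eventually_ge_atTop m] with n hn hn'
  have h1 : (d k : ℝ) ≤ (partialSups d n : U) := le_partialSups_of_le d hn
  have h2 : (m : ℝ) ≤ n := by exact_mod_cast hn'
  have h3 : 0 < (d k : ℝ) - x := by linarith
  rw [div_le_iff₀ h3] at hm
  calc (1 : ℝ) ≤ m * (d k - x) := hm
    _ ≤ n * ((partialSups d n : U) - x) := by gcongr

/-- Nonnegative functions, decreasing in `u` and `v`. -/
structure DecreasingOn (Q : Set (ℝ × ℝ)) (a : ℝ × ℝ → ℝ) : Prop where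
  contDiffOn : ContDiffOn ℝ 1 a Q
  nonneg : ∀ p ∈ Q, 0 ≤ a p
  a_u : ∀ p ∈ Q, fderiv ℝ a p (1, 0) ≤ 0
  a_v : ∀ p ∈ Q, fderiv ℝ a p (0, 1) ≤ 0

variable {Q : Set (ℝ × ℝ)}

theorem DecreasingOn.mul {a b : ℝ × ℝ → ℝ} (hQ : IsOpen Q) (ha : DecreasingOn Q a)
    (hb : DecreasingOn Q b) : DecreasingOn Q fun p => a p * b p := by
  have e : ∀ p ∈ Q, fderiv ℝ (fun p => a p * b p) p = a p • fderiv ℝ b p + b p • fderiv ℝ a p :=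
    fun p hp => ((((ha.contDiffOn.contDiffAt (hQ.mem_nhds hp)).differentiableAt
      (by simp)).hasFDerivAt).fun_mul (((hb.contDiffOn.contDiffAt (hQ.mem_nhds hp)).differentiableAt
      (by simp)).hasFDerivAt)).fderiv
  refine ⟨ha.contDiffOn.mul hb.contDiffOn, fun p hp => mul_nonneg (ha.nonneg p hp) (hb.nonneg p hp),
    fun p hp => ?_, fun p hp => ?_⟩ <;>
    rw [e p hp] <;> simp only [add_apply, smul_apply, smul_eq_mul]
  · exact add_nonpos (mul_nonpos_of_nonneg_of_nonpos (ha.nonneg p hp) (hb.a_u p hp))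
      (mul_nonpos_of_nonneg_of_nonpos (hb.nonneg p hp) (ha.a_u p hp))
  · exact add_nonpos (mul_nonpos_of_nonneg_of_nonpos (ha.nonneg p hp) (hb.a_v p hp))
      (mul_nonpos_of_nonneg_of_nonpos (hb.nonneg p hp) (ha.a_v p hp))

theorem DecreasingOn.smoothTransition {g : ℝ × ℝ → ℝ} (hQ : IsOpen Q) (hg : ContDiffOn ℝ 1 g Q)
    (hu : ∀ p ∈ Q, fderiv ℝ g p (1, 0) ≤ 0) (hv : ∀ p ∈ Q, fderiv ℝ g p (0, 1) ≤ 0) :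
    DecreasingOn Q fun p => Real.smoothTransition (g p) := by
  have hs : ContDiff ℝ 1 Real.smoothTransition := Real.smoothTransition.contDiff
  have e : ∀ p ∈ Q, fderiv ℝ (fun p => Real.smoothTransition (g p)) p =
      deriv Real.smoothTransition (g p) • fderiv ℝ g p := fun p hp =>
    ((hs.differentiable (by simp) (g p)).hasDerivAt.comp_hasFDerivAt p
      (((hg.contDiffAt (hQ.mem_nhds hp)).differentiableAt (by simp)).hasFDerivAt)).fderiv
  refine ⟨hs.comp_contDiffOn hg, fun p _ => Real.smoothTransition.nonneg _,
    fun p hp => ?_, fun p hp => ?_⟩ <;> rw [e p hp]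
  · exact mul_nonpos_of_nonneg_of_nonpos Real.smoothTransition.monotone.deriv_nonneg (hu p hp)
  · exact mul_nonpos_of_nonneg_of_nonpos Real.smoothTransition.monotone.deriv_nonneg (hv p hp)

/-- The flux through the level sets of `r` decreases. -/
theorem RadialFlow.lintegral_level_mono {r N₀ N₁ : ℝ × ℝ → ℝ} {r₀ ρ : ℝ}
    (hN : RadialFlow Q r N₀ N₁) (hρ : r₀ ≤ ρ)
    (hc : ∀ r₂ u₁ v₁ : ℝ, (∃ v, (u₁, v) ∈ Q) → (∃ u, (u, v₁) ∈ Q) →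
      IsCompact {p : ℝ × ℝ | p ∈ Q ∧ r₀ ≤ r p ∧ r p ≤ r₂ ∧ p.1 ≤ u₁ ∧ p.2 ≤ v₁}) :
    ∫⁻ u : ℝ, ∑' v : {v : ℝ // (u, v) ∈ Q ∧ r (u, v) = ρ},
      ENNReal.ofReal (radialFlux r N₀ N₁ (u, v)) ≤
    ∫⁻ u : ℝ, ∑' v : {v : ℝ // (u, v) ∈ Q ∧ r (u, v) = r₀},
      ENNReal.ofReal (radialFlux r N₀ N₁ (u, v)) := by
  rcases Q.eq_empty_or_nonempty with rfl | ⟨p₀, hp₀⟩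
  · refine lintegral_mono fun u => ?_
    have : IsEmpty {v : ℝ // (u, v) ∈ (∅ : Set (ℝ × ℝ)) ∧ r (u, v) = ρ} := ⟨fun v => v.2.1⟩
    rw [tsum_empty]
    exact zero_le
  obtain ⟨s, hsU, hs⟩ := exists_cofinal_seq (isOpenMap_fst Q hN.isOpen) ⟨p₀.1, p₀, hp₀, rfl⟩
  obtain ⟨t, htU, ht⟩ := exists_cofinal_seq (isOpenMap_snd Q hN.isOpen) ⟨p₀.2, p₀, hp₀, rfl⟩
  let st := Real.smoothTransition
  -- The three factors cut off at a leaf of constant u, at a leaf of constant v and at r = ρ + 1.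
  -- All decrease in u and v, the last one because r increases; it equals 1 on both levels being
  -- compared.
  let a : ℕ → ℝ × ℝ → ℝ := fun n p => st (n * (s n - p.1)) * st (n * (t n - p.2)) * st (ρ + 1 - r p)
  let D : ℕ → Set (ℝ × ℝ) := fun n =>
    {p | p ∈ Q ∧ r₀ ≤ r p ∧ r p ≤ ρ + 1 ∧ p.1 ≤ s n ∧ p.2 ≤ t n}
  have hdec : ∀ n, DecreasingOn Q (a n) := by
    intro n
    have hr1 := hN.contDiffOn_r.of_le (show (1 : ℕ∞ω) ≤ 2 by norm_num)
    refine DecreasingOn.mul hN.isOpen (DecreasingOn.mul hN.isOpen ?_ ?_) ?_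
    · have e : ∀ p : ℝ × ℝ, HasFDerivAt (fun p : ℝ × ℝ => (n : ℝ) * (s n - p.1))
          ((n : ℝ) • (-ContinuousLinearMap.fst ℝ ℝ ℝ)) p := fun p =>
        (hasFDerivAt_fst.const_sub (s n)).const_mul (n : ℝ)
      refine DecreasingOn.smoothTransition hN.isOpen (by fun_prop) (fun p _ => ?_) fun p _ => ?_ <;>
        rw [(e p).fderiv] <;> simp
    · have e : ∀ p : ℝ × ℝ, HasFDerivAt (fun p : ℝ × ℝ => (n : ℝ) * (t n - p.2))
          ((n : ℝ) • (-ContinuousLinearMap.snd ℝ ℝ ℝ)) p := fun p =>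
        (hasFDerivAt_snd.const_sub (t n)).const_mul (n : ℝ)
      refine DecreasingOn.smoothTransition hN.isOpen (by fun_prop) (fun p _ => ?_) fun p _ => ?_ <;>
        rw [(e p).fderiv] <;> simp
    · have e : ∀ p ∈ Q, fderiv ℝ (fun p => ρ + 1 - r p) p = -fderiv ℝ r p := fun p hp =>
        ((hN.differentiableAt_of_mem hr1 hp).hasFDerivAt.const_sub (ρ + 1)).fderiv
      refine DecreasingOn.smoothTransition hN.isOpen (contDiffOn_const.sub hr1)
        (fun p hp => ?_) fun p hp => ?_ <;> rw [e p hp, neg_apply]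
      · exact neg_nonpos.2 (hN.r_u p hp).le
      · exact neg_nonpos.2 (hN.r_v p hp).le
  have ha : ∀ n, RadialCutoff Q r r₀ (a n) (D n) := by
    intro n
    obtain ⟨p, hp, hpe⟩ := hsU n
    obtain ⟨p', hp', hpe'⟩ := htU n
    refine ⟨(hdec n).contDiffOn, (hdec n).nonneg, (hdec n).a_u, (hdec n).a_v,
      hc (ρ + 1) (s n) (t n) ⟨p.2, hpe ▸ hp⟩ ⟨p'.1, hpe' ▸ hp'⟩, fun p hp => hp.1,
      fun p hp hr hpD => ?_⟩
    have hz : ∀ x : ℝ, ¬ 0 ≤ x → st ((n : ℝ) * x) = 0 := fun x hx =>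
      Real.smoothTransition.zero_of_nonpos
        (mul_nonpos_of_nonneg_of_nonpos n.cast_nonneg (not_le.1 hx).le)
    simp only [a]
    by_cases h1 : p.1 ≤ s n
    · by_cases h2 : p.2 ≤ t n
      · have h3 : ¬ r p ≤ ρ + 1 := fun h3 => hpD ⟨hp, hr, h3, h1, h2⟩
        rw [show st (ρ + 1 - r p) = 0 from Real.smoothTransition.zero_of_nonpos (by linarith),
          mul_zero]
      · rw [hz (t n - p.2) (by simpa using h2), mul_zero, zero_mul]
    · rw [hz (s n - p.1) (by simpa using h1), zero_mul, zero_mul]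
  have ha1 : ∀ n p, a n p ≤ 1 := fun n p => mul_le_one₀ (mul_le_one₀
    (Real.smoothTransition.le_one _) (Real.smoothTransition.nonneg _)
    (Real.smoothTransition.le_one _)) (Real.smoothTransition.nonneg _)
    (Real.smoothTransition.le_one _)
  have hlim : ∀ p ∈ Q, r p = ρ → ∀ᶠ n in Filter.atTop, a n p = 1 := by
    intro p hp hr
    filter_upwards [hs p.1 ⟨p, hp, rfl⟩, ht p.2 ⟨p, hp, rfl⟩] with n h1 h2
    simp only [a, st]
    rw [Real.smoothTransition.one_of_one_le h1, Real.smoothTransition.one_of_one_le h2,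
      Real.smoothTransition.one_of_one_le (by linarith), one_mul, one_mul]
  set F : ℝ → ℝ≥0∞ := fun u => ∑' v : {v : ℝ // (u, v) ∈ Q ∧ r (u, v) = ρ},
    ENNReal.ofReal (radialFlux r N₀ N₁ (u, v)) with hF
  set Fn : ℕ → ℝ → ℝ≥0∞ := fun n u => ∑' v : {v : ℝ // (u, v) ∈ Q ∧ r (u, v) = ρ},
    ENNReal.ofReal (a n (u, v) * radialFlux r N₀ N₁ (u, v)) with hFn
  -- Finite partial sums suffice: at finitely many sheets the cutoffs are eventually 1. Fatou's
  -- lemma then needs no monotonicity of the cutoffs in n.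
  have h1 : ∀ u, F u ≤ Filter.liminf (fun n => Fn n u) Filter.atTop := by
    intro u
    simp only [hF]
    rw [ENNReal.tsum_eq_iSup_sum]
    refine iSup_le fun P => ?_
    refine Filter.le_liminf_of_le (by isBoundedDefault) ?_
    have : ∀ᶠ n in Filter.atTop, ∀ v ∈ P, a n (u, v) = 1 := by
      rw [Filter.eventually_all_finset]
      exact fun v _ => hlim (u, v) v.2.1 v.2.2
    filter_upwards [this] with n hn
    refine le_trans (Finset.sum_congr rfl fun v hv => ?_).le (ENNReal.sum_le_tsum P)
    rw [hn v hv, one_mul]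
  calc ∫⁻ u, F u ≤ ∫⁻ u, Filter.liminf (fun n => Fn n u) Filter.atTop := lintegral_mono h1
    _ ≤ Filter.liminf (fun n => ∫⁻ u, Fn n u) Filter.atTop :=
      lintegral_liminf_le' fun n => (hN.lintegral_level_eq (ha n) hρ).1
    _ ≤ _ := by
      refine Filter.liminf_le_of_frequently_le' (Filter.Eventually.frequently
        (Filter.Eventually.of_forall fun n => ?_))
      refine (hN.lintegral_level_le (ha n) hρ).trans (lintegral_mono fun u => ?_)
      refine ENNReal.tsum_le_tsum fun v => ENNReal.ofReal_le_ofReal ?_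
      exact mul_le_of_le_one_left (hN.radialFlux_nonneg v.2.1) (ha1 n _)

/-! ### Comparison of the energy with the flux of the current, and the decay estimate -/

namespace Spacetime

variable {S : Spacetime} {ε₀ C₀ : ℝ} {W : Fin 2 → Pt → Tensor4}

theorem pd_r (hε₀ : 0 < ε₀) (hS : S.BAI ε₀ C₀) {x : Pt} (hx : x ∈ S.dom) :
    ∃ d > 0, fderiv ℝ S.rad (x 0, x 1) (1, 0) = d ∧
      fderiv ℝ S.rad (x 0, x 1) (0, 1) = S.q x ^ 2 * d ∧
      pd 0 S.r x = d ∧ pd 1 S.r x = S.q x ^ 2 * d ∧ pd 2 S.r x = 0 ∧ pd 3 S.r x = 0 := by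
  have h1 := avgTrChi_pos hε₀ hS hx
  have h2 := avgTrChib_pos hε₀ hS hx
  have hr : 0 < S.rad (x 0, x 1) := rad_pos hε₀ hS hx
  have h3 : S.avgTrChi (x 0) (x 1) = S.q x ^ 2 * S.avgTrChib (x 0) (x 1) := by
    rw [q, Real.sq_sqrt (div_pos h1 h2).le]
    field_simp
  obtain ⟨e0, e1⟩ := fderiv_rad hε₀ hS (p := (x 0, x 1)) hx
  have hd : DifferentiableAt ℝ S.rad (x 0, x 1) :=
    ((contDiffOn_rad hε₀ hS).contDiffAt (S.isOpen_Q.mem_nhds hx)).differentiableAt (by simp)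
  obtain ⟨-, p0, p1, pA⟩ := pd_comp_base (f := S.rad) (x := x) hd
  have e2 : fderiv ℝ S.rad (x 0, x 1) (0, 1) =
      S.q x ^ 2 * (S.rad (x 0, x 1) / 2 * S.avgTrChib (x 0) (x 1)) := by
    rw [e1, h3]
    ring
  exact ⟨_, mul_pos (by positivity) h2, e0, e2, p0.trans e0, p1.trans e2, pA 0, pA 1⟩

theorem Mq_eq (c : Fin 2) (x : Pt) : S.Mq c x = (1 / (2 * S.Ω c x ^ 2)) • S.K c x := by
  funext μ
  simp only [Mq, K, LbHat, LHat, Pi.smul_apply, smul_eq_mul]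
  ring

/-- This is the alignment: the choice of q gives ∂_v r = q² ∂_u r, so the gradient of r is
proportional to K. Consequently the unit normal and M_q are both multiples of K. -/
theorem V_eq (hε₀ : 0 < ε₀) (hS : S.BAI ε₀ C₀) {c : Fin 2} {x : Pt} (hx : x ∈ S.dom) {d : ℝ}
    (h0 : pd 0 S.r x = d) (h1 : pd 1 S.r x = S.q x ^ 2 * d) (h2 : pd 2 S.r x = 0)
    (h3 : pd 3 S.r x = 0) : S.V c x = (S.q x * d / (2 * S.Ω c x ^ 2)) • S.K c x := by
  have hq := (q_pos hε₀ hS hx).ne'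
  have hΩ := (S.Ω_pos c x hx).ne'
  funext μ
  simp only [V, Fin.sum_univ_four, h0, h1, h2, h3, S.gInv_eq hx, K, S.L_eq, Lb_eq, Pi.smul_apply,
    smul_eq_mul]
  fin_cases μ <;> simp [doubleNullInv] <;> field_simp

theorem inner_K (hε₀ : 0 < ε₀) (hS : S.BAI ε₀ C₀) {c : Fin 2} {x : Pt} (hx : x ∈ S.dom) :
    S.inner c x (S.K c x) (S.K c x) = -(2 * S.Ω c x) ^ 2 := by
  have hq := (q_pos hε₀ hS hx).ne'
  simp only [inner, Fin.sum_univ_four, S.g_eq hx, K, S.L_eq, Lb_eq]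
  simp
  field_simp
  ring

theorem inner_smul_self (c : Fin 2) (x : Pt) (k : ℝ) (X : Fin 4 → ℝ) :
    S.inner c x (k • X) (k • X) = k ^ 2 * S.inner c x X X := by
  simp only [inner, Pi.smul_apply, smul_eq_mul, Finset.mul_sum]
  exact Finset.sum_congr rfl fun _ _ => Finset.sum_congr rfl fun _ _ => by ring

theorem n_eq (hε₀ : 0 < ε₀) (hS : S.BAI ε₀ C₀) {c : Fin 2} {x : Pt} (hx : x ∈ S.dom) :
    S.n c x = (1 / (2 * S.Ω c x)) • S.K c x := by
  obtain ⟨d, hd, -, -, h0, h1, h2, h3⟩ := pd_r hε₀ hS hx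
  have hq := q_pos hε₀ hS hx
  have hΩ := S.Ω_pos c x hx
  have hV := V_eq hε₀ hS (c := c) hx h0 h1 h2 h3
  have hl : S.lapse c x = S.Ω c x / (S.q x * d) := by
    rw [lapse, hV, inner_smul_self, inner_K hε₀ hS hx,
      show -((S.q x * d / (2 * S.Ω c x ^ 2)) ^ 2 * -(2 * S.Ω c x) ^ 2) =
        (S.q x * d / S.Ω c x) ^ 2 by field_simp, Real.sqrt_sq (by positivity), one_div_div]
  funext μ
  simp only [n, hl, hV, Pi.smul_apply, smul_eq_mul]
  field_simp

theorem volElement_eq (hε₀ : 0 < ε₀) (hS : S.BAI ε₀ C₀) {c : Fin 2} {x : Pt} (hx : x ∈ S.dom) :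
    S.volElement c x = 2 * S.Ω c x * (S.q x)⁻¹ * √(S.γ c x).det := by
  obtain ⟨d, hd, -, -, h0, h1, h2, h3⟩ := pd_r hε₀ hS hx
  have hq := q_pos hε₀ hS hx
  have hΩ := S.Ω_pos c x hx
  have s1 := S.γ_symm (c := c) hx
  have e : Matrix.det (Matrix.of fun i j : Fin 3 => S.inner c x (S.tangent x i) (S.tangent x j)) =
      (2 * S.Ω c x * (S.q x)⁻¹) ^ 2 * (S.γ c x).det := by
    rw [Matrix.det_fin_three, Matrix.det_fin_two, s1]
    simp only [Matrix.of_apply, inner, Fin.sum_univ_four, S.g_eq hx, tangent, h0, h1]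
    simp [kron]
    field_simp
    ring
  rw [volElement, e, Real.sqrt_mul (by positivity), Real.sqrt_sq (by positivity)]

theorem contract3_smul (Q : Tensor4) (k : Fin 4 → ℝ) (t : ℝ) (a : Fin 4) :
    contract3 Q (t • k) a = t ^ 3 * contract3 Q k a := by
  simp only [contract3, Pi.smul_apply, smul_eq_mul, Finset.mul_sum]
  exact Finset.sum_congr rfl fun _ _ => Finset.sum_congr rfl fun _ _ =>
    Finset.sum_congr rfl fun _ _ => by ring

/-- The flux density in terms of the energy current. -/
theorem fluxDensity_eq (hε₀ : 0 < ε₀) (hS : S.BAI ε₀ C₀) (hW : S.IsWeylField W) (hB : S.Bianchi W)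
    {x : Pt} (hx : x ∈ S.dom) : S.fluxDensity W x = 1 / (8 * S.Ω 0 x ^ 6) *
      ((fderiv ℝ S.rad (x 0, x 1) (1, 0) * S.flux W 0 x 0 +
        fderiv ℝ S.rad (x 0, x 1) (0, 1) * S.flux W 0 x 1) /
          fderiv ℝ S.rad (x 0, x 1) (0, 1)) := by
  obtain ⟨d, hd, e0, e1, -, -, -, -⟩ := pd_r hε₀ hS hx
  have hq := q_pos hε₀ hS hx
  have hΩ := S.Ω_pos 0 x hx
  have hs := flux_sum hε₀ hS hW hB hx
  have e2 : d * S.flux W 0 x 0 + S.q x ^ 2 * d * S.flux W 0 x 1 =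
      S.q x * d * (S.dens 0 x * (S.belK 0 (W 0) x / (2 * S.Ω 0 x ^ 2))) := by
    rw [← hs]
    field_simp
  -- Each of the three factors M_q contributes 1 / (2Ω²) relative to K. Their product is the 1 /
  -- (8Ω⁶) that becomes the weight r⁻⁶.
  have e3 : ∑ α, S.Pq 0 (W 0) x α * S.n 0 x α = -((1 / (2 * S.Ω 0 x ^ 2)) ^ 3 *
      (1 / (2 * S.Ω 0 x)) * S.belK 0 (W 0) x) := by
    rw [belK, Finset.mul_sum, ← Finset.sum_neg_distrib]
    refine Finset.sum_congr rfl fun α _ => ?_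
    have : S.Pq 0 (W 0) x α = -contract3 (S.belRobinson 0 (W 0) x) (S.Mq 0 x) α := rfl
    rw [this, Mq_eq, contract3_smul, n_eq hε₀ hS hx, Pi.smul_apply, smul_eq_mul]
    ring
  rw [fluxDensity, e3, volElement_eq hε₀ hS hx, e0, e1, e2, S.dens_eq hx]
  field_simp
  ring

variable {p : ℝ × ℝ}

theorem lintegral_flux_eq (hε₀ : 0 < ε₀) (hS : S.BAI ε₀ C₀) (hW : S.IsWeylField W)
    (hB : S.Bianchi W) (hp : p ∈ S.Q) :
    ∫⁻ θ : Fin 2 → ℝ, ENNReal.ofReal ((fderiv ℝ S.rad p (1, 0) * S.flux W 0 (pt p.1 p.2 θ) 0 +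
        fderiv ℝ S.rad p (0, 1) * S.flux W 0 (pt p.1 p.2 θ) 1) / fderiv ℝ S.rad p (0, 1)) =
      ENNReal.ofReal (radialFlux S.rad (S.mass W 0) (S.mass W 1) p) := by
  have hV := isVectorDensity_flux hε₀ hS hW
  have i0 := (hV.isDensity (.inl rfl : (0 : Fin 4) = 0 ∨ (0 : Fin 4) = 1)).integrable hp
  have i1 := (hV.isDensity (.inr rfl : (1 : Fin 4) = 0 ∨ (1 : Fin 4) = 1)).integrable hp
  obtain ⟨d, hd, e0, e1, -, -, -, -⟩ := pd_r hε₀ hS (S.pt_mem hp 0)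
  have e0' : fderiv ℝ S.rad p (1, 0) = d := e0
  have e1' : fderiv ℝ S.rad p (0, 1) = _ := e1
  have hq := q_pos hε₀ hS (S.pt_mem hp 0)
  have k1 : 0 ≤ fderiv ℝ S.rad p (1, 0) := e0' ▸ hd.le
  have k2 : 0 ≤ fderiv ℝ S.rad p (0, 1) := e1' ▸ (by positivity)
  refine (ofReal_integral_eq_lintegral_ofReal
    (((i0.const_mul (fderiv ℝ S.rad p (1, 0))).add
      (i1.const_mul (fderiv ℝ S.rad p (0, 1)))).div_const (fderiv ℝ S.rad p (0, 1)))
    (Filter.Eventually.of_forall fun θ => ?_)).symm.trans ?_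
  rotate_left
  · congr 1
    simp only [Pi.add_apply]
    rw [integral_div, integral_add (i0.const_mul _) (i1.const_mul _), integral_const_mul,
      integral_const_mul]
    rfl
  · have h := flux_nonneg hε₀ hS hW hB (S.pt_mem hp θ)
    exact div_nonneg (add_nonneg (mul_nonneg k1 h.1) (mul_nonneg k2 h.2)) k2

/-- The energy through a level set of the area radius is comparable to the flux of the current. -/
theorem lintegral_fluxDensity (hε₀ : 0 < ε₀) (hC₀ : 0 < C₀) (hS : S.BAI ε₀ C₀)
    (hΩ : S.LapseComparable C₀) (hW : S.IsWeylField W) (hB : S.Bianchi W) (hp : p ∈ S.Q) :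
    ∫⁻ θ : Fin 2 → ℝ, ENNReal.ofReal (S.fluxDensity W (pt p.1 p.2 θ)) ≤
      ENNReal.ofReal (C₀ ^ 6 / (8 * S.rad p ^ 6)) *
        ENNReal.ofReal (radialFlux S.rad (S.mass W 0) (S.mass W 1) p) ∧
    ENNReal.ofReal (radialFlux S.rad (S.mass W 0) (S.mass W 1) p) ≤
      ENNReal.ofReal (8 * C₀ ^ 6 * S.rad p ^ 6) *
        ∫⁻ θ : Fin 2 → ℝ, ENNReal.ofReal (S.fluxDensity W (pt p.1 p.2 θ)) := by
  have hr := rad_pos hε₀ hS hp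
  obtain ⟨d, hd, e0, e1, -, -, -, -⟩ := pd_r hε₀ hS (S.pt_mem hp 0)
  have e0' : fderiv ℝ S.rad p (1, 0) = d := e0
  have e1' : fderiv ℝ S.rad p (0, 1) = _ := e1
  have hq := q_pos hε₀ hS (S.pt_mem hp 0)
  have k1 : 0 ≤ fderiv ℝ S.rad p (1, 0) := e0' ▸ hd.le
  have k2 : 0 ≤ fderiv ℝ S.rad p (0, 1) := e1' ▸ (by positivity)
  rw [← lintegral_flux_eq hε₀ hS hW hB hp, ← lintegral_const_mul' _ _ ENNReal.ofReal_ne_top,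
    ← lintegral_const_mul' _ _ ENNReal.ofReal_ne_top]
  constructor <;> refine lintegral_mono fun θ => ?_ <;>
    rw [← ENNReal.ofReal_mul (by positivity)] <;> refine ENNReal.ofReal_le_ofReal ?_
  all_goals
    have h := flux_nonneg hε₀ hS hW hB (S.pt_mem hp θ)
    have hn := div_nonneg (add_nonneg (mul_nonneg k1 h.1) (mul_nonneg k2 h.2)) k2
    have hpos := S.Ω_pos 0 _ (S.pt_mem hp θ)
    obtain ⟨l1, l2⟩ := hΩ 0 _ (S.pt_mem hp θ)
    have l1' : C₀⁻¹ * S.rad p ≤ S.Ω 0 (pt p.1 p.2 θ) := l1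
    have l2' : S.Ω 0 (pt p.1 p.2 θ) ≤ C₀ * S.rad p := l2
    have hf := fluxDensity_eq hε₀ hS hW hB (S.pt_mem hp θ)
    have ep : ((pt p.1 p.2 θ) 0, (pt p.1 p.2 θ) 1) = p := rfl
    rw [ep] at hf
    rw [hf]
    set z := (fderiv ℝ S.rad p (1, 0) * S.flux W 0 (pt p.1 p.2 θ) 0 +
        fderiv ℝ S.rad p (0, 1) * S.flux W 0 (pt p.1 p.2 θ) 1) / fderiv ℝ S.rad p (0, 1)
  · refine mul_le_mul_of_nonneg_right ?_ hn
    have h1 : (C₀⁻¹ * S.rad p) ^ 6 ≤ S.Ω 0 (pt p.1 p.2 θ) ^ 6 := by gcongr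
    calc _ ≤ 1 / (8 * (C₀⁻¹ * S.rad p) ^ 6) := by gcongr
      _ = _ := by field_simp
  · rw [← mul_assoc]
    refine le_mul_of_one_le_left hn ?_
    have h1 : S.Ω 0 (pt p.1 p.2 θ) ^ 6 ≤ (C₀ * S.rad p) ^ 6 := by gcongr
    rw [mul_one_div, le_div_iff₀ (by positivity)]
    calc _ ≤ 8 * (C₀ * S.rad p) ^ 6 := by linarith
      _ = _ := by ring

/-- The energy current, integrated over the spheres, with a weight that compensates the error. -/
theorem radialFlow (hε₀ : 0 < ε₀) (hC₀ : 0 < C₀) (hS : S.BAI ε₀ C₀)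
    (hΩ : S.LapseComparable C₀) (hW : S.IsWeylField W) (hB : S.Bianchi W) :
    RadialFlow S.Q S.rad
      (fun p => Real.exp (6144 * (1 + ε₀) * C₀ ^ 2 / S.rad p) * S.mass W 0 p)
      (fun p => Real.exp (6144 * (1 + ε₀) * C₀ ^ 2 / S.rad p) * S.mass W 1 p) := by
  set κ := 6144 * (1 + ε₀) * C₀ ^ 2
  have hr := contDiffOn_rad hε₀ hS
  have hr1 := hr.of_le (show (1 : ℕ∞ω) ≤ 2 by norm_num)
  have hw : ContDiffOn ℝ 1 (fun p => Real.exp (κ / S.rad p)) S.Q :=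
    (contDiffOn_const.div hr1 fun p hp => (rad_pos hε₀ hS hp).ne').exp
  have m0 := contDiffOn_mass hε₀ hS hW (.inl rfl : (0 : Fin 4) = 0 ∨ (0 : Fin 4) = 1)
  have m1 := contDiffOn_mass hε₀ hS hW (.inr rfl : (1 : Fin 4) = 0 ∨ (1 : Fin 4) = 1)
  refine ⟨S.isOpen_Q, hr, fun p hp => ?_, fun p hp => ?_, hw.mul m0, hw.mul m1, fun p hp => ?_,
    fun p hp => ?_⟩
  · obtain ⟨d, hd, e0, -⟩ := pd_r hε₀ hS (S.pt_mem hp 0)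
    exact hd.trans_eq e0.symm
  · obtain ⟨d, hd, -, e1, -⟩ := pd_r hε₀ hS (S.pt_mem hp 0)
    have hq := q_pos hε₀ hS (S.pt_mem hp 0)
    exact (mul_pos (by positivity) hd).trans_eq e1.symm
  · have h := mass_nonneg hε₀ hS hW hB hp
    exact ⟨mul_nonneg (Real.exp_pos _).le h.1, mul_nonneg (Real.exp_pos _).le h.2⟩
  · have hrp := rad_pos hε₀ hS hp
    have d : ∀ {φ : ℝ × ℝ → ℝ}, ContDiffOn ℝ 1 φ S.Q → HasFDerivAt φ (fderiv ℝ φ p) p := fun h =>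
      ((h.contDiffAt (S.isOpen_Q.mem_nhds hp)).differentiableAt (by simp)).hasFDerivAt
    -- The weight contributes -κ r⁻² dr(J) to the divergence, which exactly cancels the bound of
    -- `divergence_mass_le`.
    have hinv : HasDerivAt (fun t : ℝ => Real.exp (κ / t))
        (Real.exp (κ / S.rad p) * (κ * -(S.rad p ^ 2)⁻¹)) (S.rad p) := by
      simpa only [div_eq_mul_inv] using ((hasDerivAt_inv hrp.ne').const_mul κ).exp
    have dw := hinv.comp_hasFDerivAt p (d hr1)
    have e0 := (dw.fun_mul (d m0)).fderiv
    have e1 := (dw.fun_mul (d m1)).fderiv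
    simp only [Function.comp_apply] at e0 e1
    rw [e0, e1]
    simp only [add_apply, smul_apply, smul_eq_mul]
    have h := divergence_mass_le hε₀ hC₀ hS hΩ hW hB hp
    rw [div_eq_mul_inv] at h
    have hm := mul_le_mul_of_nonneg_left h (Real.exp_pos (κ / S.rad p)).le
    linarith

/-- The energy decay estimate. -/
theorem energy_le (hε₀ : 0 < ε₀) (hC₀ : 0 < C₀) (hS : S.BAI ε₀ C₀)
    (hΩ : S.LapseComparable C₀) (hW : S.IsWeylField W) (hB : S.Bianchi W) {r₀ ρ : ℝ} (hr₀ : 0 < r₀)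
    (hρ : r₀ ≤ ρ) (hc : S.CompactDomains r₀) :
    ENNReal.ofReal (ρ ^ 6) * S.energy W ρ ≤
      ENNReal.ofReal (C₀ ^ 12 * r₀ ^ 6 * Real.exp (6144 * (1 + ε₀) * C₀ ^ 2 / r₀)) *
        S.energy W r₀ := by
  set κ := 6144 * (1 + ε₀) * C₀ ^ 2 with hκ
  have hκ0 : 0 ≤ κ := by positivity
  have hflow := radialFlow hε₀ hC₀ hS hΩ hW hB
  have hmono := hflow.lintegral_level_mono hρ hc
  have hρ0 : 0 < ρ := hr₀.trans_le hρ
  have hw : ∀ p, radialFlux S.rad (fun p => Real.exp (κ / S.rad p) * S.mass W 0 p)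
      (fun p => Real.exp (κ / S.rad p) * S.mass W 1 p) p =
      Real.exp (κ / S.rad p) * radialFlux S.rad (S.mass W 0) (S.mass W 1) p := fun p => by
    simp only [radialFlux]
    ring
  simp only [← hκ, hw] at hmono
  -- At the upper level the weight exp(κ / r) is only used to be at least 1; at the lower level its
  -- value exp(κ / r₀) goes into the constant. The two comparisons of Ω with r contribute C₀⁶ / 8
  -- and 8 C₀⁶ r₀⁶.
  have hup : ENNReal.ofReal (ρ ^ 6) * S.energy W ρ ≤ ENNReal.ofReal (C₀ ^ 6 / 8) *
      ∫⁻ u : ℝ, ∑' v : {v : ℝ // (u, v) ∈ S.Q ∧ S.rad (u, v) = ρ}, ENNReal.ofReal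
        (Real.exp (κ / S.rad (u, v)) * radialFlux S.rad (S.mass W 0) (S.mass W 1) (u, v)) := by
    rw [energy, ← lintegral_const_mul' _ _ ENNReal.ofReal_ne_top,
      ← lintegral_const_mul' _ _ ENNReal.ofReal_ne_top]
    refine lintegral_mono fun u => ?_
    rw [← ENNReal.tsum_mul_left, ← ENNReal.tsum_mul_left]
    refine ENNReal.tsum_le_tsum fun v => ?_
    have hv : S.rad (u, v) = ρ := v.2.2
    have h := (lintegral_fluxDensity hε₀ hC₀ hS hΩ hW hB (p := (u, v)) v.2.1).1
    rw [hv] at h ⊢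
    refine (mul_le_mul_right h _).trans ?_
    rw [← ENNReal.ofReal_mul (by positivity), ← ENNReal.ofReal_mul (by positivity),
      ← ENNReal.ofReal_mul (by positivity)]
    refine ENNReal.ofReal_le_ofReal ?_
    have h1 := Real.one_le_exp (div_nonneg hκ0 hρ0.le)
    have h2 := hflow.radialFlux_nonneg v.2.1
    rw [hw, hv] at h2
    have h3 := nonneg_of_mul_nonneg_right h2 (Real.exp_pos _)
    calc _ = C₀ ^ 6 / 8 * (1 * radialFlux S.rad (S.mass W 0) (S.mass W 1) (u, v)) := by
          field_simp
      _ ≤ _ := by gcongr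
  have hlow : ∫⁻ u : ℝ, ∑' v : {v : ℝ // (u, v) ∈ S.Q ∧ S.rad (u, v) = r₀}, ENNReal.ofReal
        (Real.exp (κ / S.rad (u, v)) * radialFlux S.rad (S.mass W 0) (S.mass W 1) (u, v)) ≤
      ENNReal.ofReal (8 * C₀ ^ 6 * r₀ ^ 6 * Real.exp (κ / r₀)) * S.energy W r₀ := by
    rw [energy, ← lintegral_const_mul' _ _ ENNReal.ofReal_ne_top]
    refine lintegral_mono fun u => ?_
    rw [← ENNReal.tsum_mul_left]
    refine ENNReal.tsum_le_tsum fun v => ?_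
    have hv : S.rad (u, v) = r₀ := v.2.2
    have h := (lintegral_fluxDensity hε₀ hC₀ hS hΩ hW hB (p := (u, v)) v.2.1).2
    rw [hv] at h ⊢
    rw [ENNReal.ofReal_mul (Real.exp_pos _).le, mul_comm (8 * C₀ ^ 6 * r₀ ^ 6),
      ENNReal.ofReal_mul (Real.exp_pos _).le, mul_assoc]
    exact mul_le_mul_right h _
  calc _ ≤ _ := hup
    _ ≤ _ := mul_le_mul_right (hmono.trans hlow) _
    _ = _ := by
      rw [← mul_assoc, ← ENNReal.ofReal_mul (by positivity)]
      congr 2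
      ring

end Spacetime

end DoubleNull

end

theorem mainTheorem2 (ε₀ C₀ : ℝ) (hε₀ : 0 < ε₀) (hC₀ : 0 < C₀) :
    ∃ ε : ℝ, 0 < ε ∧ ε < ε₀ ∧ ∀ r₀ : ℝ, 0 < r₀ → ∃ C : ℝ, 0 < C ∧
      ∀ S : DoubleNull.Spacetime, S.BAI ε₀ C₀ → S.LapseComparable C₀ → S.CompactDomains r₀ →
        ∀ W : Fin 2 → DoubleNull.Pt → DoubleNull.Tensor4, S.IsWeylField W → S.Bianchi W →
          ∀ r : ℝ, r₀ ≤ r →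
            ENNReal.ofReal (r ^ (6 - ε)) * S.energy W r ≤ ENNReal.ofReal C * S.energy W r₀ := by
  -- Any ε strictly between 0 and ε₀ would serve, because `energy_le` holds with the full power r⁶;
  -- the surplus factor satisfies r^(-ε) ≤ r₀^(-ε).
  refine ⟨ε₀ / 2, by positivity, by linarith, fun r₀ hr₀ => ?_⟩
  refine ⟨r₀ ^ (-(ε₀ / 2)) *
    (C₀ ^ 12 * r₀ ^ 6 * Real.exp (6144 * (1 + ε₀) * C₀ ^ 2 / r₀)), by positivity, ?_⟩
  intro S hS hΩ hc W hW hB ρ hρ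
  have hρ0 : 0 < ρ := hr₀.trans_le hρ
  have h := DoubleNull.Spacetime.energy_le hε₀ hC₀ hS hΩ hW hB hr₀ hρ hc
  have h1 : ρ ^ (6 - ε₀ / 2) = ρ ^ (-(ε₀ / 2)) * ρ ^ 6 := by
    rw [sub_eq_add_neg, Real.rpow_add hρ0, mul_comm]
    norm_num
  rw [h1, ENNReal.ofReal_mul (by positivity), ENNReal.ofReal_mul (by positivity), mul_assoc,
    mul_assoc]
  refine mul_le_mul' (ENNReal.ofReal_le_ofReal ?_) h
  exact Real.rpow_le_rpow_of_nonpos hr₀ hρ (by linarith)
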